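/- Let $M$ be a compact connected smooth manifold without boundary, and let $(g_\tau)_{\tau\in[0,\tau^*)}$, $0<\tau^*\le\infty$, be a smooth solution of the Ricci flow $\partial_\tau g_\tau=-2\,\mathrm{Ric}_{g_\tau}$ on $M$. For $p,q\in M$ and $0\le s<t<\tau^*$ put $$L((p,s),(q,t))=\inf_\gamma \mathcal L(\gamma),\qquad \mathcal L(\gamma)=\int_s^t\Big(R_{g_\tau}(\gamma(\tau))+\Big|\frac{d\gamma}{d\tau}\Big|^2_{g_\tau}\Big)\,d\tau,$$ where $R$ is the scalar curvature and the infimum is over all $C^1$ paths $\gamma:[s,t]\to M$ with $\gamma(s)=p$, $\gamma(t)=q$. A path attaining the infimum is called a minimizing $\mathcal L$-geodesic; given such a path $\gamma$ with velocity $T$, let $\parallel_\gamma:T_pM\to T_qM$ be the linear map $V(s)\mapsto V(t)$ defined by the solutions $V$ of $\nabla_TV=\mathrm{Ric}(V)^\sharp$ along $\gamma$, where at time $\tau$ the connection and the curvature are those of $g_\tau$. The flow is called a twisted gradient soliton if for all $(p,s),(q,t)$ with $0\le s<t<\tau^*$ that are joined by a unique minimizing $\mathcal L$-geodesic $\gamma$,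 the function $L((\cdot,s),(\cdot,t))$ is $C^2$ near $(p,q)$ and, for all $v,w\in T_pM$, $$\nabla^2_{M\times M}L\,(v\oplus\parallel_\gamma v,\;w\oplus\parallel_\gamma w)+\mathrm{Ric}_{g_s}(v,w)-\mathrm{Ric}_{g_t}(\parallel_\gamma v,\parallel_\gamma w)=0,$$ where $\nabla^2_{M\times M}$ is the Hessian of the product metric $g_s\oplus g_t$ on $M\times M$ acting on $L((\cdot,s),(\cdot,t))$ at $(p,q)$. Let $A>0$. Then the function $$t\mapsto \inf_{p,q\in M}L((p,t),(q,t+A)),\qquad t\ge 0,\ t+A<\tau^*,$$ is non-decreasing, and it is constant if the flow is a twisted gradient soliton. -/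

import Mathlib

open scoped Manifold ContDiff

noncomputable section

namespace RicciFlowLength

/-! ### Coordinate expressions

`G : E → Matrix` is the matrix-valued function `u ↦ (g_ij(u))` of a metric in a coordinate chart. -/

/-- Partial derivative `∂f/∂u^i` on `ℝⁿ`. -/
def pd {n : ℕ} (f : EuclideanSpace ℝ (Fin n) → ℝ) (i : Fin n)
    (u : EuclideanSpace ℝ (Fin n)) : ℝ :=
  fderiv ℝ f u (EuclideanSpace.single i 1)

/-- Christoffel symbol `Γ^k_ij` of the Levi-Civita connection. -/
def christoffel {n : ℕ} (G : EuclideanSpace ℝ (Fin n) → Matrix (Fin n) (Fin n) ℝ)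
    (k i j : Fin n) (u : EuclideanSpace ℝ (Fin n)) : ℝ :=
  (1 / 2) * ∑ l, (G u)⁻¹ k l *
    (pd (fun y => G y j l) i u + pd (fun y => G y i l) j u - pd (fun y => G y i j) l u)

/-- Ricci tensor
`R_ij = ∂_k Γ^k_ij - ∂_j Γ^k_ik + Γ^k_kl Γ^l_ij - Γ^k_jl Γ^l_ik` (positive on round spheres). -/
def ricciCoeff {n : ℕ} (G : EuclideanSpace ℝ (Fin n) → Matrix (Fin n) (Fin n) ℝ)
    (u : EuclideanSpace ℝ (Fin n)) (i j : Fin n) : ℝ :=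
  ∑ k, (pd (christoffel G k i j) k u - pd (christoffel G k i k) j u +
    ∑ l, (christoffel G k k l u * christoffel G l i j u -
      christoffel G k j l u * christoffel G l i k u))

/-- The vector with components `Γ^k_ij v^i w^j`. -/
def christoffelVec {n : ℕ} (G : EuclideanSpace ℝ (Fin n) → Matrix (Fin n) (Fin n) ℝ)
    (u v w : EuclideanSpace ℝ (Fin n)) : EuclideanSpace ℝ (Fin n) :=
  WithLp.toLp 2 (fun k => ∑ i, ∑ j, christoffel G k i j u * v i * w j)

/-- The vector `Ric(v)^♯`, with components `g^{kl} R_lj v^j`. -/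
def ricciSharpVec {n : ℕ} (G : EuclideanSpace ℝ (Fin n) → Matrix (Fin n) (Fin n) ℝ)
    (u v : EuclideanSpace ℝ (Fin n)) : EuclideanSpace ℝ (Fin n) :=
  WithLp.toLp 2 (fun k => ∑ l, ∑ j, (G u)⁻¹ k l * ricciCoeff G u l j * v j)

/-! ### Riemannian metrics on a manifold -/

/-- Smooth Riemannian metrics on the `n`-manifold `M`. -/
abbrev Metric (n : ℕ) (M : Type*) [TopologicalSpace M]
    [ChartedSpace (EuclideanSpace ℝ (Fin n)) M] [IsManifold (𝓡 n) ∞ M] :=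
  Bundle.ContMDiffRiemannianMetric (𝓡 n) ∞ (EuclideanSpace ℝ (Fin n))
    (fun x : M => TangentSpace (𝓡 n) x)

section Manifold

variable {n : ℕ} {M : Type*} [TopologicalSpace M]
  [ChartedSpace (EuclideanSpace ℝ (Fin n)) M]

/-- The coordinate components, in the preferred chart around `c`, of a tangent vector `v` at a
point `x` of the domain of that chart. -/
def coord (c : M) {x : M} (v : TangentSpace (𝓡 n) x) : EuclideanSpace ℝ (Fin n) :=
  mfderiv (𝓡 n) 𝓘(ℝ, EuclideanSpace ℝ (Fin n)) (extChartAt (𝓡 n) c) x v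

/-- The tangent vector `∂/∂u^i` of the preferred chart around `c`, at the point with
coordinates `u`. -/
def coordVec (c : M) (u : EuclideanSpace ℝ (Fin n)) (i : Fin n) :
    TangentSpace (𝓡 n) ((extChartAt (𝓡 n) c).symm u) :=
  mfderiv 𝓘(ℝ, EuclideanSpace ℝ (Fin n)) (𝓡 n) (extChartAt (𝓡 n) c).symm u
    (EuclideanSpace.single i (1 : ℝ) : EuclideanSpace ℝ (Fin n))

/-- The velocity at time `τ` of a path defined on the time interval `[s, t]` (one-sided at the
endpoints). -/
def velocity (γ : ℝ → M) (s t τ : ℝ) : TangentSpace (𝓡 n) (γ τ) :=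
  mfderivWithin 𝓘(ℝ, ℝ) (𝓡 n) γ (Set.Icc s t) τ (1 : ℝ)

/-- `γ` restricts to a `C¹` path on `[s, t]` with `γ s = p` and `γ t = q`. -/
def IsPath (n : ℕ) {M : Type*} [TopologicalSpace M]
    [ChartedSpace (EuclideanSpace ℝ (Fin n)) M] (p : M) (s : ℝ) (q : M) (t : ℝ)
    (γ : ℝ → M) : Prop :=
  ContMDiffOn 𝓘(ℝ, ℝ) (𝓡 n) 1 γ (Set.Icc s t) ∧ γ s = p ∧ γ t = q

variable [IsManifold (𝓡 n) ∞ M]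

/-- The matrix `g_ij` of the metric `h` in the preferred chart around `c`, at the point with
coordinates `u`. -/
def metricCoeff (h : Metric n M) (c : M) (u : EuclideanSpace ℝ (Fin n)) :
    Matrix (Fin n) (Fin n) ℝ :=
  Matrix.of fun i j =>
    h.inner ((extChartAt (𝓡 n) c).symm u) (coordVec c u i) (coordVec c u j)

/-- The Ricci tensor `Ric(v, w)` at `x`. -/
def ricci (h : Metric n M) (x : M) (v w : TangentSpace (𝓡 n) x) : ℝ :=
  ∑ i, ∑ j, ricciCoeff (metricCoeff h x) (extChartAt (𝓡 n) x x) i j *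
    coord x v i * coord x w j

/-- The scalar curvature `R = g^{ij} R_ij` at `x`. -/
def scalarCurv (h : Metric n M) (x : M) : ℝ :=
  ∑ i, ∑ j, (metricCoeff h x (extChartAt (𝓡 n) x x))⁻¹ i j *
    ricciCoeff (metricCoeff h x) (extChartAt (𝓡 n) x x) i j

/-- The Hessian `∇²f (X, Y)` at `(p, q)`, with `X = v ⊕ v'` and `Y = w ⊕ w'`, of a function `f` on
`M × M` with respect to the product metric `h₁ ⊕ h₂`. In product coordinates it is
`∂²f (X, Y) - ∂f (Γ(X, Y))`, and the Christoffel symbols of a product metric do not mix the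
factors. -/
def hessProd (h₁ h₂ : Metric n M) (f : M × M → ℝ) (p q : M)
    (v : TangentSpace (𝓡 n) p) (v' : TangentSpace (𝓡 n) q)
    (w : TangentSpace (𝓡 n) p) (w' : TangentSpace (𝓡 n) q) : ℝ :=
  let F : EuclideanSpace ℝ (Fin n) × EuclideanSpace ℝ (Fin n) → ℝ :=
    fun z => f ((extChartAt (𝓡 n) p).symm z.1, (extChartAt (𝓡 n) q).symm z.2)
  let a := extChartAt (𝓡 n) p p
  let b := extChartAt (𝓡 n) q q
  fderiv ℝ (fderiv ℝ F) (a, b) (coord p v, coord q v') (coord p w, coord q w') -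
    fderiv ℝ F (a, b)
      (christoffelVec (metricCoeff h₁ p) a (coord p v) (coord p w),
        christoffelVec (metricCoeff h₂ q) b (coord q v') (coord q w'))

/-! ### Ricci flow and the steady length -/

/-- The time interval `[0, T)`, where `T` may be infinite. -/
def timeInterval (T : EReal) : Set ℝ := {t | 0 ≤ t ∧ (t : EReal) < T}

/-- `g` is a smooth solution of the Ricci flow `∂g/∂τ = -2 Ric` on `M × [0, T)`. The values `g τ`
for `τ` outside `[0, T)` play no role. -/
structure IsRicciFlow (g : ℝ → Metric n M) (T : EReal) : Prop where
  /-- The metric is jointly smooth in space and time, up to the initial time. -/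
  smooth : ∀ (c : M) (i j : Fin n),
    ContDiffOn ℝ ∞ (fun z : ℝ × EuclideanSpace ℝ (Fin n) => metricCoeff (g z.1) c z.2 i j)
      (timeInterval T ×ˢ (extChartAt (𝓡 n) c).target)
  /-- The flow equation (a one-sided derivative at the initial time). -/
  flow : ∀ t ∈ timeInterval T, ∀ (x : M) (v w : TangentSpace (𝓡 n) x),
    HasDerivWithinAt (fun τ => (g τ).inner x v w) (-2 * ricci (g t) x v w) (timeInterval T) t

/-- The functional `𝓛(γ) = ∫_s^t R + |dγ/dτ|² dτ`. -/
def pathLength (g : ℝ → Metric n M) (s t : ℝ) (γ : ℝ → M) : ℝ :=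
  ∫ τ in s..t, (scalarCurv (g τ) (γ τ) +
    (g τ).inner (γ τ) (velocity γ s t τ) (velocity γ s t τ))

/-- `L((p, s), (q, t))`, the infimum of `𝓛` over `C¹` paths (meaningful for `s < t`). -/
def L (g : ℝ → Metric n M) (p : M) (s : ℝ) (q : M) (t : ℝ) : ℝ :=
  sInf (pathLength g s t '' {γ | IsPath n p s q t γ})

/-- `γ` is a minimizing `𝓛`-geodesic on `[s, t]` from `(p, s)` to `(q, t)`. -/
def IsMinimizing (g : ℝ → Metric n M) (p : M) (s : ℝ) (q : M) (t : ℝ) (γ : ℝ → M) : Prop :=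
  IsPath n p s q t γ ∧ ∀ σ, IsPath n p s q t σ → pathLength g s t γ ≤ pathLength g s t σ

/-- `V` is a vector field along `γ` on `[s, t]` with `∇_T V = Ric(V)^♯`, where `T` is the velocity
of `γ` and the connection and the curvature at time `τ` are those of `g τ`. In coordinates around
`γ τ` the equation reads `dV/dτ = Ric(V)^♯ - Γ(T, V)`. Thus `V s ↦ V t` is the map `∥_γ`. -/
def IsTransported (g : ℝ → Metric n M) (s t : ℝ) (γ : ℝ → M)
    (V : ∀ τ : ℝ, TangentSpace (𝓡 n) (γ τ)) : Prop :=
  ∀ τ ∈ Set.Icc s t,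
    HasDerivWithinAt (fun r => coord (γ τ) (V r))
      (ricciSharpVec (metricCoeff (g τ) (γ τ)) (extChartAt (𝓡 n) (γ τ) (γ τ))
          (coord (γ τ) (V τ)) -
        christoffelVec (metricCoeff (g τ) (γ τ)) (extChartAt (𝓡 n) (γ τ) (γ τ))
          (coord (γ τ) (velocity γ s t τ)) (coord (γ τ) (V τ)))
      (Set.Icc s t) τ

/-- Twisted gradient solitons: whenever `(p, s) = (γ s, s)` and `(q, t) = (γ t, t)`, with `s < t`,
are joined by a unique minimizing `𝓛`-geodesic `γ`, the spatial Hessian of `L` exists there and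
`∇²_{M × M} L ∘ (Id ⊕ ∥_γ) + Ric_{(p, s)} ⊕ (-Ric_{(q, t)}) = 0` as a bilinear form on
`T_p M`, embedded in `T_p M ⊕ T_q M` by `v ↦ v ⊕ ∥_γ v`. -/
def IsTwistedGradientSoliton (g : ℝ → Metric n M) (T : EReal) : Prop :=
  ∀ s ∈ timeInterval T, ∀ t ∈ timeInterval T, s < t → ∀ γ : ℝ → M,
    IsMinimizing g (γ s) s (γ t) t γ →
    (∀ σ, IsMinimizing g (γ s) s (γ t) t σ → Set.EqOn σ γ (Set.Icc s t)) →
    ContMDiffAt ((𝓡 n).prod (𝓡 n)) 𝓘(ℝ, ℝ) 2 (fun z : M × M => L g z.1 s z.2 t) (γ s, γ t) ∧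
    ∀ V W : ∀ τ : ℝ, TangentSpace (𝓡 n) (γ τ),
      IsTransported g s t γ V → IsTransported g s t γ W →
      hessProd (g s) (g t) (fun z => L g z.1 s z.2 t) (γ s) (γ t) (V s) (V t) (W s) (W t) +
        (ricci (g s) (γ s) (V s) (W s) - ricci (g t) (γ t) (V t) (W t)) = 0

/-- The infimum of `L` over `(M × {t}) × (M × {t + A})`. -/
def infL (g : ℝ → Metric n M) (A t : ℝ) : ℝ :=
  ⨅ z : M × M, L g z.1 t z.2 (t + A)

end Manifold

end RicciFlowLength

end

/-!
The infimum `infL` is compared at two nearby times by varying paths, without assuming that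
minimizing paths exist.

By a Whitney embedding and a smooth nearest point retraction (`exists_retraction`) the flow
becomes a family of degenerate forms `ambForm` on a Euclidean space, and paths become curves
there. This makes uniform Taylor estimates over compact sets available. Along a path there is an
orthonormal frame with `∇V = Ric(V)`, a linear differential equation
(`IsAmbientFlow.exists_frame`). Varying the path geodesically in the direction of each vector of
the frame, the second variations of the Lagrangian `R + |γ'|²` add up to its derivative in time:
this is `IsAdapted.trace_second_variation`, and comes from the contracted Bianchi identity and the
evolution equation `∂_t R = Δ R + 2 |Ric|²`, computed in coordinates adapted to a point. Hence, if
the varied paths are also moved back in time by `a² / (2 n)`, the average of their lengths agrees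
with the original length up to `O(a³)`, uniformly (`IsTube.exists_variation`). Applied to a nearly
minimizing path this gives `infL (t - a² / (2 n)) ≤ infL t + O(a³)` (`IsTube.infL_sub_le`), and
summing over small steps `infL` is monotone at positive times. The initial time is reached by
continuity. In dimension zero there is nothing to vary, and all lengths vanish.

For a soliton the scalar curvature `R` is constant. From every point a short extremal starts at
rest and is uniquely minimizing (`IsActionOn.exists_strict_minimum`,
`IsTube.exists_unique_minimizer`). The trace of the soliton equation along it, compared with the
second variation and with the energy identity, shows that it stays at rest, so that
`∇R = 0` (`IsTube.fderiv_scal_eq_zero`). Now `R` depends only on time, and constant paths are the unique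
minimizing ones between their endpoints. Varying them by the frame times a function `θ` of time
that is `1` at both ends gives an inequality that is an equality for `θ = 1`
(`IsTube.integral_rest_nonneg`); its first variation in `θ` shows that `R` does not depend on time
either. With `R = κ` the constant paths are optimal, and `infL = κ A` at all times.
-/

open scoped Manifold ContDiff
noncomputable section

set_option maxSynthPendingDepth 3

namespace RicciFlowLength

open Set Filter Topology intervalIntegral
open MeasureTheory (volume)
open Finset (sum_congr sum_comm mul_sum sum_mul sum_add_distrib sum_sub_distrib sum_const
  sum_const_zero sum_neg_distrib sum_le_sum sum_eq_zero card_univ)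

local notation:max "ℝ^" k:max => EuclideanSpace ℝ (Fin k)
local notation:max "Mat" k:max => Matrix (Fin k) (Fin k) ℝ
local notation:max "𝐞" i:max => EuclideanSpace.single i (1 : ℝ)

/-! ### Directional derivatives and uniform Taylor estimates -/

/-- The directional derivative of `f` in the direction `a`, as a function of the base point. -/
def dd {X Y : Type*} [NormedAddCommGroup X] [NormedSpace ℝ X] [NormedAddCommGroup Y]
    [NormedSpace ℝ Y] (a : X) (f : X → Y) : X → Y := fun z => fderiv ℝ f z a

section dd

variable {X Y : Type*} [NormedAddCommGroup X] [NormedSpace ℝ X] [NormedAddCommGroup Y]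
  [NormedSpace ℝ Y]

theorem contDiffAt_dd {f : X → Y} {z : X} {k m : WithTop ℕ∞} (hf : ContDiffAt ℝ k f z)
    (hk : m + 1 ≤ k) (a : X) : ContDiffAt ℝ m (dd a f) z :=
  (hf.fderiv_right hk).clm_apply contDiffAt_const

theorem contDiffAt_dd_infty {f : X → Y} {z : X} (hf : ContDiffAt ℝ ∞ f z) (a : X) :
    ContDiffAt ℝ ∞ (dd a f) z := contDiffAt_dd hf le_rfl a

theorem dd_congr {f g : X → Y} {z a : X} (h : f =ᶠ[𝓝 z] g) : dd a f z = dd a g z := by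
  unfold dd; rw [h.fderiv_eq]

theorem dd_comm {f : X → Y} {z a b : X} (hf : ContDiffAt ℝ 2 f z) :
    dd a (dd b f) z = dd b (dd a f) z := by
  have h1 : DifferentiableAt ℝ (fderiv ℝ f) z :=
    (hf.fderiv_right (m := 1) (by norm_num)).differentiableAt (by norm_num)
  have h2 : ∀ a b : X, dd a (dd b f) z = fderiv ℝ (fderiv ℝ f) z a b := by
    intro a b
    have : HasFDerivAt (fun y => fderiv ℝ f y b)
        ((ContinuousLinearMap.apply ℝ Y b).comp (fderiv ℝ (fderiv ℝ f) z)) z :=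
      (ContinuousLinearMap.apply ℝ Y b).hasFDerivAt.comp z h1.hasFDerivAt
    unfold dd
    rw [this.fderiv]; rfl
  rw [h2, h2]
  exact (hf.isSymmSndFDerivAt (by simp)).eq a b

theorem dd_add {f g : X → Y} {z a : X} (hf : DifferentiableAt ℝ f z)
    (hg : DifferentiableAt ℝ g z) : dd a (fun y => f y + g y) z = dd a f z + dd a g z := by
  unfold dd; rw [fderiv_fun_add hf hg]; rfl

theorem dd_sub {f g : X → Y} {z a : X} (hf : DifferentiableAt ℝ f z)
    (hg : DifferentiableAt ℝ g z) : dd a (fun y => f y - g y) z = dd a f z - dd a g z := by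
  unfold dd; rw [fderiv_fun_sub hf hg]; rfl

theorem dd_mul {f g : X → ℝ} {z a : X} (hf : DifferentiableAt ℝ f z) (hg : DifferentiableAt ℝ g z) :
    dd a (fun y => f y * g y) z = dd a f z * g z + f z * dd a g z := by
  unfold dd; rw [fderiv_fun_mul hf hg]
  simp only [add_apply, smul_apply, smul_eq_mul]; ring

theorem dd_const_mul {f : X → ℝ} {z a : X} (c : ℝ) (hf : DifferentiableAt ℝ f z) :
    dd a (fun y => c * f y) z = c * dd a f z := by
  unfold dd; rw [fderiv_const_mul hf]; rfl

theorem dd_neg {f : X → Y} {z a : X} : dd a (fun y => - f y) z = - dd a f z := by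
  unfold dd; rw [fderiv_fun_neg]; rfl

theorem dd_sum {ι : Type*} {s : Finset ι} {f : ι → X → Y} {z a : X}
    (hf : ∀ i ∈ s, DifferentiableAt ℝ (f i) z) :
    dd a (fun y => ∑ i ∈ s, f i y) z = ∑ i ∈ s, dd a (f i) z := by
  unfold dd; rw [fderiv_fun_sum hf]; simp

theorem dd_const {c : Y} {z a : X} : dd a (fun _ => c) z = 0 := by
  unfold dd; simp

end dd

theorem norm_sub_le_pow_succ {Y : Type*} [NormedAddCommGroup Y] [NormedSpace ℝ Y]
    {f f' : ℝ → Y} {δ C : ℝ} (k : ℕ) (hC : 0 ≤ C)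
    (hf : ∀ a, |a| ≤ δ → HasDerivAt f (f' a) a)
    (hb : ∀ a, |a| ≤ δ → ‖f' a‖ ≤ C * |a| ^ k) :
    ∀ a, |a| ≤ δ → ‖f a - f 0‖ ≤ C * |a| ^ (k + 1) := by
  intro a ha
  have hsub : ∀ x ∈ segment ℝ (0 : ℝ) a, |x| ≤ |a| := by
    intro x hx
    obtain ⟨θ, ⟨h0, h1⟩, rfl⟩ := (segment_eq_image ℝ (0 : ℝ) a ▸ hx)
    simp only [smul_eq_mul, mul_zero, zero_add, abs_mul, abs_of_nonneg h0]
    nlinarith [abs_nonneg a]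
  have := (convex_segment (𝕜 := ℝ) (0 : ℝ) a).norm_image_sub_le_of_norm_hasDerivWithin_le
    (f := f) (f' := f') (C := C * |a| ^ k)
    (fun x hx => (hf x ((hsub x hx).trans ha)).hasDerivWithinAt)
    (fun x hx => (hb x ((hsub x hx).trans ha)).trans
      (mul_le_mul_of_nonneg_left (pow_le_pow_left₀ (abs_nonneg x) (hsub x hx) k) hC))
    (left_mem_segment ℝ 0 a) (right_mem_segment ℝ 0 a)
  simpa [pow_succ, mul_assoc] using this

/-- A compact family of points of an open condition has a uniform neighbourhood. -/
theorem exists_uniform_of_forall_nhds {P : Type*} [TopologicalSpace P] {K : Set P}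
    (hK : IsCompact K) {Q : ℝ → ℝ × P → Prop} (hmono : ∀ C C' z, C ≤ C' → Q C z → Q C' z)
    (h : ∀ p ∈ K, ∃ C, ∀ᶠ z in 𝓝 ((0 : ℝ), p), Q C z) :
    ∃ C δ : ℝ, 0 ≤ C ∧ 0 < δ ∧ ∀ p ∈ K, ∀ a : ℝ, |a| ≤ δ → Q C (a, p) := by
  have h1 : ∀ p ∈ K, {w : (ℝ × ℝ) × P | Q w.1.1 (w.1.2, w.2)} ∈ (atTop ×ˢ 𝓝 0) ×ˢ 𝓝 p := by
    intro p hp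
    obtain ⟨C, hC⟩ := h p hp
    rw [nhds_prod_eq] at hC
    have h2 := (eventually_ge_atTop C).prod_mk hC
    rw [← prod_assoc, eventually_map] at h2
    filter_upwards [h2] with w hw using hmono _ _ _ hw.1 hw.2
  have h3 : ∀ᶠ w : (ℝ × ℝ) × P in (atTop ×ˢ 𝓝 0) ×ˢ 𝓝ˢ K, Q w.1.1 (w.1.2, w.2) :=
    hK.mem_prod_nhdsSet_of_forall h1
  obtain ⟨C, hC, h0⟩ := (h3.curry.curry.and (eventually_ge_atTop 0)).exists
  obtain ⟨δ, hδ, h4⟩ := Metric.nhds_basis_closedBall.eventually_iff.1 hC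
  exact ⟨C, δ, h0, hδ, fun p hp a ha => (h4 (by simpa using ha)).self_of_nhdsSet _ hp⟩

section Taylor

variable {P : Type*} [NormedAddCommGroup P] [NormedSpace ℝ P]

theorem hasDerivAt_slice {Y : Type*} [NormedAddCommGroup Y] [NormedSpace ℝ Y]
    {Φ : ℝ × P → Y} {a : ℝ} {p : P} (h : DifferentiableAt ℝ Φ (a, p)) :
    HasDerivAt (fun b => Φ (b, p)) (dd (1, 0) Φ (a, p)) a := by
  have h1 : HasDerivAt (fun b : ℝ => (b, p)) ((1 : ℝ), (0 : P)) a :=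
    (hasDerivAt_id a).prodMk (hasDerivAt_const a p)
  exact h.hasFDerivAt.comp_hasDerivAt a h1

/-- Uniform third-order Taylor estimate in a parameter varying in a compact set. -/
theorem exists_taylor_three {K : Set P} (hK : IsCompact K) {Φ : ℝ × P → ℝ}
    (hΦ : ∀ p ∈ K, ContDiffAt ℝ 3 Φ (0, p))
    (h1 : ∀ p ∈ K, deriv (fun a => Φ (a, p)) 0 = 0)
    (h2 : ∀ p ∈ K, deriv (deriv (fun a => Φ (a, p))) 0 = 0) :
    ∃ C δ : ℝ, 0 ≤ C ∧ 0 < δ ∧ ∀ p ∈ K, ∀ a : ℝ, |a| ≤ δ →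
      |Φ (a, p) - Φ (0, p)| ≤ C * |a| ^ 3 := by
  set D := dd ((1 : ℝ), (0 : P)) Φ with hD
  set D2 := dd ((1 : ℝ), (0 : P)) D with hD2
  obtain ⟨C, δ, hC, hδ, H⟩ := exists_uniform_of_forall_nhds hK
    (Q := fun C z => DifferentiableAt ℝ Φ z ∧ DifferentiableAt ℝ D z ∧ DifferentiableAt ℝ D2 z ∧
      ‖dd ((1 : ℝ), (0 : P)) D2 z‖ ≤ C)
    (fun C C' z h hz => ⟨hz.1, hz.2.1, hz.2.2.1, hz.2.2.2.trans h⟩) (by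
      intro p hp
      have e1 : ContDiffAt ℝ 2 D (0, p) := contDiffAt_dd (hΦ p hp) (by norm_num) _
      have e2 : ContDiffAt ℝ 1 D2 (0, p) := contDiffAt_dd e1 (by norm_num) _
      have e3 : ContinuousAt (dd ((1 : ℝ), (0 : P)) D2) (0, p) :=
        (contDiffAt_dd e2 (m := 0) (by norm_num) _).continuousAt
      refine ⟨‖dd ((1 : ℝ), (0 : P)) D2 (0, p)‖ + 1, ?_⟩
      filter_upwards [(hΦ p hp).eventually (by simp), e1.eventually (by simp),
        e2.eventually (by simp), e3.norm.eventually_le_const (lt_add_one _)] with z a1 a2 a3 a4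
      exact ⟨a1.differentiableAt (by norm_num), a2.differentiableAt (by norm_num),
        a3.differentiableAt (by norm_num), a4⟩)
  refine ⟨C, δ, hC, hδ, fun p hp a ha => ?_⟩
  have z0 : D (0, p) = 0 :=
    (hasDerivAt_slice (H p hp 0 (by simpa using hδ.le)).1).deriv.symm.trans (h1 p hp)
  have z1 : D2 (0, p) = 0 := by
    refine (hasDerivAt_slice (H p hp 0 (by simpa using hδ.le)).2.1).deriv.symm.trans
      ((Filter.EventuallyEq.deriv_eq ?_).symm.trans (h2 p hp))
    filter_upwards [Metric.ball_mem_nhds (0 : ℝ) hδ] with b hb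
    exact (hasDerivAt_slice (H p hp b (by simpa using (Metric.mem_ball.1 hb).le)).1).deriv
  have s1 := norm_sub_le_pow_succ (f := fun b => D2 (b, p)) 0 hC
    (fun b hb => hasDerivAt_slice (H p hp b hb).2.2.1)
    (fun b hb => by simpa using (H p hp b hb).2.2.2)
  simp only [z1, sub_zero] at s1
  have s2 := norm_sub_le_pow_succ (f := fun b => D (b, p)) 1 hC
    (fun b hb => hasDerivAt_slice (H p hp b hb).2.1) s1
  simp only [z0, sub_zero] at s2
  have s3 := norm_sub_le_pow_succ (f := fun b => Φ (b, p)) 2 hC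
    (fun b hb => hasDerivAt_slice (H p hp b hb).1) s2 a ha
  simpa using s3

end Taylor

/-! ### Linear differential equations -/

/-- Coordinatewise truncation of a vector to the cube `[-ρ, ρ]^N`. -/
def clamp {N : ℕ} (ρ : ℝ) (x : ℝ^N) : ℝ^N := WithLp.toLp 2 (fun i => max (-ρ) (min ρ (x i)))

theorem abs_clamp_sub_le (ρ a b : ℝ) :
    |max (-ρ) (min ρ a) - max (-ρ) (min ρ b)| ≤ |a - b| :=
  ((abs_max_sub_max_le_max (-ρ) (min ρ a) (-ρ) (min ρ b)).trans (by simp)).trans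
    ((abs_min_sub_min_le_max ρ a ρ b).trans (by simp))

theorem norm_clamp_sub_le {N : ℕ} (ρ : ℝ) (x y : ℝ^N) : ‖clamp ρ x - clamp ρ y‖ ≤ ‖x - y‖ := by
  rw [EuclideanSpace.norm_eq, EuclideanSpace.norm_eq]
  refine Real.sqrt_le_sqrt (sum_le_sum fun i _ => ?_)
  have := abs_clamp_sub_le ρ (x i) (y i)
  simp only [clamp, PiLp.sub_apply, Real.norm_eq_abs]
  gcongr

theorem norm_clamp_le {N : ℕ} {ρ : ℝ} (hρ : 0 ≤ ρ) (x : ℝ^N) : ‖clamp ρ x‖ ≤ ‖x‖ := by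
  have h0 : clamp ρ (0 : ℝ^N) = 0 := by
    ext i; simp [clamp, hρ]
  simpa [h0] using norm_clamp_sub_le ρ x 0

theorem norm_clamp_le_const {N : ℕ} {ρ : ℝ} (hρ : 0 ≤ ρ) (x : ℝ^N) :
    ‖clamp ρ x‖ ≤ Real.sqrt N * ρ := by
  rw [EuclideanSpace.norm_eq]
  have : ∑ i, ‖clamp ρ x i‖ ^ 2 ≤ N * ρ ^ 2 := by
    have h : ∀ i ∈ (Finset.univ : Finset (Fin N)), ‖clamp ρ x i‖ ^ 2 ≤ ρ ^ 2 := by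
      intro i _
      have h : |clamp ρ x i| ≤ ρ := by
        rw [abs_le]; simp only [clamp]
        exact ⟨le_max_left _ _, max_le (by linarith) (min_le_left _ _)⟩
      rw [Real.norm_eq_abs]; gcongr
    simpa using Finset.sum_le_card_nsmul _ _ _ h
  calc Real.sqrt (∑ i, ‖clamp ρ x i‖ ^ 2) ≤ Real.sqrt (N * ρ ^ 2) := Real.sqrt_le_sqrt this
    _ = Real.sqrt N * ρ := by rw [Real.sqrt_mul (by positivity), Real.sqrt_sq hρ]

theorem clamp_eq_self {N : ℕ} {ρ : ℝ} {x : ℝ^N} (hx : ‖x‖ ≤ ρ) : clamp ρ x = x := by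
  ext i
  have h := abs_le.1 (show |x i| ≤ ρ from (PiLp.norm_apply_le x i).trans hx)
  simp only [clamp]
  rw [min_eq_right h.2, max_eq_right h.1]

/-- Linear differential equations with continuous coefficients have global solutions. -/
theorem exists_linear_ode {N : ℕ} {a b : ℝ} (hab : a ≤ b) {A : ℝ → ℝ^N →L[ℝ] ℝ^N}
    (hA : ContinuousOn A (Icc a b)) (x₀ : ℝ^N) :
    ∃ x : ℝ → ℝ^N, x a = x₀ ∧ ∀ τ ∈ Icc a b, HasDerivWithinAt x (A τ (x τ)) (Icc a b) τ := by
  obtain ⟨C, hC⟩ := isCompact_Icc.exists_bound_of_continuousOn hA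
  have hC0 : 0 ≤ C := (norm_nonneg _).trans (hC a ⟨le_rfl, hab⟩)
  set ρ := ‖x₀‖ * Real.exp (C * (b - a)) with hρ
  have hρ0 : 0 ≤ ρ := by positivity
  set L : NNReal := Real.toNNReal (C * (Real.sqrt N * ρ)) with hL
  have hpl : IsPicardLindelof (fun τ x => A τ (clamp ρ x)) (⟨a, le_rfl, hab⟩ : Icc a b) x₀
      (L * Real.toNNReal (b - a)) 0 L (Real.toNNReal C) := by
    refine ⟨fun t ht => ?_, fun x _ => ?_, fun t ht x _ => ?_, ?_⟩
    · refine LipschitzOnWith.of_dist_le_mul fun x _ y _ => ?_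
      rw [dist_eq_norm, dist_eq_norm, ← map_sub, Real.coe_toNNReal _ hC0]
      exact ((A t).le_opNorm _).trans
        (mul_le_mul (hC t ht) (norm_clamp_sub_le ρ x y) (norm_nonneg _) hC0)
    · exact hA.clm_apply continuousOn_const
    · rw [hL, Real.coe_toNNReal _ (by positivity)]
      exact ((A t).le_opNorm _).trans
        (mul_le_mul (hC t ht) (norm_clamp_le_const hρ0 x) (norm_nonneg _) hC0)
    · simp [hab]
  obtain ⟨x, hx0, hx⟩ := hpl.exists_eq_forall_mem_Icc_hasDerivWithinAt₀
  refine ⟨x, hx0, fun τ hτ => ?_⟩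
  have hcont : ContinuousOn x (Icc a b) := fun t ht => (hx t ht).continuousWithinAt
  have hgr := norm_le_gronwallBound_of_norm_deriv_right_le (f := x)
    (f' := fun t => A t (clamp ρ (x t))) (δ := ‖x₀‖) (K := C) (ε := 0) hcont
    (fun t ht => (hx t (Ico_subset_Icc_self ht)).mono_of_mem_nhdsWithin (Icc_mem_nhdsGE_of_mem ht))
    (by simp only [hx0]; exact le_rfl)
    (fun t ht => by
      rw [add_zero]
      exact ((A t).le_opNorm _).trans (mul_le_mul (hC t (Ico_subset_Icc_self ht))
        (norm_clamp_le hρ0 _) (norm_nonneg _) hC0)) τ hτ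
  rw [gronwallBound_ε0] at hgr
  have h2 : ‖x τ‖ ≤ ρ := hgr.trans (by rw [hρ]; gcongr; exact hτ.2)
  have := hx τ hτ
  rwa [clamp_eq_self h2] at this

/-! ### Matrices with smooth entries -/

section MatrixSmooth

variable {n : ℕ} {X : Type*} [NormedAddCommGroup X] [NormedSpace ℝ X]

theorem contDiffWithinAt_det {s : Set X} {x : X} {k : WithTop ℕ∞} {A : X → Mat n}
    (hA : ∀ i j, ContDiffWithinAt ℝ k (fun y => A y i j) s x) :
    ContDiffWithinAt ℝ k (fun y => (A y).det) s x := by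
  simp only [Matrix.det_apply]
  refine ContDiffWithinAt.sum fun σ _ => ?_
  exact (contDiffWithinAt_prod fun i _ => hA _ _).const_smul _

theorem contDiffWithinAt_inv {s : Set X} {x : X} {k : WithTop ℕ∞} {A : X → Mat n}
    (hA : ∀ i j, ContDiffWithinAt ℝ k (fun y => A y i j) s x) (h0 : (A x).det ≠ 0) (i j : Fin n) :
    ContDiffWithinAt ℝ k (fun y => (A y)⁻¹ i j) s x := by
  have : (fun y => (A y)⁻¹ i j) = fun y => (A y).det⁻¹ * (A y).adjugate i j := by
    funext y; simp [Matrix.inv_def]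
  rw [this]
  refine ((contDiffWithinAt_det hA).inv h0).mul ?_
  simp only [Matrix.adjugate_apply]
  refine contDiffWithinAt_det fun a b => ?_
  simp only [Matrix.updateRow_apply]
  by_cases h : a = j
  · simp only [h, if_true]; exact contDiffWithinAt_const
  · simp only [h, if_false]; exact hA a b

theorem contDiffAt_inv_entry {x : X} {k : WithTop ℕ∞} {A : X → Mat n}
    (hA : ∀ i j, ContDiffAt ℝ k (fun y => A y i j) x) (h0 : (A x).det ≠ 0) (i j : Fin n) :
    ContDiffAt ℝ k (fun y => (A y)⁻¹ i j) x := by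
  rw [← contDiffWithinAt_univ]
  exact contDiffWithinAt_inv (fun i j => (hA i j).contDiffWithinAt) h0 i j

end MatrixSmooth

/-! ### Bilinear forms and Christoffel symbols in coordinates -/

section Coordinates

variable {n : ℕ}

/-- The bilinear form with matrix `A`. -/
def bil (A : Mat n) : ℝ^n →L[ℝ] ℝ^n →L[ℝ] ℝ :=
  ∑ i, ∑ j, A i j • (EuclideanSpace.proj i : ℝ^n →L[ℝ] ℝ).smulRight
    (EuclideanSpace.proj j : ℝ^n →L[ℝ] ℝ)

theorem bil_apply (A : Mat n) (v w : ℝ^n) : bil A v w = ∑ i, ∑ j, A i j * v i * w j := by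
  simp [bil, mul_assoc]

theorem bil_single (A : Mat n) (i j : Fin n) : bil A (𝐞 i) (𝐞 j) = A i j := by
  rw [bil_apply]
  simp

theorem bil_symm {A : Mat n} (hA : ∀ i j, A i j = A j i) (v w : ℝ^n) : bil A v w = bil A w v := by
  rw [bil_apply, bil_apply, sum_comm]
  refine sum_congr rfl fun i _ => sum_congr rfl fun j _ => ?_
  rw [hA j i]; ring

theorem contDiffWithinAt_bil {X : Type*} [NormedAddCommGroup X] [NormedSpace ℝ X] {s : Set X}
    {x : X} {k : WithTop ℕ∞} {A : X → Mat n}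
    (hA : ∀ i j, ContDiffWithinAt ℝ k (fun y => A y i j) s x) :
    ContDiffWithinAt ℝ k (fun y => bil (A y)) s x := by
  unfold bil
  exact ContDiffWithinAt.sum fun i _ => ContDiffWithinAt.sum fun j _ =>
    (hA i j).smul contDiffWithinAt_const

theorem contDiffAt_bil {X : Type*} [NormedAddCommGroup X] [NormedSpace ℝ X]
    {x : X} {k : WithTop ℕ∞} {A : X → Mat n}
    (hA : ∀ i j, ContDiffAt ℝ k (fun y => A y i j) x) :
    ContDiffAt ℝ k (fun y => bil (A y)) x := by
  rw [← contDiffWithinAt_univ]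
  exact contDiffWithinAt_bil fun i j => (hA i j).contDiffWithinAt

theorem sum_single (v : ℝ^n) : v = ∑ i, v i • 𝐞 i := by
  ext k; simp [Finset.sum_apply, Pi.single_apply]

theorem fderiv_eq_sum_pd (f : ℝ^n → ℝ) (u v : ℝ^n) : fderiv ℝ f u v = ∑ k, v k * pd f k u := by
  conv_lhs => rw [sum_single v]
  simp [pd]

theorem dd_bil {X : Type*} [NormedAddCommGroup X] [NormedSpace ℝ X] {x : X} {A : X → Mat n}
    (hA : ∀ i j, DifferentiableAt ℝ (fun y => A y i j) x) (a : X) (v w : ℝ^n) :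
    fderiv ℝ (fun y => bil (A y)) x a v w = ∑ i, ∑ j, dd a (fun y => A y i j) x * v i * w j := by
  have h : HasFDerivAt (fun y => bil (A y)) (∑ i, ∑ j,
      (fderiv ℝ (fun y => A y i j) x).smulRight ((EuclideanSpace.proj i : ℝ^n →L[ℝ] ℝ).smulRight
        (EuclideanSpace.proj j : ℝ^n →L[ℝ] ℝ))) x := by
    unfold bil
    exact HasFDerivAt.fun_sum fun i _ => HasFDerivAt.fun_sum fun j _ =>
      (hA i j).hasFDerivAt.smul_const _
  rw [h.fderiv]
  simp [dd, mul_assoc]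

/-- The Christoffel symbols of the first kind of a field `B` of bilinear forms:
`z ↦ (D_v B(w, z) + D_w B(v, z) - D_z B(v, w)) / 2`. The field may be degenerate. -/
def chr1 {X : Type*} [NormedAddCommGroup X] [NormedSpace ℝ X] (B : X → X →L[ℝ] X →L[ℝ] ℝ)
    (x v w : X) : X →L[ℝ] ℝ :=
  (1 / 2 : ℝ) • (fderiv ℝ B x v w + fderiv ℝ B x w v - ((fderiv ℝ B x).flip v).flip w)

theorem chr1_apply {X : Type*} [NormedAddCommGroup X] [NormedSpace ℝ X]
    (B : X → X →L[ℝ] X →L[ℝ] ℝ) (x v w z : X) :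
    chr1 B x v w z = 1 / 2 * (fderiv ℝ B x v w z + fderiv ℝ B x w v z - fderiv ℝ B x z v w) := by
  simp [chr1]

/-- Christoffel symbols of the first kind under pullback by an arbitrary smooth map. -/
theorem chr1_pullback {X Y : Type*} [NormedAddCommGroup X] [NormedSpace ℝ X]
    [NormedAddCommGroup Y] [NormedSpace ℝ Y] {B : X → X →L[ℝ] X →L[ℝ] ℝ}
    {B' : Y → Y →L[ℝ] Y →L[ℝ] ℝ} {ψ : X → Y} {x : X} (hψ : ContDiffAt ℝ 2 ψ x)
    (hB : DifferentiableAt ℝ B x) (hB' : DifferentiableAt ℝ B' (ψ x))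
    (hs : ∀ a b, B' (ψ x) a b = B' (ψ x) b a)
    (h : ∀ᶠ y in 𝓝 x, ∀ v w, B y v w = B' (ψ y) (fderiv ℝ ψ y v) (fderiv ℝ ψ y w))
    (v w z : X) :
    chr1 B x v w z = chr1 B' (ψ x) (fderiv ℝ ψ x v) (fderiv ℝ ψ x w) (fderiv ℝ ψ x z) +
      B' (ψ x) (fderiv ℝ (fderiv ℝ ψ) x v w) (fderiv ℝ ψ x z) := by
  have hD : DifferentiableAt ℝ (fderiv ℝ ψ) x :=
    (hψ.fderiv_right (m := 1) (by norm_num)).differentiableAt (by norm_num)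
  have hψ1 := hψ.differentiableAt (by norm_num)
  have key : ∀ a b c : X, fderiv ℝ B x a b c =
      fderiv ℝ B' (ψ x) (fderiv ℝ ψ x a) (fderiv ℝ ψ x b) (fderiv ℝ ψ x c) +
        B' (ψ x) (fderiv ℝ (fderiv ℝ ψ) x a b) (fderiv ℝ ψ x c) +
        B' (ψ x) (fderiv ℝ ψ x b) (fderiv ℝ (fderiv ℝ ψ) x a c) := by
    intro a b c
    have e1 : HasFDerivAt (fun y => B y b c) _ x :=
      (hB.hasFDerivAt.clm_apply (hasFDerivAt_const b x)).clm_apply (hasFDerivAt_const c x)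
    have f1 := hB'.hasFDerivAt.comp x hψ1.hasFDerivAt
    have f2 := (f1.clm_apply (hD.hasFDerivAt.clm_apply (hasFDerivAt_const b x))).clm_apply
      (hD.hasFDerivAt.clm_apply (hasFDerivAt_const c x))
    have e2 : (fun y => B y b c) =ᶠ[𝓝 x] fun y => B' (ψ y) (fderiv ℝ ψ y b) (fderiv ℝ ψ y c) := by
      filter_upwards [h] with y hy using hy b c
    have e3 := (e1.congr_of_eventuallyEq e2.symm).unique f2
    have e4 := congrArg (fun L => L a) e3
    simp at e4
    rw [e4]; ring
  have sy : ∀ a b, fderiv ℝ (fderiv ℝ ψ) x a b = fderiv ℝ (fderiv ℝ ψ) x b a :=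
    fun a b => (hψ.isSymmSndFDerivAt (by simp)).eq a b
  rw [chr1_apply, chr1_apply, key, key, key, sy w v, sy z v, sy z w,
    hs (fderiv ℝ ψ x w) (fderiv ℝ (fderiv ℝ ψ) x v z),
    hs (fderiv ℝ ψ x v) (fderiv ℝ (fderiv ℝ ψ) x w z)]
  ring

/-- A smooth field of positive definite symmetric matrices on an open set. -/
structure IsMetricOn (O : Set ℝ^n) (G : ℝ^n → Mat n) : Prop where
  isOpen : IsOpen O
  smooth : ∀ u ∈ O, ∀ i j, ContDiffAt ℝ ∞ (fun y => G y i j) u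
  symm : ∀ u ∈ O, ∀ i j, G u i j = G u j i
  pos : ∀ u ∈ O, ∀ v : ℝ^n, v ≠ 0 → 0 < bil (G u) v v

theorem bil_eq_dotProduct (A : Mat n) (v w : ℝ^n) : bil A v w = (v : Fin n → ℝ) ⬝ᵥ A.mulVec w := by
  rw [bil_apply]
  simp only [dotProduct, Matrix.mulVec, mul_sum]
  exact sum_congr rfl fun i _ => sum_congr rfl fun j _ => by ring

theorem det_ne_zero_of_pos {A : Mat n} (h : ∀ v : ℝ^n, v ≠ 0 → 0 < bil A v v) : A.det ≠ 0 := by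
  intro h0
  obtain ⟨v, hv, hAv⟩ := Matrix.exists_mulVec_eq_zero_iff.2 h0
  have := h (WithLp.toLp 2 v) (by simpa using hv)
  rw [bil_eq_dotProduct] at this
  simp [hAv] at this

/-- A positive definite form separates points. -/
theorem eq_of_bil_eq {A : Mat n} (h : ∀ v : ℝ^n, v ≠ 0 → 0 < bil A v v)
    {v w : ℝ^n} (hvw : ∀ z, bil A v z = bil A w z) : v = w := by
  by_contra hne
  have := h (v - w) (sub_ne_zero.2 hne)
  rw [map_sub] at this
  simp [hvw] at this

theorem sum_mul_inv {A : Mat n} (hd : A.det ≠ 0)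
    (hs : ∀ i j, A i j = A j i) (f : Fin n → ℝ) (m : Fin n) :
    ∑ k, A k m * ∑ l, A⁻¹ k l * f l = f m := by
  have h1 : A * A⁻¹ = 1 := Matrix.mul_nonsing_inv _ (isUnit_iff_ne_zero.2 hd)
  calc ∑ k, A k m * ∑ l, A⁻¹ k l * f l = ∑ l, (∑ k, A m k * A⁻¹ k l) * f l := by
        simp only [mul_sum, sum_mul]
        rw [sum_comm]
        exact sum_congr rfl fun l _ => sum_congr rfl fun k _ => by
          rw [hs k m]; ring
    _ = f m := by
        have : ∀ l, ∑ k, A m k * A⁻¹ k l = (1 : Mat n) m l := fun l => by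
          rw [← h1, Matrix.mul_apply]
        simp [this, Matrix.one_apply]

theorem bil_christoffelVec {G : ℝ^n → Mat n} {u : ℝ^n}
    (hG : ∀ i j, DifferentiableAt ℝ (fun y => G y i j) u) (hd : (G u).det ≠ 0)
    (hs : ∀ i j, G u i j = G u j i) (v w z : ℝ^n) :
    bil (G u) (christoffelVec G u v w) z = chr1 (fun y => bil (G y)) u v w z := by
  set S : Fin n → Fin n → Fin n → ℝ := fun i j l =>
    pd (fun y => G y j l) i u + pd (fun y => G y i l) j u - pd (fun y => G y i j) l u with hS
  have hchr : ∀ i j m, ∑ k, G u k m * christoffel G k i j u = 1 / 2 * S i j m := by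
    intro i j m
    rw [← sum_mul_inv hd hs (fun l => S i j l) m, mul_sum]
    exact sum_congr rfl fun k _ => by simp only [christoffel, hS]; ring
  have hL : bil (G u) (christoffelVec G u v w) z =
      ∑ i, ∑ j, ∑ m, 1 / 2 * S i j m * v i * w j * z m := by
    rw [bil_apply]
    calc ∑ k, ∑ m, G u k m * (christoffelVec G u v w) k * z m
        = ∑ k, ∑ m, ∑ i, ∑ j, G u k m * christoffel G k i j u * v i * w j * z m := by
          simp only [christoffelVec, mul_sum, sum_mul]
          exact sum_congr rfl fun k _ => sum_congr rfl fun m _ =>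
            sum_congr rfl fun i _ => sum_congr rfl fun j _ => by ring
      _ = ∑ m, ∑ i, ∑ j, ∑ k, G u k m * christoffel G k i j u * v i * w j * z m := by
          rw [sum_comm]
          refine sum_congr rfl fun m _ => ?_
          rw [sum_comm]
          refine sum_congr rfl fun i _ => ?_
          rw [sum_comm]
      _ = ∑ m, ∑ i, ∑ j, 1 / 2 * S i j m * v i * w j * z m := by
          refine sum_congr rfl fun m _ => sum_congr rfl fun i _ =>
            sum_congr rfl fun j _ => ?_
          rw [← hchr, sum_mul, sum_mul, sum_mul]
      _ = ∑ i, ∑ j, ∑ m, 1 / 2 * S i j m * v i * w j * z m := by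
          rw [sum_comm]
          refine sum_congr rfl fun i _ => ?_
          rw [sum_comm]
  have hF : ∀ a b c : ℝ^n, fderiv ℝ (fun y => bil (G y)) u a b c =
      ∑ k, ∑ i, ∑ j, pd (fun y => G y i j) k u * a k * b i * c j := by
    intro a b c
    rw [dd_bil hG]
    simp only [dd, fderiv_eq_sum_pd, sum_mul]
    calc _ = ∑ i, ∑ k, ∑ j, a k * pd (fun y => G y i j) k u * b i * c j :=
          sum_congr rfl fun i _ => sum_comm
      _ = _ := by
          rw [sum_comm]
          exact sum_congr rfl fun k _ => sum_congr rfl fun i _ =>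
            sum_congr rfl fun j _ => by ring
  have e1 := hF v w z
  have e2 : fderiv ℝ (fun y => bil (G y)) u w v z =
      ∑ i, ∑ j, ∑ m, pd (fun y => G y i m) j u * v i * w j * z m := by
    rw [hF, sum_comm]
    exact sum_congr rfl fun i _ => sum_congr rfl fun j _ =>
      sum_congr rfl fun m _ => by ring
  have e3 : fderiv ℝ (fun y => bil (G y)) u z v w =
      ∑ i, ∑ j, ∑ m, pd (fun y => G y i j) m u * v i * w j * z m := by
    rw [hF, sum_comm]
    refine sum_congr rfl fun i _ => ?_
    rw [sum_comm]
    exact sum_congr rfl fun j _ => sum_congr rfl fun m _ => by ring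
  rw [hL, chr1_apply, e1, e2, e3, ← sum_add_distrib, ← sum_sub_distrib, mul_sum]
  refine sum_congr rfl fun i _ => ?_
  rw [← sum_add_distrib, ← sum_sub_distrib, mul_sum]
  refine sum_congr rfl fun j _ => ?_
  rw [← sum_add_distrib, ← sum_sub_distrib, mul_sum]
  refine sum_congr rfl fun m _ => ?_
  simp only [hS]; ring

/-- The Christoffel symbols as a continuous bilinear map; see `chrL_apply`. -/
def chrL (G : ℝ^n → Mat n) (u : ℝ^n) : ℝ^n →L[ℝ] ℝ^n →L[ℝ] ℝ^n :=
  ∑ k, ∑ i, ∑ j, christoffel G k i j u • (EuclideanSpace.proj i : ℝ^n →L[ℝ] ℝ).smulRight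
    ((EuclideanSpace.proj j : ℝ^n →L[ℝ] ℝ).smulRight (𝐞 k))

theorem chrL_apply (G : ℝ^n → Mat n) (u v w : ℝ^n) : chrL G u v w = christoffelVec G u v w := by
  ext m
  simp only [chrL, sum_apply, smul_apply,
    ContinuousLinearMap.smulRight_apply, WithLp.ofLp_sum, Finset.sum_apply, PiLp.smul_apply,
    christoffelVec, smul_eq_mul, PiLp.proj_apply, PiLp.single_apply]
  rw [Finset.sum_eq_single m]
  · simp [mul_assoc]
  · intro k _ hk; simp [hk.symm]
  · simp

theorem IsMetricOn.contDiffAt_christoffel {O : Set ℝ^n} {G : ℝ^n → Mat n}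
    (hG : IsMetricOn O G) {u : ℝ^n} (hu : u ∈ O) (k i j : Fin n) :
    ContDiffAt ℝ ∞ (christoffel G k i j) u := by
  unfold christoffel
  have hp : ∀ a b c, ContDiffAt ℝ ∞ (fun y => pd (fun z => G z a b) c y) u := fun a b c =>
    contDiffAt_dd_infty (hG.smooth u hu a b) _
  refine contDiffAt_const.mul (ContDiffAt.sum fun l _ => ContDiffAt.mul ?_ ?_)
  · exact contDiffAt_inv_entry (hG.smooth u hu) (det_ne_zero_of_pos (hG.pos u hu)) _ _
  · exact ((hp _ _ _).add (hp _ _ _)).sub (hp _ _ _)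

theorem IsMetricOn.contDiffAt_chrL {O : Set ℝ^n} {G : ℝ^n → Mat n}
    (hG : IsMetricOn O G) {u : ℝ^n} (hu : u ∈ O) : ContDiffAt ℝ ∞ (chrL G) u := by
  unfold chrL
  exact ContDiffAt.sum fun k _ => ContDiffAt.sum fun i _ => ContDiffAt.sum fun j _ =>
    (hG.contDiffAt_christoffel hu k i j).smul contDiffAt_const

theorem IsMetricOn.bil_chrL {O : Set ℝ^n} {G : ℝ^n → Mat n}
    (hG : IsMetricOn O G) {u : ℝ^n} (hu : u ∈ O) (v w z : ℝ^n) :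
    bil (G u) (chrL G u v w) z = chr1 (fun y => bil (G y)) u v w z := by
  rw [chrL_apply]
  exact bil_christoffelVec (fun i j => (hG.smooth u hu i j).differentiableAt (by simp))
    (det_ne_zero_of_pos (hG.pos u hu)) (hG.symm u hu) v w z

theorem IsMetricOn.differentiableAt_bil {O : Set ℝ^n} {G : ℝ^n → Mat n}
    (hG : IsMetricOn O G) {u : ℝ^n} (hu : u ∈ O) :
    DifferentiableAt ℝ (fun y => bil (G y)) u :=
  (contDiffAt_bil (hG.smooth u hu)).differentiableAt (by simp)

theorem IsMetricOn.chrL_symm {O : Set ℝ^n} {G : ℝ^n → Mat n}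
    (hG : IsMetricOn O G) {u : ℝ^n} (hu : u ∈ O) (v w : ℝ^n) : chrL G u v w = chrL G u w v := by
  have hsy : ∀ a v w : ℝ^n, fderiv ℝ (fun y => bil (G y)) u a v w =
      fderiv ℝ (fun y => bil (G y)) u a w v := by
    intro a v w
    rw [dd_bil (fun i j => (hG.smooth u hu i j).differentiableAt (by simp)),
      dd_bil (fun i j => (hG.smooth u hu i j).differentiableAt (by simp)), sum_comm]
    refine sum_congr rfl fun i _ => sum_congr rfl fun j _ => ?_
    have : dd a (fun y => G y j i) u = dd a (fun y => G y i j) u :=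
      dd_congr (by filter_upwards [hG.isOpen.mem_nhds hu] with y hy using hG.symm y hy j i)
    rw [this]; ring
  refine eq_of_bil_eq (hG.pos u hu) fun z => ?_
  rw [hG.bil_chrL hu, hG.bil_chrL hu, chr1_apply, chr1_apply, hsy z v w]; ring

/-- Christoffel symbols under a change of coordinates. -/
theorem chrL_pullback {O O' : Set ℝ^n} {G G' : ℝ^n → Mat n}
    (hG : IsMetricOn O G) (hG' : IsMetricOn O' G') {ψ : ℝ^n → ℝ^n} {u : ℝ^n} (hu : u ∈ O)
    (hu' : ψ u ∈ O') (hψ : ContDiffAt ℝ 2 ψ u) (hsurj : Function.Surjective (fderiv ℝ ψ u))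
    (h : ∀ᶠ y in 𝓝 u, ∀ v w, bil (G y) v w =
      bil (G' (ψ y)) (fderiv ℝ ψ y v) (fderiv ℝ ψ y w)) (v w : ℝ^n) :
    fderiv ℝ ψ u (chrL G u v w) = fderiv ℝ (fderiv ℝ ψ) u v w +
      chrL G' (ψ u) (fderiv ℝ ψ u v) (fderiv ℝ ψ u w) := by
  refine eq_of_bil_eq (hG'.pos _ hu') fun z => ?_
  obtain ⟨z, rfl⟩ := hsurj z
  rw [← h.self_of_nhds, hG.bil_chrL hu, chr1_pullback hψ (hG.differentiableAt_bil hu)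
    (hG'.differentiableAt_bil hu') (bil_symm (hG'.symm _ hu')) h, map_add, add_apply,
    hG'.bil_chrL hu', add_comm]

/-! ### Curvature and its behaviour under changes of coordinates -/

/-- The curvature expression `∂_X Γ(Z, Y) - ∂_Y Γ(Z, X) + Γ(X, Γ(Z, Y)) - Γ(Y, Γ(Z, X))`. -/
def riem {X : Type*} [NormedAddCommGroup X] [NormedSpace ℝ X] (Γ : X → X →L[ℝ] X →L[ℝ] X)
    (x a b c : X) : X :=
  fderiv ℝ Γ x a c b - fderiv ℝ Γ x b c a + Γ x a (Γ x c b) - Γ x b (Γ x c a)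

theorem isSymmSndFDerivAt_of_two_le {X Y : Type*} [NormedAddCommGroup X] [NormedSpace ℝ X]
    [NormedAddCommGroup Y] [NormedSpace ℝ Y] {f : X → Y} {z : X} {k : WithTop ℕ∞} (hk : 2 ≤ k)
    (hf : ContDiffAt ℝ k f z) : IsSymmSndFDerivAt ℝ f z :=
  (hf.of_le hk).isSymmSndFDerivAt (by simp)

/-- The third derivative is symmetric in its last two arguments. -/
theorem fderiv_three_comm {X Y : Type*} [NormedAddCommGroup X] [NormedSpace ℝ X]
    [NormedAddCommGroup Y] [NormedSpace ℝ Y] {ψ : X → Y} {x : X} (h : ContDiffAt ℝ 3 ψ x)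
    (a b c : X) : fderiv ℝ (fderiv ℝ (fderiv ℝ ψ)) x a b c =
      fderiv ℝ (fderiv ℝ (fderiv ℝ ψ)) x a c b := by
  have h1 : ContDiffAt ℝ 1 (fderiv ℝ (fderiv ℝ ψ)) x :=
    (h.fderiv_right (m := 2) (by norm_num)).fderiv_right (by norm_num)
  have hd := (h1.differentiableAt (by simp)).hasFDerivAt
  have e (b c) := (hd.clm_apply (hasFDerivAt_const b x)).clm_apply (hasFDerivAt_const c x)
  have e3 : (fun y => fderiv ℝ (fderiv ℝ ψ) y b c) =ᶠ[𝓝 x]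
      fun y => fderiv ℝ (fderiv ℝ ψ) y c b := by
    filter_upwards [h.eventually (by simp)] with y hy
    exact (isSymmSndFDerivAt_of_two_le (by norm_cast) hy).eq b c
  simpa using DFunLike.congr_fun ((e b c).unique ((e c b).congr_of_eventuallyEq e3)) a

theorem riem_pullback {X : Type*} [NormedAddCommGroup X] [NormedSpace ℝ X]
    {Γ Γ' : X → X →L[ℝ] X →L[ℝ] X} {ψ : X → X} {x : X} (hψ : ContDiffAt ℝ 3 ψ x)
    (hΓ : DifferentiableAt ℝ Γ x) (hΓ' : DifferentiableAt ℝ Γ' (ψ x))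
    (hs : ∀ a b, Γ' (ψ x) a b = Γ' (ψ x) b a)
    (h : ∀ᶠ y in 𝓝 x, ∀ v w, fderiv ℝ ψ y (Γ y v w) = fderiv ℝ (fderiv ℝ ψ) y v w +
      Γ' (ψ y) (fderiv ℝ ψ y v) (fderiv ℝ ψ y w)) (a b c : X) :
    fderiv ℝ ψ x (riem Γ x a b c) =
      riem Γ' (ψ x) (fderiv ℝ ψ x a) (fderiv ℝ ψ x b) (fderiv ℝ ψ x c) := by
  have hD1 : ContDiffAt ℝ 2 (fderiv ℝ ψ) x := hψ.fderiv_right (by norm_num)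
  have hD : DifferentiableAt ℝ (fderiv ℝ ψ) x := hD1.differentiableAt (by norm_num)
  have hD2 : DifferentiableAt ℝ (fderiv ℝ (fderiv ℝ ψ)) x :=
    (hD1.fderiv_right (m := 1) (by norm_num)).differentiableAt (by norm_num)
  have hψ1 := hψ.differentiableAt (by norm_num)
  -- differentiate the transformation law in the direction `a`
  have key : ∀ a b c : X, fderiv ℝ (fderiv ℝ ψ) x a (Γ x c b) +
      fderiv ℝ ψ x (fderiv ℝ Γ x a c b) = fderiv ℝ (fderiv ℝ (fderiv ℝ ψ)) x a c b +
      fderiv ℝ Γ' (ψ x) (fderiv ℝ ψ x a) (fderiv ℝ ψ x c) (fderiv ℝ ψ x b) +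
      Γ' (ψ x) (fderiv ℝ (fderiv ℝ ψ) x a c) (fderiv ℝ ψ x b) +
      Γ' (ψ x) (fderiv ℝ ψ x c) (fderiv ℝ (fderiv ℝ ψ) x a b) := by
    intro a b c
    have e1 := hD.hasFDerivAt.clm_apply ((hΓ.hasFDerivAt.clm_apply
      (hasFDerivAt_const c x)).clm_apply (hasFDerivAt_const b x))
    have f1 := hΓ'.hasFDerivAt.comp x hψ1.hasFDerivAt
    have f2 := (f1.clm_apply (hD.hasFDerivAt.clm_apply (hasFDerivAt_const c x))).clm_apply
      (hD.hasFDerivAt.clm_apply (hasFDerivAt_const b x))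
    have f3 := ((hD2.hasFDerivAt.clm_apply (hasFDerivAt_const c x)).clm_apply
      (hasFDerivAt_const b x)).add f2
    have e2 : (fun y => fderiv ℝ ψ y (Γ y c b)) =ᶠ[𝓝 x] fun y => fderiv ℝ (fderiv ℝ ψ) y c b +
          Γ' (ψ y) (fderiv ℝ ψ y c) (fderiv ℝ ψ y b) := by
      filter_upwards [h] with y hy using hy c b
    have e4 := congrArg (fun L => L a) ((e1.congr_of_eventuallyEq e2.symm).unique f3)
    simp at e4
    rw [add_comm, e4]; abel
  have sy : ∀ a b, fderiv ℝ (fderiv ℝ ψ) x a b = fderiv ℝ (fderiv ℝ ψ) x b a := fun a b =>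
    (hψ.isSymmSndFDerivAt (by simp; norm_cast)).eq a b
  -- symmetry of the third derivative
  have sy3 : ∀ a b c, fderiv ℝ (fderiv ℝ (fderiv ℝ ψ)) x a c b =
      fderiv ℝ (fderiv ℝ (fderiv ℝ ψ)) x b c a := by
    have s1 : ∀ a c b, fderiv ℝ (fderiv ℝ (fderiv ℝ ψ)) x a c b =
        fderiv ℝ (fderiv ℝ (fderiv ℝ ψ)) x c a b := fun a c b =>
      congrArg (fun L => L b) ((hD1.isSymmSndFDerivAt (by simp)).eq a c)
    intro a b c
    rw [fderiv_three_comm hψ a c b, s1 a b c, fderiv_three_comm hψ b a c]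
  have h0 := h.self_of_nhds
  have k1 := key a b c
  have k2 := key b a c
  have k1' := eq_sub_of_add_eq' k1
  have k2' := eq_sub_of_add_eq' k2
  simp only [riem, map_add, map_sub, h0]
  rw [k1', k2', sy3 a b c]
  rw [sy a (Γ x c b), sy b (Γ x c a), sy b a, sy c a, sy c b,
    hs (fderiv ℝ (fderiv ℝ ψ) x a c), hs (fderiv ℝ (fderiv ℝ ψ) x b c)]
  abel

/-- The Ricci tensor as a bilinear form. -/
def ricB (G : ℝ^n → Mat n) (u : ℝ^n) : ℝ^n →L[ℝ] ℝ^n →L[ℝ] ℝ := bil (Matrix.of (ricciCoeff G u))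

theorem fderiv_chrL {O : Set ℝ^n} {G : ℝ^n → Mat n} (hG : IsMetricOn O G)
    {u : ℝ^n} (hu : u ∈ O) (a : ℝ^n) (i j k : Fin n) :
    fderiv ℝ (chrL G) u a (𝐞 i) (𝐞 j) k = fderiv ℝ (christoffel G k i j) u a := by
  have h1 := (((hG.contDiffAt_chrL hu).differentiableAt (by simp)).hasFDerivAt.clm_apply
    (hasFDerivAt_const (𝐞 i) u)).clm_apply
    (hasFDerivAt_const (𝐞 j) u)
  have h2 := (EuclideanSpace.proj k : ℝ^n →L[ℝ] ℝ).hasFDerivAt.comp u h1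
  have h3 : ((EuclideanSpace.proj k : ℝ^n →L[ℝ] ℝ) ∘ fun y =>
      chrL G y (𝐞 i) (𝐞 j)) =
      christoffel G k i j := by
    funext y
    simp [chrL_apply, christoffelVec]
  rw [h3] at h2
  rw [h2.fderiv]
  simp

theorem ricciCoeff_eq_sum_riem {O : Set ℝ^n} {G : ℝ^n → Mat n}
    (hG : IsMetricOn O G) {u : ℝ^n} (hu : u ∈ O) (i j : Fin n) :
    ricciCoeff G u i j = ∑ k, riem (chrL G) u (𝐞 k) (𝐞 j) (𝐞 i) k := by
  unfold ricciCoeff riem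
  refine sum_congr rfl fun k _ => ?_
  rw [PiLp.sub_apply, PiLp.add_apply, PiLp.sub_apply, fderiv_chrL hG hu, fderiv_chrL hG hu,
    sum_sub_distrib]
  have hc : ∀ (i j k l : Fin n), (chrL G u (𝐞 k) (chrL G u (𝐞 i) (𝐞 j))) l =
      ∑ m, christoffel G l k m u * christoffel G m i j u := by
    intro i j k l
    simp [chrL_apply, christoffelVec]
  rw [hc, hc]
  simp only [pd]
  ring

/-- The curvature as a linear map in its first argument. -/
def riemLin {X : Type*} [NormedAddCommGroup X] [NormedSpace ℝ X] (Γ : X → X →L[ℝ] X →L[ℝ] X)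
    (x b c : X) : X →ₗ[ℝ] X where
  toFun a := riem Γ x a b c
  map_add' a a' := by simp only [riem, map_add, add_apply]; abel
  map_smul' r a := by
    simp only [riem, map_smul, smul_apply, RingHom.id_apply, smul_sub, smul_add]

/-- The Ricci contraction of the curvature, as a bilinear map. -/
def ricLin {X : Type*} [NormedAddCommGroup X] [NormedSpace ℝ X] (Γ : X → X →L[ℝ] X →L[ℝ] X)
    (x : X) : X →ₗ[ℝ] X →ₗ[ℝ] ℝ :=
  LinearMap.mk₂ ℝ (fun v w => LinearMap.trace ℝ X (riemLin Γ x w v)) (fun v v' w => by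
      rw [← map_add]; congr 1; ext a
      simp only [riemLin, riem, LinearMap.coe_mk, AddHom.coe_mk, LinearMap.add_apply, map_add,
        add_apply]; abel)
    (fun r v w => by
      rw [← map_smul]; congr 1; ext a
      simp only [riemLin, riem, LinearMap.coe_mk, AddHom.coe_mk, LinearMap.smul_apply, map_smul,
        smul_apply, smul_sub, smul_add])
    (fun v w w' => by
      rw [← map_add]; congr 1; ext a
      simp only [riemLin, riem, LinearMap.coe_mk, AddHom.coe_mk, LinearMap.add_apply, map_add,
        add_apply]; abel)
    (fun r v w => by
      rw [← map_smul]; congr 1; ext a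
      simp only [riemLin, riem, LinearMap.coe_mk, AddHom.coe_mk, LinearMap.smul_apply, map_smul,
        smul_apply, smul_sub, smul_add])

theorem trace_eq_sum (f : ℝ^n →ₗ[ℝ] ℝ^n) : LinearMap.trace ℝ ℝ^n f = ∑ k, f (𝐞 k) k := by
  rw [LinearMap.trace_eq_matrix_trace ℝ (EuclideanSpace.basisFun (Fin n) ℝ).toBasis, Matrix.trace]
  refine sum_congr rfl fun k _ => ?_
  simp [LinearMap.toMatrix_apply]

theorem ricB_eq_trace {O : Set ℝ^n} {G : ℝ^n → Mat n}
    (hG : IsMetricOn O G) {u : ℝ^n} (hu : u ∈ O) (v w : ℝ^n) :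
    ricB G u v w = LinearMap.trace ℝ ℝ^n (riemLin (chrL G) u w v) := by
  change _ = ricLin (chrL G) u v w
  have hb : ∀ i j, ricciCoeff G u i j = ricLin (chrL G) u (𝐞 i) (𝐞 j) := by
    intro i j
    rw [ricciCoeff_eq_sum_riem hG hu]
    simp only [ricLin, LinearMap.mk₂_apply]
    rw [trace_eq_sum]; rfl
  rw [ricB, bil_apply]
  conv_rhs => rw [sum_single v, sum_single w]
  simp only [map_sum, map_smul, LinearMap.sum_apply, LinearMap.smul_apply, smul_eq_mul,
    Matrix.of_apply, hb, mul_sum]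
  rw [sum_comm]
  exact sum_congr rfl fun i _ => sum_congr rfl fun j _ => by ring

/-- The Ricci tensor is invariant under changes of coordinates. -/
theorem ricB_pullback {O O' : Set ℝ^n} {G G' : ℝ^n → Mat n}
    (hG : IsMetricOn O G) (hG' : IsMetricOn O' G') {ψ : ℝ^n → ℝ^n} {u : ℝ^n} (hu : u ∈ O)
    (hu' : ψ u ∈ O') (hψ : ∀ᶠ y in 𝓝 u, ContDiffAt ℝ ∞ ψ y)
    (hbij : ∀ᶠ y in 𝓝 u, Function.Bijective (fderiv ℝ ψ y))
    (h : ∀ᶠ y in 𝓝 u, ∀ v w, bil (G y) v w =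
      bil (G' (ψ y)) (fderiv ℝ ψ y v) (fderiv ℝ ψ y w)) (v w : ℝ^n) :
    ricB G u v w = ricB G' (ψ u) (fderiv ℝ ψ u v) (fderiv ℝ ψ u w) := by
  have hψu := hψ.self_of_nhds
  have hO' : ∀ᶠ y in 𝓝 u, ψ y ∈ O' := hψu.continuousAt.eventually (hG'.isOpen.mem_nhds hu')
  have hlaw : ∀ᶠ y in 𝓝 u, ∀ v w, fderiv ℝ ψ y (chrL G y v w) =
      fderiv ℝ (fderiv ℝ ψ) y v w + chrL G' (ψ y) (fderiv ℝ ψ y v) (fderiv ℝ ψ y w) := by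
    filter_upwards [hψ, hbij, h.eventually_nhds, hO', hG.isOpen.mem_nhds hu]
      with y h1 h2 h3 h4 h5 v w
    exact chrL_pullback hG hG' h5 h4 (h1.of_le (WithTop.coe_le_coe.2 le_top)) h2.surjective h3 v w
  have hR : ∀ a b c, fderiv ℝ ψ u (riem (chrL G) u a b c) =
      riem (chrL G') (ψ u) (fderiv ℝ ψ u a) (fderiv ℝ ψ u b) (fderiv ℝ ψ u c) :=
    riem_pullback (hψu.of_le (WithTop.coe_le_coe.2 le_top))
      ((hG.contDiffAt_chrL hu).differentiableAt (by simp))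
      ((hG'.contDiffAt_chrL hu').differentiableAt (by simp)) (hG'.chrL_symm hu') hlaw
  let e : ℝ^n ≃ₗ[ℝ] ℝ^n := LinearEquiv.ofBijective (fderiv ℝ ψ u : ℝ^n →ₗ[ℝ] ℝ^n) hbij.self_of_nhds
  rw [ricB_eq_trace hG hu, ricB_eq_trace hG' hu', ← LinearMap.trace_conj' _ e]
  congr 1
  ext a : 1
  obtain ⟨a, rfl⟩ := e.surjective a
  rw [LinearEquiv.conj_apply_apply, LinearEquiv.symm_apply_apply]
  exact hR a w v

end Coordinates

/-! ### Ricci flow in coordinates -/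

section CoordinateFlow

variable {n : ℕ}

/-- The spatial coordinate direction `∂/∂u^i` in space-time. -/
def sp (i : Fin n) : ℝ × ℝ^n := (0, 𝐞 i)

/-- The time direction in space-time. -/
def tm : ℝ × ℝ^n := (1, 0)

/-- Componentwise directional derivative of a matrix field. -/
def ddm {X : Type*} [NormedAddCommGroup X] [NormedSpace ℝ X] (a : X)
    (A : X → Mat n) (z : X) : Mat n :=
  Matrix.of fun i j => dd a (fun y => A y i j) z

/-- A smooth solution of the Ricci flow in coordinates on an open subset of space-time. -/
structure IsFlowOn (O : Set (ℝ × ℝ^n)) (G : ℝ × ℝ^n → Mat n) : Prop where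
  isOpen : IsOpen O
  smooth : ∀ z ∈ O, ∀ i j, ContDiffAt ℝ ∞ (fun y => G y i j) z
  symm : ∀ z ∈ O, ∀ i j, G z i j = G z j i
  pos : ∀ z ∈ O, ∀ v : ℝ^n, v ≠ 0 → 0 < bil (G z) v v
  flow : ∀ z ∈ O, ∀ i j, dd tm (fun y => G y i j) z = -2 * ricciCoeff (fun u => G (z.1, u)) z.2 i j

/-- The Christoffel symbols of a time dependent metric, as functions on space-time. -/
def chr (G : ℝ × ℝ^n → Mat n) (k i j : Fin n) (z : ℝ × ℝ^n) : ℝ :=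
  christoffel (fun u => G (z.1, u)) k i j z.2

/-- The Ricci coefficients of a time dependent metric, as functions on space-time. -/
def ric (G : ℝ × ℝ^n → Mat n) (i j : Fin n) (z : ℝ × ℝ^n) : ℝ :=
  ricciCoeff (fun u => G (z.1, u)) z.2 i j

/-- The scalar curvature of a time dependent metric, as a function on space-time. -/
def scal (G : ℝ × ℝ^n → Mat n) (z : ℝ × ℝ^n) : ℝ := ∑ i, ∑ j, (G z)⁻¹ i j * ric G i j z

theorem contDiffAt_slice {τ : ℝ} {u : ℝ^n} {f : ℝ × ℝ^n → ℝ} (hf : ContDiffAt ℝ ∞ f (τ, u)) :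
    ContDiffAt ℝ ∞ (fun v => f (τ, v)) u :=
  ContDiffAt.comp u hf (contDiffAt_const.prodMk contDiffAt_id)

theorem dd_slice {Y : Type*} [NormedAddCommGroup Y] [NormedSpace ℝ Y] {τ : ℝ} {u : ℝ^n}
    {f : ℝ × ℝ^n → Y} (hf : DifferentiableAt ℝ f (τ, u)) (a : ℝ^n) :
    dd a (fun v => f (τ, v)) u = dd ((0 : ℝ), a) f (τ, u) := by
  have h1 : HasFDerivAt (fun v : ℝ^n => (τ, v)) (ContinuousLinearMap.inr ℝ ℝ ℝ^n) u :=
    hasFDerivAt_prodMk_right τ u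
  have h2 : HasFDerivAt (fun v => f (τ, v))
      ((fderiv ℝ f (τ, u)).comp (ContinuousLinearMap.inr ℝ ℝ ℝ^n)) u :=
    HasFDerivAt.comp (g := f) u hf.hasFDerivAt h1
  unfold dd
  rw [h2.fderiv]; rfl

theorem pd_slice {τ : ℝ} {u : ℝ^n} {f : ℝ × ℝ^n → ℝ} (hf : DifferentiableAt ℝ f (τ, u))
    (i : Fin n) : pd (fun v => f (τ, v)) i u = dd (sp i) f (τ, u) := dd_slice hf _

variable {O : Set (ℝ × ℝ^n)}
  {G : ℝ × ℝ^n → Mat n}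

theorem IsFlowOn.slice (hG : IsFlowOn O G) (τ : ℝ) :
    IsMetricOn {u | (τ, u) ∈ O} (fun u => G (τ, u)) :=
  ⟨hG.isOpen.preimage (Continuous.prodMk_right τ),
    fun u hu i j => contDiffAt_slice (f := fun y => G y i j) (hG.smooth (τ, u) hu i j),
    fun u hu => hG.symm (τ, u) hu, fun u hu => hG.pos (τ, u) hu⟩

section

variable (hG : IsFlowOn O G) {z : ℝ × ℝ^n} (hz : z ∈ O)

include hG hz

theorem IsFlowOn.det_ne_zero : (G z).det ≠ 0 :=
  det_ne_zero_of_pos (hG.pos z hz)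

theorem IsFlowOn.contDiffAt_inv (i j : Fin n) : ContDiffAt ℝ ∞ (fun y => (G y)⁻¹ i j) z :=
  contDiffAt_inv_entry (hG.smooth z hz) (hG.det_ne_zero hz) i j

/-- The combination of first derivatives of the metric that enters the Christoffel symbols. -/
def chrSum (G : ℝ × ℝ^n → Mat n) (i j l : Fin n) (z : ℝ × ℝ^n) : ℝ :=
  dd (sp i) (fun y => G y j l) z + dd (sp j) (fun y => G y i l) z - dd (sp l) (fun y => G y i j) z

theorem IsFlowOn.contDiffAt_chrSum (i j l : Fin n) : ContDiffAt ℝ ∞ (chrSum G i j l) z :=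
  ((contDiffAt_dd_infty (hG.smooth z hz _ _) _).add
    (contDiffAt_dd_infty (hG.smooth z hz _ _) _)).sub
    (contDiffAt_dd_infty (hG.smooth z hz _ _) _)

theorem IsFlowOn.chr_eq (k i j : Fin n) :
    chr G k i j z = 1 / 2 * ∑ l, (G z)⁻¹ k l * chrSum G i j l z := by
  have hd : ∀ a b, DifferentiableAt ℝ (fun y => G y a b) (z.1, z.2) := fun a b =>
    (hG.smooth z hz a b).differentiableAt (by simp)
  unfold chr christoffel chrSum
  congr 1
  refine sum_congr rfl fun l _ => ?_
  rw [pd_slice (hd _ _), pd_slice (hd _ _), pd_slice (hd _ _)]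

theorem IsFlowOn.eventuallyEq_of_eqOn
    {Y : Type*} {f g : ℝ × ℝ^n → Y} (h : ∀ z ∈ O, f z = g z) : f =ᶠ[𝓝 z] g := by
  filter_upwards [hG.isOpen.mem_nhds hz] with y hy using h y hy

theorem IsFlowOn.contDiffAt_chr (k i j : Fin n) : ContDiffAt ℝ ∞ (chr G k i j) z := by
  refine ContDiffAt.congr_of_eventuallyEq ?_
    (hG.eventuallyEq_of_eqOn hz fun z hz => hG.chr_eq hz k i j)
  exact contDiffAt_const.mul (ContDiffAt.sum fun l _ =>
    (hG.contDiffAt_inv hz _ _).mul (hG.contDiffAt_chrSum hz _ _ _))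

theorem IsFlowOn.ric_eq (i j : Fin n) :
    ric G i j z = ∑ k, (dd (sp k) (chr G k i j) z - dd (sp j) (chr G k i k) z +
      ∑ l, (chr G k k l z * chr G l i j z - chr G k j l z * chr G l i k z)) := by
  have hd : ∀ a b c, DifferentiableAt ℝ (chr G a b c) (z.1, z.2) := fun a b c =>
    (hG.contDiffAt_chr hz a b c).differentiableAt (by simp)
  unfold ric ricciCoeff
  refine sum_congr rfl fun k _ => ?_
  have e : ∀ a b c, christoffel (fun u => G (z.1, u)) a b c = fun v => chr G a b c (z.1, v) :=
    fun a b c => rfl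
  simp only [e]
  rw [pd_slice (hd _ _ _), pd_slice (hd _ _ _)]

theorem IsFlowOn.contDiffAt_ric (i j : Fin n) : ContDiffAt ℝ ∞ (ric G i j) z := by
  refine ContDiffAt.congr_of_eventuallyEq ?_
    (hG.eventuallyEq_of_eqOn hz fun z hz => hG.ric_eq hz i j)
  have h := fun a b c => hG.contDiffAt_chr hz a b c
  exact ContDiffAt.sum fun k _ => ((contDiffAt_dd_infty (h _ _ _) _).sub
    (contDiffAt_dd_infty (h _ _ _) _)).add (ContDiffAt.sum fun l _ =>
      ((h _ _ _).mul (h _ _ _)).sub ((h _ _ _).mul (h _ _ _)))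

theorem IsFlowOn.contDiffAt_scal : ContDiffAt ℝ ∞ (scal G) z :=
  ContDiffAt.sum fun _ _ => ContDiffAt.sum fun _ _ =>
    (hG.contDiffAt_inv hz _ _).mul (hG.contDiffAt_ric hz _ _)

theorem IsFlowOn.flow' (i j : Fin n) :
    dd tm (fun y => G y i j) z = -2 * ric G i j z := hG.flow z hz i j

theorem IsFlowOn.ric_symm (i j : Fin n) : ric G i j z = ric G j i z := by
  have h1 := hG.flow' hz i j
  have h2 := hG.flow' hz j i
  rw [dd_congr (hG.eventuallyEq_of_eqOn hz fun z hz => hG.symm z hz i j), h2] at h1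
  linarith

theorem IsFlowOn.inv_symm (i j : Fin n) : (G z)⁻¹ i j = (G z)⁻¹ j i := by
  have h : (G z).transpose = G z := by ext a b; exact hG.symm z hz b a
  have := congrFun (congrFun (Matrix.transpose_nonsing_inv (G z)) j) i
  rw [h] at this
  simpa using this

end

/-! ### Derivatives of matrix fields -/

theorem ddm_mul {X : Type*} [NormedAddCommGroup X] [NormedSpace ℝ X] {z a : X} {A B : X → Mat n}
    (hA : ∀ i j, DifferentiableAt ℝ (fun y => A y i j) z)
    (hB : ∀ i j, DifferentiableAt ℝ (fun y => B y i j) z) :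
    ddm a (fun y => A y * B y) z = ddm a A z * B z + A z * ddm a B z := by
  ext i j
  simp only [ddm, Matrix.of_apply, Matrix.mul_apply, Matrix.add_apply]
  rw [dd_sum (f := fun k y => A y i k * B y k j) fun k _ => (hA i k).mul
      (hB k j), ← sum_add_distrib]
  exact sum_congr rfl fun k _ => dd_mul (hA i k) (hB k j)

theorem dd_trace {X : Type*} [NormedAddCommGroup X] [NormedSpace ℝ X] {z a : X} {A : X → Mat n}
    (hA : ∀ i j, DifferentiableAt ℝ (fun y => A y i j) z) :
    dd a (fun y => (A y).trace) z = (ddm a A z).trace := by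
  simp only [Matrix.trace, Matrix.diag_apply, ddm, Matrix.of_apply]
  exact dd_sum fun k _ => hA k k

theorem IsFlowOn.ddm_inv (hG : IsFlowOn O G) {z : ℝ × ℝ^n} (hz : z ∈ O) (a : ℝ × ℝ^n) :
    ddm a (fun y => (G y)⁻¹) z = - ((G z)⁻¹ * ddm a G z * (G z)⁻¹) := by
  have hd : ∀ i j, DifferentiableAt ℝ (fun y => G y i j) z := fun i j =>
    (hG.smooth z hz i j).differentiableAt (by simp)
  have hdi : ∀ i j, DifferentiableAt ℝ (fun y => (G y)⁻¹ i j) z := fun i j =>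
    (hG.contDiffAt_inv hz i j).differentiableAt (by simp)
  have h1 := ddm_mul (a := a) hdi hd
  have h2 : ddm a (fun y => (G y)⁻¹ * G y) z = 0 := by
    ext i j
    simp only [ddm, Matrix.of_apply, Matrix.zero_apply]
    rw [dd_congr (g := fun _ => (1 : Mat n) i j) (hG.eventuallyEq_of_eqOn hz fun z hz => by
        rw [Matrix.nonsing_inv_mul _ (isUnit_iff_ne_zero.2 (hG.det_ne_zero hz))]), dd_const]
  rw [h2] at h1
  have hu : G z * (G z)⁻¹ = 1 := Matrix.mul_nonsing_inv _ (isUnit_iff_ne_zero.2 (hG.det_ne_zero hz))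
  have h3 := congrArg (fun M => M * (G z)⁻¹) h1
  simp only [zero_mul, add_mul, Matrix.mul_assoc, hu, mul_one] at h3
  rw [Matrix.mul_assoc]
  exact eq_neg_of_add_eq_zero_left h3.symm

theorem IsFlowOn.scal_eq_trace (hG : IsFlowOn O G) {z : ℝ × ℝ^n} (hz : z ∈ O) :
    scal G z = -1 / 2 * ((G z)⁻¹ * ddm tm G z).trace := by
  simp only [scal, Matrix.trace, Matrix.diag_apply, Matrix.mul_apply, ddm, Matrix.of_apply, mul_sum]
  refine sum_congr rfl fun i _ => sum_congr rfl fun j _ => ?_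
  rw [hG.flow' hz, hG.ric_symm hz i j]; ring

theorem IsFlowOn.sum_chr_eq_trace (hG : IsFlowOn O G) {z : ℝ × ℝ^n} (hz : z ∈ O) (i : Fin n) :
    ∑ k, chr G k i k z = 1 / 2 * ((G z)⁻¹ * ddm (sp i) G z).trace := by
  have h0 : ∑ k, ∑ l, (G z)⁻¹ k l * (dd (sp k) (fun y => G y i l) z) =
      ∑ k, ∑ l, (G z)⁻¹ k l * (dd (sp l) (fun y => G y i k) z) := by
    rw [sum_comm]
    exact sum_congr rfl fun k _ => sum_congr rfl fun l _ => by
      rw [hG.inv_symm hz l k]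
  have hsy : ∀ k l, dd (sp i) (fun y => G y k l) z = dd (sp i) (fun y => G y l k) z := fun k l =>
    dd_congr (hG.eventuallyEq_of_eqOn hz fun z hz => hG.symm z hz k l)
  simp only [Matrix.trace, Matrix.diag_apply, Matrix.mul_apply, ddm, Matrix.of_apply]
  calc ∑ k, chr G k i k z = 1 / 2 * (∑ k, ∑ l, (G z)⁻¹ k l * dd (sp i) (fun y => G y k l) z +
        (∑ k, ∑ l, (G z)⁻¹ k l * (dd (sp k) (fun y => G y i l) z) -
        ∑ k, ∑ l, (G z)⁻¹ k l * (dd (sp l) (fun y => G y i k) z))) := by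
        rw [← sum_sub_distrib, ← sum_add_distrib, mul_sum]
        refine sum_congr rfl fun k _ => ?_
        rw [hG.chr_eq hz, ← sum_sub_distrib, ← sum_add_distrib]
        congr 1
        exact sum_congr rfl fun l _ => by unfold chrSum; ring
    _ = _ := by
        rw [h0, sub_self, add_zero]
        congr 1
        exact sum_congr rfl fun k _ => sum_congr rfl fun l _ => by rw [hsy k l]

theorem ddm_comm {z a b : ℝ × ℝ^n} (h : ∀ i j, ContDiffAt ℝ ∞ (fun y => G y i j) z) :
    ddm a (ddm b G) z = ddm b (ddm a G) z := by
  ext i j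
  simp only [ddm, Matrix.of_apply]
  exact dd_comm ((h i j).of_le (by norm_cast))

/-- The contraction `∂_t Γ^k_ik` is minus the gradient of the scalar curvature: both sides are
mixed second derivatives of half the logarithm of `det G`. -/
theorem IsFlowOn.dd_sum_chr (hG : IsFlowOn O G) {z : ℝ × ℝ^n} (hz : z ∈ O) (i : Fin n) :
    dd tm (fun y => ∑ k, chr G k i k y) z = - dd (sp i) (scal G) z := by
  have hdi : ∀ i j, DifferentiableAt ℝ (fun y => (G y)⁻¹ i j) z := fun i j =>
    (hG.contDiffAt_inv hz i j).differentiableAt (by simp)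
  have hdd : ∀ a i j, DifferentiableAt ℝ (fun y => ddm a G y i j) z := fun a i j =>
    (contDiffAt_dd_infty (hG.smooth z hz i j) a).differentiableAt (by simp)
  have hm : ∀ a i j, DifferentiableAt ℝ (fun y => ((G y)⁻¹ * ddm a G y) i j) z := by
    intro a i j
    simp only [Matrix.mul_apply]
    exact DifferentiableAt.fun_sum fun k _ => (hdi i k).mul (hdd a k j)
  have ht : ∀ a, DifferentiableAt ℝ (fun y => ((G y)⁻¹ * ddm a G y).trace) z := fun a => by
    simp only [Matrix.trace, Matrix.diag_apply]
    exact DifferentiableAt.fun_sum fun k _ => hm a k k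
  rw [dd_congr (hG.eventuallyEq_of_eqOn hz fun z hz => hG.sum_chr_eq_trace hz i),
    dd_congr (hG.eventuallyEq_of_eqOn hz fun z hz => hG.scal_eq_trace hz),
    dd_const_mul _ (ht _), dd_const_mul _ (ht _), dd_trace (hm _), dd_trace (hm _),
    ddm_mul hdi (hdd _), ddm_mul hdi (hdd _), hG.ddm_inv hz, hG.ddm_inv hz,
    ddm_comm (hG.smooth z hz), Matrix.trace_add, Matrix.trace_add]
  have : (-((G z)⁻¹ * ddm tm G z * (G z)⁻¹) * ddm (sp i) G z).trace =
      (-((G z)⁻¹ * ddm (sp i) G z * (G z)⁻¹) * ddm tm G z).trace := by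
    rw [neg_mul, neg_mul, Matrix.trace_neg, Matrix.trace_neg, Matrix.mul_assoc,
      Matrix.trace_mul_comm, Matrix.mul_assoc, Matrix.mul_assoc, Matrix.mul_assoc]
  rw [this]; ring

end CoordinateFlow

section Adapted

variable {n : ℕ}

/-! ### Pullback of a flow by a time independent change of coordinates -/

/-- The pullback of a time dependent metric by `β`. -/
def pullMet (G : ℝ × ℝ^n → Mat n) (β : ℝ^n → ℝ^n) (z : ℝ × ℝ^n) : Mat n :=
  Matrix.of fun i j => bil (G (z.1, β z.2)) (fderiv ℝ β z.2 (𝐞 i)) (fderiv ℝ β z.2 (𝐞 j))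

/-- The points where the pullback by `β` is defined and nondegenerate. -/
def pullDom (O : Set (ℝ × ℝ^n)) (β : ℝ^n → ℝ^n) : Set (ℝ × ℝ^n) :=
  {z | (z.1, β z.2) ∈ O ∧ IsUnit (fderiv ℝ β z.2)}

theorem bil_eq_of_single {A : Mat n} {B : ℝ^n →L[ℝ] ℝ^n →L[ℝ] ℝ}
    (h : ∀ i j, A i j = B (𝐞 i) (𝐞 j)) (v w : ℝ^n) :
    bil A v w = B v w := by
  rw [bil_apply]
  conv_rhs => rw [sum_single v, sum_single w]
  simp only [map_sum, map_smul, sum_apply, smul_apply, smul_eq_mul, h, mul_sum]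
  rw [sum_comm]
  exact sum_congr rfl fun i _ => sum_congr rfl fun j _ => by ring

theorem bil_pullMet (G : ℝ × ℝ^n → Mat n) (β : ℝ^n → ℝ^n) (z : ℝ × ℝ^n) (v w : ℝ^n) :
    bil (pullMet G β z) v w = bil (G (z.1, β z.2)) (fderiv ℝ β z.2 v) (fderiv ℝ β z.2 w) :=
  bil_eq_of_single (B := (bil (G (z.1, β z.2))).bilinearComp (fderiv ℝ β z.2) (fderiv ℝ β z.2))
    (fun i j => rfl) v w

theorem bijective_of_isUnit {f : ℝ^n →L[ℝ] ℝ^n} (h : IsUnit f) : Function.Bijective f := by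
  obtain ⟨u, rfl⟩ := h
  exact (ContinuousLinearEquiv.ofUnit u).bijective

theorem isUnit_of_injective {f : ℝ^n →L[ℝ] ℝ^n} (h : Function.Injective f) : IsUnit f := by
  have hs : Function.Surjective f := LinearMap.surjective_of_injective (f := (f : ℝ^n →ₗ[ℝ] ℝ^n)) h
  let e := LinearEquiv.toContinuousLinearEquiv (LinearEquiv.ofBijective (f : ℝ^n →ₗ[ℝ] ℝ^n) ⟨h, hs⟩)
  exact ⟨e.toUnit, by ext; rfl⟩

variable {O : Set (ℝ × ℝ^n)}
  {G : ℝ × ℝ^n → Mat n}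
  {β : ℝ^n → ℝ^n}

theorem IsFlowOn.isOpen_pullDom (hG : IsFlowOn O G) (hβ : ContDiff ℝ ∞ β) :
    IsOpen (pullDom O β) := by
  have hc : Continuous (fun z : ℝ × ℝ^n => (z.1, β z.2)) :=
    continuous_fst.prodMk (hβ.continuous.comp continuous_snd)
  have hd : Continuous (fun z : ℝ × ℝ^n => fderiv ℝ β z.2) :=
    (hβ.continuous_fderiv (by simp)).comp continuous_snd
  exact (hG.isOpen.preimage hc).inter (Units.isOpen.preimage hd)

theorem IsFlowOn.contDiffAt_pullMet (hG : IsFlowOn O G) (hβ : ContDiff ℝ ∞ β)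
    {z : ℝ × ℝ^n} (hz : z ∈ pullDom O β) (i j : Fin n) :
    ContDiffAt ℝ ∞ (fun y => pullMet G β y i j) z := by
  have hc : ContDiffAt ℝ ∞ (fun z : ℝ × ℝ^n => (z.1, β z.2)) z :=
    contDiffAt_fst.prodMk (hβ.contDiffAt.comp z contDiffAt_snd)
  have hd : ContDiffAt ℝ ∞ (fun z : ℝ × ℝ^n => fderiv ℝ β z.2) z :=
    ((hβ.fderiv_right (m := ∞) le_rfl).contDiffAt).comp z contDiffAt_snd
  have hb : ContDiffAt ℝ ∞ (fun y : ℝ × ℝ^n => bil (G (y.1, β y.2))) z :=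
    contDiffAt_bil fun i j => ContDiffAt.comp z (g := fun y => G y i j) (hG.smooth _ hz.1 i j) hc
  exact (hb.clm_apply (hd.clm_apply contDiffAt_const)).clm_apply (hd.clm_apply contDiffAt_const)

theorem IsFlowOn.isMetricOn_pullMet (hG : IsFlowOn O G) (hβ : ContDiff ℝ ∞ β) (τ : ℝ) :
    IsMetricOn {u | (τ, u) ∈ pullDom O β} (fun u => pullMet G β (τ, u)) := by
  refine ⟨(hG.isOpen_pullDom hβ).preimage (Continuous.prodMk_right τ),
    fun u hu i j => contDiffAt_slice (f := fun y => pullMet G β y i j)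
      (hG.contDiffAt_pullMet hβ hu i j), fun u hu i j => ?_, fun u hu v hv => ?_⟩
  · exact bil_symm (hG.symm _ hu.1) _ _
  · rw [bil_pullMet]
    exact hG.pos _ hu.1 _ fun h => hv ((bijective_of_isUnit hu.2).injective (by simpa using h))

theorem hasDerivAt_tm {Y : Type*} [NormedAddCommGroup Y] [NormedSpace ℝ Y] {f : ℝ × ℝ^n → Y}
    {z : ℝ × ℝ^n} (hf : DifferentiableAt ℝ f z) :
    HasDerivAt (fun τ => f (τ, z.2)) (dd tm f z) z.1 :=
  hasDerivAt_slice (Φ := f) (a := z.1) (p := z.2) hf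

theorem IsFlowOn.pullback (hG : IsFlowOn O G) (hβ : ContDiff ℝ ∞ β) :
    IsFlowOn (pullDom O β) (pullMet G β) := by
  refine ⟨hG.isOpen_pullDom hβ, fun z hz => hG.contDiffAt_pullMet hβ hz, fun z hz i j => ?_,
    fun z hz v hv => ?_, fun z hz i j => ?_⟩
  · exact bil_symm (hG.symm _ hz.1) _ _
  · exact (hG.isMetricOn_pullMet hβ z.1).pos z.2 hz v hv
  · have hev : ∀ᶠ y in 𝓝 z.2, (z.1, y) ∈ pullDom O β :=
      (hG.isMetricOn_pullMet hβ z.1).isOpen.mem_nhds hz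
    have hR := ricB_pullback (hG.isMetricOn_pullMet hβ z.1) (hG.slice z.1) (ψ := β) (u := z.2)
      hz hz.1 (Eventually.of_forall fun y => hβ.contDiffAt)
      (by filter_upwards [hev] with y hy using bijective_of_isUnit hy.2)
      (Eventually.of_forall fun y v w => bil_pullMet G β (z.1, y) v w)
      (𝐞 i) (𝐞 j)
    rw [ricB, bil_single] at hR
    simp only [Matrix.of_apply] at hR
    rw [hR]
    have e1 := hasDerivAt_tm ((hG.contDiffAt_pullMet hβ hz i j).differentiableAt (by simp))
    have hd : ∀ a b, DifferentiableAt ℝ (fun y => G y a b) (z.1, β z.2) := fun a b =>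
      (hG.smooth _ hz.1 a b).differentiableAt (by simp)
    have e2 : HasDerivAt (fun τ => pullMet G β (τ, z.2) i j)
        (∑ a, ∑ b, dd tm (fun y => G y a b) (z.1, β z.2) * fderiv ℝ β z.2 (𝐞 i) a *
          fderiv ℝ β z.2 (𝐞 j) b) z.1 := by
      simp only [pullMet, Matrix.of_apply, bil_apply]
      exact HasDerivAt.fun_sum fun a _ => HasDerivAt.fun_sum fun b _ =>
        ((hasDerivAt_tm (hd a b)).mul_const _).mul_const _
    rw [e1.unique e2, ricB, bil_apply, mul_sum]
    refine sum_congr rfl fun a _ => ?_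
    rw [mul_sum]
    refine sum_congr rfl fun b _ => ?_
    rw [hG.flow _ hz.1, Matrix.of_apply]; ring

/-! ### Coordinates adapted to a point -/

/-- The metric is the identity matrix to first order in space at `z`. -/
def IsAdapted (G : ℝ × ℝ^n → Mat n) (z : ℝ × ℝ^n) : Prop :=
  G z = 1 ∧ ∀ k i j, dd (sp k) (fun y => G y i j) z = 0

theorem IsMetricOn.dd_eq_zero_of_chr1 {U : Set ℝ^n} {H : ℝ^n → Mat n}
    (hH : IsMetricOn U H) {u : ℝ^n} (hu : u ∈ U)
    (h : ∀ v w z, chr1 (fun y => bil (H y)) u v w z = 0) (a : ℝ^n) (i j : Fin n) :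
    dd a (fun y => H y i j) u = 0 := by
  have hdi : ∀ i j, DifferentiableAt ℝ (fun y => H y i j) u := fun i j =>
    (hH.smooth _ hu i j).differentiableAt (by simp)
  have hB : ∀ a i j, fderiv ℝ (fun y => bil (H y)) u a (𝐞 i) (𝐞 j) = dd a (fun y => H y i j) u := by
    intro a i j
    rw [dd_bil hdi]; simp
  have hsy : ∀ a v w, fderiv ℝ (fun y => bil (H y)) u a v w =
      fderiv ℝ (fun y => bil (H y)) u a w v := by
    intro a v w
    rw [dd_bil hdi, dd_bil hdi, sum_comm]
    refine sum_congr rfl fun i _ => sum_congr rfl fun j _ => ?_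
    have : dd a (fun y => H y j i) u = dd a (fun y => H y i j) u :=
      dd_congr (by filter_upwards [hH.isOpen.mem_nhds hu] with y hy using hH.symm y hy j i)
    rw [this]; ring
  have h1 := h a (𝐞 i) (𝐞 j)
  have h2 := h a (𝐞 j) (𝐞 i)
  rw [chr1_apply] at h1 h2
  rw [← hB]
  rw [hsy a (𝐞 j), hsy (𝐞 i) a] at h2
  rw [hsy (𝐞 i) a, hsy (𝐞 j) a] at h1
  rw [hsy (𝐞 j) a] at h2
  linarith

/-- Around a given point there are coordinates adapted to it whose coordinate vectors form a given
orthonormal frame. -/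
theorem IsFlowOn.exists_adapted (hG : IsFlowOn O G) {τ₀ : ℝ} {u₀ : ℝ^n}
    (hu : (τ₀, u₀) ∈ O) (V : Fin n → ℝ^n)
    (hV : ∀ i j, bil (G (τ₀, u₀)) (V i) (V j) = if i = j then 1 else 0) :
    ∃ β : ℝ^n → ℝ^n, ContDiff ℝ ∞ β ∧ β 0 = u₀ ∧
      (∀ i, fderiv ℝ β 0 (𝐞 i) = V i) ∧ (τ₀, 0) ∈ pullDom O β ∧
      IsAdapted (pullMet G β) (τ₀, 0) := by
  set A : ℝ^n →L[ℝ] ℝ^n := ∑ i, (EuclideanSpace.proj i : ℝ^n →L[ℝ] ℝ).smulRight (V i) with hA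
  have hAi : ∀ i, A (𝐞 i) = V i := by
    intro i
    simp [hA, PiLp.single_apply]
  set C : ℝ^n →L[ℝ] ℝ^n →L[ℝ] ℝ^n := (chrL (fun u => G (τ₀, u)) u₀).bilinearComp A A with hC
  set β : ℝ^n → ℝ^n := fun v => u₀ + A v - (1 / 2 : ℝ) • C v v with hβ
  have hd1 : ∀ v, HasFDerivAt β (A - (1 / 2 : ℝ) • (C v + C.flip v)) v := by
    intro v
    have h1 : HasFDerivAt (fun v => C v v) (C v + C.flip v) v := by
      have := C.hasFDerivAt.clm_apply (hasFDerivAt_id v)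
      refine this.congr_fderiv ?_
      ext w; simp
    exact (A.hasFDerivAt.const_add u₀).sub (h1.fun_const_smul (1 / 2 : ℝ))
  have hfd : fderiv ℝ β = fun v => A - (1 / 2 : ℝ) • (C v + C.flip v) :=
    funext fun v => (hd1 v).fderiv
  have hd2 : HasFDerivAt (fderiv ℝ β) (-((1 / 2 : ℝ) • (C + C.flip))) 0 := by
    rw [hfd]
    have h1 : HasFDerivAt (fun v => C v + C.flip v) (C + C.flip) 0 := (C + C.flip).hasFDerivAt
    exact (h1.const_smul (1 / 2 : ℝ)).const_sub A
  have hsm : ContDiff ℝ ∞ β := by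
    have h1 : ContDiff ℝ ∞ (fun v => C v v) := C.contDiff.clm_apply contDiff_id
    have h2 : ContDiff ℝ ∞ (fun v => (1 / 2 : ℝ) • C v v) := h1.const_smul (1 / 2 : ℝ)
    exact (contDiff_const.add A.contDiff).sub h2
  have hβ0 : β 0 = u₀ := by simp [hβ]
  have hD0 : fderiv ℝ β 0 = A := by simp [hfd]
  have hAorth : ∀ v w, bil (G (τ₀, u₀)) (A v) (A w) = bil (1 : Mat n) v w := by
    intro v w
    refine (bil_eq_of_single (B := (bil (G (τ₀, u₀))).bilinearComp A A) (fun i j => ?_) v w).symm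
    simp [hAi, hV, Matrix.one_apply]
  have hinj : Function.Injective A := by
    rw [injective_iff_map_eq_zero]
    intro v hv
    have := hAorth v v
    rw [hv, bil_apply (1 : Mat n)] at this
    simp only [map_zero, zero_apply, Matrix.one_apply, ite_mul, one_mul, zero_mul,
      Finset.sum_ite_eq, Finset.mem_univ, if_true] at this
    have h2 := (Finset.sum_eq_zero_iff_of_nonneg fun i _ => mul_self_nonneg (v i)).1 this.symm
    ext i
    simpa using h2 i (Finset.mem_univ i)
  have hmem : (τ₀, (0 : ℝ^n)) ∈ pullDom O β := by
    refine ⟨by simpa [hβ0] using hu, ?_⟩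
    simp only [hD0]
    exact isUnit_of_injective hinj
  refine ⟨β, hsm, hβ0, fun i => by rw [hD0, hAi], hmem, ?_, ?_⟩
  · ext i j
    simp [pullMet, hβ0, hD0, hAi, hV, Matrix.one_apply]
  · have hM := hG.isMetricOn_pullMet hsm τ₀
    have hM0 := hG.slice τ₀
    have hu' : β 0 ∈ {u | (τ₀, u) ∈ O} := by simpa [hβ0] using hu
    have hmem' : (0 : ℝ^n) ∈ {u | (τ₀, u) ∈ pullDom O β} := hmem
    have hsm2 : ContDiffAt ℝ 2 β 0 := hsm.contDiffAt.of_le (by norm_cast)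
    have hCw : ∀ v w, C v w = chrL (fun u => G (τ₀, u)) u₀ (A v) (A w) := fun v w => rfl
    have hpb : ∀ᶠ y in 𝓝 (0 : ℝ^n), ∀ v w, bil (pullMet G β (τ₀, y)) v w =
        bil (G (τ₀, β y)) (fderiv ℝ β y v) (fderiv ℝ β y w) :=
      Eventually.of_forall fun y v w => bil_pullMet G β (τ₀, y) v w
    have hd2' := hd2.fderiv
    clear_value C β
    have hΓ : ∀ v w z, chr1 (fun y => bil (pullMet G β (τ₀, y))) 0 v w z = 0 := by
      intro v w z
      have hC0 : chrL (fun u => G (τ₀, u)) u₀ (A v) (A w) +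
          (-((1 / 2 : ℝ) • (C + C.flip))) v w = 0 := by
        have hs : C w v = C v w := by
          rw [hCw, hCw]; exact hM0.chrL_symm (by simpa using hu) _ _
        have : C v w = chrL (fun u => G (τ₀, u)) u₀ (A v) (A w) := hCw v w
        simp only [neg_apply, smul_apply, add_apply, ContinuousLinearMap.flip_apply]
        rw [hs, ← this, ← two_smul ℝ, smul_smul]; norm_num
      have e1 := chr1_pullback (B := fun y => bil (pullMet G β (τ₀, y)))
        (B' := fun y => bil (G (τ₀, y))) (ψ := β) hsm2
        (hM.differentiableAt_bil hmem') (hM0.differentiableAt_bil hu') (bil_symm (hM0.symm _ hu'))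
        hpb v w z
      have e2 := hM0.bil_chrL hu' (fderiv ℝ β 0 v) (fderiv ℝ β 0 w) (fderiv ℝ β 0 z)
      rw [e1, ← e2, hd2', hD0, ← add_apply, ← map_add, hβ0, hC0]
      simp
    intro k i j
    rw [← hM.dd_eq_zero_of_chr1 hmem' hΓ (𝐞 k) i j]
    exact (dd_slice (f := fun y => pullMet G β y i j)
      ((hG.contDiffAt_pullMet hsm hmem i j).differentiableAt (by simp)) _).symm

end Adapted

section Evolution

variable {n : ℕ} {O : Set (ℝ × ℝ^n)}
  {G : ℝ × ℝ^n → Mat n}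
  {z₀ : ℝ × ℝ^n}

/-! ### Curvature identities at the centre of adapted coordinates -/

theorem IsAdapted.inv (ha : IsAdapted G z₀) : (G z₀)⁻¹ = 1 := by rw [ha.1, inv_one]

theorem IsAdapted.chrSum_eq_zero (ha : IsAdapted G z₀) (i j l : Fin n) : chrSum G i j l z₀ = 0 := by
  simp [chrSum, ha.2]

theorem IsAdapted.chr_eq_zero (hG : IsFlowOn O G) (hz : z₀ ∈ O) (ha : IsAdapted G z₀)
    (k i j : Fin n) : chr G k i j z₀ = 0 := by
  simp [hG.chr_eq hz, ha.chrSum_eq_zero]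

theorem IsAdapted.dd_inv (hG : IsFlowOn O G) (hz : z₀ ∈ O) (ha : IsAdapted G z₀)
    (k i j : Fin n) : dd (sp k) (fun y => (G y)⁻¹ i j) z₀ = 0 := by
  have h0 : ddm (sp k) G z₀ = 0 := by ext a b; simp [ddm, ha.2]
  have := congrFun (congrFun (hG.ddm_inv hz (sp k)) i) j
  rw [h0] at this
  simpa [ddm] using this

theorem IsFlowOn.dd_chr (hG : IsFlowOn O G) {z : ℝ × ℝ^n} (hz : z ∈ O)
    (a : ℝ × ℝ^n) (k i j : Fin n) :
    dd a (chr G k i j) z = 1 / 2 * ∑ l, (dd a (fun y => (G y)⁻¹ k l) z * chrSum G i j l z +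
      (G z)⁻¹ k l * dd a (chrSum G i j l) z) := by
  have h1 : ∀ l, DifferentiableAt ℝ (fun y => (G y)⁻¹ k l) z := fun l =>
    (hG.contDiffAt_inv hz _ _).differentiableAt (by simp)
  have h2 : ∀ l, DifferentiableAt ℝ (chrSum G i j l) z := fun l =>
    (hG.contDiffAt_chrSum hz _ _ _).differentiableAt (by simp)
  rw [dd_congr (hG.eventuallyEq_of_eqOn hz fun z hz => hG.chr_eq hz k i j),
    dd_const_mul _ (DifferentiableAt.fun_sum fun l _ => (h1 l).fun_mul (h2 l)),
    dd_sum fun l _ => (h1 l).fun_mul (h2 l)]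
  congr 1
  exact sum_congr rfl fun l _ => dd_mul (h1 l) (h2 l)

theorem IsAdapted.dd_chr (hG : IsFlowOn O G) (hz : z₀ ∈ O) (ha : IsAdapted G z₀)
    (a : ℝ × ℝ^n) (k i j : Fin n) :
    dd a (chr G k i j) z₀ = 1 / 2 * dd a (chrSum G i j k) z₀ := by
  rw [hG.dd_chr hz]
  simp [ha.chrSum_eq_zero, ha.inv, Matrix.one_apply]

theorem IsAdapted.dd_dd_chr (hG : IsFlowOn O G) (hz : z₀ ∈ O) (ha : IsAdapted G z₀)
    (a b k i j : Fin n) :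
    dd (sp a) (dd (sp b) (chr G k i j)) z₀ = 1 / 2 * dd (sp a) (dd (sp b) (chrSum G i j k)) z₀ := by
  have h1 : ∀ l, ContDiffAt ℝ ∞ (fun y => (G y)⁻¹ k l) z₀ := fun l => hG.contDiffAt_inv hz _ _
  have h2 : ∀ l, ContDiffAt ℝ ∞ (chrSum G i j l) z₀ := fun l => hG.contDiffAt_chrSum hz _ _ _
  have d1 : ∀ l, DifferentiableAt ℝ (fun y => (G y)⁻¹ k l) z₀ := fun l =>
    (h1 l).differentiableAt (by simp)
  have d2 : ∀ l, DifferentiableAt ℝ (chrSum G i j l) z₀ := fun l =>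
    (h2 l).differentiableAt (by simp)
  have d3 : ∀ l, DifferentiableAt ℝ (dd (sp b) (fun y => (G y)⁻¹ k l)) z₀ := fun l =>
    (contDiffAt_dd_infty (h1 l) _).differentiableAt (by simp)
  have d4 : ∀ l, DifferentiableAt ℝ (dd (sp b) (chrSum G i j l)) z₀ := fun l =>
    (contDiffAt_dd_infty (h2 l) _).differentiableAt (by simp)
  rw [dd_congr (hG.eventuallyEq_of_eqOn hz fun z hz => hG.dd_chr hz (sp b) k i j),
    dd_const_mul _ (DifferentiableAt.fun_sum fun l _ =>
      ((d3 l).fun_mul (d2 l)).fun_add ((d1 l).fun_mul (d4 l))),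
    dd_sum fun l _ => ((d3 l).fun_mul (d2 l)).fun_add ((d1 l).fun_mul (d4 l))]
  congr 1
  have : ∀ l, dd (sp a) (fun y => dd (sp b) (fun y => (G y)⁻¹ k l) y * chrSum G i j l y +
      (G y)⁻¹ k l * dd (sp b) (chrSum G i j l) y) z₀ =
      (1 : Mat n) k l * dd (sp a) (dd (sp b) (chrSum G i j l)) z₀ := by
    intro l
    rw [dd_add ((d3 l).fun_mul (d2 l)) ((d1 l).fun_mul (d4 l)), dd_mul (d3 l) (d2 l),
      dd_mul (d1 l) (d4 l), ha.chrSum_eq_zero, ha.dd_inv hG hz, ha.dd_inv hG hz, ha.inv]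
    ring
  simp [this, Matrix.one_apply]

section

variable (hG : IsFlowOn O G) {z : ℝ × ℝ^n} (hz : z ∈ O)

include hG hz

theorem IsFlowOn.dd_chrSum (a : ℝ × ℝ^n) (i j l : Fin n) :
    dd a (chrSum G i j l) z = dd a (dd (sp i) (fun y => G y j l)) z +
      dd a (dd (sp j) (fun y => G y i l)) z - dd a (dd (sp l) (fun y => G y i j)) z := by
  have h : ∀ c a b, DifferentiableAt ℝ (dd (sp c) (fun y => G y a b)) z := fun c a b =>
    (contDiffAt_dd_infty (hG.smooth z hz a b) _).differentiableAt (by simp)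
  unfold chrSum
  rw [dd_sub ((h _ _ _).fun_add (h _ _ _)) (h _ _ _), dd_add (h _ _ _) (h _ _ _)]

theorem IsFlowOn.dd_dd_chrSum (b a : ℝ × ℝ^n) (i j l : Fin n) :
    dd b (dd a (chrSum G i j l)) z = dd b (dd a (dd (sp i) (fun y => G y j l))) z +
      dd b (dd a (dd (sp j) (fun y => G y i l))) z -
      dd b (dd a (dd (sp l) (fun y => G y i j))) z := by
  have h : ∀ c a' b', DifferentiableAt ℝ (dd a (dd (sp c) (fun y => G y a' b'))) z :=
    fun c a' b' => (contDiffAt_dd_infty (contDiffAt_dd_infty (hG.smooth z hz a' b') _)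
      _).differentiableAt (by simp)
  rw [dd_congr (hG.eventuallyEq_of_eqOn hz fun z hz => hG.dd_chrSum hz a i j l),
    dd_sub ((h _ _ _).fun_add (h _ _ _)) (h _ _ _), dd_add (h _ _ _) (h _ _ _)]

theorem IsFlowOn.dd2_symm (a b : ℝ × ℝ^n) (i j : Fin n) :
    dd a (dd b (fun y => G y i j)) z = dd a (dd b (fun y => G y j i)) z :=
  dd_congr (hG.eventuallyEq_of_eqOn hz fun z hz =>
    dd_congr (hG.eventuallyEq_of_eqOn hz fun z hz => hG.symm z hz i j))

theorem IsFlowOn.dd2_comm (a b : ℝ × ℝ^n) (i j : Fin n) :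
    dd a (dd b (fun y => G y i j)) z = dd b (dd a (fun y => G y i j)) z :=
  dd_comm ((hG.smooth z hz i j).of_le (by norm_cast))

theorem IsFlowOn.dd3_comm (a b c : ℝ × ℝ^n) (i j : Fin n) :
    dd a (dd b (dd c (fun y => G y i j))) z = dd b (dd a (dd c (fun y => G y i j))) z :=
  dd_comm ((contDiffAt_dd_infty (hG.smooth z hz i j) _).of_le (by norm_cast))

theorem IsFlowOn.dd3_comm' (a b c : ℝ × ℝ^n) (i j : Fin n) :
    dd a (dd b (dd c (fun y => G y i j))) z = dd a (dd c (dd b (fun y => G y i j))) z :=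
  dd_congr (hG.eventuallyEq_of_eqOn hz fun _ hz => hG.dd2_comm hz b c i j)

theorem IsFlowOn.dd3_symm (a b c : ℝ × ℝ^n) (i j : Fin n) :
    dd a (dd b (dd c (fun y => G y i j))) z = dd a (dd b (dd c (fun y => G y j i))) z :=
  dd_congr (hG.eventuallyEq_of_eqOn hz fun _ hz => hG.dd2_symm hz b c i j)

end

theorem dd_mul_eq_zero {f g : ℝ × ℝ^n → ℝ} {z a : ℝ × ℝ^n} (hf : DifferentiableAt ℝ f z)
    (hg : DifferentiableAt ℝ g z) (hf0 : f z = 0) (hg0 : g z = 0) :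
    dd a (fun y => f y * g y) z = 0 := by
  rw [dd_mul hf hg, hf0, hg0]; ring

/-- At the centre of adapted coordinates the quadratic terms of the Ricci tensor do not contribute
to its first derivatives. -/
theorem IsAdapted.dd_ric (hG : IsFlowOn O G) (hz : z₀ ∈ O) (ha : IsAdapted G z₀)
    (a : ℝ × ℝ^n) (i j : Fin n) :
    dd a (ric G i j) z₀ = ∑ k, (dd a (dd (sp k) (chr G k i j)) z₀ -
      dd a (dd (sp j) (chr G k i k)) z₀) := by
  have h1 : ∀ a b c, DifferentiableAt ℝ (chr G a b c) z₀ := fun a b c =>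
    (hG.contDiffAt_chr hz a b c).differentiableAt (by simp)
  have h2 : ∀ d a b c, DifferentiableAt ℝ (dd (sp d) (chr G a b c)) z₀ := fun d a b c =>
    (contDiffAt_dd_infty (hG.contDiffAt_chr hz a b c) _).differentiableAt (by simp)
  have h3 : ∀ k, DifferentiableAt ℝ (fun y => ∑ l, (chr G k k l y * chr G l i j y -
      chr G k j l y * chr G l i k y)) z₀ := fun k => DifferentiableAt.fun_sum fun l _ =>
    ((h1 _ _ _).fun_mul (h1 _ _ _)).fun_sub ((h1 _ _ _).fun_mul (h1 _ _ _))
  have h0 := ha.chr_eq_zero hG hz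
  rw [dd_congr (hG.eventuallyEq_of_eqOn hz fun z hz => hG.ric_eq hz i j),
    dd_sum fun k _ => ((h2 _ _ _ _).fun_sub (h2 _ _ _ _)).fun_add (h3 k)]
  refine sum_congr rfl fun k _ => ?_
  rw [dd_add ((h2 _ _ _ _).fun_sub (h2 _ _ _ _)) (h3 k), dd_sub (h2 _ _ _ _) (h2 _ _ _ _),
    dd_sum fun l _ => ((h1 _ _ _).fun_mul (h1 _ _ _)).fun_sub ((h1 _ _ _).fun_mul (h1 _ _ _)),
    sum_eq_zero, add_zero]
  intro l _
  rw [dd_sub ((h1 _ _ _).fun_mul (h1 _ _ _)) ((h1 _ _ _).fun_mul (h1 _ _ _)),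
    dd_mul_eq_zero (h1 _ _ _) (h1 _ _ _) (h0 _ _ _) (h0 _ _ _),
    dd_mul_eq_zero (h1 _ _ _) (h1 _ _ _) (h0 _ _ _) (h0 _ _ _), sub_zero]

theorem IsAdapted.ric_eq (hG : IsFlowOn O G) (hz : z₀ ∈ O) (ha : IsAdapted G z₀) (i j : Fin n) :
    ric G i j z₀ = ∑ k, 1 / 2 * (dd (sp k) (dd (sp i) (fun y => G y j k)) z₀ +
      dd (sp k) (dd (sp j) (fun y => G y i k)) z₀ - dd (sp k) (dd (sp k) (fun y => G y i j)) z₀ -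
      dd (sp j) (dd (sp i) (fun y => G y k k)) z₀) := by
  rw [hG.ric_eq hz]
  refine sum_congr rfl fun k _ => ?_
  rw [sum_eq_zero (fun l _ => by simp [ha.chr_eq_zero hG hz]), add_zero,
    ha.dd_chr hG hz, ha.dd_chr hG hz, hG.dd_chrSum hz, hG.dd_chrSum hz]
  ring

/-- The contracted second Bianchi identity. -/
theorem IsAdapted.bianchi (hG : IsFlowOn O G) (hz : z₀ ∈ O) (ha : IsAdapted G z₀) (k : Fin n) :
    2 * ∑ i, dd (sp i) (ric G i k) z₀ = ∑ i, dd (sp k) (ric G i i) z₀ := by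
  have c1 := fun a b c => hG.dd3_comm hz (sp a) (sp b) (sp c)
  have c2 := fun a b c => hG.dd3_comm' hz (sp a) (sp b) (sp c)
  have c3 := fun a b c => hG.dd3_symm hz (sp a) (sp b) (sp c)
  have key : ∀ a i j, dd (sp a) (ric G i j) z₀ = ∑ l, 1 / 2 *
      (dd (sp a) (dd (sp l) (dd (sp i) (fun y => G y j l))) z₀ +
      dd (sp a) (dd (sp l) (dd (sp j) (fun y => G y i l))) z₀ -
      dd (sp a) (dd (sp l) (dd (sp l) (fun y => G y i j))) z₀ -
      dd (sp a) (dd (sp j) (dd (sp i) (fun y => G y l l))) z₀) := by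
    intro a i j
    rw [ha.dd_ric hG hz]
    refine sum_congr rfl fun l _ => ?_
    rw [ha.dd_dd_chr hG hz, ha.dd_dd_chr hG hz, hG.dd_dd_chrSum hz, hG.dd_dd_chrSum hz]
    ring
  simp only [key]
  -- two of the four terms of the divergence cancel after renaming summation indices
  have h1 : ∑ i, ∑ l, dd (sp i) (dd (sp l) (dd (sp i) (fun y => G y k l))) z₀ =
      ∑ i, ∑ l, dd (sp i) (dd (sp l) (dd (sp l) (fun y => G y i k))) z₀ := by
    rw [sum_comm]
    refine sum_congr rfl fun i _ => sum_congr rfl fun l _ => ?_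
    rw [c1 l i l, c2 i l l, c3 i l l k i]
  have h2 : ∑ i, ∑ l, dd (sp i) (dd (sp l) (dd (sp k) (fun y => G y i l))) z₀ =
      ∑ i, ∑ l, dd (sp k) (dd (sp l) (dd (sp i) (fun y => G y i l))) z₀ := by
    refine sum_congr rfl fun i _ => sum_congr rfl fun l _ => ?_
    rw [c2 i l k, c1 i k l, c2 k i l]
  have h3 : ∑ i, ∑ l, dd (sp i) (dd (sp k) (dd (sp i) (fun y => G y l l))) z₀ =
      ∑ i, ∑ l, dd (sp k) (dd (sp l) (dd (sp l) (fun y => G y i i))) z₀ := by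
    rw [sum_comm]
    refine sum_congr rfl fun i _ => sum_congr rfl fun l _ => ?_
    rw [c1 l k l]
  have h4 : ∑ i, ∑ l, dd (sp k) (dd (sp i) (dd (sp i) (fun y => G y l l))) z₀ =
      ∑ i, ∑ l, dd (sp k) (dd (sp l) (dd (sp l) (fun y => G y i i))) z₀ := sum_comm
  simp only [← mul_sum, sum_sub_distrib, sum_add_distrib, h1, h2, h3, h4]
  ring

theorem IsFlowOn.dd_dd_tm (hG : IsFlowOn O G) {z : ℝ × ℝ^n} (hz : z ∈ O)
    (a : ℝ × ℝ^n) (i j : Fin n) :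
    dd tm (dd a (fun y => G y i j)) z = -2 * dd a (ric G i j) z := by
  rw [hG.dd2_comm hz, dd_congr (hG.eventuallyEq_of_eqOn hz fun z hz => hG.flow' hz i j),
    dd_const_mul _ ((hG.contDiffAt_ric hz i j).differentiableAt (by simp))]

theorem IsAdapted.sum_dd_tm_chr (hG : IsFlowOn O G) (hz : z₀ ∈ O) (ha : IsAdapted G z₀)
    (k : Fin n) : ∑ i, dd tm (chr G k i i) z₀ = 0 := by
  have h := ha.bianchi hG hz k
  have : ∀ i, dd tm (chr G k i i) z₀ = - 2 * dd (sp i) (ric G i k) z₀ +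
      dd (sp k) (ric G i i) z₀ := by
    intro i
    rw [ha.dd_chr hG hz, hG.dd_chrSum hz, hG.dd_dd_tm hz, hG.dd_dd_tm hz]
    ring
  simp only [this, sum_add_distrib, ← mul_sum]
  linarith

/-! ### Orthonormal frames -/

theorem exists_orthonormal_frame {A : Mat n} (hs : ∀ i j, A i j = A j i)
    (hp : ∀ v : ℝ^n, v ≠ 0 → 0 < bil A v v) :
    ∃ V : Fin n → ℝ^n, ∀ i j, bil A (V i) (V j) = if i = j then 1 else 0 := by
  have hA : A.PosDef := by
    rw [Matrix.posDef_iff_dotProduct_mulVec]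
    refine ⟨by ext i j; simp [Matrix.conjTranspose_apply, hs i j], fun x hx => ?_⟩
    have := hp (WithLp.toLp 2 x) (by simpa using hx)
    rw [bil_eq_dotProduct] at this
    simpa using this
  obtain ⟨B, hBu, hB⟩ : ∃ B : Mat n, IsUnit B ∧ A = B.transpose * B := by
    open scoped MatrixOrder in
    obtain ⟨B, hB, h⟩ := CStarAlgebra.isStrictlyPositive_iff_eq_star_mul_self.mp
      (Matrix.isStrictlyPositive_iff_posDef.2 hA)
    exact ⟨B, hB, by rw [h, Matrix.star_eq_conjTranspose, Matrix.conjTranspose_eq_transpose_of_trivial]⟩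
  have hBd : IsUnit B.det := (Matrix.isUnit_iff_isUnit_det B).1 hBu
  refine ⟨fun i => WithLp.toLp 2 (B⁻¹.col i), fun i j => ?_⟩
  rw [bil_eq_dotProduct]
  have h1 : (B⁻¹).transpose * (A * B⁻¹) = 1 := by
    rw [hB, Matrix.mul_assoc, Matrix.mul_nonsing_inv _ hBd, mul_one, ← Matrix.transpose_mul,
      Matrix.mul_nonsing_inv _ hBd, Matrix.transpose_one]
  have h2 := congrFun (congrFun h1 i) j
  rw [Matrix.one_apply] at h2
  rw [← h2]
  simp [Matrix.mul_apply, dotProduct, Matrix.mulVec, Matrix.col, Matrix.transpose_apply]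

/-- An orthonormal frame resolves the inverse of the metric. -/
theorem sum_frame_eq_inv {A : Mat n} (V : Fin n → ℝ^n)
    (hV : ∀ i j, bil A (V i) (V j) = if i = j then 1 else 0) (a b : Fin n) :
    ∑ m, V m a * V m b = A⁻¹ a b := by
  set W : Mat n := Matrix.of fun a m => V m a with hW
  have h1 : W.transpose * (A * W) = 1 := by
    ext i j
    rw [Matrix.one_apply, ← hV, bil_eq_dotProduct]
    simp [Matrix.mul_apply, dotProduct, Matrix.mulVec, Matrix.transpose_apply, hW]
  have h2 : (A * W) * W.transpose = 1 := mul_eq_one_comm.1 h1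
  have h3 : A⁻¹ = W * W.transpose := Matrix.inv_eq_right_inv (by rw [← Matrix.mul_assoc, h2])
  rw [h3]
  simp [Matrix.mul_apply, hW]

/-! ### Evolution of the connection and of the scalar curvature -/

/-- The contraction `g^ij ∂_t Γ^k_ij` vanishes under the Ricci flow. -/
theorem IsFlowOn.sum_inv_dd_tm_chr (hG : IsFlowOn O G) {z : ℝ × ℝ^n} (hz : z ∈ O) (k : Fin n) :
    ∑ i, ∑ j, (G z)⁻¹ i j * dd tm (chr G k i j) z = 0 := by
  obtain ⟨τ₀, u₀⟩ := z
  obtain ⟨V, hV⟩ := exists_orthonormal_frame (hG.symm _ hz) (hG.pos _ hz)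
  obtain ⟨β, hβ, hβ0, hβV, hmem, had⟩ := hG.exists_adapted hz V hV
  have hG' := hG.pullback hβ
  have hz' : (τ₀, β 0) ∈ O := by rw [hβ0]; exact hz
  have hdot : ∀ (H : ℝ × ℝ^n → Mat n)
      (U : Set (ℝ × ℝ^n)), IsFlowOn U H → ∀ u, (τ₀, u) ∈ U → ∀ v w k,
      HasDerivAt (fun τ => chrL (fun y => H (τ, y)) u v w k)
        (∑ i, ∑ j, dd tm (chr H k i j) (τ₀, u) * v i * w j) τ₀ := by
    intro H U hH u hu v w k
    simp only [chrL_apply, christoffelVec]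
    exact HasDerivAt.fun_sum fun i _ => HasDerivAt.fun_sum fun j _ =>
      ((hasDerivAt_tm ((hH.contDiffAt_chr hu k i j).differentiableAt (by simp))).mul_const
        _).mul_const _
  -- the transformation law of the Christoffel symbols holds at all times near `τ₀`
  have hlaw : ∀ᶠ τ in 𝓝 τ₀, ∀ v w, fderiv ℝ β 0 (chrL (fun y => pullMet G β (τ, y)) 0 v w) =
      fderiv ℝ (fderiv ℝ β) 0 v w +
        chrL (fun y => G (τ, y)) (β 0) (fderiv ℝ β 0 v) (fderiv ℝ β 0 w) := by
    have h1 : ∀ᶠ τ in 𝓝 τ₀, (τ, (0 : ℝ^n)) ∈ pullDom O β :=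
      (hG'.isOpen.preimage (Continuous.prodMk_left (0 : ℝ^n))).mem_nhds hmem
    filter_upwards [h1] with τ hτ v w
    exact chrL_pullback (hG.isMetricOn_pullMet hβ τ) (hG.slice τ) hτ hτ.1
      (hβ.contDiffAt.of_le (by norm_cast)) (bijective_of_isUnit hτ.2).surjective
      (Eventually.of_forall fun y v w => bil_pullMet G β (τ, y) v w) v w
  have hk : ∀ i, ∑ a, ∑ b, dd tm (chr G k a b) (τ₀, u₀) * V i a * V i b =
      ∑ l, fderiv ℝ β 0 (𝐞 l) k * dd tm (chr (pullMet G β) l i i) (τ₀, 0) := by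
    intro i
    have e1 := hdot G O hG (β 0) hz' (V i) (V i) k
    have e2 : HasDerivAt (fun τ => fderiv ℝ β 0 (chrL (fun y => pullMet G β (τ, y)) 0
        (𝐞 i) (𝐞 i)) k -
        fderiv ℝ (fderiv ℝ β) 0 (𝐞 i) (𝐞 i) k)
        (∑ l, fderiv ℝ β 0 (𝐞 l) k * dd tm (chr (pullMet G β) l i i) (τ₀, 0)) τ₀ := by
      have hs : ∀ v : ℝ^n, fderiv ℝ β 0 v k = ∑ l, fderiv ℝ β 0 (𝐞 l) k * v l := by
        intro v
        conv_lhs => rw [sum_single v]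
        simp [mul_comm]
      simp only [hs (chrL _ _ _ _)]
      refine HasDerivAt.sub_const _ (HasDerivAt.fun_sum fun l _ => HasDerivAt.const_mul _ ?_)
      have := hdot _ _ hG' 0 hmem (𝐞 i) (𝐞 i) l
      simpa using this
    have e3 := e1.unique (e2.congr_of_eventuallyEq ?_)
    · rw [← e3, hβ0]
    · filter_upwards [hlaw] with τ hτ
      rw [hτ, hβV]; simp
  have hsum : ∑ i, ∑ j, (G (τ₀, u₀))⁻¹ i j * dd tm (chr G k i j) (τ₀, u₀) =
      ∑ m, ∑ a, ∑ b, dd tm (chr G k a b) (τ₀, u₀) * V m a * V m b := by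
    simp only [← sum_frame_eq_inv V hV, sum_mul]
    calc _ = ∑ a, ∑ m, ∑ b, dd tm (chr G k a b) (τ₀, u₀) * V m a * V m b := by
          refine sum_congr rfl fun a _ => ?_
          rw [sum_comm]
          exact sum_congr rfl fun m _ => sum_congr rfl fun b _ => by ring
      _ = _ := sum_comm
  rw [hsum]
  simp only [hk]
  rw [sum_comm]
  refine sum_eq_zero fun l _ => ?_
  rw [← mul_sum, had.sum_dd_tm_chr hG' hmem, mul_zero]

/-- The evolution equation `∂_t R = Δ R + 2 |Ric|²`, at the centre of adapted coordinates. -/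
theorem IsAdapted.dd_tm_scal (hG : IsFlowOn O G) (hz : z₀ ∈ O) (ha : IsAdapted G z₀) :
    dd tm (scal G) z₀ = ∑ i, dd (sp i) (dd (sp i) (scal G)) z₀ +
      2 * ∑ i, ∑ j, ric G i j z₀ ^ 2 := by
  have dI : ∀ i j, DifferentiableAt ℝ (fun y => (G y)⁻¹ i j) z₀ := fun i j =>
    (hG.contDiffAt_inv hz i j).differentiableAt (by simp)
  have dR : ∀ i j, DifferentiableAt ℝ (ric G i j) z₀ := fun i j =>
    (hG.contDiffAt_ric hz i j).differentiableAt (by simp)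
  have dC : ∀ a i j k, DifferentiableAt ℝ (dd a (chr G k i j)) z₀ := fun a i j k =>
    (contDiffAt_dd_infty (hG.contDiffAt_chr hz k i j) a).differentiableAt (by simp)
  -- the product rule for `R = g^ij R_ij`
  have h1 : dd tm (scal G) z₀ = 2 * ∑ i, ∑ j, ric G i j z₀ ^ 2 + ∑ i, dd tm (ric G i i) z₀ := by
    unfold scal
    rw [dd_sum fun i _ => DifferentiableAt.fun_sum fun j _ => (dI i j).fun_mul (dR i j),
      mul_sum, ← sum_add_distrib]
    refine sum_congr rfl fun i _ => ?_
    rw [dd_sum fun j _ => (dI i j).fun_mul (dR i j)]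
    have : ∀ j, dd tm (fun y => (G y)⁻¹ i j * ric G i j y) z₀ = 2 * ric G i j z₀ ^ 2 +
        (1 : Mat n) i j * dd tm (ric G i j) z₀ := by
      intro j
      have e := congrFun (congrFun (hG.ddm_inv hz tm) i) j
      rw [ha.inv] at e
      simp only [ddm, Matrix.of_apply, Matrix.one_mul, Matrix.mul_one, Matrix.neg_apply] at e
      rw [dd_mul (dI i j) (dR i j), e, hG.flow' hz, ha.inv]; ring
    simp only [this, sum_add_distrib, mul_sum]
    simp [Matrix.one_apply]
  have h2 : ∑ i, dd tm (ric G i i) z₀ =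
      ∑ k, dd (sp k) (fun y => ∑ i, ∑ j, (G y)⁻¹ i j * dd tm (chr G k i j) y) z₀ -
      ∑ i, dd (sp i) (fun y => dd tm (fun y => ∑ k, chr G k i k y) y) z₀ := by
    simp only [ha.dd_ric hG hz, sum_sub_distrib]
    congr 1
    · rw [sum_comm]
      refine sum_congr rfl fun k _ => ?_
      rw [dd_sum fun i _ => DifferentiableAt.fun_sum fun j _ => (dI i j).fun_mul (dC _ _ _ _)]
      refine sum_congr rfl fun i _ => ?_
      rw [dd_sum fun j _ => (dI i j).fun_mul (dC _ _ _ _)]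
      have : ∀ j, dd (sp k) (fun y => (G y)⁻¹ i j * dd tm (chr G k i j) y) z₀ =
          (1 : Mat n) i j * dd (sp k) (dd tm (chr G k i j)) z₀ := by
        intro j
        rw [dd_mul (dI i j) (dC _ _ _ _), ha.dd_inv hG hz, ha.inv]; ring
      simp only [this]
      simp only [Matrix.one_apply, ite_mul, one_mul, zero_mul, Finset.sum_ite_eq, Finset.mem_univ,
        if_true]
      exact dd_comm ((hG.contDiffAt_chr hz k i i).of_le (by norm_cast))
    · refine sum_congr rfl fun i _ => ?_
      have e : (fun y => dd tm (fun y => ∑ k, chr G k i k y) y) =ᶠ[𝓝 z₀]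
          fun y => ∑ k, dd tm (chr G k i k) y :=
        hG.eventuallyEq_of_eqOn hz fun z hz => dd_sum fun k _ =>
          (hG.contDiffAt_chr hz k i k).differentiableAt (by simp)
      rw [dd_congr e, dd_sum fun k _ => dC _ _ _ _]
      exact sum_congr rfl fun k _ =>
        dd_comm ((hG.contDiffAt_chr hz k i k).of_le (by norm_cast))
  have h3 : ∀ k, dd (sp k) (fun y => ∑ i, ∑ j, (G y)⁻¹ i j * dd tm (chr G k i j) y) z₀ = 0 := by
    intro k
    rw [dd_congr (g := fun _ => (0 : ℝ)) (hG.eventuallyEq_of_eqOn hz fun z hz =>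
      hG.sum_inv_dd_tm_chr hz k), dd_const]
  have h4 : ∀ i, dd (sp i) (fun y => dd tm (fun y => ∑ k, chr G k i k y) y) z₀ =
      - dd (sp i) (dd (sp i) (scal G)) z₀ := by
    intro i
    rw [dd_congr (hG.eventuallyEq_of_eqOn hz fun z hz => hG.dd_sum_chr hz i), dd_neg]
  rw [h1, h2]
  simp only [h3, h4, sum_const_zero, sum_neg_distrib]
  ring

/-- The trace of the second variation of the Lagrangian `R + |T|²` in the directions of an
orthonormal frame moving by `∇V = Ric(V)`, at the centre of adapted coordinates, equals the time
derivative of the Lagrangian. Here `(lam, T)` is the space-time velocity. -/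
theorem IsAdapted.trace_second_variation (hG : IsFlowOn O G) (hz : z₀ ∈ O) (ha : IsAdapted G z₀)
    (lam : ℝ) (T : Fin n → ℝ) :
    ∑ i, (lam ^ 2 * dd (sp i) (dd (sp i) (scal G)) z₀ +
      (∑ a, ∑ b, dd (sp i) (dd (sp i) (fun y => G y a b)) z₀ * T a * T b) +
      2 * lam ^ 2 * (∑ k, ric G k i z₀ ^ 2) -
      2 * ∑ k, T k * (lam * dd tm (chr G k i i) z₀ + ∑ m, T m * dd (sp m) (chr G k i i) z₀)) =
    lam ^ 2 * dd tm (scal G) z₀ + ∑ a, ∑ b, dd tm (fun y => G y a b) z₀ * T a * T b := by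
  have hB : ∑ i, ∑ k, T k * (lam * dd tm (chr G k i i) z₀) = 0 := by
    rw [sum_comm]
    refine sum_eq_zero fun k _ => ?_
    rw [← mul_sum, ← mul_sum, ha.sum_dd_tm_chr hG hz, mul_zero, mul_zero]
  have hR : ∑ i, (∑ a, ∑ b, dd (sp i) (dd (sp i) (fun y => G y a b)) z₀ * T a * T b) -
      2 * ∑ i, ∑ k, T k * ∑ m, T m * dd (sp m) (chr G k i i) z₀ =
      ∑ a, ∑ b, dd tm (fun y => G y a b) z₀ * T a * T b := by
    have e1 : ∑ a, ∑ b, dd tm (fun y => G y a b) z₀ * T a * T b =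
        ∑ a, ∑ b, ∑ i, T a * T b * (- dd (sp i) (dd (sp a) (fun y => G y b i)) z₀ -
          dd (sp i) (dd (sp b) (fun y => G y a i)) z₀ +
          dd (sp i) (dd (sp i) (fun y => G y a b)) z₀ +
          dd (sp b) (dd (sp a) (fun y => G y i i)) z₀) := by
      refine sum_congr rfl fun a _ => sum_congr rfl fun b _ => ?_
      rw [hG.flow' hz, ha.ric_eq hG hz, ← mul_sum, ← mul_sum]
      have : ∀ x : ℝ, ∀ S S' : ℝ, S' = -S → -2 * (1 / 2 * S) * x * T b = x * T b * S' := by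
        intro x S S' h; rw [h]; ring
      refine this _ _ _ ?_
      rw [← sum_neg_distrib]
      exact sum_congr rfl fun i _ => by ring
    have e2 : 2 * ∑ i, ∑ k, T k * ∑ m, T m * dd (sp m) (chr G k i i) z₀ =
        ∑ k, ∑ m, ∑ i, T k * T m * (2 * dd (sp i) (dd (sp m) (fun y => G y k i)) z₀ -
          dd (sp m) (dd (sp k) (fun y => G y i i)) z₀) := by
      rw [sum_comm, mul_sum]
      refine sum_congr rfl fun k _ => ?_
      simp only [mul_sum]
      rw [sum_comm]
      refine sum_congr rfl fun m _ => sum_congr rfl fun i _ => ?_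
      rw [ha.dd_chr hG hz, hG.dd_chrSum hz, hG.dd2_comm hz (sp m) (sp i), hG.dd2_symm hz _ _ i k]
      ring
    have e3 : ∑ i, (∑ a, ∑ b, dd (sp i) (dd (sp i) (fun y => G y a b)) z₀ * T a * T b) =
        ∑ a, ∑ b, ∑ i, T a * T b * dd (sp i) (dd (sp i) (fun y => G y a b)) z₀ := by
      rw [sum_comm]
      refine sum_congr rfl fun a _ => ?_
      rw [sum_comm]
      exact sum_congr rfl fun b _ => sum_congr rfl fun i _ => by ring
    have e4 : ∑ a, ∑ b, ∑ i, T a * T b * dd (sp i) (dd (sp a) (fun y => G y b i)) z₀ =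
        ∑ a, ∑ b, ∑ i, T a * T b * dd (sp i) (dd (sp b) (fun y => G y a i)) z₀ := by
      rw [sum_comm]
      exact sum_congr rfl fun a _ => sum_congr rfl fun b _ =>
        sum_congr rfl fun i _ => by ring
    rw [e1, e2, e3]
    simp only [mul_add, mul_sub, sum_add_distrib, sum_sub_distrib, mul_neg, sum_neg_distrib, e4]
    have e5 : ∀ f : Fin n → Fin n → Fin n → ℝ, ∑ a, ∑ b, ∑ i, T a * T b * (2 * f a b i) =
        2 * ∑ a, ∑ b, ∑ i, T a * T b * f a b i := by
      intro f
      simp only [mul_sum]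
      exact sum_congr rfl fun a _ => sum_congr rfl fun b _ =>
        sum_congr rfl fun i _ => by ring
    rw [e5]; ring
  have hsplit : ∑ i, ∑ k, T k * (lam * dd tm (chr G k i i) z₀ +
        ∑ m, T m * dd (sp m) (chr G k i i) z₀) =
      ∑ i, ∑ k, T k * ∑ m, T m * dd (sp m) (chr G k i i) z₀ := by
    simp only [mul_add, sum_add_distrib]
    rw [hB, zero_add]
  rw [ha.dd_tm_scal hG hz, ← hR, sum_sub_distrib, sum_add_distrib,
    sum_add_distrib, ← mul_sum, ← mul_sum, ← mul_sum, hsplit]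
  have : ∑ i, ∑ k, ric G k i z₀ ^ 2 = ∑ i, ∑ j, ric G i j z₀ ^ 2 := sum_comm
  rw [this]; ring

end Evolution

/-! ### Metrics, Ricci and scalar curvature in arbitrary charts -/

section Charts

variable {n : ℕ} {M : Type*} [TopologicalSpace M] [ChartedSpace (ℝ^n) M]

local notation "χ" => extChartAt (𝓡 n)

/-- The differential of the chart around `c` at `x`, with the tangent space of `M` at `x` read as
the model space. -/
def chartD (c x : M) : ℝ^n →L[ℝ] ℝ^n := mfderiv (𝓡 n) 𝓘(ℝ, ℝ^n) (χ c) x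

/-- The differential of the inverse of the chart around `c` at the coordinates `u`, with the
tangent space of `M` read as the model space. -/
def chartSymmD (c : M) (u : ℝ^n) : ℝ^n →L[ℝ] ℝ^n := mfderiv 𝓘(ℝ, ℝ^n) (𝓡 n) (χ c).symm u

theorem coord_eq (c : M) {x : M} (v : TangentSpace (𝓡 n) x) : coord c v = chartD c x v := rfl

variable [IsManifold (𝓡 n) ∞ M]

/-- The metric at `x` as a bilinear form on the model space. -/
def innerAt (h : Metric n M) (x : M) : ℝ^n →L[ℝ] ℝ^n →L[ℝ] ℝ := h.inner x

theorem isManifold_one : IsManifold (𝓡 n) 1 M :=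
  IsManifold.of_le (n := ∞) (WithTop.coe_le_coe.2 le_top)

theorem mdifferentiableAt_chart {c x : M} (hx : x ∈ (χ c).source) :
    MDifferentiableAt (𝓡 n) 𝓘(ℝ, ℝ^n) (χ c) x :=
  have := isManifold_one (n := n) (M := M)
  mdifferentiableAt_extChartAt (by simpa using hx)

theorem contMDiffAt_chart_symm {c : M} {u : ℝ^n} (hu : u ∈ (χ c).target) :
    ContMDiffAt 𝓘(ℝ, ℝ^n) (𝓡 n) ∞ (χ c).symm u :=
  (contMDiffOn_extChartAt_symm c).contMDiffAt ((isOpen_extChartAt_target c).mem_nhds hu)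

theorem mdifferentiableAt_chart_symm {c : M} {u : ℝ^n} (hu : u ∈ (χ c).target) :
    MDifferentiableAt 𝓘(ℝ, ℝ^n) (𝓡 n) (χ c).symm u :=
  (contMDiffAt_chart_symm hu).mdifferentiableAt (by simp)

theorem chartD_chartSymmD {c : M} {u : ℝ^n} (hu : u ∈ (χ c).target) (v : ℝ^n) :
    chartD c ((χ c).symm u) (chartSymmD c u v) = v := by
  have := isManifold_one (n := n) (M := M)
  have h := mfderiv_extChartAt_comp_mfderivWithin_extChartAt_symm (I := 𝓡 n) hu
  rw [modelWithCornersSelf_coe, range_id, mfderivWithin_univ] at h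
  exact DFunLike.congr_fun h v

theorem chartSymmD_chartD {c x : M} (hx : x ∈ (χ c).source) (v : ℝ^n) :
    chartSymmD c (χ c x) (chartD c x v) = v := by
  have := isManifold_one (n := n) (M := M)
  have h := mfderivWithin_extChartAt_symm_comp_mfderiv_extChartAt (I := 𝓡 n) ((χ c).map_source hx)
  rw [modelWithCornersSelf_coe, range_id, mfderivWithin_univ] at h
  have h2 := DFunLike.congr_fun h v
  have h3 : chartSymmD c (χ c x) (chartD c ((χ c).symm (χ c x)) v) = v := h2
  rwa [(χ c).left_inv hx] at h3

/-- The change of coordinates from the chart around `c` to the chart around `c'`. -/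
def chartTrans (c c' : M) : ℝ^n → ℝ^n := χ c' ∘ (χ c).symm

/-- The domain of the change of coordinates, in the chart around `c`. -/
def transDom (c c' : M) : Set (ℝ^n) := (χ c).target ∩ (χ c).symm ⁻¹' (χ c').source

theorem isOpen_transDom (c c' : M) : IsOpen (transDom (n := n) c c') :=
  (continuousOn_extChartAt_symm c).isOpen_inter_preimage (isOpen_extChartAt_target c)
    (isOpen_extChartAt_source c')

theorem contDiffAt_chartTrans {c c' : M} {u : ℝ^n} (hu : u ∈ transDom (n := n) c c') :
    ContDiffAt ℝ ∞ (chartTrans (n := n) c c') u := by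
  have h1 := contMDiffAt_chart_symm (n := n) hu.1
  have h2 : ContMDiffAt (𝓡 n) 𝓘(ℝ, ℝ^n) ∞ (χ c')
      ((χ c).symm u) := contMDiffAt_extChartAt' (by simpa using hu.2)
  exact contMDiffAt_iff_contDiffAt.1 (h2.comp u h1)

theorem fderiv_chartTrans {c c' : M} {u : ℝ^n} (hu : u ∈ transDom (n := n) c c') (v : ℝ^n) :
    fderiv ℝ (chartTrans (n := n) c c') u v = chartD c' ((χ c).symm u) (chartSymmD c u v) := by
  have h := mfderiv_comp u (mdifferentiableAt_chart (n := n) hu.2)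
    (mdifferentiableAt_chart_symm (n := n) hu.1)
  rw [← mfderiv_eq_fderiv]
  exact DFunLike.congr_fun h v

theorem chartSymmD_fderiv_chartTrans {c c' : M} {u : ℝ^n} (hu : u ∈ transDom (n := n) c c') (v :
    ℝ^n) :
    chartSymmD c' (chartTrans c c' u) (fderiv ℝ (chartTrans (n := n) c c') u v) =
      chartSymmD c u v := by
  rw [fderiv_chartTrans hu]
  exact chartSymmD_chartD hu.2 _

theorem bijective_fderiv_chartTrans {c c' : M} {u : ℝ^n} (hu : u ∈ transDom (n := n) c c') :
    Function.Bijective (fderiv ℝ (chartTrans (n := n) c c') u) := by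
  refine bijective_of_isUnit (isUnit_of_injective ?_)
  intro v w h
  have h1 := congrArg (chartSymmD c' (chartTrans c c' u)) h
  rw [chartSymmD_fderiv_chartTrans hu, chartSymmD_fderiv_chartTrans hu] at h1
  rw [← chartD_chartSymmD hu.1 v, h1, chartD_chartSymmD hu.1]

theorem chartTrans_symm {c c' : M} {u : ℝ^n} (hu : u ∈ transDom (n := n) c c') :
    (χ c').symm (chartTrans c c' u) = (χ c).symm u :=
  (χ c').left_inv hu.2

theorem bil_metricCoeff (h : Metric n M) (c : M) (u v w : ℝ^n) :
    bil (metricCoeff h c u) v w = innerAt h ((χ c).symm u) (chartSymmD c u v) (chartSymmD c u w) :=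
  bil_eq_of_single (B := (innerAt h ((χ c).symm u)).bilinearComp (chartSymmD c u)
    (chartSymmD c u)) (fun _ _ => rfl) v w

theorem innerAt_eq (h : Metric n M) {c x : M} (hx : x ∈ (χ c).source) (v w : ℝ^n) :
    innerAt h x v w = bil (metricCoeff h c (χ c x)) (chartD c x v) (chartD c x w) := by
  rw [bil_metricCoeff, chartSymmD_chartD hx, chartSymmD_chartD hx, (χ c).left_inv hx]

theorem bil_metricCoeff_trans (h : Metric n M) {c c' : M} {u : ℝ^n} (hu :
    u ∈ transDom (n := n) c c')
    (v w : ℝ^n) : bil (metricCoeff h c u) v w = bil (metricCoeff h c' (chartTrans c c' u))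
      (fderiv ℝ (chartTrans (n := n) c c') u v) (fderiv ℝ (chartTrans (n := n) c c') u w) := by
  rw [bil_metricCoeff, bil_metricCoeff, chartSymmD_fderiv_chartTrans hu,
    chartSymmD_fderiv_chartTrans hu, chartTrans_symm hu]

variable {g : ℝ → Metric n M} {T : EReal}

/-- The components of the flow in the chart around `c`, as functions on space-time. -/
def flowCoeff (g : ℝ → Metric n M) (c : M) (z : ℝ × ℝ^n) : Mat n := metricCoeff (g z.1) c z.2

theorem IsRicciFlow.isMetricOn (hg : IsRicciFlow g T) {τ : ℝ} (hτ : τ ∈ timeInterval T) (c : M) :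
    IsMetricOn (χ c).target (metricCoeff (g τ) c) where
  isOpen := isOpen_extChartAt_target c
  smooth u hu i j := by
    have h : ContDiffOn ℝ ∞ (fun u => metricCoeff (g τ) c u i j) (χ c).target :=
      (hg.smooth c i j).comp (g := fun z : ℝ × ℝ^n => metricCoeff (g z.1) c z.2 i j)
        (f := fun u : ℝ^n => (τ, u)) (contDiff_const.prodMk contDiff_id).contDiffOn
        fun u hu => ⟨hτ, hu⟩
    exact h.contDiffAt ((isOpen_extChartAt_target c).mem_nhds hu)
  symm u hu i j := (g τ).symm _ _ _
  pos u hu v hv := by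
    rw [bil_metricCoeff]
    refine (g τ).pos _ _ fun h0 => hv ?_
    rw [← chartD_chartSymmD hu v]
    exact (congrArg _ h0).trans (map_zero (chartD c _))

theorem IsRicciFlow.ricB_chartTrans (hg : IsRicciFlow g T) {τ : ℝ} (hτ : τ ∈ timeInterval T)
    {c c' : M} {u : ℝ^n} (hu : u ∈ transDom (n := n) c c') (v w : ℝ^n) :
    ricB (metricCoeff (g τ) c) u v w = ricB (metricCoeff (g τ) c') (chartTrans c c' u)
      (fderiv ℝ (chartTrans (n := n) c c') u v) (fderiv ℝ (chartTrans (n := n) c c') u w) := by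
  have hev := (isOpen_transDom (n := n) c c').mem_nhds hu
  refine ricB_pullback (hg.isMetricOn hτ c) (hg.isMetricOn hτ c') hu.1
    ((χ c').map_source hu.2) ?_ ?_ ?_ v w
  · filter_upwards [hev] with y hy using contDiffAt_chartTrans hy
  · filter_upwards [hev] with y hy using bijective_fderiv_chartTrans hy
  · filter_upwards [hev] with y hy using bil_metricCoeff_trans (g τ) hy

theorem ricci_eq_ricB (h : Metric n M) (x : M) (v w : ℝ^n) :
    ricci h x v w = ricB (metricCoeff h x) (χ x x) (chartD x x v) (chartD x x w) := by
  rw [ricB, bil_apply]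
  rfl

theorem mem_transDom {c x : M} (hx : x ∈ (χ c).source) : χ x x ∈ transDom (n := n) x c :=
  ⟨mem_extChartAt_target x, by
    rw [mem_preimage, (χ x).left_inv (mem_extChartAt_source x)]; exact hx⟩

theorem chartTrans_self {c x : M} : chartTrans x c (χ x x) = χ c x := by
  simp [chartTrans, (χ x).left_inv (mem_extChartAt_source x)]

theorem fderiv_chartTrans_chartD {c x : M} (hx : x ∈ (χ c).source) (v : ℝ^n) :
    fderiv ℝ (chartTrans (n := n) x c) (χ x x) (chartD x x v) = chartD c x v := by
  rw [fderiv_chartTrans (mem_transDom hx), chartSymmD_chartD (mem_extChartAt_source x),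
    (χ x).left_inv (mem_extChartAt_source x)]

/-- The Ricci tensor may be computed in any chart. -/
theorem IsRicciFlow.ricci_eq (hg : IsRicciFlow g T) {τ : ℝ} (hτ : τ ∈ timeInterval T) {c x : M}
    (hx : x ∈ (χ c).source) (v w : ℝ^n) :
    ricci (g τ) x v w = ricB (metricCoeff (g τ) c) (χ c x) (chartD c x v) (chartD c x w) := by
  rw [ricci_eq_ricB, hg.ricB_chartTrans hτ (mem_transDom hx), fderiv_chartTrans_chartD hx,
    fderiv_chartTrans_chartD hx, chartTrans_self]

/-- The trace of a bilinear form with respect to a metric, computed in an orthonormal frame. -/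
theorem sum_inv_mul_eq_sum_frame {A B : Mat n} (V : Fin n → ℝ^n)
    (hV : ∀ i j, bil A (V i) (V j) = if i = j then 1 else 0) :
    ∑ i, ∑ j, A⁻¹ i j * B i j = ∑ m, bil B (V m) (V m) := by
  simp only [← sum_frame_eq_inv V hV, bil_apply, sum_mul]
  calc _ = ∑ i, ∑ m, ∑ j, B i j * V m i * V m j := by
        refine sum_congr rfl fun i _ => ?_
        rw [sum_comm]
        exact sum_congr rfl fun m _ => sum_congr rfl fun j _ => by ring
    _ = _ := sum_comm

theorem scal_eq_sum_frame {G : ℝ × ℝ^n → Mat n} {z : ℝ × ℝ^n} (V : Fin n → ℝ^n)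
    (hV : ∀ i j, bil (G z) (V i) (V j) = if i = j then 1 else 0) :
    scal G z = ∑ m, ricB (fun u => G (z.1, u)) z.2 (V m) (V m) := by
  have h := sum_inv_mul_eq_sum_frame (B := Matrix.of (ricciCoeff (fun u => G (z.1, u)) z.2)) V hV
  simp only [Matrix.of_apply] at h
  unfold scal ric ricB
  exact h

/-- The scalar curvature may be computed in any chart. -/
theorem IsRicciFlow.scalarCurv_eq (hg : IsRicciFlow g T) {τ : ℝ} (hτ : τ ∈ timeInterval T) {c x : M}
    (hx : x ∈ (χ c).source) :
    scalarCurv (g τ) x = scal (flowCoeff g c) (τ, χ c x) := by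
  have hm := hg.isMetricOn hτ x
  obtain ⟨V, hV⟩ := exists_orthonormal_frame (hm.symm _ (mem_extChartAt_target x))
    (hm.pos _ (mem_extChartAt_target x))
  have h1 : scalarCurv (g τ) x = scal (flowCoeff g x) (τ, χ x x) := by
    simp only [scalarCurv, scal, ric, flowCoeff]
  have hV' : ∀ i j, bil (flowCoeff g c (τ, χ c x))
      (fderiv ℝ (chartTrans (n := n) x c) (χ x x) (V i))
      (fderiv ℝ (chartTrans (n := n) x c) (χ x x) (V j)) = if i = j then 1 else 0 := by
    intro i j
    rw [← hV, bil_metricCoeff_trans (g τ) (mem_transDom hx), chartTrans_self]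
    simp only [flowCoeff]
  have hV0 : ∀ i j, bil (flowCoeff g x (τ, χ x x)) (V i) (V j) =
      if i = j then 1 else 0 := by simpa only [flowCoeff] using hV
  rw [h1, scal_eq_sum_frame V hV0, scal_eq_sum_frame _ hV']
  refine sum_congr rfl fun m _ => ?_
  have := hg.ricB_chartTrans hτ (mem_transDom hx) (V m) (V m)
  rw [chartTrans_self] at this
  simpa only [flowCoeff] using this

/-- The interior of the time interval. -/
def openInterval (T : EReal) : Set ℝ := {t | 0 < t ∧ (t : EReal) < T}

theorem isOpen_openInterval (T : EReal) : IsOpen (openInterval T) :=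
  (isOpen_lt continuous_const continuous_id).inter
    (isOpen_lt continuous_coe_real_ereal continuous_const)

theorem openInterval_subset (T : EReal) : openInterval T ⊆ timeInterval T :=
  fun _ h => ⟨h.1.le, h.2⟩

theorem timeInterval_mem_nhds {T : EReal} {τ : ℝ} (h : τ ∈ openInterval T) : timeInterval T ∈ 𝓝 τ :=
  mem_of_superset ((isOpen_openInterval T).mem_nhds h) (openInterval_subset T)

theorem IsRicciFlow.hasDerivWithinAt_flowCoeff (hg : IsRicciFlow g T) {τ : ℝ}
    (hτ : τ ∈ timeInterval T) (c : M) {u : ℝ^n} (hu : u ∈ (χ c).target) (i j : Fin n) :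
    HasDerivWithinAt (fun τ => flowCoeff g c (τ, u) i j)
      (-2 * ricciCoeff (metricCoeff (g τ) c) u i j) (timeInterval T) τ := by
  have h := hg.flow τ hτ ((χ c).symm u) (coordVec c u i) (coordVec c u j)
  have h2 := hg.ricci_eq hτ ((χ c).map_target hu) (chartSymmD c u (𝐞 i)) (chartSymmD c u (𝐞 j))
  rw [chartD_chartSymmD hu, chartD_chartSymmD hu, (χ c).right_inv hu, ricB,
    bil_single, Matrix.of_apply] at h2
  rw [← h2]
  exact h

/-- In every chart the flow is a solution of the coordinate Ricci flow for positive times. -/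
theorem IsRicciFlow.isFlowOn (hg : IsRicciFlow g T) (c : M) :
    IsFlowOn (openInterval T ×ˢ (χ c).target) (flowCoeff g c) where
  isOpen := (isOpen_openInterval T).prod (isOpen_extChartAt_target c)
  smooth z hz i j := (hg.smooth c i j).contDiffAt
    (prod_mem_nhds (timeInterval_mem_nhds hz.1) ((isOpen_extChartAt_target c).mem_nhds hz.2))
  symm z hz i j := (g z.1).symm _ _ _
  pos z hz := (hg.isMetricOn (openInterval_subset T hz.1) c).pos _ hz.2
  flow z hz i j := by
    have h1 := (hg.hasDerivWithinAt_flowCoeff (openInterval_subset T hz.1) c hz.2 i j).hasDerivAt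
      (timeInterval_mem_nhds hz.1)
    have h2 : DifferentiableAt ℝ (fun y => flowCoeff g c y i j) z :=
      ((hg.smooth c i j).contDiffAt (prod_mem_nhds (timeInterval_mem_nhds hz.1)
        ((isOpen_extChartAt_target c).mem_nhds hz.2))).differentiableAt (by simp)
    exact (hasDerivAt_tm h2).unique h1

theorem convex_timeInterval (T : EReal) : Convex ℝ (timeInterval T) := by
  refine OrdConnected.convex ⟨fun x hx y hy z hz => ⟨hx.1.trans hz.1, ?_⟩⟩
  exact lt_of_le_of_lt (EReal.coe_le_coe_iff.2 hz.2) hy.2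

theorem openInterval_nonempty {T : EReal} {τ : ℝ} (hτ : τ ∈ timeInterval T) :
    (openInterval T).Nonempty := by
  obtain ⟨s, h1, h2⟩ := EReal.lt_iff_exists_real_btwn.1 hτ.2
  exact ⟨s, lt_of_le_of_lt hτ.1 (EReal.coe_lt_coe_iff.1 h1), h2⟩

/-- The Ricci coefficients are continuous up to the initial time. -/
theorem IsRicciFlow.continuousOn_ric (hg : IsRicciFlow g T) (c : M) (i j : Fin n) :
    ContinuousOn (ric (flowCoeff g c) i j) (timeInterval T ×ˢ (χ c).target) := by
  rcases (timeInterval T).eq_empty_or_nonempty with h0 | ⟨τ₀, h0⟩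
  · simp [h0]
  have hu1 : UniqueDiffOn ℝ (timeInterval T) :=
    uniqueDiffOn_convex (convex_timeInterval T) ((openInterval_nonempty h0).mono
      (interior_maximal (openInterval_subset T) (isOpen_openInterval T)))
  have hud : UniqueDiffOn ℝ (timeInterval T ×ˢ (χ c).target) :=
    hu1.prod (isOpen_extChartAt_target c).uniqueDiffOn
  have h1 := (hg.smooth c i j).continuousOn_fderivWithin hud (by simp)
  have h2 : ContinuousOn (fun z => (-1 / 2 : ℝ) * fderivWithin ℝ
      (fun z : ℝ × ℝ^n => metricCoeff (g z.1) c z.2 i j)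
      (timeInterval T ×ˢ (χ c).target) z (1, 0))
      (timeInterval T ×ˢ (χ c).target) :=
    continuousOn_const.mul (h1.clm_apply continuousOn_const)
  refine h2.congr fun z hz => ?_
  have h3 := (((hg.smooth c i j).differentiableOn (by simp)) z hz).hasFDerivWithinAt
  have h4 : HasDerivWithinAt (fun τ : ℝ => (τ, z.2)) ((1 : ℝ), (0 : ℝ^n)) (timeInterval T) z.1 :=
    (hasDerivWithinAt_id _ _).prodMk (hasDerivWithinAt_const _ _ _)
  have h5 := h3.comp_hasDerivWithinAt (x := z.1) h4 (fun τ hτ => (⟨hτ, hz.2⟩ :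
      (τ, z.2) ∈ timeInterval T ×ˢ (χ c).target))
  have h6 := (hu1 z.1 hz.1).eq_deriv _ h5 (hg.hasDerivWithinAt_flowCoeff hz.1 c hz.2 i j)
  simp only [h6]
  show ricciCoeff (metricCoeff (g z.1) c) z.2 i j = _
  ring

theorem IsRicciFlow.continuousOn_scal (hg : IsRicciFlow g T) (c : M) :
    ContinuousOn (scal (flowCoeff g c)) (timeInterval T ×ˢ (χ c).target) := by
  unfold scal
  refine continuousOn_finsetSum _ fun i _ => continuousOn_finsetSum _ fun j _ =>
    ContinuousOn.mul ?_ (hg.continuousOn_ric c i j)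
  intro z hz
  have := contDiffWithinAt_inv (k := 0) (A := flowCoeff g c) (fun i j =>
      ((hg.smooth c i j) z hz).of_le (by simp))
    (det_ne_zero_of_pos ((hg.isMetricOn hz.1 c).pos _ hz.2)) i j
  exact this.continuousWithinAt

end Charts

/-! ### A smooth retraction onto a compact submanifold of Euclidean space -/

section Retraction

variable {n : ℕ} {M : Type*} [TopologicalSpace M] [ChartedSpace (ℝ^n) M]
  [IsManifold (𝓡 n) ∞ M]

local notation "χ" => extChartAt (𝓡 n)

theorem isInvertible_of_injective_dual {B : ℝ^n →L[ℝ] ℝ^n →L[ℝ] ℝ} (hB : Function.Injective B) :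
    B.IsInvertible := by
  have hr : Module.finrank ℝ ℝ^n = Module.finrank ℝ (ℝ^n →L[ℝ] ℝ) := by
    rw [← (LinearMap.toContinuousLinearMap (𝕜 := ℝ) (E := ℝ^n) (F' := ℝ)).finrank_eq]
    exact (Subspace.dual_finrank_eq (K := ℝ) (V := ℝ^n)).symm
  let e := (LinearEquiv.ofInjectiveOfFinrankEq (B : ℝ^n →ₗ[ℝ] (ℝ^n →L[ℝ] ℝ)) hB
    hr).toContinuousLinearEquiv
  exact ⟨e, by ext; rfl⟩

/-- The embedded submanifold admits a retraction, smooth near it: the nearest point map, which by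
the implicit function theorem applied to the equation of critical points of the distance is
single valued and smooth near the submanifold. -/
theorem exists_retraction [CompactSpace M] [Nonempty M] {N : ℕ} {f : M → ℝ^N}
    (hf : ContMDiff (𝓡 n) 𝓘(ℝ, ℝ^N) ∞ f) (he : IsClosedEmbedding f)
    (hd : ∀ x, Function.Injective (mfderiv (𝓡 n) 𝓘(ℝ, ℝ^N) f x)) :
    ∃ r : ℝ^N → M, (∀ x, r (f x) = x) ∧ ∀ x, ContMDiffAt 𝓘(ℝ, ℝ^N) (𝓡 n) ∞ r (f x) := by
  have hmin : ∀ y, ∃ x, ∀ x', ‖f x - y‖ ≤ ‖f x' - y‖ := by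
    intro y
    obtain ⟨x, -, hx⟩ := isCompact_univ.exists_isMinOn (univ_nonempty (α := M))
      (f := fun x => ‖f x - y‖) (by have := he.continuous; fun_prop)
    exact ⟨x, fun x' => hx (mem_univ x')⟩
  choose r hr using hmin
  have hrf : ∀ x, r (f x) = x := by
    intro x
    have := hr (f x) x
    rw [sub_self, norm_zero] at this
    exact he.injective (sub_eq_zero.1 (norm_le_zero_iff.1 this))
  refine ⟨r, hrf, fun x₀ => ?_⟩
  -- the nearest point to `y` is within `2 ‖y - f x₀‖` of `f x₀`
  have htend : Tendsto r (𝓝 (f x₀)) (𝓝 x₀) := by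
    rw [he.isInducing.tendsto_nhds_iff, tendsto_iff_norm_sub_tendsto_zero]
    have h2 : Tendsto (fun y => 2 * ‖y - f x₀‖) (𝓝 (f x₀)) (𝓝 0) := by
      have : Continuous (fun y => 2 * ‖y - f x₀‖) := by fun_prop
      simpa using this.tendsto (f x₀)
    refine squeeze_zero (fun _ => norm_nonneg _) (fun y => ?_) h2
    calc ‖f (r y) - f x₀‖ ≤ ‖f (r y) - y‖ + ‖y - f x₀‖ := norm_sub_le_norm_sub_add_norm_sub _ _ _
      _ ≤ ‖f x₀ - y‖ + ‖y - f x₀‖ := by gcongr; exact hr y x₀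
      _ = 2 * ‖y - f x₀‖ := by rw [norm_sub_rev (f x₀)]; ring
  set φ := χ x₀ with hφ
  set u₀ : ℝ^n := φ x₀ with hu₀
  have hu₀t : u₀ ∈ φ.target := mem_extChartAt_target x₀
  have hto : IsOpen φ.target := isOpen_extChartAt_target x₀
  set F : ℝ^n → ℝ^N := f ∘ φ.symm with hF
  have hFu : F u₀ = f x₀ := by
    simp [hF, hu₀, hφ]
  have hFs : ∀ u ∈ φ.target, ContDiffAt ℝ ∞ F u := fun u hu =>
    contMDiffAt_iff_contDiffAt.1 ((hf _).comp u (contMDiffAt_chart_symm hu))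
  have hFi : Function.Injective (fderiv ℝ F u₀) := by
    have h1 := mfderiv_comp u₀ ((hf (φ.symm u₀)).mdifferentiableAt (by simp))
      (mdifferentiableAt_chart_symm hu₀t)
    rw [mfderiv_eq_fderiv] at h1
    intro v w hvw
    have e : ∀ v, fderiv ℝ F u₀ v = mfderiv (𝓡 n) 𝓘(ℝ, ℝ^N) f (φ.symm u₀) (chartSymmD x₀ u₀ v) :=
      fun v => DFunLike.congr_fun h1 v
    rw [e, e] at hvw
    have h2 := hd _ hvw
    rw [← chartD_chartSymmD hu₀t v, ← chartD_chartSymmD hu₀t w]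
    exact congrArg _ h2
  -- the equation of critical points of the distance to `y`
  set Θ : ℝ^N × ℝ^n → (ℝ^n →L[ℝ] ℝ) :=
    fun z => (innerSL ℝ (F z.2 - z.1)).comp (fderiv ℝ F z.2) with hΘ
  have hΘs : ContDiffAt ℝ ∞ Θ (f x₀, u₀) := by
    have h1 : ContDiffAt ℝ ∞ (fun z : ℝ^N × ℝ^n => F z.2) (f x₀, u₀) :=
      ContDiffAt.comp (g := F) (f := Prod.snd) (f x₀, u₀) (hFs u₀ hu₀t) contDiffAt_snd
    have h2 : ContDiffAt ℝ ∞ (fun z : ℝ^N × ℝ^n => fderiv ℝ F z.2) (f x₀, u₀) :=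
      ContDiffAt.comp (g := fderiv ℝ F) (f := Prod.snd) (f x₀, u₀)
        ((hFs u₀ hu₀t).fderiv_right (m := ∞) (by simp)) contDiffAt_snd
    exact ((innerSL ℝ).contDiff.contDiffAt.comp (f x₀, u₀) (h1.sub contDiffAt_fst)).clm_comp h2
  have hΘ0 : Θ (f x₀, u₀) = 0 := by simp [hΘ, hFu]
  have hΘd : ∀ v w, fderiv ℝ Θ (f x₀, u₀) (0, v) w =
      inner ℝ (fderiv ℝ F u₀ v) (fderiv ℝ F u₀ w) := by
    intro v w
    have hF1 := ((hFs u₀ hu₀t).differentiableAt (by simp)).hasFDerivAt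
    have hF2 := (((hFs u₀ hu₀t).fderiv_right (m := ∞) (by simp)).differentiableAt
      (by simp)).hasFDerivAt
    have h1 : HasFDerivAt (fun u => Θ (f x₀, u)) _ u₀ :=
      ((innerSL ℝ).hasFDerivAt.comp u₀ (hF1.sub_const (f x₀))).clm_comp hF2
    have h2 : HasFDerivAt (fun u => Θ (f x₀, u))
        ((fderiv ℝ Θ (f x₀, u₀)).comp (ContinuousLinearMap.inr ℝ _ ℝ^n)) u₀ :=
      HasFDerivAt.comp (g := Θ) u₀ (hΘs.differentiableAt (by simp)).hasFDerivAt
        (hasFDerivAt_prodMk_right _ _)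
    have h3 := DFunLike.congr_fun (DFunLike.congr_fun (h2.unique h1) v) w
    simp only [hFu, sub_self] at h3
    refine h3.trans ?_
    simp [hFu]
    rfl
  -- the partial derivative in `u` is the Gram form of the immersion, hence invertible
  have hinv : (fderiv ℝ Θ (f x₀, u₀) ∘L .inr ℝ _ ℝ^n).IsInvertible := by
    refine isInvertible_of_injective_dual ((injective_iff_map_eq_zero _).2 fun v hv => ?_)
    have h1 := hΘd v v
    have h2 : fderiv ℝ Θ (f x₀, u₀) (0, v) = 0 := hv
    rw [h2, zero_apply] at h1
    exact hFi (by rw [inner_self_eq_zero.1 h1.symm, map_zero])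
  set ι := hΘs.implicitFunction (by simp) hinv with hι
  have hιs : ContDiffAt ℝ ∞ ι (f x₀) := hΘs.contDiffAt_implicitFunction (by simp) hinv
  have hι0 : ι (f x₀) = u₀ := hΘs.implicitFunction_apply_self (by simp) hinv
  have hiff := hΘs.eventually_apply_eq_iff_implicitFunction (by simp) hinv
  have hsrc : ∀ᶠ y in 𝓝 (f x₀), r y ∈ φ.source := htend.eventually (extChartAt_source_mem_nhds x₀)
  have htend2 : Tendsto (fun y => (y, φ (r y))) (𝓝 (f x₀)) (𝓝 (f x₀, u₀)) :=
    Tendsto.prodMk_nhds tendsto_id ((continuousAt_extChartAt x₀).tendsto.comp htend)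
  have hev : r =ᶠ[𝓝 (f x₀)] fun y => φ.symm (ι y) := by
    filter_upwards [hsrc, htend2.eventually hiff] with y h1 h2
    have hcrit : Θ (y, φ (r y)) = 0 := by
      have hu : φ (r y) ∈ φ.target := φ.map_source h1
      have hloc : IsLocalMin (fun u => ‖F u - y‖ ^ 2) (φ (r y)) := by
        refine Eventually.of_forall fun u => ?_
        have : F (φ (r y)) = f (r y) := by simp [hF, φ.left_inv h1]
        simp only [this]
        gcongr
        exact hr y _
      have h3 := (((hFs _ hu).differentiableAt (by simp)).hasFDerivAt.sub_const y).norm_sq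
      have h4 := hloc.hasFDerivAt_eq_zero h3
      ext v
      have h5 := DFunLike.congr_fun h4 v
      simpa [hΘ] using h5
    rw [hcrit, hΘ0] at h2
    have : ι y = φ (r y) := h2.1 rfl
    show r y = φ.symm (ι y)
    rw [this, φ.left_inv h1]
  refine ContMDiffAt.congr_of_eventuallyEq ?_ hev
  have h1 : ContMDiffAt 𝓘(ℝ, ℝ^n) (𝓡 n) ∞ φ.symm (ι (f x₀)) := by
    rw [hι0]; exact contMDiffAt_chart_symm hu₀t
  exact h1.comp (f x₀) hιs.contMDiffAt

end Retraction

/-! ### Two-jets of curves -/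

section Jets

variable {V V' : Type*} [NormedAddCommGroup V] [NormedSpace ℝ V]
  [NormedAddCommGroup V'] [NormedSpace ℝ V']

/-- The curve `f` has value `v₀`, first derivative `v₁` and second derivative `v₂` at `0`. -/
def HasJet (f : ℝ → V) (v₀ v₁ v₂ : V) : Prop :=
  ∃ f₁ : ℝ → V, f 0 = v₀ ∧ (∀ᶠ a in 𝓝 0, HasDerivAt f (f₁ a) a) ∧ f₁ 0 = v₁ ∧ HasDerivAt f₁ v₂ 0

theorem HasJet.congr {f g : ℝ → V} {v₀ v₁ v₂ : V} (h : HasJet f v₀ v₁ v₂) (hg : g =ᶠ[𝓝 0] f) :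
    HasJet g v₀ v₁ v₂ := by
  obtain ⟨f₁, h0, h1, h2, h3⟩ := h
  refine ⟨f₁, by rw [hg.self_of_nhds, h0], ?_, h2, h3⟩
  filter_upwards [h1, hg.eventually_nhds] with a ha hg
  exact ha.congr_of_eventuallyEq hg

theorem HasJet.hasDerivAt {f : ℝ → V} {v₀ v₁ v₂ : V} (h : HasJet f v₀ v₁ v₂) :
    HasDerivAt f v₁ 0 := by
  obtain ⟨f₁, h0, h1, h2, h3⟩ := h
  exact h2 ▸ h1.self_of_nhds

theorem HasJet.deriv {f : ℝ → V} {v₀ v₁ v₂ : V} (h : HasJet f v₀ v₁ v₂) : _root_.deriv f 0 = v₁ :=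
  h.hasDerivAt.deriv

theorem HasJet.deriv_deriv {f : ℝ → V} {v₀ v₁ v₂ : V} (h : HasJet f v₀ v₁ v₂) :
    _root_.deriv (_root_.deriv f) 0 = v₂ := by
  obtain ⟨f₁, h0, h1, h2, h3⟩ := h
  refine (h3.congr_of_eventuallyEq ?_).deriv
  filter_upwards [h1] with a ha using ha.deriv

theorem HasJet.continuousAt {f : ℝ → V} {v₀ v₁ v₂ : V} (h : HasJet f v₀ v₁ v₂) :
    Tendsto f (𝓝 0) (𝓝 v₀) := by
  have := h.hasDerivAt.continuousAt.tendsto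
  rwa [h.choose_spec.1] at this

theorem hasJet_const (v : V) : HasJet (fun _ => v) v 0 0 :=
  ⟨fun _ => 0, rfl, Eventually.of_forall fun a => hasDerivAt_const a v, rfl, hasDerivAt_const _ _⟩

/-- The quadratic curve with prescribed two-jet. -/
theorem hasJet_quadratic (v₀ v₁ v₂ : V) :
    HasJet (fun a : ℝ => v₀ + a • v₁ + (a ^ 2 / 2) • v₂) v₀ v₁ v₂ := by
  refine ⟨fun a => v₁ + a • v₂, by simp, Eventually.of_forall fun a => ?_, by simp, ?_⟩
  · have h1 : HasDerivAt (fun a : ℝ => a ^ 2 / 2) a a := by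
      simpa using (hasDerivAt_pow 2 a).div_const 2
    simpa using (((hasDerivAt_id a).smul_const v₁).const_add v₀).fun_add (h1.smul_const v₂)
  · simpa using ((hasDerivAt_id (0 : ℝ)).smul_const v₂).const_add v₁

theorem HasJet.add {f g : ℝ → V} {v₀ v₁ v₂ w₀ w₁ w₂ : V} (hf : HasJet f v₀ v₁ v₂)
    (hg : HasJet g w₀ w₁ w₂) : HasJet (fun a => f a + g a) (v₀ + w₀) (v₁ + w₁) (v₂ + w₂) := by
  obtain ⟨f₁, h0, h1, h2, h3⟩ := hf
  obtain ⟨g₁, k0, k1, k2, k3⟩ := hg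
  refine ⟨fun a => f₁ a + g₁ a, by simp [h0, k0], ?_, by simp [h2, k2], h3.add k3⟩
  filter_upwards [h1, k1] with a ha hb using ha.add hb

theorem HasJet.const_smul {f : ℝ → V} {v₀ v₁ v₂ : V} (c : ℝ) (hf : HasJet f v₀ v₁ v₂) :
    HasJet (fun a => c • f a) (c • v₀) (c • v₁) (c • v₂) := by
  obtain ⟨f₁, h0, h1, h2, h3⟩ := hf
  refine ⟨fun a => c • f₁ a, by simp [h0], ?_, by simp [h2], h3.const_smul c⟩
  filter_upwards [h1] with a ha using ha.const_smul c

theorem HasJet.sum {ι : Type*} {s : Finset ι} {f : ι → ℝ → V} {v₀ v₁ v₂ : ι → V}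
    (h : ∀ i, HasJet (f i) (v₀ i) (v₁ i) (v₂ i)) :
    HasJet (fun a => ∑ i ∈ s, f i a) (∑ i ∈ s, v₀ i) (∑ i ∈ s, v₁ i) (∑ i ∈ s, v₂ i) := by
  classical
  induction s using Finset.induction_on with
  | empty => simpa using hasJet_const (0 : V)
  | insert i s hi ih => simpa [Finset.sum_insert hi] using (h i).add ih

theorem HasJet.comp_neg {f : ℝ → V} {v₀ v₁ v₂ : V} (hf : HasJet f v₀ v₁ v₂) :
    HasJet (fun a => f (-a)) v₀ (-v₁) v₂ := by
  obtain ⟨f₁, h0, h1, h2, h3⟩ := hf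
  have hn : Tendsto (fun a : ℝ => -a) (𝓝 0) (𝓝 0) := by
    simpa using (continuous_neg (G := ℝ)).tendsto 0
  refine ⟨fun a => - f₁ (-a), by simp [h0], ?_, by simp [h2], ?_⟩
  · filter_upwards [hn.eventually h1] with a ha
    simpa [Function.comp_def] using ha.scomp a (hasDerivAt_neg a)
  · have h4 : HasDerivAt f₁ v₂ (-0) := by simpa using h3
    simpa using (h4.scomp (0 : ℝ) (hasDerivAt_neg 0)).fun_neg

theorem HasJet.prodMk {f : ℝ → V} {g : ℝ → V'} {v₀ v₁ v₂ : V} {w₀ w₁ w₂ : V'}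
    (hf : HasJet f v₀ v₁ v₂) (hg : HasJet g w₀ w₁ w₂) :
    HasJet (fun a => (f a, g a)) (v₀, w₀) (v₁, w₁) (v₂, w₂) := by
  obtain ⟨f₁, h0, h1, h2, h3⟩ := hf
  obtain ⟨g₁, k0, k1, k2, k3⟩ := hg
  refine ⟨fun a => (f₁ a, g₁ a), by simp [h0, k0], ?_, by simp [h2, k2], h3.prodMk k3⟩
  filter_upwards [h1, k1] with a ha hb using ha.prodMk hb

theorem HasJet.clm_apply {A : ℝ → V →L[ℝ] V'} {f : ℝ → V} {A₀ A₁ A₂ : V →L[ℝ] V'} {v₀ v₁ v₂ : V}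
    (hA : HasJet A A₀ A₁ A₂) (hf : HasJet f v₀ v₁ v₂) :
    HasJet (fun a => A a (f a)) (A₀ v₀) (A₁ v₀ + A₀ v₁) (A₂ v₀ + (2 : ℝ) • A₁ v₁ + A₀ v₂) := by
  obtain ⟨f₁, h0, h1, h2, h3⟩ := hf
  obtain ⟨A', k0, k1, k2, k3⟩ := hA
  have hA0 := k1.self_of_nhds
  have hf0 := h1.self_of_nhds
  refine ⟨fun a => A' a (f a) + A a (f₁ a), by simp [h0, k0], ?_, by simp [h0, h2, k0, k2], ?_⟩
  · filter_upwards [h1, k1] with a ha hb using hb.clm_apply ha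
  · have := (k3.clm_apply hf0).add (hA0.clm_apply h3)
    simp only [h0, h2, k0, k2] at this
    refine this.congr_deriv ?_
    rw [two_smul]; abel

/-- The chain rule for two-jets. -/
theorem HasJet.comp {f : ℝ → V} {v₀ v₁ v₂ : V} {Φ : V → V'} (hf : HasJet f v₀ v₁ v₂)
    (hΦ : ContDiffAt ℝ 2 Φ v₀) :
    HasJet (fun a => Φ (f a)) (Φ v₀) (fderiv ℝ Φ v₀ v₁)
      (fderiv ℝ (fderiv ℝ Φ) v₀ v₁ v₁ + fderiv ℝ Φ v₀ v₂) := by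
  have hc := hf.continuousAt
  obtain ⟨f₁, h0, h1, h2, h3⟩ := hf
  have hev : ∀ᶠ v in 𝓝 v₀, DifferentiableAt ℝ Φ v := by
    filter_upwards [hΦ.eventually (by simp)] with v hv using hv.differentiableAt (by simp)
  refine ⟨fun a => fderiv ℝ Φ (f a) (f₁ a), by simp [h0], ?_, by simp [h0, h2], ?_⟩
  · filter_upwards [h1, hc.eventually hev] with a ha hb
    exact hb.hasFDerivAt.comp_hasDerivAt a ha
  · have hD : DifferentiableAt ℝ (fderiv ℝ Φ) (f 0) := by
      rw [h0]
      exact (hΦ.fderiv_right (m := 1) (by norm_num)).differentiableAt (by norm_num)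
    have h4 := (hD.hasFDerivAt.comp_hasDerivAt 0 h1.self_of_nhds).clm_apply h3
    rw [h0, h2] at h4
    simp only [Function.comp_apply, h0] at h4
    exact h4

end Jets

/-! ### A flow seen from an ambient Euclidean space -/

section Extrinsic

variable {n : ℕ} {W : Type*} [NormedAddCommGroup W] [InnerProductSpace ℝ W] [FiniteDimensional ℝ W]
  {B : ℝ × W → W →L[ℝ] W →L[ℝ] ℝ} {R : ℝ × W → ℝ} {ρ : W → W} {O : Set (ℝ × ℝ^n)}
  {G : ℝ × ℝ^n → Mat n} {ψ : W → ℝ^n} {F : ℝ^n → W} {z₀ : ℝ × W}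

/-- Near `(τ₀, y₀)` the degenerate metrics `B`, the function `R` and the retraction `ρ` onto a
submanifold come from a coordinate Ricci flow `G` through coordinates `ψ`, whose inverse on the
submanifold is `F`: `B` is the pullback of `G` by `ψ`, `R` is the scalar curvature, and `ρ = F ∘ ψ`. -/
structure IsLocalModel (B : ℝ × W → W →L[ℝ] W →L[ℝ] ℝ) (R : ℝ × W → ℝ) (ρ : W → W)
    (O : Set (ℝ × ℝ^n)) (G : ℝ × ℝ^n → Mat n) (ψ : W → ℝ^n) (F : ℝ^n → W)
    (z₀ : ℝ × W) : Prop where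
  flow : IsFlowOn O G
  mem : (z₀.1, ψ z₀.2) ∈ O
  smooth : ContDiffAt ℝ 6 ψ z₀.2
  smooth_inv : ContDiffAt ℝ 6 F (ψ z₀.2)
  metric_eq : ∀ᶠ z in 𝓝 z₀, ∀ v w, B z v w =
    bil (G (z.1, ψ z.2)) (fderiv ℝ ψ z.2 v) (fderiv ℝ ψ z.2 w)
  scal_eq : ∀ᶠ z in 𝓝 z₀, R z = scal G (z.1, ψ z.2)
  retr_eq : ∀ᶠ y in 𝓝 z₀.2, ρ y = F (ψ y)
  inv : ∀ᶠ u in 𝓝 (ψ z₀.2), ψ (F u) = u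
  fix : F (ψ z₀.2) = z₀.2

/-- The ambient inner product as a bilinear form. -/
def ambientInner (W : Type*) [NormedAddCommGroup W] [InnerProductSpace ℝ W] :
    W →L[ℝ] W →L[ℝ] ℝ := innerSL ℝ

/-- The nondegenerate extension of `B` by the ambient inner product of the components transverse
to the submanifold. -/
def extForm (B : ℝ × W → W →L[ℝ] W →L[ℝ] ℝ) (ρ : W → W) (z : ℝ × W) : W →L[ℝ] W →L[ℝ] ℝ :=
  B z + (ambientInner W).bilinearComp (ContinuousLinearMap.id ℝ W - fderiv ℝ ρ z.2)
    (ContinuousLinearMap.id ℝ W - fderiv ℝ ρ z.2)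

/-- The operator raising indices with `extForm`. -/
def extSharp (B : ℝ × W → W →L[ℝ] W →L[ℝ] ℝ) (ρ : W → W) (z : ℝ × W) : (W →L[ℝ] ℝ) →L[ℝ] W :=
  (extForm B ρ z).inverse

/-- The Christoffel symbols of the first kind of `B` in the spatial directions. -/
def extChr (B : ℝ × W → W →L[ℝ] W →L[ℝ] ℝ) (z : ℝ × W) (v w : W) : W →L[ℝ] ℝ :=
  (1 / 2 : ℝ) • (fderiv ℝ B z (0, v) w + fderiv ℝ B z (0, w) v -
    (((fderiv ℝ B z).comp (ContinuousLinearMap.inr ℝ ℝ W)).flip v).flip w)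

/-- The acceleration of a geodesic with initial velocity `σ`, as a function of `(τ, y, σ)`. -/
def extAcc (B : ℝ × W → W →L[ℝ] W →L[ℝ] ℝ) (ρ : W → W) (q : ℝ × W × W) : W :=
  -(extSharp B ρ (q.1, q.2.1) (extChr B (q.1, q.2.1) q.2.2 q.2.2))

/-- The derivative of a vector field `σ` with `∇_T σ = Ric(σ)` along a curve with space-time
velocity `l`, as a function of `((τ, y), σ, l)`. -/
def extTransport (B : ℝ × W → W →L[ℝ] W →L[ℝ] ℝ) (ρ : W → W) (q : (ℝ × W) × W × (ℝ × W)) : W :=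
  -(extSharp B ρ q.1 ((1 / 2 : ℝ) • fderiv ℝ B q.1 (q.2.2.1, 0) q.2.1 + extChr B q.1 q.2.2.2 q.2.1))

theorem extChr_eq_chr1 {B : ℝ × W → W →L[ℝ] W →L[ℝ] ℝ} {τ : ℝ} {y : W}
    (hB : DifferentiableAt ℝ B (τ, y)) (v w : W) :
    extChr B (τ, y) v w = chr1 (fun y => B (τ, y)) y v w := by
  have h : fderiv ℝ (fun y => B (τ, y)) y =
      (fderiv ℝ B (τ, y)).comp (ContinuousLinearMap.inr ℝ ℝ W) :=
    (HasFDerivAt.comp (g := B) y hB.hasFDerivAt (hasFDerivAt_prodMk_right τ y)).fderiv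
  rw [chr1, h]; rfl

theorem bil_ricciSharpVec {G : ℝ^n → Mat n} {u : ℝ^n} (hd : (G u).det ≠ 0)
    (hs : ∀ i j, G u i j = G u j i) (hr : ∀ i j, ricciCoeff G u i j = ricciCoeff G u j i)
    (v z : ℝ^n) : bil (G u) (ricciSharpVec G u v) z = ricB G u v z := by
  have h : ∀ k, (ricciSharpVec G u v) k = ∑ l, (G u)⁻¹ k l * ∑ j, ricciCoeff G u l j * v j := by
    intro k
    simp only [ricciSharpVec, mul_sum]
    exact sum_congr rfl fun l _ => sum_congr rfl fun j _ => by ring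
  rw [ricB, bil_apply, bil_apply, sum_comm]
  have h2 : ∀ m, ∑ k, G u k m * (ricciSharpVec G u v) k * z m =
      (∑ j, ricciCoeff G u m j * v j) * z m := by
    intro m
    rw [← sum_mul]
    simp only [h]
    rw [sum_mul_inv hd hs]
  simp only [h2, sum_mul]
  rw [sum_comm]
  exact sum_congr rfl fun i _ => sum_congr rfl fun j _ => by
    rw [hr j i, Matrix.of_apply]

theorem contDiffAt_bilinearComp {X Y Z : Type*} [NormedAddCommGroup X] [NormedSpace ℝ X]
    [NormedAddCommGroup Y] [NormedSpace ℝ Y] [NormedAddCommGroup Z] [NormedSpace ℝ Z]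
    {k : WithTop ℕ∞} {x : X} {A : X → Y →L[ℝ] Y →L[ℝ] ℝ} {D : X → Z →L[ℝ] Y}
    (hA : ContDiffAt ℝ k A x) (hD : ContDiffAt ℝ k D x) :
    ContDiffAt ℝ k (fun x => (A x).bilinearComp (D x) (D x)) x :=
  (ContinuousLinearMap.flipₗᵢ ℝ Z Z ℝ).contDiff.contDiffAt.comp x
    (((ContinuousLinearMap.flipₗᵢ ℝ Z Y ℝ).contDiff.contDiffAt.comp x (hA.clm_comp hD)).clm_comp hD)

namespace IsLocalModel

variable (h : IsLocalModel B R ρ O G ψ F z₀)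

include h

theorem fderiv_retr : fderiv ℝ ρ z₀.2 = (fderiv ℝ F (ψ z₀.2)).comp (fderiv ℝ ψ z₀.2) := by
  rw [EventuallyEq.fderiv_eq (f := fun y => F (ψ y)) h.retr_eq]
  exact fderiv_comp _ (h.smooth_inv.differentiableAt (by simp))
    (h.smooth.differentiableAt (by simp))

theorem fderiv_inv (ℓ : ℝ^n) : fderiv ℝ ψ z₀.2 (fderiv ℝ F (ψ z₀.2) ℓ) = ℓ := by
  have h1 : HasFDerivAt ψ (fderiv ℝ ψ z₀.2) (F (ψ z₀.2)) := by
    rw [h.fix]; exact (h.smooth.differentiableAt (by simp)).hasFDerivAt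
  have h2 := h1.comp _ (h.smooth_inv.differentiableAt (by simp)).hasFDerivAt
  have h3 : HasFDerivAt (ψ ∘ F) (ContinuousLinearMap.id ℝ ℝ^n) (ψ z₀.2) :=
    (hasFDerivAt_id _).congr_of_eventuallyEq h.inv
  exact DFunLike.congr_fun (h2.unique h3) ℓ

theorem fderiv_retr_apply_inv (ℓ : ℝ^n) :
    fderiv ℝ ρ z₀.2 (fderiv ℝ F (ψ z₀.2) ℓ) = fderiv ℝ F (ψ z₀.2) ℓ := by
  rw [h.fderiv_retr, ContinuousLinearMap.comp_apply, h.fderiv_inv]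

theorem injective_extForm : Function.Injective (extForm B ρ z₀) := by
  refine (injective_iff_map_eq_zero _).2 fun v hv => ?_
  have h1 : extForm B ρ z₀ v v = 0 := by rw [hv, zero_apply]
  simp only [extForm, add_apply, ContinuousLinearMap.bilinearComp_apply, sub_apply,
    ContinuousLinearMap.id_apply] at h1
  have h2 : ambientInner W (v - fderiv ℝ ρ z₀.2 v) (v - fderiv ℝ ρ z₀.2 v) =
    ‖v - fderiv ℝ ρ z₀.2 v‖ ^ 2 := real_inner_self_eq_norm_sq _
  have hB := h.metric_eq.self_of_nhds v v
  have h0 : 0 ≤ B z₀ v v := by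
    rw [hB]
    by_cases h0 : fderiv ℝ ψ z₀.2 v = 0
    · simp [h0]
    · exact (h.flow.pos _ h.mem _ h0).le
  rw [h2] at h1
  have h3 : ‖v - fderiv ℝ ρ z₀.2 v‖ ^ 2 = 0 := by nlinarith [sq_nonneg ‖v - fderiv ℝ ρ z₀.2 v‖]
  have h4 : B z₀ v v = 0 := by linarith
  have h5 : v = fderiv ℝ ρ z₀.2 v := by
    rw [← sub_eq_zero, ← norm_eq_zero]; exact pow_eq_zero_iff (by norm_num) |>.1 h3
  have h6 : fderiv ℝ ψ z₀.2 v = 0 := by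
    by_contra h7
    have := h.flow.pos _ h.mem _ h7
    rw [← hB, h4] at this
    exact lt_irrefl _ this
  rw [h5, h.fderiv_retr, ContinuousLinearMap.comp_apply, h6, map_zero]

theorem isInvertible_extForm : (extForm B ρ z₀).IsInvertible := by
  have hr : Module.finrank ℝ W = Module.finrank ℝ (W →L[ℝ] ℝ) := by
    rw [← (LinearMap.toContinuousLinearMap (𝕜 := ℝ) (E := W) (F' := ℝ)).finrank_eq]
    exact (Subspace.dual_finrank_eq (K := ℝ) (V := W)).symm
  let e := (LinearEquiv.ofInjectiveOfFinrankEq (extForm B ρ z₀ : W →ₗ[ℝ] (W →L[ℝ] ℝ))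
    h.injective_extForm hr).toContinuousLinearEquiv
  exact ⟨e, by ext; rfl⟩

/-- Raising the index of a form coming from the coordinates yields a tangent vector of the
submanifold. -/
theorem extSharp_eq {ξ : W →L[ℝ] ℝ} {ℓ : ℝ^n}
    (hξ : ∀ v, ξ v = bil (G (z₀.1, ψ z₀.2)) ℓ (fderiv ℝ ψ z₀.2 v)) :
    extSharp B ρ z₀ ξ = fderiv ℝ F (ψ z₀.2) ℓ := by
  rw [extSharp, h.isInvertible_extForm.inverse_apply_eq]
  ext v
  rw [hξ, extForm, add_apply, add_apply, h.metric_eq.self_of_nhds, h.fderiv_inv,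
    ContinuousLinearMap.bilinearComp_apply]
  have : (ContinuousLinearMap.id ℝ W - fderiv ℝ ρ z₀.2) (fderiv ℝ F (ψ z₀.2) ℓ) = 0 := by
    rw [sub_apply, h.fderiv_retr_apply_inv, ContinuousLinearMap.id_apply, sub_self]
  rw [this, map_zero, zero_apply, add_zero]

theorem contDiffAt_metric : ContDiffAt ℝ 5 B z₀ := by
  have h1 : ContDiffAt ℝ 5 (fun z : ℝ × W => ((z.1, ψ z.2) : ℝ × ℝ^n)) z₀ :=
    contDiffAt_fst.prodMk ((h.smooth.of_le (by norm_cast)).comp (g := ψ) z₀ contDiffAt_snd)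
  have h2 : ContDiffAt ℝ 5 (fun z : ℝ × W => fderiv ℝ ψ z.2) z₀ :=
    (h.smooth.fderiv_right (m := 5) (by norm_num)).comp (g := fderiv ℝ ψ) z₀ contDiffAt_snd
  have h3 : ContDiffAt ℝ 5 (fun z => bil (G z)) (z₀.1, ψ z₀.2) :=
    (contDiffAt_bil (h.flow.smooth _ h.mem)).of_le (WithTop.coe_le_coe.2 le_top)
  have h4 : ContDiffAt ℝ 5 (fun z : ℝ × W => bil (G (z.1, ψ z.2))) z₀ :=
    ContDiffAt.comp (g := fun z => bil (G z)) z₀ h3 h1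
  have h5 : ContDiffAt ℝ 5 (fun z : ℝ × W => (bil (G (z.1, ψ z.2))).bilinearComp
      (fderiv ℝ ψ z.2) (fderiv ℝ ψ z.2)) z₀ := contDiffAt_bilinearComp h4 h2
  refine h5.congr_of_eventuallyEq ?_
  filter_upwards [h.metric_eq] with z hz
  ext v w
  rw [hz]; rfl

end IsLocalModel

theorem IsFlowOn.bil_ricciSharpVec (hG : IsFlowOn O G) {τ : ℝ} {u : ℝ^n} (hz : (τ, u) ∈ O)
    (v z : ℝ^n) : bil (G (τ, u)) (ricciSharpVec (fun u => G (τ, u)) u v) z =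
      ricB (fun u => G (τ, u)) u v z := by
  have h1 := hG.det_ne_zero hz
  have h2 := hG.symm _ hz
  have h3 : ∀ i j, ricciCoeff (fun u => G (τ, u)) u i j = ricciCoeff (fun u => G (τ, u)) u j i :=
    fun i j => hG.ric_symm hz i j
  exact RicciFlowLength.bil_ricciSharpVec (G := fun u => G (τ, u)) h1 h2 h3 v z

namespace IsLocalModel

/-! ### Smoothness of the ambient connection -/

theorem contDiffAt_retr (h : IsLocalModel B R ρ O G ψ F z₀) : ContDiffAt ℝ 6 ρ z₀.2 :=
  (h.smooth_inv.comp (g := F) z₀.2 h.smooth).congr_of_eventuallyEq h.retr_eq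

variable (h : IsLocalModel B R ρ O G ψ F z₀)

include h

theorem contDiffAt_extSharp : ContDiffAt ℝ 5 (extSharp B ρ) z₀ := by
  have : CompleteSpace W := FiniteDimensional.complete ℝ W
  have h1 : ContDiffAt ℝ 5 (fun z : ℝ × W => fderiv ℝ ρ z.2) z₀ :=
    (h.contDiffAt_retr.fderiv_right (m := 5) (by norm_num)).comp (g := fderiv ℝ ρ) z₀ contDiffAt_snd
  have h2 : ContDiffAt ℝ 5 (extForm B ρ) z₀ :=
    h.contDiffAt_metric.add (contDiffAt_bilinearComp contDiffAt_const (contDiffAt_const.sub h1))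
  obtain ⟨e, he⟩ := h.isInvertible_extForm
  have h3 := contDiffAt_map_inverse (n := 5) e
  rw [he] at h3
  exact h3.comp z₀ h2

theorem contDiffAt_fderiv_metric :
    ContDiffAt ℝ 4 (fderiv ℝ B) z₀ := h.contDiffAt_metric.fderiv_right (m := 4) (by norm_num)

theorem contDiffAt_extChr {X : Type*} [NormedAddCommGroup X]
    [NormedSpace ℝ X] {x : X} {z : X → ℝ × W} {v w : X → W} (hz : ContDiffAt ℝ 4 z x)
    (hzx : z x = z₀) (hv : ContDiffAt ℝ 4 v x) (hw : ContDiffAt ℝ 4 w x) :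
    ContDiffAt ℝ 4 (fun x => extChr B (z x) (v x) (w x)) x := by
  have h1 : ContDiffAt ℝ 4 (fun x => fderiv ℝ B (z x)) x :=
    ContDiffAt.comp (g := fderiv ℝ B) x (by rw [hzx]; exact h.contDiffAt_fderiv_metric) hz
  have h2 : ∀ {v w : X → W}, ContDiffAt ℝ 4 v x → ContDiffAt ℝ 4 w x →
      ContDiffAt ℝ 4 (fun x => fderiv ℝ B (z x) (0, v x) (w x)) x := fun hv hw =>
    (h1.clm_apply (contDiffAt_const.prodMk hv)).clm_apply hw
  have h3 : ContDiffAt ℝ 4 (fun x => (((fderiv ℝ B (z x)).comp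
      (ContinuousLinearMap.inr ℝ ℝ W)).flip (v x)).flip (w x)) x := by
    have h4 := (h1.clm_comp (contDiffAt_const (c := ContinuousLinearMap.inr ℝ ℝ W)))
    have h5 := ((ContinuousLinearMap.flipₗᵢ ℝ W W (W →L[ℝ] ℝ)).contDiff.contDiffAt.comp x
      h4).clm_apply hv
    exact ((ContinuousLinearMap.flipₗᵢ ℝ W W ℝ).contDiff.contDiffAt.comp x h5).clm_apply hw
  exact (((h2 hv hw).add (h2 hw hv)).sub h3).const_smul (1 / 2 : ℝ)

theorem contDiffAt_extAcc (σ : W) : ContDiffAt ℝ 4 (extAcc B ρ) (z₀.1, z₀.2, σ) := by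
  have hz : ContDiffAt ℝ 4 (fun q : ℝ × W × W => (q.1, q.2.1)) (z₀.1, z₀.2, σ) := by fun_prop
  have h1 : ContDiffAt ℝ 4 (fun q : ℝ × W × W => extSharp B ρ (q.1, q.2.1)) (z₀.1, z₀.2, σ) :=
    ContDiffAt.comp (g := extSharp B ρ) _ (h.contDiffAt_extSharp.of_le (by norm_cast)) hz
  exact (h1.clm_apply (h.contDiffAt_extChr hz rfl (by fun_prop) (by fun_prop))).neg

theorem contDiffAt_extTransport (σ : W) (l : ℝ × W) :
    ContDiffAt ℝ 4 (extTransport B ρ) (z₀, σ, l) := by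
  have hz : ContDiffAt ℝ 4 (fun q : (ℝ × W) × W × (ℝ × W) => q.1) (z₀, σ, l) := by fun_prop
  have h1 : ContDiffAt ℝ 4 (fun q : (ℝ × W) × W × (ℝ × W) => extSharp B ρ q.1) (z₀, σ, l) :=
    ContDiffAt.comp (g := extSharp B ρ) _ (h.contDiffAt_extSharp.of_le (by norm_cast)) hz
  have h2 : ContDiffAt ℝ 4 (fun q : (ℝ × W) × W × (ℝ × W) => fderiv ℝ B q.1) (z₀, σ, l) :=
    ContDiffAt.comp (g := fderiv ℝ B) _ h.contDiffAt_fderiv_metric hz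
  have h3 : ContDiffAt ℝ 4 (fun q : (ℝ × W) × W × (ℝ × W) =>
      (1 / 2 : ℝ) • fderiv ℝ B q.1 (q.2.2.1, 0) q.2.1) (z₀, σ, l) :=
    ((h2.clm_apply (by fun_prop)).clm_apply (by fun_prop)).const_smul (1 / 2 : ℝ)
  exact (h1.clm_apply (h3.add (h.contDiffAt_extChr hz rfl (by fun_prop) (by fun_prop)))).neg

/-! ### The ambient connection in coordinates -/

theorem extChr_eq (v w z : W) :
    extChr B z₀ v w z = bil (G (z₀.1, ψ z₀.2)) (fderiv ℝ (fderiv ℝ ψ) z₀.2 v w +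
        chrL (fun u => G (z₀.1, u)) (ψ z₀.2) (fderiv ℝ ψ z₀.2 v) (fderiv ℝ ψ z₀.2 w))
      (fderiv ℝ ψ z₀.2 z) := by
  obtain ⟨τ, y⟩ := z₀
  have hB : DifferentiableAt ℝ B (τ, y) := h.contDiffAt_metric.differentiableAt (by simp)
  have hM := h.flow.slice τ
  have hm : ψ y ∈ {u | (τ, u) ∈ O} := h.mem
  have hB1 : DifferentiableAt ℝ (fun y => B (τ, y)) y :=
    DifferentiableAt.comp (g := B) y hB (by fun_prop)
  rw [extChr_eq_chr1 hB, chr1_pullback (B' := fun u => bil (G (τ, u))) (ψ := ψ)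
    (h.smooth.of_le (by norm_cast)) hB1
    (hM.differentiableAt_bil hm) (bil_symm (hM.symm _ hm)), map_add, add_apply, hM.bil_chrL hm,
    add_comm]
  exact (Continuous.prodMk_right τ).continuousAt.eventually h.metric_eq

theorem fderiv_metric_time (c : ℝ) (v w : W) :
    fderiv ℝ B z₀ (c, 0) v w = c * (-2 * ricB (fun u => G (z₀.1, u)) (ψ z₀.2)
      (fderiv ℝ ψ z₀.2 v) (fderiv ℝ ψ z₀.2 w)) := by
  obtain ⟨τ, y⟩ := z₀
  have hB : DifferentiableAt ℝ B (τ, y) := h.contDiffAt_metric.differentiableAt (by simp)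
  have hG : ∀ i j, DifferentiableAt ℝ (fun z => G z i j) (τ, ψ y) := fun i j =>
    (h.flow.smooth _ h.mem i j).differentiableAt (by simp)
  have hbG : DifferentiableAt ℝ (fun z => bil (G z)) (τ, ψ y) :=
    (contDiffAt_bil (h.flow.smooth _ h.mem)).differentiableAt (by simp)
  have e1 : HasDerivAt (fun t => B (t, y) v w) (fderiv ℝ B (τ, y) (1, 0) v w) τ := by
    have := hasDerivAt_slice (Φ := B) (a := τ) (p := y) hB
    exact ((this.clm_apply (hasDerivAt_const τ v)).clm_apply (hasDerivAt_const τ w)).congr_deriv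
      (by simp [dd])
  have e2 : HasDerivAt (fun t => bil (G (t, ψ y)) (fderiv ℝ ψ y v) (fderiv ℝ ψ y w))
      (fderiv ℝ (fun z => bil (G z)) (τ, ψ y) tm (fderiv ℝ ψ y v) (fderiv ℝ ψ y w)) τ := by
    have := hasDerivAt_slice (Φ := fun z => bil (G z)) (a := τ) (p := ψ y) hbG
    exact ((this.clm_apply (hasDerivAt_const τ _)).clm_apply (hasDerivAt_const τ _)).congr_deriv
      (by simp [tm, dd])
  have e3 : (fun t => B (t, y) v w) =ᶠ[𝓝 τ]
      fun t => bil (G (t, ψ y)) (fderiv ℝ ψ y v) (fderiv ℝ ψ y w) := by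
    filter_upwards [(Continuous.prodMk_left y).continuousAt.eventually h.metric_eq] with t ht
    exact ht v w
  have e4 := e1.unique (e2.congr_of_eventuallyEq e3)
  have e5 : ((c, 0) : ℝ × W) = c • ((1, 0) : ℝ × W) := by simp
  rw [e5, map_smul, smul_apply, smul_apply, e4, dd_bil hG, smul_eq_mul, ricB, bil_apply]
  congr 1
  rw [mul_sum]
  refine sum_congr rfl fun i _ => ?_
  rw [mul_sum]
  refine sum_congr rfl fun j _ => ?_
  rw [h.flow.flow _ h.mem, Matrix.of_apply]; ring

/-- The acceleration `extAcc` is the geodesic one in the coordinates `ψ`. -/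
theorem extAcc_eq (σ : W) :
    fderiv ℝ (fderiv ℝ ψ) z₀.2 σ σ + fderiv ℝ ψ z₀.2 (extAcc B ρ (z₀.1, z₀.2, σ)) =
      -chrL (fun u => G (z₀.1, u)) (ψ z₀.2) (fderiv ℝ ψ z₀.2 σ) (fderiv ℝ ψ z₀.2 σ) := by
  have h1 := h.extSharp_eq fun v => h.extChr_eq σ σ v
  have h2 : extAcc B ρ (z₀.1, z₀.2, σ) = -extSharp B ρ z₀ (extChr B z₀ σ σ) := rfl
  rw [h2, h1, map_neg, h.fderiv_inv]
  abel

theorem extTransport_eq_fderiv_inv (σ : W) (l : ℝ × W) :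
    extTransport B ρ (z₀, σ, l) = fderiv ℝ F (ψ z₀.2)
      (l.1 • ricciSharpVec (fun u => G (z₀.1, u)) (ψ z₀.2) (fderiv ℝ ψ z₀.2 σ) -
        (fderiv ℝ (fderiv ℝ ψ) z₀.2 l.2 σ +
          chrL (fun u => G (z₀.1, u)) (ψ z₀.2) (fderiv ℝ ψ z₀.2 l.2) (fderiv ℝ ψ z₀.2 σ))) := by
  have h1 : ∀ v, (-((1 / 2 : ℝ) • fderiv ℝ B z₀ (l.1, 0) σ + extChr B z₀ l.2 σ)) v =
      bil (G (z₀.1, ψ z₀.2)) (l.1 • ricciSharpVec (fun u => G (z₀.1, u)) (ψ z₀.2)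
        (fderiv ℝ ψ z₀.2 σ) - (fderiv ℝ (fderiv ℝ ψ) z₀.2 l.2 σ +
        chrL (fun u => G (z₀.1, u)) (ψ z₀.2) (fderiv ℝ ψ z₀.2 l.2) (fderiv ℝ ψ z₀.2 σ)))
        (fderiv ℝ ψ z₀.2 v) := by
    intro v
    have hr := h.flow.bil_ricciSharpVec h.mem (fderiv ℝ ψ z₀.2 σ) (fderiv ℝ ψ z₀.2 v)
    rw [neg_apply, add_apply, smul_apply, h.fderiv_metric_time, h.extChr_eq]
    simp only [map_add, add_apply, map_sub, sub_apply, map_smul, smul_apply, hr, smul_eq_mul]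
    ring
  rw [← h.extSharp_eq h1, map_neg]
  rfl

/-- In the coordinates `ψ` the equation `σ' = extTransport` is `∇_T V = Ric(V)`. -/
theorem extTransport_eq (σ : W) (l : ℝ × W) :
    fderiv ℝ (fderiv ℝ ψ) z₀.2 l.2 σ + fderiv ℝ ψ z₀.2 (extTransport B ρ (z₀, σ, l)) =
      l.1 • ricciSharpVec (fun u => G (z₀.1, u)) (ψ z₀.2) (fderiv ℝ ψ z₀.2 σ) -
      chrL (fun u => G (z₀.1, u)) (ψ z₀.2) (fderiv ℝ ψ z₀.2 l.2) (fderiv ℝ ψ z₀.2 σ) := by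
  rw [h.extTransport_eq_fderiv_inv, h.fderiv_inv]
  abel

/-- The local model is also one at the neighbouring points of the submanifold. -/
theorem eventually : ∀ᶠ x in 𝓝 (z₀.1, ψ z₀.2), IsLocalModel B R ρ O G ψ F (x.1, F x.2) := by
  have hF : Tendsto F (𝓝 (ψ z₀.2)) (𝓝 z₀.2) := by
    have := h.smooth_inv.continuousAt.tendsto; rwa [h.fix] at this
  have h2 : Tendsto (fun x : ℝ × ℝ^n => x.2) (𝓝 (z₀.1, ψ z₀.2)) (𝓝 (ψ z₀.2)) :=
    continuous_snd.tendsto _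
  have h3 : Tendsto (fun x : ℝ × ℝ^n => F x.2) (𝓝 (z₀.1, ψ z₀.2)) (𝓝 z₀.2) := hF.comp h2
  have h4 : Tendsto (fun x : ℝ × ℝ^n => (x.1, F x.2)) (𝓝 (z₀.1, ψ z₀.2)) (𝓝 z₀) :=
    (continuous_fst.tendsto (z₀.1, ψ z₀.2)).prodMk_nhds h3
  filter_upwards [h.flow.isOpen.mem_nhds h.mem, h3.eventually (h.smooth.eventually (by simp)),
    h2.eventually (h.smooth_inv.eventually (by simp)), h4.eventually h.metric_eq.eventually_nhds,
    h4.eventually h.scal_eq.eventually_nhds, h3.eventually h.retr_eq.eventually_nhds,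
    h2.eventually h.inv.eventually_nhds] with x k1 k2 k3 k4 k5 k6 k7
  have k8 : ψ (F x.2) = x.2 := k7.self_of_nhds
  exact ⟨h.flow, by simpa [k8] using k1, k2, by simpa [k8] using k3, k4, k5, k6,
    by simpa [k8] using k7, by simp [k8]⟩

end IsLocalModel

/-! ### Adapted local models -/

theorem IsFlowOn.scal_pullMet (hG : IsFlowOn O G) {β : ℝ^n → ℝ^n} (hβ : ContDiff ℝ ∞ β)
    {z : ℝ × ℝ^n} (hz : z ∈ pullDom O β) : scal (pullMet G β) z = scal G (z.1, β z.2) := by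
  obtain ⟨τ, u⟩ := z
  have hM := hG.isMetricOn_pullMet hβ τ
  have hM' := hG.slice τ
  have hu : u ∈ {u | (τ, u) ∈ pullDom O β} := hz
  have hu' : β u ∈ {u | (τ, u) ∈ O} := hz.1
  obtain ⟨V, hV⟩ := exists_orthonormal_frame (hM.symm _ hu) (hM.pos _ hu)
  have hV' : ∀ i j, bil (G (τ, β u)) (fderiv ℝ β u (V i)) (fderiv ℝ β u (V j)) =
      if i = j then 1 else 0 := fun i j => by rw [← hV, bil_pullMet]
  have hb : ∀ᶠ y in 𝓝 u, Function.Bijective (fderiv ℝ β y) := by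
    filter_upwards [hM.isOpen.mem_nhds hu] with y hy using bijective_of_isUnit hy.2
  rw [scal_eq_sum_frame (G := pullMet G β) V hV, scal_eq_sum_frame (G := G) (z := (τ, β u)) _ hV']
  exact sum_congr rfl fun m _ => ricB_pullback hM hM' hu hu'
    (Eventually.of_forall fun y => hβ.contDiffAt) hb
    (Eventually.of_forall fun y v w => bil_pullMet G β (τ, y) v w) _ _

/-- Around a point, a local model whose coordinates are adapted to it, and map a given orthonormal
frame to the standard basis. -/
theorem IsLocalModel.exists_adapted (h : IsLocalModel B R ρ O G ψ F z₀) (σ : Fin n → W)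
    (hσ : ∀ i j, B z₀ (σ i) (σ j) = if i = j then 1 else 0) :
    ∃ (O' : Set (ℝ × ℝ^n)) (G' : ℝ × ℝ^n → Mat n) (ψ' : W → ℝ^n) (F' : ℝ^n → W),
      IsLocalModel B R ρ O' G' ψ' F' z₀ ∧ ψ' z₀.2 = 0 ∧ IsAdapted G' (z₀.1, 0) ∧
      ∀ i, fderiv ℝ ψ' z₀.2 (σ i) = 𝐞 i := by
  obtain ⟨β, hβ, hβ0, hβV, hmem, had⟩ := h.flow.exists_adapted h.mem
    (fun i => fderiv ℝ ψ z₀.2 (σ i)) fun i j => by rw [← hσ, h.metric_eq.self_of_nhds]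
  obtain ⟨e, he⟩ := hmem.2
  set e' : ℝ^n ≃L[ℝ] ℝ^n := ContinuousLinearEquiv.ofUnit e with he'
  have hd : HasFDerivAt β (e' : ℝ^n →L[ℝ] ℝ^n) 0 := by
    have h1 := (hβ.differentiable (by simp) 0).hasFDerivAt
    have h2 : (e' : ℝ^n →L[ℝ] ℝ^n) = fderiv ℝ β 0 := by
      rw [← show (e : ℝ^n →L[ℝ] ℝ^n) = fderiv ℝ β 0 from he]; ext; rfl
    rwa [h2]
  have hs : HasStrictFDerivAt β (e' : ℝ^n →L[ℝ] ℝ^n) 0 :=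
    hβ.contDiffAt.hasStrictFDerivAt' hd (by simp)
  set ι := hs.localInverse β e' 0 with hι
  have hιs : ContDiffAt ℝ ∞ ι (ψ z₀.2) := by
    have := hβ.contDiffAt.to_localInverse (n := ∞) hd (by simp)
    rw [hβ0] at this; exact this
  have hr : ∀ᶠ y in 𝓝 (ψ z₀.2), β (ι y) = y := by
    have := hs.eventually_right_inverse; rwa [hβ0] at this
  have hl : ∀ᶠ x in 𝓝 (0 : ℝ^n), ι (β x) = x := hs.eventually_left_inverse
  have hι0 : ι (ψ z₀.2) = 0 := by rw [← hβ0]; exact hl.self_of_nhds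
  clear_value ι
  have hψc : Tendsto ψ (𝓝 z₀.2) (𝓝 (ψ z₀.2)) := h.smooth.continuousAt.tendsto
  have hψ's : ContDiffAt ℝ 6 (fun y => ι (ψ y)) z₀.2 :=
    (hιs.of_le (WithTop.coe_le_coe.2 le_top)).comp (g := ι) z₀.2 h.smooth
  have hβψ : ∀ᶠ y in 𝓝 z₀.2, β (ι (ψ y)) = ψ y := hψc.eventually hr
  have hD : ∀ᶠ y in 𝓝 z₀.2, ∀ v, fderiv ℝ β (ι (ψ y)) (fderiv ℝ (fun y => ι (ψ y)) y v) =
      fderiv ℝ ψ y v := by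
    filter_upwards [hβψ.eventually_nhds, hψ's.eventually (by simp)] with y h1 h2 v
    have h3 := fderiv_comp y (hβ.differentiable (by simp) (ι (ψ y))) (h2.differentiableAt (by simp))
    have h4 : β ∘ (fun y => ι (ψ y)) =ᶠ[𝓝 y] ψ := h1
    rw [← h4.fderiv_eq, h3]; rfl
  have hsnd : Tendsto (Prod.snd : ℝ × W → W) (𝓝 z₀) (𝓝 z₀.2) := continuous_snd.tendsto _
  have hcont : ContinuousAt (fun z : ℝ × W => ((z.1, ι (ψ z.2)) : ℝ × ℝ^n)) z₀ :=
    continuous_fst.continuousAt.prodMk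
      (ContinuousAt.comp (g := fun y => ι (ψ y)) hψ's.continuousAt continuous_snd.continuousAt)
  have hdom : ∀ᶠ z in 𝓝 z₀, ((z.1, ι (ψ z.2)) : ℝ × ℝ^n) ∈ pullDom O β := by
    refine hcont.eventually ((h.flow.isOpen_pullDom hβ).mem_nhds ?_)
    show ((z₀.1, ι (ψ z₀.2)) : ℝ × ℝ^n) ∈ pullDom O β
    rw [hι0]; exact hmem
  refine ⟨pullDom O β, pullMet G β, fun y => ι (ψ y), fun u => F (β u), ?_, hι0, had, ?_⟩
  · refine ⟨h.flow.pullback hβ, by simpa only [hι0] using hmem, hψ's, ?_, ?_, ?_, ?_, ?_, ?_⟩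
    · simp only [hι0]
      refine ContDiffAt.comp (g := F) 0 (by rw [hβ0]; exact h.smooth_inv)
        (hβ.contDiffAt.of_le (WithTop.coe_le_coe.2 le_top))
    · filter_upwards [h.metric_eq, hsnd.eventually hD, hsnd.eventually hβψ] with z h1 h2 h3 v w
      rw [h1, bil_pullMet]
      simp only [h2, h3]
    · filter_upwards [h.scal_eq, hdom, hsnd.eventually hβψ] with z h1 h2 h3
      rw [h1, h.flow.scal_pullMet hβ h2]
      simp only [h3]
    · filter_upwards [h.retr_eq, hβψ] with y h1 h2
      rw [h1, h2]
    · simp only [hι0]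
      have hβc : Tendsto β (𝓝 0) (𝓝 (ψ z₀.2)) := by
        have := hβ.continuous.tendsto 0; rwa [hβ0] at this
      filter_upwards [hl, hβc.eventually h.inv] with u h1 h2
      rw [h2, h1]
    · simp only [hι0, hβ0, h.fix]
  · intro i
    have h1 := hD.self_of_nhds (σ i)
    rw [hι0, ← hβV] at h1
    exact (bijective_of_isUnit hmem.2).injective h1

/-! ### The second variation of the Lagrangian -/

/-- The variation of the point `z.2` at time `z.1` in the direction `σ`. -/
def varPos (B : ℝ × W → W →L[ℝ] W →L[ℝ] ℝ) (ρ : W → W) (a : ℝ) (z : ℝ × W) (σ : W) : W :=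
  z.2 + a • σ + (a ^ 2 / 2) • extAcc B ρ (z.1, z.2, σ)

/-- The velocity of the variation, along a curve with space-time velocity `l` and a vector field
`σ` with `σ' = extTransport`. -/
def varVel (B : ℝ × W → W →L[ℝ] W →L[ℝ] ℝ) (ρ : W → W) (a : ℝ) (z : ℝ × W) (σ : W)
    (l : ℝ × W) : W :=
  l.2 + a • extTransport B ρ (z, σ, l) + (a ^ 2 / 2) •
    fderiv ℝ (extAcc B ρ) (z.1, z.2, σ) (l.1, l.2, extTransport B ρ (z, σ, l))

/-- The Lagrangian of the variation, moved back in time by `κ a² / 2`. -/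
def varLag (B : ℝ × W → W →L[ℝ] W →L[ℝ] ℝ) (R : ℝ × W → ℝ) (ρ : W → W) (κ a : ℝ) (z : ℝ × W)
    (σ : W) (l : ℝ × W) : ℝ :=
  l.1 ^ 2 * R (z.1 - κ * (a ^ 2 / 2), varPos B ρ a z σ) +
    B (z.1 - κ * (a ^ 2 / 2), varPos B ρ a z σ) (varVel B ρ a z σ l) (varVel B ρ a z σ l)

theorem fderiv_fderiv_eq_dd {X Y : Type*} [NormedAddCommGroup X] [NormedSpace ℝ X]
    [NormedAddCommGroup Y] [NormedSpace ℝ Y] {f : X → Y} {z : X} (hf : ContDiffAt ℝ 2 f z)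
    (a b : X) : fderiv ℝ (fderiv ℝ f) z a b = dd a (dd b f) z := by
  have h1 : DifferentiableAt ℝ (fderiv ℝ f) z :=
    (hf.fderiv_right (m := 1) (by norm_num)).differentiableAt (by norm_num)
  have : HasFDerivAt (fun y => fderiv ℝ f y b)
      ((ContinuousLinearMap.apply ℝ Y b).comp (fderiv ℝ (fderiv ℝ f) z)) z :=
    (ContinuousLinearMap.apply ℝ Y b).hasFDerivAt.comp z h1.hasFDerivAt
  unfold dd
  rw [this.fderiv]; rfl

namespace IsLocalModel

/-- The mixed third derivative of the variation in adapted coordinates: the geodesic equation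
`∂_a² X = -Γ(∂_a X, ∂_a X)` at `a = 0`, differentiated along the curve. -/
theorem mixed_third_derivative (h : IsLocalModel B R ρ O G ψ F z₀) (h0 : ψ z₀.2 = 0)
    (had : IsAdapted G (z₀.1, 0)) {i : Fin n} {σ : W}
    (hσ : fderiv ℝ ψ z₀.2 σ = 𝐞 i) (lam : ℝ) (T : ℝ^n) (k : Fin n) :
    (fderiv ℝ (fderiv ℝ (fderiv ℝ ψ)) z₀.2 σ σ (fderiv ℝ F 0 T) +
      fderiv ℝ (fderiv ℝ ψ) z₀.2 (extAcc B ρ (z₀.1, z₀.2, σ)) (fderiv ℝ F 0 T) +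
      (2 : ℝ) • fderiv ℝ (fderiv ℝ ψ) z₀.2 σ (extTransport B ρ (z₀, σ, (lam, fderiv ℝ F 0 T))) +
      fderiv ℝ ψ z₀.2 (fderiv ℝ (extAcc B ρ) (z₀.1, z₀.2, σ)
        (lam, fderiv ℝ F 0 T, extTransport B ρ (z₀, σ, (lam, fderiv ℝ F 0 T))))) k =
      -(lam * dd tm (chr G k i i) (z₀.1, 0) + ∑ m, T m * dd (sp m) (chr G k i i) (z₀.1, 0)) := by
  obtain ⟨τ, y⟩ := z₀
  simp only at h0 had hσ ⊢
  set w := fderiv ℝ F 0 T with hw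
  set b := extTransport B ρ ((τ, y), σ, (lam, w)) with hb
  have hF0 : F 0 = y := by have := h.fix; simp only [h0] at this; exact this
  have hmem : (τ, (0 : ℝ^n)) ∈ O := by have := h.mem; simp only [h0] at this; exact this
  have hFd : HasFDerivAt F (fderiv ℝ F 0) 0 := by
    have := h.smooth_inv.differentiableAt (by simp)
    simp only [h0] at this; exact this.hasFDerivAt
  -- a curve in the submanifold with velocity `w`, and the field `σ` along it
  have hτ : HasDerivAt (fun ζ : ℝ => τ + ζ * lam) lam 0 := by
    simpa using ((hasDerivAt_id (0 : ℝ)).mul_const lam).const_add τ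
  have hT : HasDerivAt (fun ζ : ℝ => ζ • T) T 0 := by
    simpa using (hasDerivAt_id (0 : ℝ)).smul_const T
  have hx := hτ.prodMk hT
  have hxc : Tendsto (fun ζ : ℝ => ((τ + ζ * lam, ζ • T) : ℝ × ℝ^n)) (𝓝 0) (𝓝 (τ, 0)) := by
    have := hx.continuousAt.tendsto; simpa using this
  have hy : HasDerivAt (fun ζ : ℝ => F (ζ • T)) w 0 := by
    have h3 : HasFDerivAt F (fderiv ℝ F 0) ((0 : ℝ) • T) := by simpa using hFd
    exact h3.comp_hasDerivAt 0 hT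
  have hsg : HasDerivAt (fun ζ : ℝ => σ + ζ • b) b 0 := by
    simpa using ((hasDerivAt_id (0 : ℝ)).smul_const b).const_add σ
  have hy0 : F ((0 : ℝ) • T) = y := by simpa using hF0
  have hs2 : ContDiffAt ℝ 4 (fderiv ℝ (fderiv ℝ ψ)) y :=
    (h.smooth.fderiv_right (m := 5) (by norm_num)).fderiv_right (m := 4) (by norm_num)
  have hD1 : HasDerivAt (fun ζ : ℝ => fderiv ℝ ψ (F (ζ • T))) (fderiv ℝ (fderiv ℝ ψ) y w) 0 := by
    have h1 : HasFDerivAt (fderiv ℝ ψ) (fderiv ℝ (fderiv ℝ ψ) y) (F ((0 : ℝ) • T)) := by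
      rw [hy0]
      exact ((h.smooth.fderiv_right (m := 5) (by norm_num)).differentiableAt (by simp)).hasFDerivAt
    exact h1.comp_hasDerivAt 0 hy
  have hD2 : HasDerivAt (fun ζ : ℝ => fderiv ℝ (fderiv ℝ ψ) (F (ζ • T)))
      (fderiv ℝ (fderiv ℝ (fderiv ℝ ψ)) y w) 0 := by
    have h1 : HasFDerivAt (fderiv ℝ (fderiv ℝ ψ)) (fderiv ℝ (fderiv ℝ (fderiv ℝ ψ)) y)
        (F ((0 : ℝ) • T)) := by
      rw [hy0]; exact (hs2.differentiableAt (by simp)).hasFDerivAt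
    exact h1.comp_hasDerivAt 0 hy
  have hA : HasDerivAt (fun ζ : ℝ => extAcc B ρ (τ + ζ * lam, F (ζ • T), σ + ζ • b))
      (fderiv ℝ (extAcc B ρ) (τ, y, σ) (lam, w, b)) 0 := by
    have h1 : HasFDerivAt (extAcc B ρ) (fderiv ℝ (extAcc B ρ) (τ, y, σ))
        (τ + 0 * lam, F ((0 : ℝ) • T), σ + (0 : ℝ) • b) := by
      simp only [zero_mul, add_zero, hy0, zero_smul]
      simp only [zero_smul] at hy0
      rw [hy0]
      exact ((h.contDiffAt_extAcc σ).differentiableAt (by simp)).hasFDerivAt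
    exact h1.comp_hasDerivAt 0 (hτ.prodMk (hy.prodMk hsg))
  have hL := ((hD2.clm_apply hsg).clm_apply hsg).add (hD1.clm_apply hA)
  have hev : ∀ᶠ ζ : ℝ in 𝓝 0, IsLocalModel B R ρ O G ψ F (τ + ζ * lam, F (ζ • T)) ∧
      ψ (F (ζ • T)) = ζ • T := by
    have h1 := h.eventually
    simp only [h0] at h1
    have h2 := h.inv
    simp only [h0] at h2
    have h3 : Tendsto (fun ζ : ℝ => ζ • T) (𝓝 0) (𝓝 0) := by simpa using hT.continuousAt.tendsto
    exact (hxc.eventually h1).and (h3.eventually h2)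
  -- the Christoffel symbols vanish at the centre, so that only their derivative contributes
  have hV : HasDerivAt (fun ζ : ℝ => fderiv ℝ ψ (F (ζ • T)) (σ + ζ • b)) _ 0 := hD1.clm_apply hsg
  have hcomp : ∀ j, ∃ d, HasDerivAt (fun ζ : ℝ => (fderiv ℝ ψ (F (ζ • T)) (σ + ζ • b)) j) d 0 :=
    fun j => ⟨_, (EuclideanSpace.proj j : ℝ^n →L[ℝ] ℝ).hasFDerivAt.comp_hasDerivAt 0 hV⟩
  choose d hd using hcomp
  have hc : ∀ p q, HasDerivAt (fun ζ : ℝ => chr G k p q (τ + ζ * lam, ζ • T))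
      (dd (lam, T) (chr G k p q) (τ, 0)) 0 := by
    intro p q
    have h1 : HasFDerivAt (chr G k p q) (fderiv ℝ (chr G k p q) (τ, 0))
        (τ + 0 * lam, (0 : ℝ) • T) := by
      simp only [zero_mul, add_zero, zero_smul]
      exact ((h.flow.contDiffAt_chr hmem k p q).differentiableAt (by simp)).hasFDerivAt
    exact h1.comp_hasDerivAt 0 hx
  have hRd : HasDerivAt (fun ζ : ℝ => -(∑ p, ∑ q, chr G k p q (τ + ζ * lam, ζ • T) *
      (fderiv ℝ ψ (F (ζ • T)) (σ + ζ • b)) p * (fderiv ℝ ψ (F (ζ • T)) (σ + ζ • b)) q))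
      (-(dd (lam, T) (chr G k i i) (τ, 0))) 0 := by
    have h1 := HasDerivAt.fun_sum (u := Finset.univ) fun p _ =>
      HasDerivAt.fun_sum (u := Finset.univ) fun q _ => ((hc p q).fun_mul (hd p)).fun_mul (hd q)
    refine h1.fun_neg.congr_deriv ?_
    congr 1
    have h2 : ∀ p q, chr G k p q (τ, 0) = 0 := fun p q => had.chr_eq_zero h.flow hmem k p q
    simp only [zero_mul, add_zero, zero_smul, hF0, hσ, h2]
    rw [Finset.sum_eq_single i, Finset.sum_eq_single i]
    · simp
    · intro q _ hq; simp [hq]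
    · simp
    · intro p _ hp; simp [hp]
    · simp
  have hLk := (EuclideanSpace.proj k : ℝ^n →L[ℝ] ℝ).hasFDerivAt.comp_hasDerivAt 0 hL
  have heq := hLk.unique (hRd.congr_of_eventuallyEq ?_)
  · have sy2 : ∀ a c, fderiv ℝ (fderiv ℝ ψ) y a c = fderiv ℝ (fderiv ℝ ψ) y c a := fun a c =>
      (isSymmSndFDerivAt_of_two_le (by norm_cast) h.smooth).eq a c
    have sy3 : ∀ a c, fderiv ℝ (fderiv ℝ (fderiv ℝ ψ)) y a c =
        fderiv ℝ (fderiv ℝ (fderiv ℝ ψ)) y c a := fun a c =>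
      (isSymmSndFDerivAt_of_two_le (k := 5) (by norm_cast)
        (h.smooth.fderiv_right (m := 5) (by norm_num))).eq a c
    have hlin : dd (lam, T) (chr G k i i) (τ, 0) = lam * dd tm (chr G k i i) (τ, 0) +
        ∑ m, T m * dd (sp m) (chr G k i i) (τ, 0) := by
      have e1 : ((lam, T) : ℝ × ℝ^n) = lam • tm + ∑ m, T m • sp m := by
        ext j
        · simp [tm, sp, Prod.fst_sum]
        · conv_lhs => rw [show (lam, T).2 = ∑ m, T m • 𝐞 m from sum_single T]
          simp [tm, sp, Prod.snd_sum]
      unfold dd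
      rw [e1, map_add, map_smul, map_sum]
      simp
    rw [← hlin, ← heq, fderiv_three_comm (h.smooth.of_le (by norm_cast)) σ σ w, sy3 σ w, sy2 _ w]
    simp only [zero_smul, add_zero, zero_mul, hF0, add_apply]
    rw [sy2 σ b, two_smul, PiLp.proj_apply]
    exact congrArg (fun v : ℝ^n => v k) (by abel)
  · filter_upwards [hev] with ζ hζ
    have e1 := hζ.1.extAcc_eq (σ + ζ • b)
    simp only [hζ.2] at e1
    have e2 := congrArg (fun v : ℝ^n => v k) e1
    refine Eq.trans ?_ (e2.trans ?_)
    · rfl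
    rw [chrL_apply]
    rfl

end IsLocalModel

theorem HasJet.mul {f g : ℝ → ℝ} {v₀ v₁ v₂ w₀ w₁ w₂ : ℝ}
    (hf : HasJet f v₀ v₁ v₂) (hg : HasJet g w₀ w₁ w₂) :
    HasJet (fun a => f a * g a) (v₀ * w₀) (v₁ * w₀ + v₀ * w₁)
      (v₂ * w₀ + 2 * (v₁ * w₁) + v₀ * w₂) := by
  obtain ⟨f₁, h0, h1, h2, h3⟩ := hf
  obtain ⟨g₁, k0, k1, k2, k3⟩ := hg
  refine ⟨fun a => f₁ a * g a + f a * g₁ a, by simp [h0, k0], ?_, by simp [h0, h2, k0, k2], ?_⟩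
  · filter_upwards [h1, k1] with a ha hb using ha.fun_mul hb
  · have := (h3.fun_mul k1.self_of_nhds).fun_add (h1.self_of_nhds.fun_mul k3)
    simp only [h0, h2, k0, k2] at this
    exact this.congr_deriv (by ring)

theorem HasJet.clm {V V' : Type*} [NormedAddCommGroup V] [NormedSpace ℝ V]
    [NormedAddCommGroup V'] [NormedSpace ℝ V'] {f : ℝ → V} {v₀ v₁ v₂ : V}
    (hf : HasJet f v₀ v₁ v₂) (A : V →L[ℝ] V') :
    HasJet (fun a => A (f a)) (A v₀) (A v₁) (A v₂) := by
  simpa using (hasJet_const A).clm_apply hf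

theorem HasJet.cast {V : Type*} [NormedAddCommGroup V] [NormedSpace ℝ V] {f : ℝ → V}
    {v₀ v₁ v₂ w₀ w₁ w₂ : V} (hf : HasJet f v₀ v₁ v₂) (h0 : v₀ = w₀) (h1 : v₁ = w₁) (h2 : v₂ = w₂) :
    HasJet f w₀ w₁ w₂ := by subst h0 h1 h2; exact hf

namespace IsLocalModel

theorem fderiv_scal_time (h : IsLocalModel B R ρ O G ψ F z₀) :
    fderiv ℝ R z₀ (1, 0) = dd tm (scal G) (z₀.1, ψ z₀.2) := by
  have h1 : HasFDerivAt (fun z : ℝ × W => ((z.1, ψ z.2) : ℝ × ℝ^n))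
      ((ContinuousLinearMap.fst ℝ ℝ W).prod
        ((fderiv ℝ ψ z₀.2).comp (ContinuousLinearMap.snd ℝ ℝ W))) z₀ :=
    hasFDerivAt_fst.prodMk (((h.smooth.differentiableAt (by simp)).hasFDerivAt).comp (g := ψ) z₀
      hasFDerivAt_snd)
  have h2 : HasFDerivAt (scal G) (fderiv ℝ (scal G) (z₀.1, ψ z₀.2)) (z₀.1, ψ z₀.2) :=
    ((h.flow.contDiffAt_scal h.mem).differentiableAt (by simp)).hasFDerivAt
  have h3 := (HasFDerivAt.comp (g := scal G) z₀ h2 h1).congr_of_eventuallyEq h.scal_eq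
  rw [h3.fderiv]
  simp [dd, tm]

/-- The two-jets of the point and of the velocity of the variation, in adapted coordinates. -/
theorem hasJet_var (h : IsLocalModel B R ρ O G ψ F z₀) (h0 : ψ z₀.2 = 0)
    (had : IsAdapted G (z₀.1, 0)) {i : Fin n} {σ : W}
    (hσ : fderiv ℝ ψ z₀.2 σ = 𝐞 i) (κ lam : ℝ) (T : ℝ^n) :
    HasJet (fun a => (((z₀.1 - κ * (a ^ 2 / 2), ψ (varPos B ρ a z₀ σ))) : ℝ × ℝ^n))
      (z₀.1, 0) (sp i) (-κ, 0) ∧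
    ∃ Z₂ : ℝ^n, HasJet (fun a => fderiv ℝ ψ (varPos B ρ a z₀ σ)
        (varVel B ρ a z₀ σ (lam, fderiv ℝ F 0 T))) T
        (WithLp.toLp 2 fun k => lam * ric G k i (z₀.1, 0)) Z₂ ∧
      ∀ k, Z₂ k = -(lam * dd tm (chr G k i i) (z₀.1, 0) +
        ∑ m, T m * dd (sp m) (chr G k i i) (z₀.1, 0)) := by
  obtain ⟨τ, y⟩ := z₀
  simp only at h0 had hσ ⊢
  have hmem : (τ, (0 : ℝ^n)) ∈ O := by have := h.mem; simp only [h0] at this; exact this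
  have hcz : ∀ v w : ℝ^n, chrL (fun u => G (τ, u)) 0 v w = 0 := by
    intro v w
    rw [chrL_apply]
    ext k
    have h2 : ∀ p q, christoffel (fun u => G (τ, u)) k p q 0 = 0 := fun p q =>
      had.chr_eq_zero h.flow hmem k p q
    simp [christoffelVec, h2]
  have hP : HasJet (fun a => varPos B ρ a (τ, y) σ) y σ (extAcc B ρ (τ, y, σ)) :=
    hasJet_quadratic _ _ _
  set w := fderiv ℝ F 0 T with hw
  have hψw : fderiv ℝ ψ y w = T := by
    have := h.fderiv_inv T
    simp only [h0] at this; exact this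
  have hsm : ContDiffAt ℝ 6 ψ y := h.smooth
  refine ⟨?_, _, ((hP.comp (Φ := fderiv ℝ ψ) ?_).clm_apply (hasJet_quadratic w _ _)).cast
    hψw ?_ rfl, ?_⟩
  · have h1 : HasJet (fun a : ℝ => τ - κ * (a ^ 2 / 2)) τ 0 (-κ) := by
      have := hasJet_quadratic τ 0 (-κ)
      refine this.congr (Eventually.of_forall fun a => ?_)
      simp only [smul_eq_mul]; ring
    refine h1.prodMk ((hP.comp (hsm.of_le (by norm_cast))).cast h0 hσ ?_)
    have := h.extAcc_eq σ
    simp only [h0] at this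
    rw [this, hcz, neg_zero]
  · exact (hsm.fderiv_right (m := 5) (by norm_num)).of_le (by norm_cast)
  · have := h.extTransport_eq σ (lam, w)
    simp only [h0, hcz, sub_zero] at this
    rw [(isSymmSndFDerivAt_of_two_le (by norm_cast) hsm).eq σ w, this, hσ]
    ext k
    simp only [PiLp.smul_apply, smul_eq_mul, ricciSharpVec]
    rw [show (G (τ, 0))⁻¹ = 1 from had.inv]
    congr 1
    rw [Finset.sum_eq_single k, Finset.sum_eq_single i]
    · simp [ric]
    · intro j _ hj; simp [hj]
    · simp
    · intro j _ hj; simp [hj.symm]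
    · simp
  · intro k
    have := h.mixed_third_derivative h0 had hσ lam T k
    rw [← this]
    rfl

/-- The second variation of the Lagrangian in one direction, in adapted coordinates. -/
theorem hasJet_varLag (h : IsLocalModel B R ρ O G ψ F z₀) (h0 : ψ z₀.2 = 0)
    (had : IsAdapted G (z₀.1, 0)) {i : Fin n} {σ : W}
    (hσ : fderiv ℝ ψ z₀.2 σ = 𝐞 i) (κ lam : ℝ) (T : ℝ^n) :
    ∃ v₀ v₁, HasJet (fun a => varLag B R ρ κ a z₀ σ (lam, fderiv ℝ F 0 T)) v₀ v₁
      ((lam ^ 2 * dd (sp i) (dd (sp i) (scal G)) (z₀.1, 0) +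
        (∑ a, ∑ b, dd (sp i) (dd (sp i) (fun y => G y a b)) (z₀.1, 0) * T a * T b) +
        2 * lam ^ 2 * (∑ k, ric G k i (z₀.1, 0) ^ 2) -
        2 * ∑ k, T k * (lam * dd tm (chr G k i i) (z₀.1, 0) +
          ∑ m, T m * dd (sp m) (chr G k i i) (z₀.1, 0))) -
      κ * (lam ^ 2 * dd tm (scal G) (z₀.1, 0) +
        ∑ a, ∑ b, dd tm (fun y => G y a b) (z₀.1, 0) * T a * T b)) := by
  have hmem : (z₀.1, (0 : ℝ^n)) ∈ O := by have := h.mem; rwa [h0] at this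
  obtain ⟨hX, Z₂, hZ, hZ₂⟩ := h.hasJet_var h0 had hσ κ lam T
  have hk : ((-κ, 0) : ℝ × ℝ^n) = (-κ) • tm := by simp [tm]
  have hjet : ∀ f : ℝ × ℝ^n → ℝ, ContDiffAt ℝ ∞ f (z₀.1, 0) →
      HasJet (fun a => f (z₀.1 - κ * (a ^ 2 / 2), ψ (varPos B ρ a z₀ σ))) (f (z₀.1, 0))
        (dd (sp i) f (z₀.1, 0)) (dd (sp i) (dd (sp i) f) (z₀.1, 0) - κ * dd tm f (z₀.1, 0)) := by
    intro f hf
    have hf2 : ContDiffAt ℝ 2 f (z₀.1, 0) := hf.of_le (by norm_cast)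
    refine (hX.comp hf2).cast rfl rfl ?_
    rw [fderiv_fderiv_eq_dd hf2, hk, map_smul]
    simp only [dd, smul_eq_mul]; ring
  have hS := (hjet _ (h.flow.contDiffAt_scal hmem)).const_smul (lam ^ 2)
  have hc : ∀ k, HasJet (fun a => (fderiv ℝ ψ (varPos B ρ a z₀ σ)
        (varVel B ρ a z₀ σ (lam, fderiv ℝ F 0 T))) k) (T k) (lam * ric G k i (z₀.1, 0)) (Z₂ k) :=
    fun k => hZ.clm (EuclideanSpace.proj k : ℝ^n →L[ℝ] ℝ)
  have hG := HasJet.sum (s := Finset.univ) fun a => HasJet.sum (s := Finset.univ) fun b =>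
    ((hjet _ (h.flow.smooth _ hmem a b)).mul (hc a)).mul (hc b)
  refine ⟨_, _, ((hS.add hG).congr ?_).cast rfl rfl ?_⟩
  · have hcur : Tendsto (fun a => (z₀.1 - κ * (a ^ 2 / 2), varPos B ρ a z₀ σ)) (𝓝 0) (𝓝 z₀) := by
      have h1 : Continuous fun a => (z₀.1 - κ * (a ^ 2 / 2), varPos B ρ a z₀ σ) := by
        unfold varPos; fun_prop
      have := h1.tendsto 0
      simpa [varPos] using this
    filter_upwards [hcur.eventually h.metric_eq, hcur.eventually h.scal_eq] with a h1 h2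
    rw [varLag, h1, h2, bil_apply]
    rfl
  · have hd : ∀ a b, dd (sp i) (fun y => G y a b) (z₀.1, 0) = 0 := fun a b => had.2 i a b
    have h1 : G (z₀.1, 0) = 1 := had.1
    simp only [hd, h1, zero_mul, add_zero, mul_zero, zero_add, smul_eq_mul, hZ₂]
    have e1 : ∀ a b, ((dd (sp i) (dd (sp i) fun y => G y a b) (z₀.1, 0) -
          κ * dd tm (fun y => G y a b) (z₀.1, 0)) * T a +
        (1 : Mat n) a b * -(lam * dd tm (chr G a i i) (z₀.1, 0) +
          ∑ m, T m * dd (sp m) (chr G a i i) (z₀.1, 0))) * T b +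
        2 * ((1 : Mat n) a b * (lam * ric G a i (z₀.1, 0)) * (lam * ric G b i (z₀.1, 0))) +
        (1 : Mat n) a b * T a * -(lam * dd tm (chr G b i i) (z₀.1, 0) +
          ∑ m, T m * dd (sp m) (chr G b i i) (z₀.1, 0)) =
        dd (sp i) (dd (sp i) fun y => G y a b) (z₀.1, 0) * T a * T b -
          κ * (dd tm (fun y => G y a b) (z₀.1, 0) * T a * T b) +
        (1 : Mat n) a b * (2 * lam ^ 2 * ric G a i (z₀.1, 0) ^ 2 -
          2 * (T a * (lam * dd tm (chr G a i i) (z₀.1, 0) +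
          ∑ m, T m * dd (sp m) (chr G a i i) (z₀.1, 0)))) := by
      intro a b
      rcases eq_or_ne a b with rfl | hab
      · ring
      · simp [hab]; ring
    simp only [e1, sum_add_distrib, sum_sub_distrib, ← mul_sum]
    have e2 : ∀ f : Fin n → ℝ, ∑ a, ∑ b, (1 : Mat n) a b * f a = ∑ a, f a := by
      intro f
      refine sum_congr rfl fun a _ => ?_
      rw [Finset.sum_eq_single a]
      · simp
      · intro b _ hb; simp [hb.symm]
      · simp
    rw [e2, sum_sub_distrib, ← mul_sum, ← mul_sum]
    ring

end IsLocalModel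

/-- The homogenised Lagrangian. -/
def lag (B : ℝ × W → W →L[ℝ] W →L[ℝ] ℝ) (R : ℝ × W → ℝ) (z l : ℝ × W) : ℝ :=
  l.1 ^ 2 * R z + B z l.2 l.2

/-- The partial derivative in time of the homogenised Lagrangian. -/
def lagTime (B : ℝ × W → W →L[ℝ] W →L[ℝ] ℝ) (R : ℝ × W → ℝ) (z l : ℝ × W) : ℝ :=
  l.1 ^ 2 * fderiv ℝ R z (1, 0) + fderiv ℝ B z (1, 0) l.2 l.2

/-- The trace of the second variation of the Lagrangian is its time derivative. -/
theorem IsLocalModel.hasJet_sum_varLag (h : IsLocalModel B R ρ O G ψ F z₀) (κ : ℝ) {σ : Fin n → W}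
    (hσ : ∀ i j, B z₀ (σ i) (σ j) = if i = j then 1 else 0) {l : ℝ × W}
    (hl : fderiv ℝ ρ z₀.2 l.2 = l.2) :
    ∃ v₀ v₁, HasJet (fun a => ∑ i, varLag B R ρ κ a z₀ (σ i) l) v₀ v₁
      ((1 - n * κ) * lagTime B R z₀ l) := by
  obtain ⟨O', G', ψ', F', h', h0, had, hi⟩ := h.exists_adapted σ hσ
  have hmem : (z₀.1, (0 : ℝ^n)) ∈ O' := by have := h'.mem; rwa [h0] at this
  have hT : fderiv ℝ F' 0 (fderiv ℝ ψ' z₀.2 l.2) = l.2 := by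
    have := h'.fderiv_retr
    rw [h0] at this
    rw [this] at hl; exact hl
  choose v₀ v₁ H using fun i => h'.hasJet_varLag h0 had (hi i) κ l.1 (fderiv ℝ ψ' z₀.2 l.2)
  rw [hT] at H
  refine ⟨_, _, (HasJet.sum (s := Finset.univ) H).cast rfl rfl ?_⟩
  have e1 : lagTime B R z₀ l = l.1 ^ 2 * dd tm (scal G') (z₀.1, 0) +
      ∑ a, ∑ b, dd tm (fun y => G' y a b) (z₀.1, 0) * (fderiv ℝ ψ' z₀.2 l.2) a *
        (fderiv ℝ ψ' z₀.2 l.2) b := by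
    rw [lagTime, h'.fderiv_scal_time, h'.fderiv_metric_time, h0, ricB, bil_apply, one_mul, mul_sum]
    congr 1
    refine sum_congr rfl fun a _ => ?_
    rw [mul_sum]
    refine sum_congr rfl fun b _ => ?_
    rw [h'.flow.flow' hmem]
    simp only [ric, Matrix.of_apply]; ring
  rw [sum_sub_distrib, had.trace_second_variation h'.flow hmem, ← e1]
  simp
  ring

namespace IsLocalModel

variable (h : IsLocalModel B R ρ O G ψ F z₀)

include h

theorem contDiffAt_scal : ContDiffAt ℝ 6 R z₀ := by
  have h1 : ContDiffAt ℝ 6 (fun z : ℝ × W => ((z.1, ψ z.2) : ℝ × ℝ^n)) z₀ :=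
    contDiffAt_fst.prodMk (h.smooth.comp (g := ψ) z₀ contDiffAt_snd)
  exact (ContDiffAt.comp (g := scal G) z₀ ((h.flow.contDiffAt_scal h.mem).of_le
    (by norm_cast)) h1).congr_of_eventuallyEq h.scal_eq

theorem contDiffAt_varPos (σ : W) :
    ContDiffAt ℝ 3 (fun q : ℝ × (ℝ × W) × W => varPos B ρ q.1 q.2.1 q.2.2) (0, z₀, σ) := by
  have h1 : ContDiffAt ℝ 3 (fun q : ℝ × (ℝ × W) × W => (q.2.1.1, q.2.1.2, q.2.2)) (0, z₀, σ) := by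
    fun_prop
  have h2 : ContDiffAt ℝ 3 (fun q : ℝ × (ℝ × W) × W => extAcc B ρ (q.2.1.1, q.2.1.2, q.2.2))
      (0, z₀, σ) := ContDiffAt.comp (g := extAcc B ρ) _
    ((h.contDiffAt_extAcc σ).of_le (by norm_cast)) h1
  unfold varPos
  fun_prop

theorem contDiffAt_varVel (σ : W) (l : ℝ × W) :
    ContDiffAt ℝ 3 (fun q : ℝ × (ℝ × W) × W × (ℝ × W) => varVel B ρ q.1 q.2.1 q.2.2.1 q.2.2.2)
      (0, z₀, σ, l) := by
  have h1 : ContDiffAt ℝ 3 (fun q : ℝ × (ℝ × W) × W × (ℝ × W) => (q.2.1.1, q.2.1.2, q.2.2.1))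
      (0, z₀, σ, l) := by fun_prop
  have h2 : ContDiffAt ℝ 3 (fun q : ℝ × (ℝ × W) × W × (ℝ × W) =>
      fderiv ℝ (extAcc B ρ) (q.2.1.1, q.2.1.2, q.2.2.1)) (0, z₀, σ, l) :=
    ContDiffAt.comp (g := fderiv ℝ (extAcc B ρ)) _
      ((h.contDiffAt_extAcc σ).fderiv_right (m := 3) (by norm_num)) h1
  have h3 : ContDiffAt ℝ 3 (fun q : ℝ × (ℝ × W) × W × (ℝ × W) =>
      extTransport B ρ (q.2.1, q.2.2.1, q.2.2.2)) (0, z₀, σ, l) :=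
    ContDiffAt.comp (g := extTransport B ρ) _
      ((h.contDiffAt_extTransport σ l).of_le (by norm_cast)) (by fun_prop)
  unfold varVel
  fun_prop

theorem contDiffAt_varLag (κ : ℝ) (σ : W) (l : ℝ × W) :
    ContDiffAt ℝ 3 (fun q : ℝ × (ℝ × W) × W × (ℝ × W) =>
      varLag B R ρ κ q.1 q.2.1 q.2.2.1 q.2.2.2) (0, z₀, σ, l) := by
  have h1 := h.contDiffAt_varVel σ l
  have h2 : ContDiffAt ℝ 3 (fun q : ℝ × (ℝ × W) × W × (ℝ × W) =>
      varPos B ρ q.1 q.2.1 q.2.2.1) (0, z₀, σ, l) :=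
    ContDiffAt.comp (g := fun q : ℝ × (ℝ × W) × W => varPos B ρ q.1 q.2.1 q.2.2) _
      (h.contDiffAt_varPos σ) (f := fun q : ℝ × (ℝ × W) × W × (ℝ × W) => (q.1, q.2.1, q.2.2.1))
      (by fun_prop)
  have h3 : ContDiffAt ℝ 3 (fun q : ℝ × (ℝ × W) × W × (ℝ × W) =>
      (q.2.1.1 - κ * (q.1 ^ 2 / 2), varPos B ρ q.1 q.2.1 q.2.2.1)) (0, z₀, σ, l) := by
    fun_prop
  have h0 : ((z₀.1 - κ * ((0 : ℝ) ^ 2 / 2), varPos B ρ 0 z₀ σ) : ℝ × W) = z₀ := by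
    simp [varPos]
  have hR : ContDiffAt ℝ 3 (fun q : ℝ × (ℝ × W) × W × (ℝ × W) =>
      R (q.2.1.1 - κ * (q.1 ^ 2 / 2), varPos B ρ q.1 q.2.1 q.2.2.1)) (0, z₀, σ, l) :=
    ContDiffAt.comp (g := R) _ (by rw [h0]; exact h.contDiffAt_scal.of_le (by norm_cast)) h3
  have hB : ContDiffAt ℝ 3 (fun q : ℝ × (ℝ × W) × W × (ℝ × W) =>
      B (q.2.1.1 - κ * (q.1 ^ 2 / 2), varPos B ρ q.1 q.2.1 q.2.2.1)) (0, z₀, σ, l) :=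
    ContDiffAt.comp (g := B) _ (by rw [h0]; exact h.contDiffAt_metric.of_le (by norm_cast)) h3
  unfold varLag
  exact (ContDiffAt.mul (by fun_prop) hR).add ((hB.clm_apply h1).clm_apply h1)

theorem contDiffAt_lagTime (l : ℝ × W) :
    ContDiffAt ℝ 3 (fun q : (ℝ × W) × (ℝ × W) => lagTime B R q.1 q.2) (z₀, l) := by
  have h1 : ContDiffAt ℝ 3 (fun q : (ℝ × W) × (ℝ × W) => fderiv ℝ R q.1) (z₀, l) :=
    ContDiffAt.comp (g := fderiv ℝ R) _ ((h.contDiffAt_scal.fderiv_right (m := 5)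
      (by norm_num)).of_le (by norm_cast)) contDiffAt_fst
  have h2 : ContDiffAt ℝ 3 (fun q : (ℝ × W) × (ℝ × W) => fderiv ℝ B q.1) (z₀, l) :=
    ContDiffAt.comp (g := fderiv ℝ B) _ ((h.contDiffAt_metric.fderiv_right (m := 4)
      (by norm_num)).of_le (by norm_cast)) contDiffAt_fst
  unfold lagTime
  have h3 : ContDiffAt ℝ 3 (fun q : (ℝ × W) × (ℝ × W) => q.2.2) (z₀, l) := by fun_prop
  exact (ContDiffAt.mul (by fun_prop) (h1.clm_apply contDiffAt_const)).add
    (((h2.clm_apply contDiffAt_const).clm_apply h3).clm_apply h3)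

end IsLocalModel

theorem extTransport_smul (z : ℝ × W) (σ : W) (c : ℝ) (l : ℝ × W) :
    extTransport B ρ (z, σ, c • l) = c • extTransport B ρ (z, σ, l) := by
  have h1 : ∀ v : W, ((0 : ℝ), c • v) = c • ((0 : ℝ), v) := fun v => by simp
  have h2 : (c * l.1, (0 : W)) = c • (l.1, (0 : W)) := by simp
  simp only [extTransport, Prod.smul_fst, Prod.smul_snd, smul_eq_mul, extChr, h1, h2, map_smul,
    smul_apply]
  rw [smul_neg, ← (extSharp B ρ z).map_smul]
  refine congrArg Neg.neg (congrArg _ (ContinuousLinearMap.ext fun x => ?_))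
  simp
  ring

theorem varVel_smul (a : ℝ) (z : ℝ × W) (σ : W) (c : ℝ) (l : ℝ × W) :
    varVel B ρ a z σ (c • l) = c • varVel B ρ a z σ l := by
  have h1 : ((c • l).1, (c • l).2, c • extTransport B ρ (z, σ, l)) =
      c • (l.1, l.2, extTransport B ρ (z, σ, l)) := rfl
  simp only [varVel, extTransport_smul, h1, map_smul]
  simp only [Prod.smul_snd, smul_add, smul_smul]
  congr 2 <;> ring_nf

theorem varLag_smul (κ a : ℝ) (z : ℝ × W) (σ : W) (c : ℝ) (l : ℝ × W) :
    varLag B R ρ κ a z σ (c • l) = c ^ 2 * varLag B R ρ κ a z σ l := by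
  simp only [varLag, varVel_smul, map_smul, smul_apply, Prod.smul_fst, smul_eq_mul]
  ring

theorem lagTime_smul (z : ℝ × W) (c : ℝ) (l : ℝ × W) :
    lagTime B R z (c • l) = c ^ 2 * lagTime B R z l := by
  simp only [lagTime, map_smul, smul_apply, Prod.smul_fst, Prod.smul_snd, smul_eq_mul]
  ring

theorem lag_smul (z : ℝ × W) (c : ℝ) (l : ℝ × W) : lag B R z (c • l) = c ^ 2 * lag B R z l := by
  simp only [lag, map_smul, smul_apply, Prod.smul_fst, Prod.smul_snd, smul_eq_mul]
  ring

theorem varLag_zero (κ : ℝ) (z : ℝ × W) (σ : W) (l : ℝ × W) :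
    varLag B R ρ κ 0 z σ l = lag B R z l := by
  simp [varLag, lag, varPos, varVel]

/-- The degenerate metrics `B`, the function `R` and the retraction `ρ` are locally, at points of
`K` and times of `J`, those of an `n`-dimensional Ricci flow. -/
def IsAmbientFlow (n : ℕ) (B : ℝ × W → W →L[ℝ] W →L[ℝ] ℝ) (R : ℝ × W → ℝ) (ρ : W → W)
    (J : Set ℝ) (K : Set W) : Prop :=
  ∀ τ ∈ J, ∀ y ∈ K, ∃ (O : Set (ℝ × ℝ^n)) (G : ℝ × ℝ^n → Mat n)
    (ψ : W → ℝ^n) (F : ℝ^n → W), IsLocalModel B R ρ O G ψ F (τ, y)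

theorem IsAmbientFlow.mono {J J' : Set ℝ} {K : Set W} (h : IsAmbientFlow n B R ρ J K)
    (hJ : J' ⊆ J) : IsAmbientFlow n B R ρ J' K := fun τ hτ => h τ (hJ hτ)

/-- The second variation formula with a remainder which is uniform over a compact set. -/
theorem IsAmbientFlow.exists_uniform_second_variation {J : Set ℝ} {K : Set W}
    (h : IsAmbientFlow n B R ρ J K) (hJ : IsCompact J) (hK : IsCompact K) (κ D : ℝ) :
    ∃ C δ : ℝ, 0 ≤ C ∧ 0 < δ ∧ ∀ τ ∈ J, ∀ y ∈ K, ∀ σ : Fin n → W,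
      (∀ i, ‖σ i‖ ≤ D) → (∀ i j, B (τ, y) (σ i) (σ j) = if i = j then 1 else 0) →
      ∀ l : ℝ × W, fderiv ℝ ρ y l.2 = l.2 → ∀ a : ℝ, |a| ≤ δ →
      |∑ i, (varLag B R ρ κ a (τ, y) (σ i) l + varLag B R ρ κ (-a) (τ, y) (σ i) l) -
        2 * n * lag B R (τ, y) l - (1 - n * κ) * a ^ 2 * lagTime B R (τ, y) l| ≤
      C * |a| ^ 3 * ‖l‖ ^ 2 := by
  set Φ : ℝ × (ℝ × W) × (Fin n → W) × (ℝ × W) → ℝ := fun q =>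
    ∑ i, (varLag B R ρ κ q.1 q.2.1 (q.2.2.1 i) q.2.2.2 +
      varLag B R ρ κ (-q.1) q.2.1 (q.2.2.1 i) q.2.2.2) -
      (1 - n * κ) * q.1 ^ 2 * lagTime B R q.2.1 q.2.2.2 with hΦ
  set Q : Set ((ℝ × W) × (Fin n → W) × (ℝ × W)) :=
    (J ×ˢ K) ×ˢ (Metric.closedBall 0 (max D 0) ×ˢ Metric.sphere 0 1) with hQ
  have hQc : IsCompact Q :=
    (hJ.prod hK).prod ((isCompact_closedBall _ _).prod (isCompact_sphere _ _))
  set f : (ℝ × W) × (Fin n → W) × (ℝ × W) → (Fin n → Fin n → ℝ) × W := fun p =>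
    (fun i j => B p.1 (p.2.1 i) (p.2.1 j), fderiv ℝ ρ p.1.2 p.2.2.2 - p.2.2.2) with hf
  set Q' := Q ∩ f ⁻¹' {(fun i j => if i = j then 1 else 0, 0)} with hQ'
  -- the admissible data form a compact set: bounded orthonormal frames, and unit `l` with tangent
  -- spatial part
  have hfc : ContinuousOn f Q := by
    rintro ⟨⟨τ, y⟩, σ, l⟩ ⟨⟨hτ, hy⟩, -⟩
    obtain ⟨O, G, ψ, F, hm⟩ := h τ hτ y hy
    have c1 : ContinuousAt (fun p : (ℝ × W) × (Fin n → W) × (ℝ × W) => B p.1) ((τ, y), σ, l) :=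
      ContinuousAt.comp (g := B) hm.contDiffAt_metric.continuousAt continuousAt_fst
    have c2 : ContinuousAt (fun p : (ℝ × W) × (Fin n → W) × (ℝ × W) => fderiv ℝ ρ p.1.2)
        ((τ, y), σ, l) :=
      ContinuousAt.comp (g := fderiv ℝ ρ)
        (hm.contDiffAt_retr.fderiv_right (m := 5) (by norm_num)).continuousAt
        (continuous_snd.comp continuous_fst).continuousAt
    refine ContinuousAt.continuousWithinAt (ContinuousAt.prodMk ?_ ?_)
    · refine continuousAt_pi.2 fun i => continuousAt_pi.2 fun j => ?_
      exact (c1.clm_apply (by fun_prop)).clm_apply (by fun_prop)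
    · exact (c2.clm_apply (by fun_prop)).sub (by fun_prop)
  have hQ'c : IsCompact Q' :=
    hQc.of_isClosed_subset (hfc.preimage_isClosed_of_isClosed hQc.isClosed isClosed_singleton)
      inter_subset_left
  have hmem : ∀ {τ y σ l}, ((τ, y), σ, l) ∈ Q' → (τ ∈ J ∧ y ∈ K) ∧
      (∀ i j, B (τ, y) (σ i) (σ j) = if i = j then 1 else 0) ∧ fderiv ℝ ρ y l.2 = l.2 := by
    rintro τ y σ l ⟨⟨hz, -⟩, hp⟩
    have hp' := Prod.ext_iff.1 hp
    refine ⟨hz, fun i j => congrFun (congrFun hp'.1 i) j, sub_eq_zero.1 hp'.2⟩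
  -- symmetrizing in `a` removes the first order term, and the trace formula the second order one
  have hjet : ∀ p ∈ Q', ∃ v₀, HasJet (fun a => Φ (a, p)) v₀ 0 0 := by
    rintro ⟨⟨τ, y⟩, σ, l⟩ hp
    obtain ⟨⟨hτ, hy⟩, hσ, hl⟩ := hmem hp
    obtain ⟨O, G, ψ, F, hm⟩ := h τ hτ y hy
    obtain ⟨v₀, v₁, H⟩ := hm.hasJet_sum_varLag κ hσ hl
    have H2 := (H.add H.comp_neg).add
      (hasJet_quadratic 0 0 (-(2 * ((1 - n * κ) * lagTime B R (τ, y) l))))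
    refine ⟨_, (H2.congr (Eventually.of_forall fun a => ?_)).cast rfl (by simp) (by ring)⟩
    simp only [hΦ, sum_add_distrib, smul_eq_mul]
    ring
  have hsmooth : ∀ p ∈ Q', ContDiffAt ℝ 3 Φ (0, p) := by
    rintro ⟨⟨τ, y⟩, σ, l⟩ hp
    obtain ⟨⟨hτ, hy⟩, -⟩ := hmem hp
    obtain ⟨O, G, ψ, F, hm⟩ := h τ hτ y hy
    have e1 : ∀ i, ContDiffAt ℝ 3 (fun q : ℝ × (ℝ × W) × (Fin n → W) × (ℝ × W) =>
        varLag B R ρ κ q.1 q.2.1 (q.2.2.1 i) q.2.2.2) (0, (τ, y), σ, l) := fun i =>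
      ContDiffAt.comp (g := fun q : ℝ × (ℝ × W) × W × (ℝ × W) =>
        varLag B R ρ κ q.1 q.2.1 q.2.2.1 q.2.2.2) _ (hm.contDiffAt_varLag κ (σ i) l)
        (f := fun q : ℝ × (ℝ × W) × (Fin n → W) × (ℝ × W) => (q.1, q.2.1, q.2.2.1 i, q.2.2.2))
        (by fun_prop)
    have e2 : ∀ i, ContDiffAt ℝ 3 (fun q : ℝ × (ℝ × W) × (Fin n → W) × (ℝ × W) =>
        varLag B R ρ κ (-q.1) q.2.1 (q.2.2.1 i) q.2.2.2) (0, (τ, y), σ, l) := fun i =>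
      ContDiffAt.comp (g := fun q : ℝ × (ℝ × W) × W × (ℝ × W) =>
        varLag B R ρ κ q.1 q.2.1 q.2.2.1 q.2.2.2) _
        (by simpa using hm.contDiffAt_varLag κ (σ i) l)
        (f := fun q : ℝ × (ℝ × W) × (Fin n → W) × (ℝ × W) => (-q.1, q.2.1, q.2.2.1 i, q.2.2.2))
        (by fun_prop)
    have e3 : ContDiffAt ℝ 3 (fun q : ℝ × (ℝ × W) × (Fin n → W) × (ℝ × W) =>
        lagTime B R q.2.1 q.2.2.2) (0, (τ, y), σ, l) :=
      ContDiffAt.comp (g := fun q : (ℝ × W) × (ℝ × W) => lagTime B R q.1 q.2) _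
        (hm.contDiffAt_lagTime l)
        (f := fun q : ℝ × (ℝ × W) × (Fin n → W) × (ℝ × W) => (q.2.1, q.2.2.2)) (by fun_prop)
    exact (ContDiffAt.sum fun i _ => (e1 i).add (e2 i)).sub (ContDiffAt.mul (by fun_prop) e3)
  obtain ⟨C, δ, hC, hδ, H⟩ := exists_taylor_three hQ'c (Φ := Φ) hsmooth
    (fun p hp => by obtain ⟨v₀, hv⟩ := hjet p hp; exact hv.deriv)
    (fun p hp => by obtain ⟨v₀, hv⟩ := hjet p hp; exact hv.deriv_deriv)
  · refine ⟨C, δ, hC, hδ, fun τ hτ y hy σ hσD hσ l hl a ha => ?_⟩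
    -- everything is homogeneous of degree two in `l`, which reduces the estimate to unit `l`
    rcases eq_or_ne l 0 with rfl | hl0
    · have h1 : ∀ b i, varLag B R ρ κ b (τ, y) (σ i) 0 = 0 := fun b i => by
        simpa using varLag_smul (B := B) (R := R) (ρ := ρ) κ b (τ, y) (σ i) 0 0
      have h2 : lag B R (τ, y) 0 = 0 := by simp [lag]
      have h3 : lagTime B R (τ, y) 0 = 0 := by simp [lagTime]
      simp [h1, h2, h3]
    · have hc : ‖l‖ ≠ 0 := norm_ne_zero_iff.2 hl0
      set u := ‖l‖⁻¹ • l with hu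
      have hlu : l = ‖l‖ • u := by rw [hu, smul_smul, mul_inv_cancel₀ hc, one_smul]
      have hp : ((τ, y), σ, u) ∈ Q' := by
        refine ⟨⟨⟨hτ, hy⟩, ?_, ?_⟩, ?_⟩
        · rw [mem_closedBall_zero_iff, pi_norm_le_iff_of_nonneg (le_max_right _ _)]
          exact fun i => (hσD i).trans (le_max_left _ _)
        · rw [mem_sphere_zero_iff_norm, hu, norm_smul, norm_inv, norm_norm, inv_mul_cancel₀ hc]
        · refine Prod.ext (funext fun i => funext fun j => hσ i j) ?_
          simp only [hf, hu, Prod.smul_snd, map_smul, hl, sub_self]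
      have key := H _ hp a ha
      simp only [hΦ, neg_zero, varLag_zero] at key
      rw [hlu]
      simp only [varLag_smul, lag_smul, lagTime_smul, norm_smul, norm_norm]
      have hu1 : ‖u‖ = 1 := by
        rw [hu, norm_smul, norm_inv, norm_norm, inv_mul_cancel₀ hc]
      rw [hu1, mul_one, mul_comm (C * |a| ^ 3)]
      refine le_trans (le_of_eq ?_) (mul_le_mul_of_nonneg_left key (sq_nonneg ‖l‖))
      rw [← abs_of_nonneg (sq_nonneg ‖l‖), ← abs_mul, abs_of_nonneg (sq_nonneg ‖l‖)]
      congr 1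
      simp only [← mul_add, ← mul_sum, sum_const, card_univ, Fintype.card_fin, nsmul_eq_mul]
      ring

/-! ### Frames along curves -/

variable {J : Set ℝ} {K : Set W}

/-- The transport equation, as a linear operator on `σ`. -/
def extTransportL (B : ℝ × W → W →L[ℝ] W →L[ℝ] ℝ) (ρ : W → W) (z l : ℝ × W) : W →L[ℝ] W :=
  LinearMap.toContinuousLinearMap
    { toFun := fun σ => extTransport B ρ (z, σ, l)
      map_add' := fun σ σ' => by
        have h1 : ((0 : ℝ), σ + σ') = (0, σ) + (0, σ') := by simp
        simp only [extTransport, extChr]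
        rw [← neg_add, ← map_add]
        refine congrArg Neg.neg (congrArg _ (ContinuousLinearMap.ext fun x => ?_))
        simp only [h1, map_add, add_apply, smul_apply, smul_eq_mul, sub_apply,
          ContinuousLinearMap.flip_apply]
        ring
      map_smul' := fun c σ => by
        have h1 : ((0 : ℝ), c • σ) = c • (0, σ) := by simp
        simp only [extTransport, extChr, RingHom.id_apply]
        rw [smul_neg, ← (extSharp B ρ z).map_smul]
        refine congrArg Neg.neg (congrArg _ (ContinuousLinearMap.ext fun x => ?_))
        simp only [h1, map_smul, add_apply, smul_apply, smul_eq_mul, sub_apply,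
          ContinuousLinearMap.flip_apply]
        ring }

theorem extTransportL_apply (z l : ℝ × W) (σ : W) :
    extTransportL B ρ z l σ = extTransport B ρ (z, σ, l) := rfl

namespace IsLocalModel

variable (h : IsLocalModel B R ρ O G ψ F z₀)

include h

theorem metric_symm : ∀ᶠ z in 𝓝 z₀, ∀ v w, B z v w = B z w v := by
  have h1 : ContinuousAt (fun z : ℝ × W => ((z.1, ψ z.2) : ℝ × ℝ^n)) z₀ :=
    continuousAt_fst.prodMk (h.smooth.continuousAt.comp (f := Prod.snd) continuousAt_snd)
  filter_upwards [h.metric_eq, h1.eventually (h.flow.isOpen.mem_nhds h.mem)] with z hz hm v w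
  rw [hz, hz, bil_apply, bil_apply, sum_comm]
  refine sum_congr rfl fun i _ => sum_congr rfl fun j _ => ?_
  rw [h.flow.symm _ hm]; ring

theorem fderiv_metric_symm (a : ℝ × W) (v w : W) : fderiv ℝ B z₀ a v w = fderiv ℝ B z₀ a w v := by
  have hB := (h.contDiffAt_metric.differentiableAt (by simp)).hasFDerivAt
  have e1 := (hB.clm_apply (hasFDerivAt_const v z₀)).clm_apply (hasFDerivAt_const w z₀)
  have e2 := (hB.clm_apply (hasFDerivAt_const w z₀)).clm_apply (hasFDerivAt_const v z₀)
  have e4 := DFunLike.congr_fun (e1.unique (e2.congr_of_eventuallyEq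
    (h.metric_symm.mono fun z hz => hz v w))) a
  simpa using e4

theorem metric_pos {v : W} (hv : fderiv ℝ ρ z₀.2 v = v) (h0 : v ≠ 0) : 0 < B z₀ v v := by
  rw [h.metric_eq.self_of_nhds]
  refine h.flow.pos _ h.mem _ fun h1 => h0 ?_
  rw [← hv, h.fderiv_retr, ContinuousLinearMap.comp_apply, h1, map_zero]

theorem metric_extTransport (σ v : W) (l : ℝ × W) : B z₀ (extTransport B ρ (z₀, σ, l)) v =
      -((1 / 2 : ℝ) * fderiv ℝ B z₀ (l.1, 0) σ v + extChr B z₀ l.2 σ v) := by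
  have hr := h.flow.bil_ricciSharpVec h.mem (fderiv ℝ ψ z₀.2 σ) (fderiv ℝ ψ z₀.2 v)
  rw [h.extTransport_eq_fderiv_inv, h.metric_eq.self_of_nhds, h.fderiv_inv, h.fderiv_metric_time,
    h.extChr_eq]
  simp only [map_add, add_apply, map_sub, sub_apply, map_smul, smul_apply, hr, smul_eq_mul]
  ring

/-- The transport equation is compatible with the metric. -/
theorem metric_compatible (σ σ' : W) (l : ℝ × W) :
    fderiv ℝ B z₀ l σ σ' + B z₀ (extTransport B ρ (z₀, σ, l)) σ' +
      B z₀ σ (extTransport B ρ (z₀, σ', l)) = 0 := by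
  have hl : l = (l.1, 0) + (0, l.2) := by simp
  rw [h.metric_symm.self_of_nhds σ, h.metric_extTransport, h.metric_extTransport,
    h.fderiv_metric_symm _ σ' σ]
  conv_lhs => rw [hl]
  simp only [map_add, add_apply, extChr, smul_apply, sub_apply, smul_eq_mul,
    ContinuousLinearMap.flip_apply, ContinuousLinearMap.comp_apply, ContinuousLinearMap.inr_apply,
    Prod.fst_add, Prod.snd_add, add_zero, zero_add]
  rw [h.fderiv_metric_symm _ σ' σ, h.fderiv_metric_symm _ l.2 σ', h.fderiv_metric_symm _ l.2 σ]
  ring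

omit h in
theorem hasDerivWithinAt_metric {Y σ σ' : ℝ → W} {w : W} {S : Set ℝ} {τ : ℝ}
    (h : IsLocalModel B R ρ O G ψ F (τ, Y τ)) (hY : HasDerivWithinAt Y w S τ)
    (hσ : HasDerivWithinAt σ (extTransport B ρ ((τ, Y τ), σ τ, (1, w))) S τ)
    (hσ' : HasDerivWithinAt σ' (extTransport B ρ ((τ, Y τ), σ' τ, (1, w))) S τ) :
    HasDerivWithinAt (fun τ => B (τ, Y τ) (σ τ) (σ' τ)) 0 S τ := by
  have h1 : HasDerivWithinAt (fun τ => (τ, Y τ)) (1, w) S τ := (hasDerivWithinAt_id _ _).prodMk hY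
  have h0 : HasFDerivAt B (fderiv ℝ B (τ, Y τ)) (τ, Y τ) :=
    (h.contDiffAt_metric.differentiableAt (by simp)).hasFDerivAt
  have h2 : HasDerivWithinAt (fun τ => B (τ, Y τ)) (fderiv ℝ B (τ, Y τ) (1, w)) S τ :=
    HasFDerivAt.comp_hasDerivWithinAt (l := B) (f := fun τ => (τ, Y τ)) τ h0 h1
  have h3 := (h2.clm_apply hσ).clm_apply hσ'
  refine h3.congr_deriv ?_
  rw [← h.metric_compatible (σ τ) (σ' τ) (1, w)]
  rfl

theorem exists_orthonormal : ∃ σ : Fin n → W, (∀ i j, B z₀ (σ i) (σ j) = if i = j then 1 else 0) ∧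
      ∀ i, fderiv ℝ ρ z₀.2 (σ i) = σ i := by
  obtain ⟨V, hV⟩ := exists_orthonormal_frame (h.flow.symm _ h.mem) (h.flow.pos _ h.mem)
  refine ⟨fun i => fderiv ℝ F (ψ z₀.2) (V i), fun i j => ?_, fun i => h.fderiv_retr_apply_inv _⟩
  rw [h.metric_eq.self_of_nhds, h.fderiv_inv, h.fderiv_inv, hV]

end IsLocalModel

/-- Forms which are positive on the fixed spaces of operators `D` are uniformly so over a compact
set. -/
theorem exists_pos_mul_norm_sq_le {X : Type*} [TopologicalSpace X] {S : Set X} (hS : IsCompact S)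
    {B : X → W →L[ℝ] W →L[ℝ] ℝ} {D : X → W →L[ℝ] W} (hB : ContinuousOn B S)
    (hD : ContinuousOn D S) (hpos : ∀ x ∈ S, ∀ v, v ≠ 0 → D x v = v → 0 < B x v v) :
    ∃ c : ℝ, 0 < c ∧ ∀ x ∈ S, ∀ v, D x v = v → c * ‖v‖ ^ 2 ≤ B x v v := by
  have hQc : IsCompact (S ×ˢ Metric.sphere (0 : W) 1) := hS.prod (isCompact_sphere _ _)
  have hfst : ContinuousOn (Prod.fst : X × W → X) (S ×ˢ Metric.sphere (0 : W) 1) := continuousOn_fst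
  have hD' : ContinuousOn (fun p : X × W => D p.1 p.2 - p.2) (S ×ˢ Metric.sphere (0 : W) 1) :=
    ((hD.comp hfst fun p hp => hp.1).clm_apply continuousOn_snd).sub continuousOn_snd
  have hB' : ContinuousOn (fun p : X × W => B p.1 p.2 p.2) (S ×ˢ Metric.sphere (0 : W) 1) :=
    ((hB.comp hfst fun p hp => hp.1).clm_apply continuousOn_snd).clm_apply continuousOn_snd
  have hsub : IsCompact ((fun p : X × W => (B p.1 p.2 p.2, D p.1 p.2 - p.2)) ''
      (S ×ˢ Metric.sphere (0 : W) 1)) := hQc.image_of_continuousOn (hB'.prodMk hD')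
  have hsub2 : IsCompact (((fun p : X × W => (B p.1 p.2 p.2, D p.1 p.2 - p.2)) ''
      (S ×ˢ Metric.sphere (0 : W) 1)) ∩ Prod.snd ⁻¹' {0}) :=
    hsub.inter_right (isClosed_singleton.preimage continuous_snd)
  obtain ⟨c, hc, H⟩ : ∃ c : ℝ, 0 < c ∧ ∀ x ∈ S, ∀ v : W, ‖v‖ = 1 → D x v = v → c ≤ B x v v := by
    rcases (((fun p : X × W => (B p.1 p.2 p.2, D p.1 p.2 - p.2)) ''
      (S ×ˢ Metric.sphere (0 : W) 1)) ∩ Prod.snd ⁻¹' {0}).eq_empty_or_nonempty with h0 | h0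
    · refine ⟨1, one_pos, fun x hx v hv hvD => ?_⟩
      exact absurd h0 (Nonempty.ne_empty ⟨_, ⟨⟨(x, v), ⟨hx, by simpa using hv⟩, rfl⟩, by
        simp [hvD]⟩⟩)
    · obtain ⟨q, hq, hmin⟩ := hsub2.exists_isMinOn h0 continuousOn_fst
      obtain ⟨⟨⟨x, v⟩, ⟨hx, hv⟩, rfl⟩, hq2⟩ := hq
      refine ⟨B x v v, hpos x hx v ?_ (sub_eq_zero.1 hq2), fun x' hx' v' hv' hvD => ?_⟩
      · rintro rfl
        have hv : (0 : W) ∈ Metric.sphere (0 : W) 1 := hv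
        simp at hv
      · exact hmin ⟨⟨(x', v'), ⟨hx', by simpa using hv'⟩, rfl⟩, by simp [hvD]⟩
  refine ⟨c, hc, fun x hx v hv => ?_⟩
  rcases eq_or_ne v 0 with rfl | hv0
  · simp
  · have hx' := norm_ne_zero_iff.2 hv0
    have h1 := H x hx (‖v‖⁻¹ • v)
      (by rw [norm_smul, norm_inv, norm_norm, inv_mul_cancel₀ hx']) (by rw [map_smul, hv])
    simp only [map_smul, smul_apply, smul_eq_mul] at h1
    have h2 : B x v v = ‖v‖ ^ 2 * (‖v‖⁻¹ * (‖v‖⁻¹ * B x v v)) := by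
      field_simp
    rw [h2, mul_comm c]
    exact mul_le_mul_of_nonneg_left h1 (sq_nonneg _)

namespace IsAmbientFlow

theorem continuousOn_scal (h : IsAmbientFlow n B R ρ J K) : ContinuousOn R (J ×ˢ K) := by
  rintro ⟨τ, y⟩ ⟨hτ, hy⟩
  obtain ⟨O, G, ψ, F, hm⟩ := h τ hτ y hy
  exact hm.contDiffAt_scal.continuousAt.continuousWithinAt

theorem continuousOn_metric (h : IsAmbientFlow n B R ρ J K) : ContinuousOn B (J ×ˢ K) := by
  rintro ⟨τ, y⟩ ⟨hτ, hy⟩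
  obtain ⟨O, G, ψ, F, hm⟩ := h τ hτ y hy
  exact hm.contDiffAt_metric.continuousAt.continuousWithinAt

theorem exists_bound_extTransport (h : IsAmbientFlow n B R ρ J K) (hJ : IsCompact J)
    (hK : IsCompact K) : ∃ C : ℝ, 0 ≤ C ∧ ∀ τ ∈ J, ∀ y ∈ K, ∀ (σ : W) (l : ℝ × W),
      ‖extTransport B ρ ((τ, y), σ, l)‖ ≤ C * ‖σ‖ * ‖l‖ := by
  have hc : IsCompact ((J ×ˢ K) ×ˢ (Metric.closedBall (0 : W) 1 ×ˢ
      Metric.closedBall (0 : ℝ × W) 1)) :=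
    (hJ.prod hK).prod ((isCompact_closedBall _ _).prod (isCompact_closedBall _ _))
  have hcont : ContinuousOn (extTransport B ρ) ((J ×ˢ K) ×ˢ (Metric.closedBall (0 : W) 1 ×ˢ
      Metric.closedBall (0 : ℝ × W) 1)) := by
    rintro ⟨⟨τ, y⟩, σ, l⟩ ⟨⟨hτ, hy⟩, -⟩
    obtain ⟨O, G, ψ, F, hm⟩ := h τ hτ y hy
    exact (hm.contDiffAt_extTransport σ l).continuousAt.continuousWithinAt
  obtain ⟨C, hC⟩ := hc.exists_bound_of_continuousOn hcont
  refine ⟨max C 0, le_max_right _ _, fun τ hτ y hy σ l => ?_⟩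
  have hu : ∀ {X : Type _} [NormedAddCommGroup X] [NormedSpace ℝ X] (x : X),
      ∃ u : X, ‖u‖ ≤ 1 ∧ x = ‖x‖ • u := by
    intro X _ _ x
    rcases eq_or_ne x 0 with rfl | hx
    · exact ⟨0, by simp, by simp⟩
    · have hx' := norm_ne_zero_iff.2 hx
      refine ⟨‖x‖⁻¹ • x, ?_, by rw [smul_smul, mul_inv_cancel₀ hx', one_smul]⟩
      rw [norm_smul, norm_inv, norm_norm, inv_mul_cancel₀ hx']
  obtain ⟨u, hu1, hu2⟩ := hu σ
  obtain ⟨m, hm1, hm2⟩ := hu l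
  have h1 := hC ((τ, y), u, m) ⟨⟨hτ, hy⟩, by simpa using hu1, by simpa using hm1⟩
  have h2 : extTransport B ρ ((τ, y), σ, l) = ‖l‖ • ‖σ‖ • extTransport B ρ ((τ, y), u, m) := by
    conv_lhs => rw [hm2, extTransport_smul, ← extTransportL_apply, hu2, map_smul]
    rfl
  rw [h2, norm_smul, norm_smul, norm_norm, norm_norm, mul_comm ‖l‖, mul_comm ‖σ‖]
  gcongr
  exact h1.trans (le_max_left _ _)

theorem exists_coercive (h : IsAmbientFlow n B R ρ J K) (hJ : IsCompact J) (hK : IsCompact K) :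
    ∃ c : ℝ, 0 < c ∧ ∀ τ ∈ J, ∀ y ∈ K, ∀ v : W, fderiv ℝ ρ y v = v →
      c * ‖v‖ ^ 2 ≤ B (τ, y) v v := by
  obtain ⟨c, hc, H⟩ := exists_pos_mul_norm_sq_le (hJ.prod hK) (D := fun z => fderiv ℝ ρ z.2)
    h.continuousOn_metric (by
      rintro ⟨τ, y⟩ ⟨hτ, hy⟩
      obtain ⟨O, G, ψ, F, hm⟩ := h τ hτ y hy
      exact (ContinuousAt.comp (g := fderiv ℝ ρ) (f := Prod.snd)
        (hm.contDiffAt_retr.fderiv_right (m := 5) (by norm_num)).continuousAt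
        continuous_snd.continuousAt).continuousWithinAt) (by
      rintro ⟨τ, y⟩ ⟨hτ, hy⟩ v h0 hv
      obtain ⟨O, G, ψ, F, hm⟩ := h τ hτ y hy
      exact hm.metric_pos hv h0)
  exact ⟨c, hc, fun τ hτ y hy v hv => H (τ, y) ⟨hτ, hy⟩ v hv⟩

end IsAmbientFlow

theorem norm_le_exp_of_norm_deriv_le {X : Type*} [NormedAddCommGroup X] [NormedSpace ℝ X]
    {x x' : ℝ → X} {u : ℝ → ℝ} {s t C : ℝ} (hC : 0 ≤ C) (hst : s ≤ t)
    (hx : ∀ τ ∈ Icc s t, HasDerivWithinAt x (x' τ) (Icc s t) τ)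
    (hu : ContinuousOn u (Icc s t)) (hu1 : ∀ τ ∈ Icc s t, 1 ≤ u τ)
    (hb : ∀ τ ∈ Icc s t, ‖x' τ‖ ≤ C * ‖x τ‖ * u τ) :
    ∀ τ ∈ Icc s t, ‖x τ‖ ≤ (‖x s‖ + 1) * Real.exp ((C + 1) * ∫ r in s..t, u r) := by
  set U : ℝ → ℝ := IccExtend hst (fun τ : Icc s t => u τ) with hU
  have hUc : Continuous U := (continuousOn_iff_continuous_domRestrict.1 hu).Icc_extend'
  have hUu : ∀ τ ∈ Icc s t, U τ = u τ := fun τ hτ => IccExtend_of_mem hst _ hτ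
  have hU1 : ∀ τ, 1 ≤ U τ := fun τ => hu1 _ (projIcc s t hst τ).2
  have hI : ∀ τ, HasDerivAt (fun τ => ∫ r in s..τ, U r) (U τ) τ := fun τ =>
    integral_hasDerivAt_right (hUc.intervalIntegrable _ _)
      (hUc.stronglyMeasurableAtFilter _ _) hUc.continuousAt
  have hE : ∀ τ, HasDerivAt (fun τ => (‖x s‖ + 1) * Real.exp ((C + 1) * ∫ r in s..τ, U r))
      ((‖x s‖ + 1) * (Real.exp ((C + 1) * ∫ r in s..τ, U r) * ((C + 1) * U τ))) τ := fun τ =>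
    (((hI τ).const_mul (C + 1)).exp).const_mul _
  have key := image_norm_le_of_norm_deriv_right_lt_deriv_boundary' (a := s) (b := t) (f := x)
    (f' := x') (fun τ hτ => (hx τ hτ).continuousWithinAt)
    (fun τ hτ => (hx τ ⟨hτ.1, hτ.2.le⟩).mono_of_mem_nhdsWithin (Icc_mem_nhdsGE_of_mem hτ))
    (B := fun τ => (‖x s‖ + 1) * Real.exp ((C + 1) * ∫ r in s..τ, U r))
    (by simp) (fun τ _ => (hE τ).continuousAt.continuousWithinAt)
    (fun τ _ => (hE τ).hasDerivWithinAt) ?_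
  · intro τ hτ
    refine (key hτ).trans ?_
    have h1 : ∫ r in s..t, u r = ∫ r in s..t, U r := by
      refine integral_congr fun r hr => ?_
      rw [uIcc_of_le hst] at hr
      exact (hUu r hr).symm
    rw [h1]
    have h2 : ∫ r in s..τ, U r ≤ ∫ r in s..t, U r := by
      refine integral_mono_interval le_rfl hτ.1 hτ.2 ?_ (hUc.intervalIntegrable _ _)
      exact Eventually.of_forall fun r => zero_le_one.trans (hU1 r)
    gcongr
  · intro τ hτ he
    have hτ' : τ ∈ Icc s t := ⟨hτ.1, hτ.2.le⟩
    have h1 := hb τ hτ'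
    rw [he, ← hUu τ hτ'] at h1
    refine h1.trans_lt ?_
    have h2 : 0 < (‖x s‖ + 1) * Real.exp ((C + 1) * ∫ r in s..τ, U r) := by positivity
    have h3 := hU1 τ
    nlinarith [mul_pos h2 (zero_lt_one.trans_le h3)]

/-- Along a curve with velocity `w` in the submanifold there is a frame which solves the transport
equation, is orthonormal for all times, and is bounded in terms of the length of the curve. -/
theorem IsAmbientFlow.exists_frame {N : ℕ} {B : ℝ × ℝ^N → ℝ^N →L[ℝ] ℝ^N →L[ℝ] ℝ} {R : ℝ × ℝ^N → ℝ}
    {ρ : ℝ^N → ℝ^N} {K : Set (ℝ^N)}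
    (h : IsAmbientFlow n B R ρ J K) (hJ : IsCompact J) (hK : IsCompact K) :
    ∃ D : ℝ, 0 ≤ D ∧ ∀ s t : ℝ, s ≤ t → Icc s t ⊆ J → ∀ Y w : ℝ → ℝ^N,
      (∀ τ ∈ Icc s t, HasDerivWithinAt Y (w τ) (Icc s t) τ) → ContinuousOn w (Icc s t) →
      (∀ τ ∈ Icc s t, Y τ ∈ K) → ∃ σ : Fin n → ℝ → ℝ^N,
      (∀ i, ∀ τ ∈ Icc s t, HasDerivWithinAt (σ i)
        (extTransport B ρ ((τ, Y τ), σ i τ, (1, w τ))) (Icc s t) τ) ∧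
      (∀ τ ∈ Icc s t, ∀ i j, B (τ, Y τ) (σ i τ) (σ j τ) = if i = j then 1 else 0) ∧
      ∀ i, ∀ τ ∈ Icc s t, ‖σ i τ‖ ≤ D * Real.exp (D * ∫ r in s..t, (1 + ‖w r‖)) := by
  obtain ⟨C, hC, hCb⟩ := h.exists_bound_extTransport hJ hK
  obtain ⟨c, hc, hcb⟩ := h.exists_coercive hJ hK
  refine ⟨max (Real.sqrt c⁻¹ + 1) (C + 1), le_max_of_le_right (by linarith), ?_⟩
  intro s t hst hJ' Y w hY hw hYK
  have hs : s ∈ Icc s t := ⟨le_rfl, hst⟩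
  have hYc : ContinuousOn Y (Icc s t) := fun τ hτ => (hY τ hτ).continuousWithinAt
  have hA : ContinuousOn (fun τ => extTransportL B ρ (τ, Y τ) (1, w τ)) (Icc s t) := by
    refine continuousOn_clm_apply.2 fun σ τ hτ => ?_
    obtain ⟨O, G, ψ, F, hm⟩ := h τ (hJ' hτ) _ (hYK τ hτ)
    have h1 := (hm.contDiffAt_extTransport σ (1, w τ)).continuousAt
    have h2 : ContinuousWithinAt (fun τ => ((τ, Y τ), σ, ((1 : ℝ), w τ))) (Icc s t) τ :=
      (continuousWithinAt_id.prodMk (hYc τ hτ)).prodMk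
        (continuousWithinAt_const.prodMk (continuousWithinAt_const.prodMk (hw τ hτ)))
    exact ContinuousAt.comp_continuousWithinAt (g := extTransport B ρ) h1 h2
  obtain ⟨O, G, ψ, F, hm⟩ := h s (hJ' hs) _ (hYK s hs)
  obtain ⟨σ₀, ho, hσt⟩ := hm.exists_orthonormal
  choose σ hσ0 hσ using fun i => exists_linear_ode hst hA (σ₀ i)
  simp only [extTransportL_apply] at hσ
  refine ⟨σ, hσ, fun τ hτ i j => ?_, fun i τ hτ => ?_⟩
  · have hd : ∀ τ ∈ Icc s t, HasDerivWithinAt (fun τ => B (τ, Y τ) (σ i τ) (σ j τ)) 0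
        (Icc s t) τ := by
      intro τ hτ
      obtain ⟨O, G, ψ, F, hm⟩ := h τ (hJ' hτ) _ (hYK τ hτ)
      exact hm.hasDerivWithinAt_metric (hY τ hτ) (hσ i τ hτ) (hσ j τ hτ)
    have h1 := constant_of_derivWithin_zero (fun τ hτ => (hd τ hτ).differentiableWithinAt)
      (fun τ hτ => by
        have hne : s < t := hτ.1.trans_lt hτ.2
        exact (hd τ ⟨hτ.1, hτ.2.le⟩).derivWithin (uniqueDiffOn_Icc hne τ ⟨hτ.1, hτ.2.le⟩)) τ hτ
    rw [h1, hσ0, hσ0, ho]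
  · have hn : ‖σ₀ i‖ ≤ Real.sqrt c⁻¹ := by
      have h1 := hcb s (hJ' hs) _ (hYK s hs) _ (hσt i)
      rw [ho, if_pos rfl] at h1
      refine Real.le_sqrt_of_sq_le ?_
      rw [inv_eq_one_div, le_div_iff₀ hc]; linarith
    have h2 := norm_le_exp_of_norm_deriv_le (u := fun τ => 1 + ‖w τ‖) hC hst (hσ i)
      (continuousOn_const.add hw.norm) (fun τ _ => by linarith [norm_nonneg (w τ)])
      (fun τ hτ => (hCb τ (hJ' hτ) _ (hYK τ hτ) (σ i τ) (1, w τ)).trans (by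
        refine mul_le_mul_of_nonneg_left ?_ (by positivity)
        rw [Prod.norm_def]
        simp only [norm_one]
        exact max_le (by linarith [norm_nonneg (w τ)]) (by linarith))) τ hτ
    rw [hσ0] at h2
    refine h2.trans ?_
    have h3 : 0 ≤ ∫ r in s..t, (1 + ‖w r‖) := integral_nonneg hst fun r _ => by positivity
    have h4 : C + 1 ≤ max (Real.sqrt c⁻¹ + 1) (C + 1) := le_max_right _ _
    have h5 : ‖σ₀ i‖ + 1 ≤ max (Real.sqrt c⁻¹ + 1) (C + 1) := by
      refine le_trans ?_ (le_max_left _ _); linarith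
    gcongr

/-! ### Variations of curves -/

namespace IsLocalModel

theorem hasDerivWithinAt_varPos {Y σ : ℝ → W} {w : W} {S : Set ℝ} {τ : ℝ} (a : ℝ)
    (h : IsLocalModel B R ρ O G ψ F (τ, Y τ)) (hY : HasDerivWithinAt Y w S τ)
    (hσ : HasDerivWithinAt σ (extTransport B ρ ((τ, Y τ), σ τ, (1, w))) S τ) :
    HasDerivWithinAt (fun τ => varPos B ρ a (τ, Y τ) (σ τ))
      (varVel B ρ a (τ, Y τ) (σ τ) (1, w)) S τ := by
  have h0 : HasFDerivAt (extAcc B ρ) (fderiv ℝ (extAcc B ρ) (τ, Y τ, σ τ)) (τ, Y τ, σ τ) :=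
    ((h.contDiffAt_extAcc (σ τ)).differentiableAt (by simp)).hasFDerivAt
  have h1 : HasDerivWithinAt (fun τ => (τ, Y τ, σ τ))
      (1, w, extTransport B ρ ((τ, Y τ), σ τ, (1, w))) S τ :=
    (hasDerivWithinAt_id _ _).prodMk (hY.prodMk hσ)
  have h2 : HasDerivWithinAt (fun τ => extAcc B ρ (τ, Y τ, σ τ)) _ S τ :=
    HasFDerivAt.comp_hasDerivWithinAt (l := extAcc B ρ) (f := fun τ => (τ, Y τ, σ τ)) τ h0 h1
  exact (hY.fun_add (hσ.fun_const_smul a)).fun_add (h2.fun_const_smul (a ^ 2 / 2))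

theorem continuousWithinAt_varVel {Y σ w : ℝ → W} {S : Set ℝ} {τ : ℝ} (a : ℝ)
    (h : IsLocalModel B R ρ O G ψ F (τ, Y τ)) (hY : ContinuousWithinAt Y S τ)
    (hσ : ContinuousWithinAt σ S τ) (hw : ContinuousWithinAt w S τ) :
    ContinuousWithinAt (fun τ => varVel B ρ a (τ, Y τ) (σ τ) (1, w τ)) S τ := by
  have h1 : ContinuousWithinAt (fun τ => (τ, Y τ, σ τ)) S τ :=
    continuousWithinAt_id.prodMk (hY.prodMk hσ)
  have h2 : ContinuousWithinAt (fun τ => ((τ, Y τ), σ τ, ((1 : ℝ), w τ))) S τ :=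
    (continuousWithinAt_id.prodMk hY).prodMk (hσ.prodMk (continuousWithinAt_const.prodMk hw))
  have h3 : ContinuousWithinAt (fun τ => extTransport B ρ ((τ, Y τ), σ τ, (1, w τ))) S τ :=
    ContinuousAt.comp_continuousWithinAt (g := extTransport B ρ)
      (h.contDiffAt_extTransport (σ τ) (1, w τ)).continuousAt h2
  have h4 : ContinuousWithinAt (fun τ => fderiv ℝ (extAcc B ρ) (τ, Y τ, σ τ)) S τ :=
    ContinuousAt.comp_continuousWithinAt (g := fderiv ℝ (extAcc B ρ))
      ((h.contDiffAt_extAcc (σ τ)).fderiv_right (m := 3) (by norm_num)).continuousAt h1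
  exact (hw.add (h3.const_smul a)).add
    ((h4.clm_apply (continuousWithinAt_const.prodMk (hw.prodMk h3))).const_smul (a ^ 2 / 2))

end IsLocalModel

namespace IsAmbientFlow

/-- For small parameters, uniformly over a compact set, variations stay in the open set where the
ambient objects are regular. -/
theorem exists_varPos_regular (h : IsAmbientFlow n B R ρ J K) (hJ : IsCompact J) (hK : IsCompact K)
    {P : W → Prop} (hP : ∀ y ∈ K, ∀ᶠ y' in 𝓝 y, P y') (κ D : ℝ) :
    ∃ δ : ℝ, 0 < δ ∧ ∀ τ ∈ J, ∀ y ∈ K, ∀ σ : W, ‖σ‖ ≤ D → ∀ a : ℝ, |a| ≤ δ →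
      P (varPos B ρ a (τ, y) σ) ∧
      ContinuousAt B (τ - κ * (a ^ 2 / 2), varPos B ρ a (τ, y) σ) ∧
      ContinuousAt R (τ - κ * (a ^ 2 / 2), varPos B ρ a (τ, y) σ) := by
  have hc : IsCompact ((J ×ˢ K) ×ˢ Metric.closedBall (0 : W) D) :=
    (hJ.prod hK).prod (isCompact_closedBall _ _)
  have hnear : ∀ p ∈ (J ×ˢ K) ×ˢ Metric.closedBall (0 : W) D, ∃ C : ℝ,
      ∀ᶠ q in 𝓝 ((0 : ℝ), p), P (varPos B ρ q.1 q.2.1 q.2.2) ∧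
      ContinuousAt B (q.2.1.1 - κ * (q.1 ^ 2 / 2), varPos B ρ q.1 q.2.1 q.2.2) ∧
      ContinuousAt R (q.2.1.1 - κ * (q.1 ^ 2 / 2), varPos B ρ q.1 q.2.1 q.2.2) := by
    rintro ⟨⟨τ, y⟩, σ⟩ ⟨⟨hτ, hy⟩, -⟩
    refine ⟨0, ?_⟩
    obtain ⟨O, G, ψ, F, hm⟩ := h τ hτ y hy
    have h1 : ContinuousAt (fun q : ℝ × (ℝ × W) × W => varPos B ρ q.1 q.2.1 q.2.2)
        (0, (τ, y), σ) := (hm.contDiffAt_varPos σ).continuousAt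
    have h2 : ContinuousAt (fun q : ℝ × (ℝ × W) × W =>
        (q.2.1.1 - κ * (q.1 ^ 2 / 2), varPos B ρ q.1 q.2.1 q.2.2)) (0, (τ, y), σ) :=
      ContinuousAt.prodMk (by fun_prop) h1
    have e1 : varPos B ρ 0 (τ, y) σ = y := by simp [varPos]
    have e2 : ((τ - κ * ((0 : ℝ) ^ 2 / 2), varPos B ρ 0 (τ, y) σ) : ℝ × W) = (τ, y) := by
      simp [varPos]
    have h1' : Tendsto (fun q : ℝ × (ℝ × W) × W => varPos B ρ q.1 q.2.1 q.2.2)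
        (𝓝 (0, (τ, y), σ)) (𝓝 y) := by simpa only [ContinuousAt, e1] using h1
    have h2' : Tendsto (fun q : ℝ × (ℝ × W) × W =>
        (q.2.1.1 - κ * (q.1 ^ 2 / 2), varPos B ρ q.1 q.2.1 q.2.2)) (𝓝 (0, (τ, y), σ))
        (𝓝 (τ, y)) := by simpa only [ContinuousAt, e2] using h2
    have c1 := h1'.eventually (hP y hy)
    have c2 : ∀ᶠ z in 𝓝 (τ, y), ContinuousAt B z := by
      filter_upwards [hm.contDiffAt_metric.eventually (by simp)] with z hz using hz.continuousAt
    have c3 : ∀ᶠ z in 𝓝 (τ, y), ContinuousAt R z := by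
      filter_upwards [hm.contDiffAt_scal.eventually (by simp)] with z hz using hz.continuousAt
    exact c1.and ((h2'.eventually c2).and (h2'.eventually c3))
  obtain ⟨C, δ, hC, hδ, H⟩ := exists_uniform_of_forall_nhds hc
    (Q := fun _ q => P (varPos B ρ q.1 q.2.1 q.2.2) ∧
      ContinuousAt B (q.2.1.1 - κ * (q.1 ^ 2 / 2), varPos B ρ q.1 q.2.1 q.2.2) ∧
      ContinuousAt R (q.2.1.1 - κ * (q.1 ^ 2 / 2), varPos B ρ q.1 q.2.1 q.2.2))
    (fun _ _ _ _ h => h) hnear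
  exact ⟨δ, hδ, fun τ hτ y hy σ hσ a ha => H ((τ, y), σ) ⟨⟨hτ, hy⟩, by simpa using hσ⟩ a ha⟩

theorem continuousOn_lag (h : IsAmbientFlow n B R ρ J K) {s t : ℝ} (hJ : Icc s t ⊆ J)
    {Y w : ℝ → W} (hY : ContinuousOn Y (Icc s t)) (hw : ContinuousOn w (Icc s t))
    (hYK : ∀ τ ∈ Icc s t, Y τ ∈ K) :
    ContinuousOn (fun τ => lag B R (τ, Y τ) (1, w τ)) (Icc s t) := by
  have h1 : ContinuousOn (fun τ => (τ, Y τ)) (Icc s t) := continuousOn_id.prodMk hY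
  have h2 : ContinuousOn (fun τ => B (τ, Y τ)) (Icc s t) :=
    h.continuousOn_metric.comp h1 fun τ hτ => ⟨hJ hτ, hYK τ hτ⟩
  have h3 : ContinuousOn (fun τ => R (τ, Y τ)) (Icc s t) :=
    h.continuousOn_scal.comp h1 fun τ hτ => ⟨hJ hτ, hYK τ hτ⟩
  have h4 : ContinuousOn (fun τ => ((1 : ℝ), w τ).1 ^ 2) (Icc s t) := by
    simp only [one_pow]; exact continuousOn_const
  unfold lag
  exact ContinuousOn.add (ContinuousOn.mul h4 h3) ((h2.clm_apply hw).clm_apply hw)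

theorem continuousOn_lagTime (h : IsAmbientFlow n B R ρ J K) {s t : ℝ} (hJ : Icc s t ⊆ J)
    {Y w : ℝ → W} (hY : ContinuousOn Y (Icc s t)) (hw : ContinuousOn w (Icc s t))
    (hYK : ∀ τ ∈ Icc s t, Y τ ∈ K) :
    ContinuousOn (fun τ => lagTime B R (τ, Y τ) (1, w τ)) (Icc s t) := by
  intro τ hτ
  obtain ⟨O, G, ψ, F, hm⟩ := h τ (hJ hτ) _ (hYK τ hτ)
  exact ContinuousAt.comp_continuousWithinAt (g := fun q : (ℝ × W) × (ℝ × W) => lagTime B R q.1 q.2)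
    (f := fun τ => ((τ, Y τ), ((1 : ℝ), w τ))) (hm.contDiffAt_lagTime (1, w τ)).continuousAt
    ((continuousWithinAt_id.prodMk (hY τ hτ)).prodMk (continuousWithinAt_const.prodMk (hw τ hτ)))

end IsAmbientFlow

/-! ### Traces along constant curves -/

/-- Traces over an orthonormal frame transported along a constant curve, when the scalar curvature
depends only on time: they are the scalar curvature and half its time derivative. -/
theorem IsLocalModel.trace_transport_rest (h : IsLocalModel B R ρ O G ψ F z₀) {σ : Fin n → W}
    (hσ : ∀ i j, B z₀ (σ i) (σ j) = if i = j then 1 else 0) {Rt : ℝ → ℝ}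
    (hR : ∀ᶠ z in 𝓝 z₀, R z = Rt z.1) :
    ∑ i, B z₀ (extTransport B ρ (z₀, σ i, (1, 0))) (σ i) = R z₀ ∧
    2 * ∑ i, B z₀ (extTransport B ρ (z₀, σ i, (1, 0))) (extTransport B ρ (z₀, σ i, (1, 0))) =
      fderiv ℝ R z₀ (1, 0) := by
  obtain ⟨O', G', ψ', F', h', h0, had, hi⟩ := h.exists_adapted σ hσ
  have hz : (z₀.1, (0 : ℝ^n)) ∈ O' := by have := h'.mem; rwa [h0] at this
  have hext : ∀ i k, fderiv ℝ ψ' z₀.2 (extTransport B ρ (z₀, σ i, (1, 0))) k =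
      ric G' k i (z₀.1, 0) := by
    intro i k
    have h1 := h'.extTransport_eq (σ i) (1, 0)
    simp only [map_zero, zero_apply, zero_add, sub_zero, one_smul] at h1
    rw [h1, hi, h0]
    simp only [ricciSharpVec]
    rw [had.inv]
    simp [Matrix.one_apply, Pi.single_apply]
    rfl
  have hB : ∀ v w, B z₀ v w = ∑ k, fderiv ℝ ψ' z₀.2 v k * fderiv ℝ ψ' z₀.2 w k := by
    intro v w
    rw [h'.metric_eq.self_of_nhds, h0, had.1, bil_apply]
    simp [Matrix.one_apply]
  have hscal : scal G' (z₀.1, 0) = R z₀ := by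
    have := h'.scal_eq.self_of_nhds
    rw [h0] at this
    exact this.symm
  constructor
  · rw [← hscal, scal, had.inv]
    refine sum_congr rfl fun i _ => ?_
    rw [hB]
    simp [hext, hi, Matrix.one_apply, Pi.single_apply]
  · have hF : Tendsto F' (𝓝 0) (𝓝 z₀.2) := by
      have := h'.smooth_inv.continuousAt.tendsto
      rw [h'.fix, h0] at this
      exact this
    have h1 : Tendsto (fun z : ℝ × ℝ^n => (z.1, F' z.2)) (𝓝 (z₀.1, 0)) (𝓝 z₀) := by
      rw [← Prod.mk.eta (p := z₀)]
      exact (continuous_fst.tendsto (z₀.1, (0 : ℝ^n))).prodMk_nhds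
        (hF.comp (continuous_snd.tendsto (z₀.1, (0 : ℝ^n))))
    have hinv := h'.inv
    rw [h0] at hinv
    have h2 : scal G' =ᶠ[𝓝 (z₀.1, 0)] fun z => Rt z.1 := by
      filter_upwards [h1.eventually (h'.scal_eq.and hR),
        (continuous_snd.tendsto (z₀.1, (0 : ℝ^n))).eventually hinv]
        with z hz1 hz2
      rw [← hz1.2, hz1.1, hz2]
    have h3 : ∀ i, dd (sp i) (dd (sp i) (scal G')) (z₀.1, 0) = 0 := by
      intro i
      have h4 : dd (sp i) (scal G') =ᶠ[𝓝 (z₀.1, 0)] fun _ => 0 := by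
        filter_upwards [h2.eventuallyEq_nhds, hz |> h'.flow.isOpen.mem_nhds] with z hz hzO
        have h5 := dd_slice (f := scal G') (τ := z.1) (u := z.2)
          ((h'.flow.contDiffAt_scal hzO).differentiableAt (by simp)) (𝐞 i)
        have h6 : (fun v => scal G' (z.1, v)) =ᶠ[𝓝 z.2] fun _ => Rt z.1 :=
          ((Continuous.prodMk_right z.1).tendsto z.2).eventually hz
        rw [dd_congr h6] at h5
        simpa [dd, sp] using h5.symm
      rw [dd_congr h4]
      simp [dd]
    have h4 := had.dd_tm_scal h'.flow hz
    rw [h'.fderiv_scal_time, h0, h4]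
    simp only [h3, sum_const_zero, zero_add, hB, hext]
    rw [sum_comm]
    exact congrArg _ (sum_congr rfl fun i _ => sum_congr rfl fun j _ => by ring)

end Extrinsic

/-! ### Extremals of the Lagrangian in coordinates -/

section Extremal

variable {E : Type*} [NormedAddCommGroup E] [InnerProductSpace ℝ E] [FiniteDimensional ℝ E]

/-- A smooth family of Riemannian metrics `B` and a smooth potential `R`, on an open subset of
space-time. -/
structure IsActionOn (O : Set (ℝ × E)) (B : ℝ × E → E →L[ℝ] E →L[ℝ] ℝ) (R : ℝ × E → ℝ) : Prop where
  isOpen : IsOpen O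
  smooth : ∀ z ∈ O, ContDiffAt ℝ 3 B z
  smooth_pot : ∀ z ∈ O, ContDiffAt ℝ 3 R z
  symm : ∀ z ∈ O, ∀ v w, B z v w = B z w v
  pos : ∀ z ∈ O, ∀ v, v ≠ 0 → 0 < B z v v

/-- The spatial derivative of the Lagrangian minus the part of `d/dτ (2 B v)` that does not involve
the acceleration. -/
def forceForm (B : ℝ × E → E →L[ℝ] E →L[ℝ] ℝ) (R : ℝ × E → ℝ) (q : ℝ × E × E) : E →L[ℝ] ℝ :=
  (fderiv ℝ R (q.1, q.2.1)).comp (ContinuousLinearMap.inr ℝ ℝ E) +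
    (((fderiv ℝ B (q.1, q.2.1)).comp (ContinuousLinearMap.inr ℝ ℝ E)).flip q.2.2).flip q.2.2 -
    (2 : ℝ) • fderiv ℝ B (q.1, q.2.1) (1, q.2.2) q.2.2

/-- The acceleration of an extremal, as a function of time, position and velocity. -/
def extremalAcc (B : ℝ × E → E →L[ℝ] E →L[ℝ] ℝ) (R : ℝ × E → ℝ) (q : ℝ × E × E) : E :=
  (1 / 2 : ℝ) • (B (q.1, q.2.1)).inverse (forceForm B R q)

variable {O : Set (ℝ × E)} {B : ℝ × E → E →L[ℝ] E →L[ℝ] ℝ} {R : ℝ × E → ℝ}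

namespace IsActionOn

theorem isInvertible (h : IsActionOn O B R) {z : ℝ × E} (hz : z ∈ O) : (B z).IsInvertible := by
  have hinj : Function.Injective (B z) := by
    refine (injective_iff_map_eq_zero _).2 fun v hv => ?_
    by_contra h0
    have := h.pos z hz v h0
    rw [hv, zero_apply] at this
    exact lt_irrefl _ this
  have hr : Module.finrank ℝ E = Module.finrank ℝ (E →L[ℝ] ℝ) := by
    rw [← (LinearMap.toContinuousLinearMap (𝕜 := ℝ) (E := E) (F' := ℝ)).finrank_eq]
    exact (Subspace.dual_finrank_eq (K := ℝ) (V := E)).symm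
  let e := (LinearEquiv.ofInjectiveOfFinrankEq (B z : E →ₗ[ℝ] (E →L[ℝ] ℝ))
    hinj hr).toContinuousLinearEquiv
  exact ⟨e, by ext; rfl⟩

theorem contDiffAt_extremalAcc (h : IsActionOn O B R) {τ : ℝ} {x : E} (hz : (τ, x) ∈ O) (v : E) :
    ContDiffAt ℝ 1 (extremalAcc B R) (τ, x, v) := by
  have : CompleteSpace E := FiniteDimensional.complete ℝ E
  have hz1 : ContDiffAt ℝ 1 (fun q : ℝ × E × E => (q.1, q.2.1)) (τ, x, v) := by fun_prop
  have h1 : ContDiffAt ℝ 1 (fun q : ℝ × E × E => fderiv ℝ B (q.1, q.2.1)) (τ, x, v) :=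
    ContDiffAt.comp (g := fderiv ℝ B) _ ((h.smooth _ hz).fderiv_right (m := 1) (by norm_num)) hz1
  have h2 : ContDiffAt ℝ 1 (fun q : ℝ × E × E => fderiv ℝ R (q.1, q.2.1)) (τ, x, v) :=
    ContDiffAt.comp (g := fderiv ℝ R) _ ((h.smooth_pot _ hz).fderiv_right (m := 1) (by norm_num))
      hz1
  have hv : ContDiffAt ℝ 1 (fun q : ℝ × E × E => q.2.2) (τ, x, v) := by fun_prop
  have h3 : ContDiffAt ℝ 1 (fun q : ℝ × E × E =>
      (((fderiv ℝ B (q.1, q.2.1)).comp (ContinuousLinearMap.inr ℝ ℝ E)).flip q.2.2).flip q.2.2)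
      (τ, x, v) := by
    have e1 := (ContinuousLinearMap.flipₗᵢ ℝ E E (E →L[ℝ] ℝ)).contDiff.contDiffAt.comp (τ, x, v)
      (h1.clm_comp (contDiffAt_const (c := ContinuousLinearMap.inr ℝ ℝ E)))
    exact (ContinuousLinearMap.flipₗᵢ ℝ E E ℝ).contDiff.contDiffAt.comp (τ, x, v)
      (e1.clm_apply hv) |>.clm_apply hv
  have h4 : ContDiffAt ℝ 1 (fun q : ℝ × E × E => fderiv ℝ B (q.1, q.2.1) (1, q.2.2) q.2.2)
      (τ, x, v) := (h1.clm_apply (contDiffAt_const.prodMk hv)).clm_apply hv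
  have h5 : ContDiffAt ℝ 1 (forceForm B R) (τ, x, v) :=
    ((h2.clm_comp contDiffAt_const).add h3).sub (h4.const_smul (2 : ℝ))
  obtain ⟨e, he⟩ := h.isInvertible hz
  have h6 := contDiffAt_map_inverse (n := 1) e
  rw [he] at h6
  have h7 : ContDiffAt ℝ 1 (fun q : ℝ × E × E => B (q.1, q.2.1)) (τ, x, v) :=
    ContDiffAt.comp (g := B) _ ((h.smooth _ hz).of_le (by norm_cast)) hz1
  have h8 : ContDiffAt ℝ 1 (fun q : ℝ × E × E => (B (q.1, q.2.1)).inverse) (τ, x, v) :=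
    ContDiffAt.comp (g := ContinuousLinearMap.inverse) (τ, x, v) h6 h7
  exact (h8.clm_apply h5).const_smul (1 / 2 : ℝ)

/-- The Euler–Lagrange equation. -/
theorem extremalAcc_apply (h : IsActionOn O B R) {τ : ℝ} {x : E} (hz : (τ, x) ∈ O) (v ξ : E) :
    2 * B (τ, x) (extremalAcc B R (τ, x, v)) ξ = fderiv ℝ R (τ, x) (0, ξ) +
      fderiv ℝ B (τ, x) (0, ξ) v v - 2 * fderiv ℝ B (τ, x) (1, v) v ξ := by
  obtain ⟨e, he⟩ := h.isInvertible hz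
  have h1 : B (τ, x) ((B (τ, x)).inverse (forceForm B R (τ, x, v))) = forceForm B R (τ, x, v) := by
    rw [← he, ContinuousLinearMap.inverse_equiv]
    simp
  rw [extremalAcc, (B (τ, x)).map_smul, h1]
  simp [forceForm]

/-- There is an extremal starting at rest at any point. -/
theorem exists_extremal (h : IsActionOn O B R) {s : ℝ} {u : E} (hz : (s, u) ∈ O) :
    ∃ (x v : ℝ → E) (ε : ℝ), 0 < ε ∧ x s = u ∧ v s = 0 ∧ ∀ τ ∈ Ioo (s - ε) (s + ε),
      (τ, x τ) ∈ O ∧ ‖v τ‖ ≤ 1 ∧ HasDerivAt x (v τ) τ ∧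
      HasDerivAt v (extremalAcc B R (τ, x τ, v τ)) τ := by
  have : CompleteSpace E := FiniteDimensional.complete ℝ E
  have hF : ContDiffAt ℝ 1 (fun q : ℝ × E × E => ((1 : ℝ), q.2.2, extremalAcc B R q)) (s, u, 0) :=
    contDiffAt_const.prodMk (contDiffAt_snd.snd.prodMk (h.contDiffAt_extremalAcc hz 0))
  obtain ⟨α, hα0, ε, hε, hα⟩ :=
    hF.exists_forall_mem_closedBall_exists_eq_forall_mem_Ioo_hasDerivAt₀ s
  have hsε : s ∈ Ioo (s - ε) (s + ε) := ⟨by linarith, by linarith⟩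
  have h1 : ∀ τ ∈ Ioo (s - ε) (s + ε), HasDerivAt (fun τ => (α τ).1) 1 τ := fun τ hτ =>
    (hα τ hτ).fst
  have h2 : ∀ τ ∈ Ioo (s - ε) (s + ε), (α τ).1 = τ := by
    intro τ hτ
    have hd : ∀ τ ∈ Ioo (s - ε) (s + ε), HasDerivAt (fun τ => (α τ).1 - τ) 0 τ := fun τ hτ => by
      simpa using (h1 τ hτ).fun_sub (hasDerivAt_id τ)
    have := (convex_Ioo (s - ε) (s + ε)).is_const_of_fderivWithin_eq_zero (𝕜 := ℝ)
      (fun τ hτ => (hd τ hτ).differentiableAt.differentiableWithinAt)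
      (fun τ hτ => by
        rw [fderivWithin_of_isOpen isOpen_Ioo hτ]
        ext
        simpa using (hd τ hτ).deriv) hτ hsε
    simp only [hα0, sub_self] at this
    linarith
  have hc : ContinuousAt α s := (hα s hsε).continuousAt
  have e1 : ∀ᶠ τ in 𝓝 s, ((α τ).1, (α τ).2.1) ∈ O := by
    refine (hc.fst.prodMk hc.snd.fst).eventually (p := (· ∈ O)) ?_
    simp only [hα0]
    exact h.isOpen.mem_nhds hz
  have e2 : ∀ᶠ τ in 𝓝 s, ‖(α τ).2.2‖ < 1 := by
    refine (hc.snd.snd.norm).eventually (p := (· < 1)) ?_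
    simp only [hα0]
    exact gt_mem_nhds (by simp)
  obtain ⟨δ, hδ, H⟩ := Metric.eventually_nhds_iff.1 (e1.and e2)
  refine ⟨fun τ => (α τ).2.1, fun τ => (α τ).2.2, min ε δ, lt_min hε hδ, by simp only [hα0],
    by simp only [hα0],
    ?_⟩
  intro τ hτ
  have hτε : τ ∈ Ioo (s - ε) (s + ε) :=
    ⟨by linarith [hτ.1, min_le_left ε δ], by linarith [hτ.2, min_le_left ε δ]⟩
  obtain ⟨k1, k2⟩ := H (y := τ) (by
    rw [Real.dist_eq, abs_lt]
    exact ⟨by linarith [hτ.1, min_le_right ε δ], by linarith [hτ.2, min_le_right ε δ]⟩)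
  have h3 := (hα τ hτε).snd
  have h4 : α τ = (τ, (α τ).2.1, (α τ).2.2) := by
    conv_lhs => rw [← Prod.mk.eta (p := α τ), h2 τ hτε]
  refine ⟨by rwa [h2 τ hτε] at k1, k2.le, h3.fst, ?_⟩
  have h5 := h3.snd
  rw [h4] at h5
  exact h5

theorem hasDerivWithinAt_form (h : IsActionOn O B R) {x y z : ℝ → E} {v y' z' : E} {S : Set ℝ}
    {τ : ℝ} (hz : (τ, x τ) ∈ O) (hx : HasDerivWithinAt x v S τ) (hy : HasDerivWithinAt y y' S τ)
    (hz' : HasDerivWithinAt z z' S τ) :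
    HasDerivWithinAt (fun τ => B (τ, x τ) (y τ) (z τ)) (fderiv ℝ B (τ, x τ) (1, v) (y τ) (z τ) +
      B (τ, x τ) y' (z τ) + B (τ, x τ) (y τ) z') S τ := by
  have h1 : HasDerivWithinAt (fun τ => (τ, x τ)) ((1 : ℝ), v) S τ :=
    (hasDerivWithinAt_id _ _).prodMk hx
  have h2 : HasDerivWithinAt (fun τ => B (τ, x τ)) (fderiv ℝ B (τ, x τ) (1, v)) S τ :=
    HasFDerivAt.comp_hasDerivWithinAt (l := B) (f := fun τ => (τ, x τ)) τ
      ((h.smooth _ hz).differentiableAt (by simp)).hasFDerivAt h1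
  refine ((h2.clm_apply hy).clm_apply hz').congr_deriv ?_
  simp

/-- The energy identity: along an extremal the Hamiltonian changes by the partial time derivative
of the Lagrangian. -/
theorem hasDerivAt_energy (h : IsActionOn O B R) {x v : ℝ → E} {τ : ℝ} (hz : (τ, x τ) ∈ O)
    (hx : HasDerivAt x (v τ) τ) (hv : HasDerivAt v (extremalAcc B R (τ, x τ, v τ)) τ) :
    HasDerivAt (fun τ => R (τ, x τ) - B (τ, x τ) (v τ) (v τ))
      (lagTime B R (τ, x τ) (1, v τ)) τ := by
  have h1 : HasDerivAt (fun τ => R (τ, x τ)) (fderiv ℝ R (τ, x τ) (1, v τ)) τ :=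
    HasFDerivAt.comp_hasDerivAt (l := R) (f := fun τ => (τ, x τ)) τ
      ((h.smooth_pot _ hz).differentiableAt (by simp)).hasFDerivAt ((hasDerivAt_id τ).prodMk hx)
  have h2 := h.hasDerivWithinAt_form (S := univ) hz hx.hasDerivWithinAt hv.hasDerivWithinAt
    hv.hasDerivWithinAt
  rw [hasDerivWithinAt_univ] at h2
  refine (h1.fun_sub h2).congr_deriv ?_
  have h3 := h.extremalAcc_apply hz (v τ) (v τ)
  have h4 := h.symm _ hz (v τ) (extremalAcc B R (τ, x τ, v τ))
  have h5 : ((1 : ℝ), v τ) = (1, 0) + (0, v τ) := by simp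
  rw [h5, (fderiv ℝ B (τ, x τ)).map_add, add_apply, add_apply] at h3 ⊢
  rw [(fderiv ℝ R (τ, x τ)).map_add]
  simp only [lagTime, Prod.fst_add, Prod.snd_add, add_zero, zero_add, one_pow, one_mul]
  linarith

end IsActionOn

/-! ### Short extremals minimize -/

/-- A uniform second order Taylor estimate near a point. -/
theorem exists_taylor_nhds {X Y : Type*} [NormedAddCommGroup X] [NormedSpace ℝ X]
    [NormedAddCommGroup Y] [NormedSpace ℝ Y] {Φ : X → Y} {z₀ : X} (hΦ : ContDiffAt ℝ 2 Φ z₀) :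
    ∃ K η : ℝ, 0 ≤ K ∧ 0 < η ∧ ∀ z z', dist z z₀ < η → dist z' z₀ < η →
      ‖Φ z' - Φ z - fderiv ℝ Φ z (z' - z)‖ ≤ K * ‖z' - z‖ ^ 2 ∧ ‖Φ z' - Φ z‖ ≤ K * ‖z' - z‖ := by
  obtain ⟨K₁, S₁, hS₁, hL₁⟩ := (hΦ.fderiv_right (m := 1) (by norm_num)).exists_lipschitzOnWith
  obtain ⟨K₂, S₂, hS₂, hL₂⟩ := (hΦ.of_le (m := 1) (by norm_num)).exists_lipschitzOnWith
  have hd : ∀ᶠ z in 𝓝 z₀, DifferentiableAt ℝ Φ z := by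
    filter_upwards [hΦ.eventually (by simp)] with z hz using hz.differentiableAt (by simp)
  obtain ⟨η, hη, H⟩ := Metric.eventually_nhds_iff_ball.1
    ((eventually_mem_set.2 hS₁).and ((eventually_mem_set.2 hS₂).and hd))
  refine ⟨K₁ + K₂, η, by positivity, hη, fun z z' hz hz' => ⟨?_, ?_⟩⟩
  · have hseg : segment ℝ z z' ⊆ Metric.ball z₀ η := (convex_ball z₀ η).segment_subset hz hz'
    have h1 := (convex_segment z z').norm_image_sub_le_of_norm_hasFDerivWithin_le'
      (f := Φ) (f' := fderiv ℝ Φ) (φ := fderiv ℝ Φ z) (C := K₁ * ‖z' - z‖)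
      (fun y hy => ((H y (hseg hy)).2.2).hasFDerivAt.hasFDerivWithinAt)
      (fun y hy => ?_) (left_mem_segment ℝ z z') (right_mem_segment ℝ z z')
    · refine h1.trans ?_
      have : (0 : ℝ) ≤ K₂ * ‖z' - z‖ ^ 2 := by positivity
      nlinarith
    · have h2 := hL₁.dist_le_mul _ (H y (hseg hy)).1 _ (H z hz).1
      rw [dist_eq_norm, dist_eq_norm] at h2
      refine h2.trans (mul_le_mul_of_nonneg_left ?_ K₁.2)
      obtain ⟨θ, h0, h1, rfl⟩ := by rw [segment_eq_image'] at hy; exact hy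
      simp only [add_sub_cancel_left, norm_smul, Real.norm_eq_abs]
      rw [abs_of_nonneg h0.1]
      exact mul_le_of_le_one_left (norm_nonneg _) h0.2
  · have h2 := hL₂.dist_le_mul _ (H z' hz').2.1 _ (H z hz).2.1
    rw [dist_eq_norm, dist_eq_norm] at h2
    have : (0 : ℝ) ≤ K₁ * ‖z' - z‖ := by positivity
    linarith

namespace IsActionOn

/-- The Lagrangian is uniformly convex in the velocity, and differs by a quadratic error from its
linearization. -/
theorem exists_convexity (h : IsActionOn O B R) {s : ℝ} {u : E} (hz : (s, u) ∈ O) :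
    ∃ c K η : ℝ, 0 < c ∧ 0 ≤ K ∧ 0 < η ∧ ∀ τ x y v v', |τ - s| < η → ‖x - u‖ < η → ‖y - u‖ < η →
      ‖v‖ ≤ 1 → (τ, x) ∈ O ∧ (τ, y) ∈ O ∧
      fderiv ℝ R (τ, x) (0, y - x) + fderiv ℝ B (τ, x) (0, y - x) v v +
        2 * B (τ, x) v (v' - v) + c * ‖v' - v‖ ^ 2 - K * ‖y - x‖ ^ 2 ≤
      lag B R (τ, y) (1, v') - lag B R (τ, x) (1, v) := by
  obtain ⟨K₁, η₁, hK₁, hη₁, H₁⟩ := exists_taylor_nhds ((h.smooth _ hz).of_le (by norm_cast))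
  obtain ⟨K₂, η₂, hK₂, hη₂, H₂⟩ := exists_taylor_nhds ((h.smooth_pot _ hz).of_le (by norm_cast))
  obtain ⟨c, hc, Hc⟩ := exists_pos_mul_norm_sq_le (S := {(s, u)}) isCompact_singleton (B := B)
    (D := fun _ => ContinuousLinearMap.id ℝ E) (continuousOn_singleton _ _) continuousOn_const
    (by rintro _ rfl v hv -; exact h.pos _ hz v hv)
  have hcu : ∀ v, c * ‖v‖ ^ 2 ≤ B (s, u) v v := fun v => Hc _ rfl v rfl
  have hB : ∀ᶠ z in 𝓝 (s, u), ‖B z - B (s, u)‖ < c / 2 := by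
    have h1 := ((h.smooth _ hz).continuousAt.sub (continuousAt_const (y := B (s, u)))).norm
    refine h1.eventually (p := (· < c / 2)) (gt_mem_nhds ?_)
    simpa using hc
  obtain ⟨η₃, hη₃, H₃⟩ := Metric.eventually_nhds_iff.1 (hB.and (h.isOpen.mem_nhds hz))
  -- a quarter of the convexity survives: half is lost to the variation of `B`, and half of the rest
  -- to the cross term `2 K₁ ‖ξ‖ ‖ζ‖`
  refine ⟨c / 4, K₁ + K₂ + 4 * K₁ ^ 2 / c, min η₁ (min η₂ η₃), by positivity, by positivity,
    by positivity, ?_⟩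
  intro τ x y v v' hτ hx hy hv
  have hd : ∀ x : E, ‖x - u‖ < min η₁ (min η₂ η₃) → dist (τ, x) (s, u) < min η₁ (min η₂ η₃) := by
    intro x hx
    rw [Prod.dist_eq, max_lt_iff, Real.dist_eq, dist_eq_norm]
    exact ⟨hτ, hx⟩
  have hdx := lt_min_iff.1 (hd x hx)
  have hdy := lt_min_iff.1 (hd y hy)
  have hdx' := lt_min_iff.1 hdx.2
  have hdy' := lt_min_iff.1 hdy.2
  have hxO : (τ, x) ∈ O := (H₃ hdx'.2).2
  have hyO : (τ, y) ∈ O := (H₃ hdy'.2).2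
  refine ⟨hxO, hyO, ?_⟩
  set ξ := y - x with hξ
  set ζ := v' - v with hζ
  have hv' : v' = v + ζ := by rw [hζ]; abel
  have e0 : ((τ, y) : ℝ × E) - (τ, x) = (0, ξ) := by simp [hξ]
  have e1 : ‖((0 : ℝ), ξ)‖ = ‖ξ‖ := by simp [Prod.norm_def]
  obtain ⟨t1, t2⟩ := H₁ _ _ hdx.1 hdy.1
  obtain ⟨t3, -⟩ := H₂ _ _ hdx'.1 hdy'.1
  rw [e0, e1] at t1 t2 t3
  have b1 : -(K₁ * ‖ξ‖ ^ 2) ≤ B (τ, y) v v - B (τ, x) v v - fderiv ℝ B (τ, x) (0, ξ) v v := by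
    have := ContinuousLinearMap.le_opNorm₂ (B (τ, y) - B (τ, x) - fderiv ℝ B (τ, x) (0, ξ)) v v
    simp only [sub_apply, Real.norm_eq_abs] at this
    have h2 : ‖B (τ, y) - B (τ, x) - fderiv ℝ B (τ, x) (0, ξ)‖ * ‖v‖ * ‖v‖ ≤
        K₁ * ‖ξ‖ ^ 2 * 1 * 1 := by
      gcongr
    have := neg_le_of_abs_le this
    linarith
  have b2 : -(K₁ * ‖ξ‖ * ‖ζ‖) ≤ B (τ, y) v ζ - B (τ, x) v ζ := by
    have := ContinuousLinearMap.le_opNorm₂ (B (τ, y) - B (τ, x)) v ζ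
    simp only [sub_apply, Real.norm_eq_abs] at this
    have h2 : ‖B (τ, y) - B (τ, x)‖ * ‖v‖ * ‖ζ‖ ≤ K₁ * ‖ξ‖ * 1 * ‖ζ‖ := by gcongr
    have := neg_le_of_abs_le this
    linarith
  have b3 : c / 2 * ‖ζ‖ ^ 2 ≤ B (τ, y) ζ ζ := by
    have := ContinuousLinearMap.le_opNorm₂ (B (τ, y) - B (s, u)) ζ ζ
    simp only [sub_apply, Real.norm_eq_abs] at this
    have h2 : ‖B (τ, y) - B (s, u)‖ * ‖ζ‖ * ‖ζ‖ ≤ c / 2 * ‖ζ‖ * ‖ζ‖ := by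
      have := (H₃ hdy'.2).1.le
      gcongr
    have h3 := neg_le_of_abs_le this
    have h4 := hcu ζ
    nlinarith
  have b4 : -(K₂ * ‖ξ‖ ^ 2) ≤ R (τ, y) - R (τ, x) - fderiv ℝ R (τ, x) (0, ξ) := by
    rw [Real.norm_eq_abs] at t3
    exact neg_le_of_abs_le t3
  have b5 : 2 * (K₁ * ‖ξ‖ * ‖ζ‖) ≤ c / 4 * ‖ζ‖ ^ 2 + 4 * K₁ ^ 2 / c * ‖ξ‖ ^ 2 := by
    have h1 : 0 ≤ c / 4 * (‖ζ‖ - 4 * K₁ / c * ‖ξ‖) ^ 2 := by positivity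
    have h2 : c / 4 * (‖ζ‖ - 4 * K₁ / c * ‖ξ‖) ^ 2 =
      c / 4 * ‖ζ‖ ^ 2 - 2 * (K₁ * ‖ξ‖ * ‖ζ‖) + 4 * K₁ ^ 2 / c * ‖ξ‖ ^ 2 := by field_simp; ring
    linarith
  have b6 : B (τ, y) v' v' = B (τ, y) v v + 2 * B (τ, y) v ζ + B (τ, y) ζ ζ := by
    rw [hv', (B (τ, y)).map_add, add_apply, (B (τ, y) v).map_add, (B (τ, y) ζ).map_add,
      h.symm _ hyO ζ v]
    ring
  simp only [lag, one_pow, one_mul, b6]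
  linarith

/-- An extremal which is short enough, and starts at rest, has less action than every nearby curve
with the same endpoints. -/
theorem exists_strict_minimum (h : IsActionOn O B R) {s : ℝ} {u : E} (hz : (s, u) ∈ O) :
    ∃ η : ℝ, 0 < η ∧ ∀ t, s < t → t - s < η → ∀ x v y v' : ℝ → E,
      (∀ τ ∈ Icc s t, ‖x τ - u‖ < η ∧ ‖y τ - u‖ < η ∧ ‖v τ‖ ≤
          1 ∧ HasDerivWithinAt x (v τ) (Icc s t) τ ∧
        HasDerivWithinAt v (extremalAcc B R (τ, x τ, v τ)) (Icc s t) τ ∧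
        HasDerivWithinAt y (v' τ) (Icc s t) τ) →
      ContinuousOn v' (Icc s t) → x s = y s → x t = y t →
      ∫ τ in s..t, lag B R (τ, y τ) (1, v' τ) ≤ ∫ τ in s..t, lag B R (τ, x τ) (1, v τ) →
      EqOn y x (Icc s t) := by
  obtain ⟨c, K, η, hc, hK, hη, H⟩ := h.exists_convexity hz
  -- the weight `k (τ - s) |y - x|²` absorbs the quadratic error on short intervals
  set k := K + 1 with hk
  set μ := min η (c / (2 * k ^ 2 + 2 * c)) with hμ
  have hk0 : 0 < k := by positivity
  have hμ0 : 0 < μ := by positivity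
  refine ⟨μ, hμ0, ?_⟩
  intro t hst htμ x v y v' hxy hv'c hs ht hle
  have hμη : μ ≤ η := min_le_left _ _
  have hμ1 : k ^ 2 * μ ≤ c / 2 := by
    have h1 : μ ≤ c / (2 * k ^ 2 + 2 * c) := min_le_right _ _
    rw [le_div_iff₀ (by positivity)] at h1
    nlinarith
  have hμ2 : μ ≤ 1 := by
    have h1 : μ ≤ c / (2 * k ^ 2 + 2 * c) := min_le_right _ _
    refine h1.trans ((div_le_one (by positivity)).2 ?_)
    nlinarith [sq_nonneg k]
  have hH : ∀ τ ∈ Icc s t, ∀ w, (τ, x τ) ∈ O ∧ (τ, y τ) ∈ O ∧ _ := fun τ hτ w =>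
    H τ (x τ) (y τ) (v τ) w (by
      rw [abs_of_nonneg (by linarith [hτ.1])]; linarith [hτ.2]) ((hxy τ hτ).1.trans_le hμη)
      ((hxy τ hτ).2.1.trans_le hμη) (hxy τ hτ).2.2.1
  -- the momentum paired with `y - x`, minus the weight: it vanishes at both endpoints, and by the
  -- Euler–Lagrange equation and convexity its derivative is at most the difference of Lagrangians
  set Ψ : ℝ → ℝ := fun τ => 2 * B (τ, x τ) (v τ) (y τ - x τ) - k * ((τ - s) * ‖y τ - x τ‖ ^ 2)
    with hΨ
  have hΨd : ∀ τ ∈ Icc s t, HasDerivWithinAt Ψ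
      (fderiv ℝ R (τ, x τ) (0, y τ - x τ) + fderiv ℝ B (τ, x τ) (0, y τ - x τ) (v τ) (v τ) +
        2 * B (τ, x τ) (v τ) (v' τ - v τ) - k * (‖y τ - x τ‖ ^ 2 +
        (τ - s) * (2 * inner ℝ (y τ - x τ) (v' τ - v τ)))) (Icc s t) τ := by
    intro τ hτ
    obtain ⟨-, -, -, hx, hv, hy⟩ := hxy τ hτ
    have h1 := (h.hasDerivWithinAt_form (hH τ hτ 0).1 hx hv (hy.fun_sub hx)).const_mul 2
    have h2 := (((hasDerivWithinAt_id τ (Icc s t)).sub_const s).fun_mul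
      (hy.fun_sub hx).norm_sq).const_mul k
    refine (h1.fun_sub h2).congr_deriv ?_
    have h3 := h.extremalAcc_apply (hH τ hτ 0).1 (v τ) (y τ - x τ)
    simp only [id, one_mul]
    linarith
  have hxc : ContinuousOn x (Icc s t) := fun τ hτ => (hxy τ hτ).2.2.2.1.continuousWithinAt
  have hyc : ContinuousOn y (Icc s t) := fun τ hτ => (hxy τ hτ).2.2.2.2.2.continuousWithinAt
  have hvc : ContinuousOn v (Icc s t) := fun τ hτ => (hxy τ hτ).2.2.2.2.1.continuousWithinAt
  have hlagc : ∀ (x v : ℝ → E), ContinuousOn x (Icc s t) → ContinuousOn v (Icc s t) →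
      (∀ τ ∈ Icc s t, (τ, x τ) ∈ O) → ContinuousOn (fun τ => lag B R (τ, x τ) (1, v τ))
        (Icc s t) := by
    intro x v hx hv hO τ hτ
    have h1 : ContinuousWithinAt (fun τ => (τ, x τ)) (Icc s t) τ :=
      continuousWithinAt_id.prodMk (hx τ hτ)
    have h2 := ContinuousAt.comp_continuousWithinAt (g := B) (f := fun τ => (τ, x τ)) (x := τ)
      (h.smooth _ (hO τ hτ)).continuousAt h1
    have h3 := ContinuousAt.comp_continuousWithinAt (g := R) (f := fun τ => (τ, x τ)) (x := τ)
      (h.smooth_pot _ (hO τ hτ)).continuousAt h1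
    simp only [lag, one_pow, one_mul]
    exact h3.add ((h2.clm_apply (hv τ hτ)).clm_apply (hv τ hτ))
  have hint : ∀ {φ : ℝ → ℝ}, ContinuousOn φ (Icc s t) → IntervalIntegrable φ volume s t :=
    (·.intervalIntegrable_of_Icc hst.le)
  have hix := hint (hlagc x v hxc hvc fun τ hτ => (hH τ hτ 0).1)
  have hiy := hint (hlagc y v' hyc hv'c fun τ hτ => (hH τ hτ 0).2.1)
  have hnc : ContinuousOn (fun τ => ‖y τ - x τ‖ ^ 2 / 2) (Icc s t) :=
    ((hyc.sub hxc).norm.pow 2).div_const 2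
  -- the pointwise comparison
  have key : ∀ τ ∈ Icc s t, ∀ d, HasDerivWithinAt Ψ d (Icc s t) τ →
      d ≤ lag B R (τ, y τ) (1, v' τ) - lag B R (τ, x τ) (1, v τ) - ‖y τ - x τ‖ ^ 2 / 2 := by
    intro τ hτ d hd
    rw [(uniqueDiffOn_Icc hst τ hτ).eq_deriv _ hd (hΨd τ hτ)]
    have h1 := (hH τ hτ (v' τ)).2.2
    have h2 := abs_real_inner_le_norm (y τ - x τ) (v' τ - v τ)
    have h3 := neg_le_of_abs_le h2
    set a := ‖y τ - x τ‖
    set b := ‖v' τ - v τ‖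
    have hτ0 : 0 ≤ τ - s := by linarith [hτ.1]
    have hτμ : τ - s ≤ μ := by linarith [hτ.2]
    have ha : 0 ≤ a := norm_nonneg _
    have hb : 0 ≤ b := norm_nonneg _
    have h4 : -(k * (2 * μ * (a * b))) ≤ k * ((τ - s) * (2 * inner ℝ (y τ - x τ)
        (v' τ - v τ))) := by
      have h5 : (τ - s) * (a * b) ≤ μ * (a * b) := by gcongr
      have h6 := mul_le_mul_of_nonneg_left h3 hτ0
      nlinarith
    have h7 : k * (2 * μ * (a * b)) ≤ c * b ^ 2 + a ^ 2 / 2 := by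
      have h8 : (k * μ) ^ 2 ≤ c / 2 := by nlinarith
      have h9 : 0 ≤ c * (b - k * μ / c * a) ^ 2 := by positivity
      have h10 : c * (b - k * μ / c * a) ^ 2 =
        c * b ^ 2 - k * (2 * μ * (a * b)) + (k * μ) ^ 2 / c * a ^ 2 := by field_simp; ring
      have h11 : (k * μ) ^ 2 / c ≤ 1 / 2 := by rw [div_le_iff₀ hc]; linarith
      nlinarith [sq_nonneg a]
    rw [hk] at h4 h7 ⊢
    linarith
  have hsub := integral_sub hiy hix
  have hint2 := (hiy.sub hix).sub (hint hnc)
  have hmono : Ψ t - Ψ s ≤ ∫ τ in s..t, (lag B R (τ, y τ) (1, v' τ) - lag B R (τ, x τ) (1, v τ) -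
      ‖y τ - x τ‖ ^ 2 / 2) := by
    refine sub_le_integral_of_hasDeriv_right_of_le hst.le
      (fun τ hτ => (hΨd τ hτ).continuousWithinAt)
      (fun τ hτ => ((hΨd τ (Ioo_subset_Icc_self hτ)).hasDerivAt
        (Icc_mem_nhds hτ.1 hτ.2)).hasDerivWithinAt) ?_
      (fun τ hτ => key τ (Ioo_subset_Icc_self hτ) _ (hΨd τ (Ioo_subset_Icc_self hτ)))
    exact (intervalIntegrable_iff_integrableOn_Icc_of_le hst.le).1 hint2
  have hΨs : Ψ s = 0 := by simp [hΨ, hs]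
  have hΨt : Ψ t = 0 := by simp [hΨ, ht]
  rw [hΨs, hΨt, integral_sub (hiy.sub hix) (hint hnc), hsub] at hmono
  have hzero : ∫ τ in s..t, ‖y τ - x τ‖ ^ 2 / 2 = 0 := by
    refine le_antisymm (by linarith) (integral_nonneg hst.le fun τ _ => ?_)
    positivity
  intro τ hτ
  by_contra hne
  have hpos : 0 < ∫ τ in s..t, ‖y τ - x τ‖ ^ 2 / 2 := by
    refine integral_pos hst hnc (fun τ _ => by positivity) ⟨τ, hτ, ?_⟩
    have := norm_pos_iff.2 (sub_ne_zero.2 hne)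
    positivity
  linarith

end IsActionOn

end Extremal

/-! ### The Hessian of the length at the endpoints of a variation -/

/-- A function whose symmetric second differences are at most `K a²` to second order has second
derivative at most `K`. -/
theorem HasJet.le_of_second_difference {F : ℝ → ℝ} {v₀ v₁ v₂ K : ℝ} (hF : HasJet F v₀ v₁ v₂)
    (h : ∀ ε > 0, ∀ᶠ a in 𝓝[>] (0 : ℝ), F a + F (-a) ≤ 2 * v₀ + a ^ 2 * (K + ε)) : v₂ ≤ K := by
  obtain ⟨F₁, h0, h1, h2, h3⟩ := hF
  refine le_of_forall_pos_le_add fun ε hε => ?_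
  by_contra hcon
  push Not at hcon
  -- the difference between the two sides decreases strictly
  set η := (v₂ - K - ε) / 2 with hη
  have hη0 : 0 < η := by rw [hη]; linarith
  have h4 : ∀ᶠ a in 𝓝 (0 : ℝ), |F₁ a - v₁ - a * v₂| ≤ η / 2 * |a| := by
    have := (hasDerivAt_iff_isLittleO.1 h3).def (half_pos hη0)
    filter_upwards [this] with a ha
    simpa [h2, Real.norm_eq_abs] using ha
  have hneg : Tendsto (fun a : ℝ => -a) (𝓝 0) (𝓝 0) := by
    simpa using (continuous_neg (G := ℝ)).tendsto 0
  obtain ⟨δ, hδ, H⟩ := Metric.eventually_nhds_iff.1 ((h1.and h4).and (hneg.eventually (h1.and h4)))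
  have hmem : ∀ᶠ a in 𝓝[>] (0 : ℝ), a ∈ Ioo 0 δ := Ioo_mem_nhdsGT hδ
  obtain ⟨a, ha, ha0, haδ⟩ := ((h ε hε).and hmem).exists
  have hball : ∀ b ∈ Icc 0 a, dist b 0 < δ := fun b hb => by
    rw [Real.dist_eq, sub_zero, abs_of_nonneg hb.1]; exact hb.2.trans_lt haδ
  have hd : ∀ b ∈ Icc 0 a, HasDerivAt (fun b => F b + F (-b) - (v₂ - η) * b ^ 2)
      (F₁ b - F₁ (-b) - (v₂ - η) * (2 * b)) b := by
    intro b hb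
    obtain ⟨⟨k1, -⟩, k2, -⟩ := H (hball b hb)
    have k3 := k2.scomp b (hasDerivAt_neg b)
    have k4 := (k1.fun_add k3).fun_sub ((hasDerivAt_pow 2 b).const_mul (v₂ - η))
    refine k4.congr_deriv ?_
    simp; ring
  have hmono : MonotoneOn (fun b => F b + F (-b) - (v₂ - η) * b ^ 2) (Icc 0 a) := by
    refine monotoneOn_of_deriv_nonneg (convex_Icc _ _)
      (fun b hb => (hd b hb).continuousAt.continuousWithinAt)
      (fun b hb => (hd b (interior_subset hb)).differentiableAt.differentiableWithinAt) ?_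
    intro b hb
    rw [(hd b (interior_subset hb)).deriv]
    obtain ⟨⟨-, k1⟩, -, k2⟩ := H (hball b (interior_subset hb))
    have hb0 : 0 ≤ b := (interior_subset hb).1
    rw [abs_of_nonneg hb0] at k1
    rw [abs_neg, abs_of_nonneg hb0] at k2
    have := neg_le_of_abs_le k1
    have := le_of_abs_le k2
    have := mul_nonneg hη0.le hb0
    linarith
  have hfin := hmono (left_mem_Icc.2 ha0.le) (right_mem_Icc.2 ha0.le) ha0.le
  simp only [neg_zero, h0] at hfin
  have : 0 < η * a ^ 2 := by positivity
  have e : (v₂ - η - (K + ε)) * a ^ 2 = η * a ^ 2 := by rw [hη]; ring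
  nlinarith

section Hess

variable {n : ℕ} {M : Type*} [TopologicalSpace M] [ChartedSpace (ℝ^n) M]
  [IsManifold (𝓡 n) ∞ M]

local notation "χ" => extChartAt (𝓡 n)

/-- The second derivative of a function along a pair of curves with the 2-jets of geodesics. -/
theorem hasJet_hessProd {h₁ h₂ : Metric n M} {φ : M × M → ℝ} {c d : ℝ → M} {p q : M}
    (hφ : ContMDiffAt ((𝓡 n).prod (𝓡 n)) 𝓘(ℝ, ℝ) 2 φ (p, q))
    (hc : ContinuousAt c 0) (hc0 : c 0 = p) (hd : ContinuousAt d 0) (hd0 : d 0 = q)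
    (v : TangentSpace (𝓡 n) p) (v' : TangentSpace (𝓡 n) q)
    (hjc : HasJet (fun a => χ p (c a)) (χ p p) (coord p v)
      (-christoffelVec (metricCoeff h₁ p) (χ p p) (coord p v) (coord p v)))
    (hjd : HasJet (fun a => χ q (d a)) (χ q q) (coord q v')
      (-christoffelVec (metricCoeff h₂ q) (χ q q) (coord q v') (coord q v'))) :
    ∃ v₁, HasJet (fun a => φ (c a, d a)) (φ (p, q)) v₁ (hessProd h₁ h₂ φ p q v v' v v') := by
  set F : ℝ^n × ℝ^n → ℝ := fun z => φ ((χ p).symm z.1, (χ q).symm z.2) with hFd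
  set a := χ p p
  set b := χ q q
  have hF : ContDiffAt ℝ 2 F (a, b) := by
    rw [← contMDiffAt_iff_contDiffAt]
    have h1 : ContMDiffAt 𝓘(ℝ, ℝ^n × ℝ^n) (𝓡 n) 2 (fun z : ℝ^n × ℝ^n =>
          (χ p).symm z.1) (a, b) :=
      ContMDiffAt.comp (g := (χ p).symm) (f := Prod.fst) (a, b)
        ((contMDiffAt_chart_symm (mem_extChartAt_target p)).of_le (by norm_cast))
        contDiffAt_fst.contMDiffAt
    have h2 : ContMDiffAt 𝓘(ℝ, ℝ^n × ℝ^n) (𝓡 n) 2 (fun z : ℝ^n × ℝ^n =>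
          (χ q).symm z.2) (a, b) :=
      ContMDiffAt.comp (g := (χ q).symm) (f := Prod.snd) (a, b)
        ((contMDiffAt_chart_symm (mem_extChartAt_target q)).of_le (by norm_cast))
        contDiffAt_snd.contMDiffAt
    refine ContMDiffAt.comp (g := φ) (f := fun z => (_, _)) (a, b) ?_ (h1.prodMk h2)
    simpa [a, b] using hφ
  have hj := (hjc.prodMk hjd).comp hF
  have hev : ∀ᶠ t in 𝓝 (0 : ℝ), φ (c t, d t) = F (χ p (c t), χ q (d t)) := by
    have e1 : ∀ᶠ t in 𝓝 (0 : ℝ), c t ∈ (χ p).source :=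
      hc.eventually (by rw [hc0]; exact extChartAt_source_mem_nhds p)
    have e2 : ∀ᶠ t in 𝓝 (0 : ℝ), d t ∈ (χ q).source :=
      hd.eventually (by rw [hd0]; exact extChartAt_source_mem_nhds q)
    filter_upwards [e1, e2] with t h1 h2
    simp only [hFd, (χ p).left_inv h1, (χ q).left_inv h2]
  refine ⟨_, (hj.congr hev).cast ?_ rfl ?_⟩
  · simp [hFd, a, b]
  · rw [hessProd, ← Prod.neg_mk, map_neg, sub_eq_add_neg]

end Hess

/-! ### The flow in an ambient Euclidean space -/

section Ambient

variable {n : ℕ} {M : Type*} [TopologicalSpace M] [ChartedSpace (ℝ^n) M]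
  {W : Type*} [NormedAddCommGroup W] [InnerProductSpace ℝ W] [FiniteDimensional ℝ W]

local notation "χ" => extChartAt (𝓡 n)

/-- `f` embeds `M` smoothly in `W`, and `r` is a retraction onto `M` which is smooth near it. -/
structure IsTube (n : ℕ) {M : Type*} [TopologicalSpace M] [ChartedSpace (ℝ^n) M] {W : Type*}
    [NormedAddCommGroup W] [NormedSpace ℝ W] (f : M → W) (r : W → M) : Prop where
  left_inv : ∀ x, r (f x) = x
  smooth : ContMDiff (𝓡 n) 𝓘(ℝ, W) ∞ f
  smooth_retr : ∀ x, ContMDiffAt 𝓘(ℝ, W) (𝓡 n) ∞ r (f x)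

/-- The differential of the retraction, with the tangent space of `M` read as the model space. -/
def retrD (r : W → M) (y : W) : W →L[ℝ] ℝ^n := mfderiv 𝓘(ℝ, W) (𝓡 n) r y

variable [IsManifold (𝓡 n) ∞ M] {f : M → W} {r : W → M} {g : ℝ → Metric n M} {T : EReal}

/-- The degenerate metrics on the ambient space pulled back from the flow by the retraction. -/
def ambForm (g : ℝ → Metric n M) (r : W → M) (z : ℝ × W) : W →L[ℝ] W →L[ℝ] ℝ :=
  (innerAt (g z.1) (r z.2)).bilinearComp (retrD r z.2) (retrD r z.2)

/-- The scalar curvature as a function on the ambient space. -/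
def ambScal (g : ℝ → Metric n M) (r : W → M) (z : ℝ × W) : ℝ := scalarCurv (g z.1) (r z.2)

namespace IsTube

theorem eventually_smooth_retr (h : IsTube n f r) (x : M) :
    ∀ᶠ y in 𝓝 (f x), ContMDiffAt 𝓘(ℝ, W) (𝓡 n) 6 r y :=
  (contMDiffAt_iff_contMDiffAt_nhds (by simp)).1 ((h.smooth_retr x).of_le (by norm_cast))

theorem fderiv_chart_retr {c : M} {y : W} (hy : r y ∈ (χ c).source)
    (hr : ContMDiffAt 𝓘(ℝ, W) (𝓡 n) 1 r y) (v : W) :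
    fderiv ℝ (fun y => χ c (r y)) y v = chartD c (r y) (retrD r y v) := by
  have := mfderiv_comp y (mdifferentiableAt_chart (n := n) hy) (hr.mdifferentiableAt (by simp))
  rw [← mfderiv_eq_fderiv]
  exact DFunLike.congr_fun this v

theorem ambForm_eq {c : M} {y : W} (hy : r y ∈ (χ c).source)
    (hr : ContMDiffAt 𝓘(ℝ, W) (𝓡 n) 1 r y) (τ : ℝ) (v w : W) :
    ambForm g r (τ, y) v w = bil (flowCoeff g c (τ, χ c (r y))) (fderiv ℝ (fun y => χ c (r y)) y v)
      (fderiv ℝ (fun y => χ c (r y)) y w) := by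
  rw [fderiv_chart_retr hy hr, fderiv_chart_retr hy hr, ambForm,
    ContinuousLinearMap.bilinearComp_apply, innerAt_eq _ hy]
  rfl

theorem isLocalModel (h : IsTube n f r) (hg : IsRicciFlow g T) {τ : ℝ}
    (hτ : τ ∈ openInterval T) {c x : M} (hx : x ∈ (χ c).source) :
    IsLocalModel (ambForm g r) (ambScal g r) (fun y => f (r y))
      (openInterval T ×ˢ (χ c).target) (flowCoeff g c)
      (fun y => χ c (r y)) (fun u => f ((χ c).symm u)) (τ, f x) := by
  have hrc : ∀ᶠ y in 𝓝 (f x), r y ∈ (χ c).source := by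
    refine (h.smooth_retr x).continuousAt.eventually ?_
    rw [h.left_inv]
    exact (isOpen_extChartAt_source c).mem_nhds hx
  have hsnd : Tendsto (Prod.snd : ℝ × W → W) (𝓝 (τ, f x)) (𝓝 (f x)) := continuous_snd.tendsto _
  have hfst : Tendsto (Prod.fst : ℝ × W → ℝ) (𝓝 (τ, f x)) (𝓝 τ) := continuous_fst.tendsto _
  have ht := (isOpen_openInterval T).mem_nhds hτ
  refine ⟨hg.isFlowOn c, ⟨hτ, ?_⟩, ?_, ?_, ?_, ?_, ?_, ?_, ?_⟩
  · simp only [h.left_inv]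
    exact (χ c).map_source hx
  · have h1 : ContMDiffAt (𝓡 n) 𝓘(ℝ, ℝ^n) 6 (χ c) (r (f x)) := by
      rw [h.left_inv]
      exact (contMDiffAt_extChartAt' (n := ∞) (by simpa using hx)).of_le (by norm_cast)
    exact contMDiffAt_iff_contDiffAt.1 (h1.comp (f x) ((h.smooth_retr x).of_le (by norm_cast)))
  · simp only [h.left_inv]
    have h1 := contMDiffAt_chart_symm (n := n) ((χ c).map_source hx)
    have h2 : ContMDiffAt (𝓡 n) 𝓘(ℝ, W) ∞ f ((χ c).symm (χ c x)) := h.smooth _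
    exact contMDiffAt_iff_contDiffAt.1 ((h2.comp _ h1).of_le (by norm_cast))
  · filter_upwards [hsnd.eventually hrc, hsnd.eventually (h.eventually_smooth_retr x)]
      with z h1 h2 v w
    exact ambForm_eq h1 (h2.of_le (by norm_cast)) z.1 v w
  · filter_upwards [hsnd.eventually hrc, hfst.eventually ht] with z h1 h2
    exact hg.scalarCurv_eq (openInterval_subset T h2) h1
  · filter_upwards [hrc] with y hy
    simp only [(χ c).left_inv hy]
  · simp only [h.left_inv]
    filter_upwards [(isOpen_extChartAt_target c).mem_nhds ((χ c).map_source hx)]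
      with u hu using (χ c).right_inv hu
  · simp only [h.left_inv, (χ c).left_inv hx]

theorem isAmbientFlow (h : IsTube n f r) (hg : IsRicciFlow g T) :
    IsAmbientFlow n (ambForm g r) (ambScal g r) (fun y => f (r y)) (openInterval T) (range f) := by
  rintro τ hτ _ ⟨x, rfl⟩
  exact ⟨_, _, _, _, h.isLocalModel hg hτ (mem_extChartAt_source (I := 𝓡 n) x)⟩

/-- A `C¹` curve in the ambient space near `M` retracts to a `C¹` path. -/
theorem velocity_comp {Y w : ℝ → W} {s t : ℝ} (hst : s < t)
    (hY : ∀ τ ∈ Icc s t, HasDerivWithinAt Y (w τ) (Icc s t) τ) (hw : ContinuousOn w (Icc s t))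
    (hr : ∀ τ ∈ Icc s t, ContMDiffAt 𝓘(ℝ, W) (𝓡 n) 1 r (Y τ)) :
    ContMDiffOn 𝓘(ℝ, ℝ) (𝓡 n) 1 (fun τ => r (Y τ)) (Icc s t) ∧
    ∀ τ ∈ Icc s t, velocity (n := n) (fun τ => r (Y τ)) s t τ = retrD r (Y τ) (w τ) := by
  have hu := uniqueDiffOn_Icc hst
  have hY1 : ContDiffOn ℝ 1 Y (Icc s t) := by
    rw [contDiffOn_one_iff_derivWithin hu]
    exact ⟨fun τ hτ => (hY τ hτ).differentiableWithinAt,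
      hw.congr fun τ hτ => (hY τ hτ).derivWithin (hu τ hτ)⟩
  refine ⟨fun τ hτ => (hr τ hτ).comp_contMDiffWithinAt τ (hY1.contMDiffOn τ hτ), fun τ hτ => ?_⟩
  have h1 := mfderiv_comp_mfderivWithin τ ((hr τ hτ).mdifferentiableAt (by simp))
    ((hY1.contMDiffOn τ hτ).mdifferentiableWithinAt (by simp))
    (hu.uniqueMDiffOn τ hτ)
  have h2 : mfderivWithin 𝓘(ℝ, ℝ) 𝓘(ℝ, W) Y (Icc s t) τ (1 : ℝ) = w τ := by
    rw [mfderivWithin_eq_fderivWithin]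
    exact (fderivWithin_derivWithin (f := Y) (x := τ) (s := Icc s t)).trans
      ((hY τ hτ).derivWithin (hu τ hτ))
  rw [← h2]
  exact DFunLike.congr_fun h1 (1 : ℝ)

theorem pathLength_comp {Y w : ℝ → W} {s t : ℝ} (hst : s < t)
    (hY : ∀ τ ∈ Icc s t, HasDerivWithinAt Y (w τ) (Icc s t) τ) (hw : ContinuousOn w (Icc s t))
    (hr : ∀ τ ∈ Icc s t, ContMDiffAt 𝓘(ℝ, W) (𝓡 n) 1 r (Y τ)) :
    pathLength g s t (fun τ => r (Y τ)) =
      ∫ τ in s..t, lag (ambForm g r) (ambScal g r) (τ, Y τ) (1, w τ) := by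
  refine integral_congr fun τ hτ => ?_
  rw [uIcc_of_le hst.le] at hτ
  simp only [(velocity_comp hst hY hw hr).2 τ hτ, lag, one_pow, one_mul]
  rfl

/-- A `C¹` path as a curve in the ambient space. -/
theorem exists_lift (h : IsTube n f r) {γ : ℝ → M} {s t : ℝ} (hst : s < t)
    (hγ : ContMDiffOn 𝓘(ℝ, ℝ) (𝓡 n) 1 γ (Icc s t)) :
    ∃ w : ℝ → W, (∀ τ ∈ Icc s t, HasDerivWithinAt (fun τ => f (γ τ)) (w τ) (Icc s t) τ) ∧
      ContinuousOn w (Icc s t) ∧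
      (∀ τ ∈ Icc s t, fderiv ℝ (fun y => f (r y)) (f (γ τ)) (w τ) = w τ) ∧
      (∀ τ ∈ Icc s t, velocity (n := n) γ s t τ = retrD (n := n) r (f (γ τ)) (w τ)) ∧
      pathLength g s t γ = ∫ τ in s..t, lag (ambForm g r) (ambScal g r) (τ, f (γ τ)) (1, w τ) := by
  have hu := uniqueDiffOn_Icc hst
  have h1 : ContDiffOn ℝ 1 (fun τ => f (γ τ)) (Icc s t) := contMDiffOn_iff_contDiffOn.1
    ((h.smooth.of_le (by norm_cast)).comp_contMDiffOn hγ)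
  have h2 := (contDiffOn_one_iff_derivWithin hu).1 h1
  have hY : ∀ τ ∈ Icc s t, HasDerivWithinAt (fun τ => f (γ τ))
      (derivWithin (fun τ => f (γ τ)) (Icc s t) τ) (Icc s t) τ := fun τ hτ =>
    (h2.1 τ hτ).hasDerivWithinAt
  have hr : ∀ τ ∈ Icc s t, ContMDiffAt 𝓘(ℝ, W) (𝓡 n) 1 r (f (γ τ)) := fun τ _ =>
    (h.smooth_retr _).of_le (by norm_cast)
  have he : (fun τ => r (f (γ τ))) = γ := funext fun τ => h.left_inv _
  have hv := (velocity_comp hst hY h2.2 hr).2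
  have hp := pathLength_comp (g := g) hst hY h2.2 hr
  rw [he] at hv hp
  refine ⟨_, hY, h2.2, fun τ hτ => ?_, hv, hp⟩
  have h3 : DifferentiableAt ℝ (fun y => f (r y)) (f (γ τ)) := by
    have : ContMDiffAt 𝓘(ℝ, W) 𝓘(ℝ, W) ∞ (fun y => f (r y)) (f (γ τ)) :=
      (h.smooth (r (f (γ τ)))).comp (f (γ τ)) (h.smooth_retr (γ τ))
    exact (contMDiffAt_iff_contDiffAt.1 this).differentiableAt (by simp)
  have h4 := h3.hasFDerivAt.comp_hasDerivWithinAt τ (hY τ hτ)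
  have h5 : (fun y => f (r y)) ∘ (fun τ => f (γ τ)) = fun τ => f (γ τ) :=
    funext fun τ => by simp only [Function.comp_apply, h.left_inv]
  rw [h5] at h4
  exact (hu τ hτ).eq_deriv _ h4 (hY τ hτ)

end IsTube

/-- The path in `M` obtained by varying the curve `Y` in the direction of the field `σ`, moved back
in time by `κ a² / 2`. -/
def varPath (g : ℝ → Metric n M) (f : M → W) (r : W → M) (κ : ℝ) (Y σ : ℝ → W) (a τ : ℝ) : M :=
  r (varPos (ambForm g r) (fun y => f (r y)) a (τ + κ * (a ^ 2 / 2), Y (τ + κ * (a ^ 2 / 2)))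
    (σ (τ + κ * (a ^ 2 / 2))))

namespace IsTube

theorem isCompact_range [CompactSpace M] (h : IsTube n f r) : IsCompact (range f) :=
  _root_.isCompact_range h.smooth.continuous

theorem eventually_smooth_retr_one (h : IsTube n f r) :
    ∀ y ∈ range f, ∀ᶠ y' in 𝓝 y, ContMDiffAt 𝓘(ℝ, W) (𝓡 n) 1 r y' := by
  rintro _ ⟨x, rfl⟩
  filter_upwards [h.eventually_smooth_retr x] with y hy using hy.of_le (by norm_cast)

/-- The trace of the second variation of `𝓛` along a curve: the integral of the time derivative of
the Lagrangian, up to a uniform cubic error. -/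
theorem exists_variation [CompactSpace M] (h : IsTube n f r) (hg : IsRicciFlow g T)
    {J : Set ℝ} (hJ : IsCompact J) (hJT : J ⊆ openInterval T) (κ D : ℝ) :
    ∃ C δ : ℝ, 0 ≤ C ∧ 0 < δ ∧ ∀ s t : ℝ, s < t → Icc s t ⊆ J → ∀ Y w : ℝ → W,
      (∀ τ ∈ Icc s t, HasDerivWithinAt Y (w τ) (Icc s t) τ) → ContinuousOn w (Icc s t) →
      (∀ τ ∈ Icc s t, Y τ ∈ range f) →
      (∀ τ ∈ Icc s t, fderiv ℝ (fun y => f (r y)) (Y τ) (w τ) = w τ) →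
      ∀ σ : Fin n → ℝ → W,
      (∀ i, ∀ τ ∈ Icc s t, HasDerivWithinAt (σ i) (extTransport (ambForm g r) (fun y => f (r y))
        ((τ, Y τ), σ i τ, (1, w τ))) (Icc s t) τ) →
      (∀ τ ∈ Icc s t, ∀ i j, ambForm g r (τ, Y τ) (σ i τ) (σ j τ) = if i = j then 1 else 0) →
      (∀ i, ∀ τ ∈ Icc s t, ‖σ i τ‖ ≤ D) → ∀ a : ℝ, |a| ≤ δ →
      (∀ i, ContMDiffOn 𝓘(ℝ, ℝ) (𝓡 n) 1 (varPath g f r κ Y (σ i) a)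
        (Icc (s - κ * (a ^ 2 / 2)) (t - κ * (a ^ 2 / 2)))) ∧
      |∑ i, (pathLength g (s - κ * (a ^ 2 / 2)) (t - κ * (a ^ 2 / 2)) (varPath g f r κ Y (σ i) a) +
          pathLength g (s - κ * (a ^ 2 / 2)) (t - κ * (a ^ 2 / 2)) (varPath g f r κ Y (σ i) (-a))) -
        2 * n * (∫ τ in s..t, lag (ambForm g r) (ambScal g r) (τ, Y τ) (1, w τ)) -
        (1 - n * κ) * a ^ 2 * ∫ τ in s..t, lagTime (ambForm g r) (ambScal g r) (τ, Y τ) (1, w τ)| ≤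
      C * |a| ^ 3 * ∫ τ in s..t, (1 + ‖w τ‖ ^ 2) := by
  have hA := (h.isAmbientFlow hg).mono hJT
  obtain ⟨C, δ₁, hC, hδ₁, H1⟩ := hA.exists_uniform_second_variation hJ h.isCompact_range κ D
  obtain ⟨δ₂, hδ₂, H2⟩ := hA.exists_varPos_regular hJ h.isCompact_range
    h.eventually_smooth_retr_one κ D
  refine ⟨C, min δ₁ δ₂, hC, lt_min hδ₁ hδ₂, ?_⟩
  intro s t hst hsJ Y w hY hw hYK hwt σ hσ ho hσD a ha
  set B := ambForm g r with hB
  set R := ambScal g r with hR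
  set ρ : W → W := fun y => f (r y) with hρ
  have hYc : ContinuousOn Y (Icc s t) := fun τ hτ => (hY τ hτ).continuousWithinAt
  have hσc : ∀ i, ContinuousOn (σ i) (Icc s t) := fun i τ hτ => (hσ i τ hτ).continuousWithinAt
  -- a single varied path
  have key : ∀ (a : ℝ), |a| ≤ δ₂ → ∀ i, ContMDiffOn 𝓘(ℝ, ℝ) (𝓡 n) 1 (varPath g f r κ Y (σ i) a)
        (Icc (s - κ * (a ^ 2 / 2)) (t - κ * (a ^ 2 / 2))) ∧
      pathLength g (s - κ * (a ^ 2 / 2)) (t - κ * (a ^ 2 / 2)) (varPath g f r κ Y (σ i) a) =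
        ∫ τ in s..t, varLag B R ρ κ a (τ, Y τ) (σ i τ) (1, w τ) ∧
      ContinuousOn (fun τ => varLag B R ρ κ a (τ, Y τ) (σ i τ) (1, w τ)) (Icc s t) := by
    intro a ha i
    set θ := κ * (a ^ 2 / 2) with hθ
    set P : ℝ → W := fun τ => varPos B ρ a (τ, Y τ) (σ i τ) with hP
    set V : ℝ → W := fun τ => varVel B ρ a (τ, Y τ) (σ i τ) (1, w τ) with hV
    have hPd : ∀ τ ∈ Icc s t, HasDerivWithinAt P (V τ) (Icc s t) τ := by
      intro τ hτ
      obtain ⟨O, G, ψ, F, hm⟩ := hA τ (hsJ hτ) _ (hYK τ hτ)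
      exact hm.hasDerivWithinAt_varPos a (hY τ hτ) (hσ i τ hτ)
    have hVc : ContinuousOn V (Icc s t) := by
      intro τ hτ
      obtain ⟨O, G, ψ, F, hm⟩ := hA τ (hsJ hτ) _ (hYK τ hτ)
      exact hm.continuousWithinAt_varVel a (hYc τ hτ) (hσc i τ hτ) (hw τ hτ)
    have hreg := fun τ hτ => H2 τ (hsJ hτ) _ (hYK τ hτ) (σ i τ) (hσD i τ hτ) a ha
    have hmap : MapsTo (fun τ => τ + θ) (Icc (s - θ) (t - θ)) (Icc s t) := fun τ hτ =>
      ⟨by linarith [hτ.1], by linarith [hτ.2]⟩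
    have hPd' : ∀ τ ∈ Icc (s - θ) (t - θ), HasDerivWithinAt (fun τ => P (τ + θ)) (V (τ + θ))
        (Icc (s - θ) (t - θ)) τ := by
      intro τ hτ
      have h1 : HasDerivWithinAt (fun τ => τ + θ) 1 (Icc (s - θ) (t - θ)) τ :=
        (hasDerivWithinAt_id _ _).add_const θ
      simpa [Function.comp_def] using (hPd _ (hmap hτ)).scomp τ h1 hmap
    have hVc' : ContinuousOn (fun τ => V (τ + θ)) (Icc (s - θ) (t - θ)) :=
      hVc.comp (by fun_prop) hmap
    have hsm : ∀ τ ∈ Icc (s - θ) (t - θ), ContMDiffAt 𝓘(ℝ, W) (𝓡 n) 1 r (P (τ + θ)) :=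
      fun τ hτ => (hreg _ (hmap hτ)).1
    have hlt : s - θ < t - θ := by linarith
    refine ⟨(velocity_comp hlt hPd' hVc' hsm).1, ?_, ?_⟩
    · have h1 := pathLength_comp (g := g) hlt hPd' hVc' hsm
      have h2 := integral_comp_add_right (a := s - θ) (b := t - θ)
        (fun τ => varLag B R ρ κ a (τ, Y τ) (σ i τ) (1, w τ)) θ
      rw [sub_add_cancel, sub_add_cancel] at h2
      rw [← h2]
      refine h1.trans (integral_congr fun τ _ => ?_)
      simp only [lag, varLag, hP, hV, ← hθ, add_sub_cancel_right, one_pow, one_mul, hB, hR]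
    · intro τ hτ
      have c1 : ContinuousWithinAt (fun τ => (τ - θ, P τ)) (Icc s t) τ :=
        (continuousWithinAt_id.sub continuousWithinAt_const).prodMk (hPd τ hτ).continuousWithinAt
      have c2 : ContinuousWithinAt (fun τ => B (τ - θ, P τ)) (Icc s t) τ :=
        ContinuousAt.comp_continuousWithinAt (g := B) (hreg τ hτ).2.1 c1
      have c3 : ContinuousWithinAt (fun τ => R (τ - θ, P τ)) (Icc s t) τ :=
        ContinuousAt.comp_continuousWithinAt (g := R) (hreg τ hτ).2.2 c1
      exact (continuousWithinAt_const.mul c3).add ((c2.clm_apply (hVc τ hτ)).clm_apply (hVc τ hτ))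
  have ha1 : |a| ≤ δ₁ := ha.trans (min_le_left _ _)
  have ha2 : |a| ≤ δ₂ := ha.trans (min_le_right _ _)
  have ha3 : |(-a)| ≤ δ₂ := by rwa [abs_neg]
  refine ⟨fun i => (key a ha2 i).1, ?_⟩
  have kp := fun i => key a ha2 i
  have kn := fun i => key (-a) ha3 i
  simp only [neg_sq] at kn
  simp only [(kp _).2.1, (kn _).2.1]
  have hint : ∀ {φ : ℝ → ℝ}, ContinuousOn φ (Icc s t) → IntervalIntegrable φ volume s t :=
    (·.intervalIntegrable_of_Icc hst.le)
  have i1 := fun i => hint (kp i).2.2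
  have i2 := fun i => hint (kn i).2.2
  have i3 := hint (hA.continuousOn_lag hsJ hYc hw hYK)
  have i4 := hint (hA.continuousOn_lagTime hsJ hYc hw hYK)
  have i5 : IntervalIntegrable (fun τ => ∑ i, (varLag B R ρ κ a (τ, Y τ) (σ i τ) (1, w τ) +
      varLag B R ρ κ (-a) (τ, Y τ) (σ i τ) (1, w τ))) volume s t :=
    hint (continuousOn_finsetSum _ fun i _ => (kp i).2.2.add (kn i).2.2)
  have e1 : ∑ i, ((∫ τ in s..t, varLag B R ρ κ a (τ, Y τ) (σ i τ) (1, w τ)) +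
      ∫ τ in s..t, varLag B R ρ κ (-a) (τ, Y τ) (σ i τ) (1, w τ)) =
      ∫ τ in s..t, ∑ i, (varLag B R ρ κ a (τ, Y τ) (σ i τ) (1, w τ) +
        varLag B R ρ κ (-a) (τ, Y τ) (σ i τ) (1, w τ)) := by
    rw [integral_finsetSum fun i _ => (i1 i).add (i2 i)]
    exact sum_congr rfl fun i _ => (integral_add (i1 i) (i2 i)).symm
  rw [e1, ← integral_const_mul, ← integral_const_mul, ← integral_sub i5 (i3.const_mul _),
    ← integral_sub (i5.sub (i3.const_mul _)) (i4.const_mul _),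
    ← integral_const_mul]
  refine (abs_integral_le_integral_abs hst.le).trans (integral_mono_on hst.le ?_ ?_ fun τ hτ => ?_)
  · exact ((i5.sub (i3.const_mul _)).sub (i4.const_mul _)).abs
  · exact hint (continuousOn_const.mul (continuousOn_const.add (hw.norm.pow 2)))
  · refine (H1 τ (hsJ hτ) _ (hYK τ hτ) (fun i => σ i τ) (fun i => hσD i τ hτ) (ho τ hτ)
      (1, w τ) (hwt τ hτ) a ha1).trans ?_
    refine mul_le_mul_of_nonneg_left ?_ (by positivity)
    rw [Prod.norm_def]
    simp only [norm_one]
    rcases max_cases 1 ‖w τ‖ with h1 | h1 <;> rw [h1.1] <;> nlinarith [norm_nonneg (w τ)]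

end IsTube

/-! ### Regularity up to the initial time, and existence of paths -/

namespace IsTube

theorem contDiffAt_chart_retr (h : IsTube n f r) (x : M) :
    ContDiffAt ℝ 6 (fun y => χ x (r y)) (f x) := by
  have h1 : ContMDiffAt (𝓡 n) 𝓘(ℝ, ℝ^n) 6 (χ x) (r (f x)) := by
    rw [h.left_inv]
    exact (contMDiffAt_extChartAt (n := ∞)).of_le (by norm_cast)
  exact contMDiffAt_iff_contDiffAt.1 (h1.comp (f x) ((h.smooth_retr x).of_le (by norm_cast)))

theorem continuousOn_ambForm (h : IsTube n f r) (hg : IsRicciFlow g T) :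
    ContinuousOn (ambForm g r) (timeInterval T ×ˢ range f) := by
  rintro ⟨τ, _⟩ ⟨hτ, ⟨x, rfl⟩⟩
  set S : Set (ℝ × W) := timeInterval T ×ˢ range f with hS
  have hτ : τ ∈ timeInterval T := hτ
  have hψ := h.contDiffAt_chart_retr x
  have hrc : ∀ᶠ y in 𝓝 (f x), r y ∈ (χ x).source := by
    refine (h.smooth_retr x).continuousAt.eventually ?_
    rw [h.left_inv]
    exact (isOpen_extChartAt_source x).mem_nhds (mem_extChartAt_source x)
  have hsnd : Tendsto (Prod.snd : ℝ × W → W) (𝓝[S] (τ, f x)) (𝓝 (f x)) :=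
    (continuous_snd.tendsto _).mono_left nhdsWithin_le_nhds
  have hev : ∀ᶠ z in 𝓝[S] (τ, f x), ambForm g r z =
      (bil (flowCoeff g x (z.1, χ x (r z.2)))).bilinearComp
      (fderiv ℝ (fun y => χ x (r y)) z.2)
      (fderiv ℝ (fun y => χ x (r y)) z.2) := by
    filter_upwards [hsnd.eventually hrc, hsnd.eventually (h.eventually_smooth_retr x)] with z h1 h2
    ext v w
    exact ambForm_eq h1 (h2.of_le (by norm_cast)) z.1 v w
  have hG : ∀ i j, ContinuousWithinAt (fun z : ℝ × W =>
      flowCoeff g x (z.1, χ x (r z.2)) i j) S (τ, f x) := by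
    intro i j
    have h1 : ContinuousWithinAt (fun z : ℝ × ℝ^n => flowCoeff g x z i j)
        (timeInterval T ×ˢ (χ x).target) (τ, χ x (r (f x))) := by
      refine (hg.smooth x i j).continuousOn _ ⟨hτ, ?_⟩
      rw [h.left_inv]
      exact mem_extChartAt_target x
    refine ContinuousWithinAt.comp_of_preimage_mem_nhdsWithin
      (g := fun z : ℝ × ℝ^n => flowCoeff g x z i j)
      (f := fun z : ℝ × W => (z.1, χ x (r z.2))) h1 ?_ ?_
    · exact (continuousAt_fst.prodMk (ContinuousAt.comp (g := fun y => χ x (r y))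
        hψ.continuousAt continuousAt_snd)).continuousWithinAt
    · filter_upwards [self_mem_nhdsWithin, hsnd.eventually hrc] with z hz hz2
      exact ⟨hz.1, (χ x).map_source hz2⟩
  have hD : ContinuousWithinAt (fun z : ℝ × W =>
      fderiv ℝ (fun y => χ x (r y)) z.2) S (τ, f x) :=
    (ContinuousAt.comp (g := fderiv ℝ (fun y => χ x (r y))) (f := Prod.snd)
      (x := (τ, f x)) (hψ.fderiv_right (m := 5) (by norm_num)).continuousAt
      continuousAt_snd).continuousWithinAt
  have hbil : ContinuousWithinAt (fun z : ℝ × W =>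
      bil (flowCoeff g x (z.1, χ x (r z.2)))) S (τ, f x) := by
    unfold bil
    refine tendsto_finsetSum _ fun i _ => tendsto_finsetSum _ fun j _ => ?_
    exact (hG i j).smul continuousWithinAt_const
  have h1 : ContinuousWithinAt (fun z : ℝ × W =>
      (bil (flowCoeff g x (z.1, χ x (r z.2)))).bilinearComp
      (fderiv ℝ (fun y => χ x (r y)) z.2)
      (fderiv ℝ (fun y => χ x (r y)) z.2)) S (τ, f x) :=
    (ContinuousLinearMap.flipₗᵢ ℝ W W ℝ).continuous.continuousAt.comp_continuousWithinAt
      (((ContinuousLinearMap.flipₗᵢ ℝ W ℝ^n ℝ).continuous.continuousAt.comp_continuousWithinAt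
        (hbil.clm_comp hD)).clm_comp hD)
  exact h1.congr_of_eventuallyEq hev (hev.self_of_nhdsWithin ⟨hτ, ⟨x, rfl⟩⟩)

theorem continuousOn_scalarCurv (hg : IsRicciFlow g T) :
    ContinuousOn (fun z : ℝ × M => scalarCurv (g z.1) z.2) (timeInterval T ×ˢ univ) := by
  rintro ⟨τ, x⟩ ⟨hτ, -⟩
  have hτ : τ ∈ timeInterval T := hτ
  have hsnd : Tendsto (Prod.snd : ℝ × M → M) (𝓝[timeInterval T ×ˢ univ] (τ, x)) (𝓝 x) :=
    (continuous_snd.tendsto _).mono_left nhdsWithin_le_nhds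
  have hs := (isOpen_extChartAt_source (I := 𝓡 n) x).mem_nhds (mem_extChartAt_source x)
  have hev : ∀ᶠ z in 𝓝[timeInterval T ×ˢ univ] (τ, x), scalarCurv (g z.1) z.2 =
      scal (flowCoeff g x) (z.1, χ x z.2) := by
    filter_upwards [self_mem_nhdsWithin, hsnd.eventually hs] with z hz hz2
    exact hg.scalarCurv_eq hz.1 hz2
  have h1 : ContinuousWithinAt (fun z : ℝ × M =>
      scal (flowCoeff g x) (z.1, χ x z.2)) (timeInterval T ×ˢ univ) (τ, x) := by
    refine ContinuousWithinAt.comp_of_preimage_mem_nhdsWithin (g := scal (flowCoeff g x))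
      (f := fun z : ℝ × M => (z.1, χ x z.2))
      (hg.continuousOn_scal x _ ⟨hτ, mem_extChartAt_target x⟩) ?_ ?_
    · exact (continuousAt_fst.prodMk (ContinuousAt.comp (g := χ x)
        (continuousAt_extChartAt x) continuousAt_snd)).continuousWithinAt
    · filter_upwards [self_mem_nhdsWithin, hsnd.eventually hs] with z hz hz2
      exact ⟨hz.1, (χ x).map_source hz2⟩
  exact h1.congr_of_eventuallyEq hev (hev.self_of_nhdsWithin ⟨hτ, mem_univ _⟩)

theorem continuousOn_ambScal (h : IsTube n f r) (hg : IsRicciFlow g T) :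
    ContinuousOn (ambScal g r) (timeInterval T ×ˢ range f) := by
  rintro ⟨τ, _⟩ ⟨hτ, ⟨x, rfl⟩⟩
  have hτ : τ ∈ timeInterval T := hτ
  have h1 := continuousOn_scalarCurv (n := n) hg (τ, r (f x)) ⟨hτ, mem_univ _⟩
  refine ContinuousWithinAt.comp (g := fun z : ℝ × M => scalarCurv (g z.1) z.2)
    (f := fun z : ℝ × W => (z.1, r z.2)) (x := (τ, f x)) h1 ?_ fun z hz => ⟨hz.1, mem_univ _⟩
  exact (continuousAt_fst.prodMk (ContinuousAt.comp (g := r)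
    (h.smooth_retr x).continuousAt continuousAt_snd)).continuousWithinAt

theorem contDiffAt_retr (h : IsTube n f r) (x : M) : ContDiffAt ℝ ∞ (fun y => f (r y)) (f x) := by
  have h1 : ContMDiffAt 𝓘(ℝ, W) 𝓘(ℝ, W) ∞ (fun y => f (r y)) (f x) :=
    (h.smooth (r (f x))).comp (f x) (h.smooth_retr x)
  exact contMDiffAt_iff_contDiffAt.1 h1

theorem continuousOn_lag (h : IsTube n f r) (hg : IsRicciFlow g T) {s t : ℝ}
    (hst : Icc s t ⊆ timeInterval T) {Y w : ℝ → W} (hY : ContinuousOn Y (Icc s t))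
    (hw : ContinuousOn w (Icc s t)) (hYK : ∀ τ ∈ Icc s t, Y τ ∈ range f) :
    ContinuousOn (fun τ => lag (ambForm g r) (ambScal g r) (τ, Y τ) (1, w τ)) (Icc s t) := by
  have h1 : ContinuousOn (fun τ => (τ, Y τ)) (Icc s t) := continuousOn_id.prodMk hY
  have h2 : ContinuousOn (fun τ => ambForm g r (τ, Y τ)) (Icc s t) :=
    (h.continuousOn_ambForm hg).comp h1 fun τ hτ => ⟨hst hτ, hYK τ hτ⟩
  have h3 : ContinuousOn (fun τ => ambScal g r (τ, Y τ)) (Icc s t) :=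
    (h.continuousOn_ambScal hg).comp h1 fun τ hτ => ⟨hst hτ, hYK τ hτ⟩
  have h4 : ContinuousOn (fun τ => ((1 : ℝ), w τ).1 ^ 2) (Icc s t) := by
    simp only [one_pow]; exact continuousOn_const
  unfold lag
  exact ContinuousOn.add (ContinuousOn.mul h4 h3) ((h2.clm_apply hw).clm_apply hw)

theorem exists_coercive [CompactSpace M] (h : IsTube n f r) (hg : IsRicciFlow g T)
    {J : Set ℝ} (hJ : IsCompact J) (hJT : J ⊆ timeInterval T) :
    ∃ c : ℝ, 0 < c ∧ ∀ τ ∈ J, ∀ y ∈ range f, ∀ v : W, fderiv ℝ (fun y => f (r y)) y v = v →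
      c * ‖v‖ ^ 2 ≤ ambForm g r (τ, y) v v := by
  obtain ⟨c, hc, H⟩ := exists_pos_mul_norm_sq_le (hJ.prod h.isCompact_range)
    (D := fun z => fderiv ℝ (fun y => f (r y)) z.2)
    ((h.continuousOn_ambForm hg).mono (prod_mono hJT subset_rfl)) (by
      rintro ⟨τ, _⟩ ⟨hτ, ⟨x, rfl⟩⟩
      exact (ContinuousAt.comp (g := fderiv ℝ (fun y => f (r y))) (f := Prod.snd)
        ((h.contDiffAt_retr x).fderiv_right (m := ∞) (by simp)).continuousAt
        continuous_snd.continuousAt).continuousWithinAt) (by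
      rintro ⟨τ, _⟩ ⟨hτ, ⟨x, rfl⟩⟩ v h0 hv
      have h2 : MDifferentiableAt 𝓘(ℝ, W) (𝓡 n) r (f x) :=
        (h.smooth_retr x).mdifferentiableAt (by simp)
      have h3 : MDifferentiableAt (𝓡 n) 𝓘(ℝ, W) f (r (f x)) :=
        (h.smooth _).mdifferentiableAt (by simp)
      have h4 := DFunLike.congr_fun (mfderiv_comp (f x) h3 h2) v
      refine (g τ).pos (r (f x)) (retrD r (f x) v) fun h5 => h0 ?_
      rw [← hv, ← mfderiv_eq_fderiv]
      refine h4.trans ?_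
      have h6 : mfderiv 𝓘(ℝ, W) (𝓡 n) r (f x) v = 0 := h5
      exact (congrArg (mfderiv (𝓡 n) 𝓘(ℝ, W) f (r (f x))) h6).trans (map_zero _))
  exact ⟨c, hc, fun τ hτ y hy v hv => H (τ, y) ⟨hτ, hy⟩ v hv⟩

theorem ambForm_nonneg (z : ℝ × W) (v : W) : 0 ≤ ambForm g r z v v := by
  by_cases h0 : retrD (n := n) r z.2 v = 0
  · simp [ambForm, h0]
  · exact ((g z.1).pos (r z.2) (retrD r z.2 v) h0).le

end IsTube

theorem exists_bound_scalarCurv [CompactSpace M] (hg : IsRicciFlow g T) {J : Set ℝ}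
    (hJ : IsCompact J) (hJT : J ⊆ timeInterval T) :
    ∃ C : ℝ, 0 ≤ C ∧ ∀ τ ∈ J, ∀ x : M, |scalarCurv (g τ) x| ≤ C := by
  obtain ⟨C, hC⟩ := (hJ.prod isCompact_univ).exists_bound_of_continuousOn
    ((IsTube.continuousOn_scalarCurv (n := n) (M := M) hg).mono (prod_mono hJT subset_rfl))
  exact ⟨max C 0, le_max_right _ _, fun τ hτ x =>
    (hC (τ, x) ⟨hτ, mem_univ _⟩).trans (le_max_left _ _)⟩

theorem inner_self_nonneg (h : Metric n M) (x : M) (v : TangentSpace (𝓡 n) x) :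
    0 ≤ h.inner x v v := by
  by_cases h0 : v = 0
  · simp [h0]
  · exact (h.pos x v h0).le

theorem neg_le_pathLength {s t C : ℝ} (hst : s ≤ t) (hC : 0 ≤ C)
    (hb : ∀ τ ∈ Icc s t, ∀ x : M, |scalarCurv (g τ) x| ≤ C) (γ : ℝ → M) :
    -(C * (t - s)) ≤ pathLength g s t γ := by
  unfold pathLength
  by_cases hi : IntervalIntegrable (fun τ => scalarCurv (g τ) (γ τ) +
      (g τ).inner (γ τ) (velocity γ s t τ) (velocity γ s t τ)) volume s t
  · have h1 : ∫ _ in s..t, -C ≤ ∫ τ in s..t, (scalarCurv (g τ) (γ τ) +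
        (g τ).inner (γ τ) (velocity γ s t τ) (velocity γ s t τ)) := by
      refine integral_mono_on hst (by simp) hi fun τ hτ => ?_
      have h1 := neg_le_of_abs_le (hb τ hτ (γ τ))
      have h2 := inner_self_nonneg (g τ) (γ τ) (velocity γ s t τ)
      linarith
    rw [integral_const, smul_eq_mul] at h1
    linarith
  · rw [integral_undef hi]
    have := mul_nonneg hC (sub_nonneg.2 hst)
    linarith

theorem bddBelow_pathLength [CompactSpace M] (hg : IsRicciFlow g T) {s t : ℝ} (hst : s ≤ t)
    (hsT : Icc s t ⊆ timeInterval T) : ∃ m : ℝ, m ≤ 0 ∧ ∀ γ : ℝ → M, m ≤ pathLength g s t γ := by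
  obtain ⟨C, hC, hb⟩ := exists_bound_scalarCurv hg isCompact_Icc hsT
  exact ⟨-(C * (t - s)), by nlinarith [mul_nonneg hC (sub_nonneg.2 hst)],
    neg_le_pathLength hst hC hb⟩

theorem L_le_pathLength [CompactSpace M] (hg : IsRicciFlow g T) {s t : ℝ} (hst : s ≤ t)
    (hsT : Icc s t ⊆ timeInterval T) {p q : M} {γ : ℝ → M} (hγ : IsPath n p s q t γ) :
    L g p s q t ≤ pathLength g s t γ := by
  obtain ⟨m, -, hm⟩ := bddBelow_pathLength hg hst hsT
  exact csInf_le ⟨m, by rintro _ ⟨σ, -, rfl⟩; exact hm σ⟩ ⟨γ, hγ, rfl⟩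

theorem bddBelow_range_L [CompactSpace M] (hg : IsRicciFlow g T) {s t : ℝ} (hst : s ≤ t)
    (hsT : Icc s t ⊆ timeInterval T) : BddBelow (range fun z : M × M => L g z.1 s z.2 t) := by
  obtain ⟨m, hm0, hm⟩ := bddBelow_pathLength hg hst hsT
  refine ⟨m, ?_⟩
  rintro _ ⟨z, rfl⟩
  exact Real.le_sInf (by rintro _ ⟨σ, -, rfl⟩; exact hm σ) hm0

theorem infL_le_pathLength [CompactSpace M] (hg : IsRicciFlow g T) {A t : ℝ} (hA : 0 ≤ A)
    (hsT : Icc t (t + A) ⊆ timeInterval T) {γ : ℝ → M}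
    (hγ : ContMDiffOn 𝓘(ℝ, ℝ) (𝓡 n) 1 γ (Icc t (t + A))) :
    infL g A t ≤ pathLength g t (t + A) γ :=
  (ciInf_le (bddBelow_range_L hg (by linarith) hsT) (γ t, γ (t + A))).trans
    (L_le_pathLength hg (by linarith) hsT ⟨hγ, rfl, rfl⟩)

/-! ### The traced soliton equation -/

/-- The tangent vector of `M` at `x` which is the image of the ambient vector `σ`. -/
def tangentOf (f : M → W) (r : W → M) (x : M) (σ : W) : TangentSpace (𝓡 n) x :=
  retrD (n := n) r (f x) σ

namespace IsTube

theorem coord_tangentOf (h : IsTube n f r) {c x : M} (hx : x ∈ (χ c).source) (σ : W) :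
    coord c (tangentOf (n := n) f r x σ) = fderiv ℝ (fun y => χ c (r y)) (f x) σ := by
  rw [fderiv_chart_retr (by rwa [h.left_inv]) ((h.smooth_retr x).of_le (by norm_cast)), h.left_inv]
  rfl

variable (h : IsTube n f r) (hg : IsRicciFlow g T)

include h hg

/-- The endpoints of a variation move along curves with the 2-jets of geodesics. -/
theorem hasJet_varPos {τ : ℝ} (hτ : τ ∈ openInterval T) (x : M) (σ : W) :
    HasJet (fun a => χ x (r (varPos (ambForm g r) (fun y => f (r y)) a (τ, f x) σ)))
      (χ x x) (coord x (tangentOf (n := n) f r x σ))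
      (-christoffelVec (metricCoeff (g τ) x) (χ x x)
        (coord x (tangentOf (n := n) f r x σ)) (coord x (tangentOf (n := n) f r x σ))) := by
  have hm := h.isLocalModel hg hτ (mem_extChartAt_source (I := 𝓡 n) x)
  have h1 := (hasJet_quadratic (f x) σ
    (extAcc (ambForm g r) (fun y => f (r y)) (τ, f x, σ))).comp (hm.smooth.of_le (by norm_cast))
  have h2 := hm.extAcc_eq σ
  rw [h.coord_tangentOf (mem_extChartAt_source x)]
  refine h1.cast (by simp only [h.left_inv]) rfl (h2.trans ?_)
  rw [chrL_apply]
  simp only [h.left_inv]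
  rfl

omit hg in
theorem continuousAt_varPos (g : ℝ → Metric n M) (τ : ℝ) (x : M) (σ : W) : ContinuousAt
      (fun a => r (varPos (ambForm g r) (fun y => f (r y)) a (τ, f x) σ)) 0 := by
  refine ContinuousAt.comp (g := r) ?_ ?_
  · have : varPos (ambForm g r) (fun y => f (r y)) 0 (τ, f x) σ = f x := by simp [varPos]
    rw [this]
    exact (h.smooth_retr x).continuousAt
  · unfold varPos
    fun_prop

theorem isTransported {s t : ℝ} (hsT : Icc s t ⊆ openInterval T) {γ : ℝ → M} {σ w : ℝ → W}
    (hY : ∀ τ ∈ Icc s t, HasDerivWithinAt (fun τ => f (γ τ)) (w τ) (Icc s t) τ)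
    (hv : ∀ τ ∈ Icc s t, velocity (n := n) γ s t τ = retrD (n := n) r (f (γ τ)) (w τ))
    (hσ : ∀ τ ∈ Icc s t, HasDerivWithinAt σ
      (extTransport (ambForm g r) (fun y => f (r y)) ((τ, f (γ τ)), σ τ, (1, w τ))) (Icc s t) τ) :
    IsTransported g s t γ (fun τ => tangentOf (n := n) f r (γ τ) (σ τ)) := by
  intro τ hτ
  have hm := h.isLocalModel hg (hsT hτ) (mem_extChartAt_source (I := 𝓡 n) (γ τ))
  set ψ : W → ℝ^n := fun y => χ (γ τ) (r y) with hψ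
  have hd : HasFDerivAt (fderiv ℝ ψ) (fderiv ℝ (fderiv ℝ ψ) (f (γ τ))) (f (γ τ)) :=
    ((hm.smooth.fderiv_right (m := 5) (by norm_num)).differentiableAt (by simp)).hasFDerivAt
  have h1 : HasDerivWithinAt (fun r' => fderiv ℝ ψ (f (γ r'))) _ (Icc s t) τ :=
    HasFDerivAt.comp_hasDerivWithinAt (l := fderiv ℝ ψ) (f := fun τ => f (γ τ)) τ hd (hY τ hτ)
  have h2 := h1.clm_apply (hσ τ hτ)
  have hs : ∀ r', γ r' ∈ (χ (γ τ)).source →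
      coord (γ τ) (tangentOf (n := n) f r (γ r') (σ r')) = fderiv ℝ ψ (f (γ r')) (σ r') :=
    fun r' hr' => h.coord_tangentOf hr' _
  have hγ : ∀ᶠ r' in 𝓝[Icc s t] τ, γ r' ∈ (χ (γ τ)).source := by
    have h3 : ContinuousWithinAt (fun τ => r (f (γ τ))) (Icc s t) τ :=
      ContinuousAt.comp_continuousWithinAt (g := r) (f := fun τ => f (γ τ))
        (h.smooth_retr (γ τ)).continuousAt (hY τ hτ).continuousWithinAt
    simp only [h.left_inv] at h3
    exact h3.eventually (extChartAt_source_mem_nhds (γ τ))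
  have h4 := h2.congr_of_eventuallyEq (f₁ := fun r' => coord (γ τ)
    (tangentOf (n := n) f r (γ r') (σ r'))) (by filter_upwards [hγ] with r' hr' using hs r' hr')
    (hs τ (mem_extChartAt_source (γ τ)))
  refine h4.congr_deriv ?_
  have h5 := hm.extTransport_eq (σ τ) (1, w τ)
  have h6 : coord (γ τ) (velocity (n := n) γ s t τ) = fderiv ℝ ψ (f (γ τ)) (w τ) := by
    rw [hv τ hτ, ← h.coord_tangentOf (mem_extChartAt_source (γ τ))]
    rfl
  refine h5.trans ?_
  have h7 : ψ (f (γ τ)) = χ (γ τ) (γ τ) := by simp only [hψ, h.left_inv]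
  rw [h6, hs τ (mem_extChartAt_source (γ τ)), one_smul, chrL_apply, h7]
  rfl

theorem sum_ricci {τ : ℝ} (hτ : τ ∈ openInterval T) (x : M) {σ : Fin n → W}
    (hσ : ∀ i j, ambForm g r (τ, f x) (σ i) (σ j) = if i = j then 1 else 0) :
    ∑ i, ricci (g τ) x (tangentOf (n := n) f r x (σ i)) (tangentOf (n := n) f r x (σ i)) =
      scalarCurv (g τ) x := by
  have hV : ∀ i j, bil (metricCoeff (g τ) x (χ x x)) (chartD x x (tangentOf (n := n) f r x (σ i)))
      (chartD x x (tangentOf (n := n) f r x (σ j))) = if i = j then 1 else 0 := by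
    intro i j
    rw [← coord_eq, ← coord_eq, h.coord_tangentOf (mem_extChartAt_source x),
      h.coord_tangentOf (mem_extChartAt_source x), ← hσ i j, ambForm_eq (c := x)
      (by rw [h.left_inv]; exact mem_extChartAt_source x) ((h.smooth_retr x).of_le (by norm_cast)),
      h.left_inv]
    rfl
  rw [scalarCurv]
  refine (sum_congr rfl fun i _ => ricci_eq_ricB (g τ) x _ _).trans ?_
  exact (sum_inv_mul_eq_sum_frame (B := Matrix.of (ricciCoeff (metricCoeff (g τ) x)
    (χ x x))) _ hV).symm

/-- The trace of the soliton equation along a unique minimizing path: an upper bound for the second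
differences of `L` bounds the difference of the scalar curvatures at the endpoints. -/
theorem scalarCurv_sub_le
    (hS : IsTwistedGradientSoliton g T) {s t : ℝ} (hst : s < t) (hsT : Icc s t ⊆ openInterval T)
    {γ : ℝ → M} {w : ℝ → W} {σ : Fin n → ℝ → W}
    (hY : ∀ τ ∈ Icc s t, HasDerivWithinAt (fun τ => f (γ τ)) (w τ) (Icc s t) τ)
    (hv : ∀ τ ∈ Icc s t, velocity (n := n) γ s t τ = retrD (n := n) r (f (γ τ)) (w τ))
    (hσ : ∀ i, ∀ τ ∈ Icc s t, HasDerivWithinAt (σ i)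
      (extTransport (ambForm g r) (fun y => f (r y)) ((τ, f (γ τ)), σ i τ, (1, w τ))) (Icc s t) τ)
    (ho : ∀ τ ∈ Icc s t, ∀ i j, ambForm g r (τ, f (γ τ)) (σ i τ) (σ j τ) = if i = j then 1 else 0)
    (hmin : IsMinimizing g (γ s) s (γ t) t γ)
    (huniq : ∀ σ, IsMinimizing g (γ s) s (γ t) t σ → EqOn σ γ (Icc s t)) {K : ℝ}
    (hK : ∀ ε > 0, ∀ᶠ a in 𝓝[>] (0 : ℝ),
      ∑ i, L g (r (varPos (ambForm g r) (fun y => f (r y)) a (s, f (γ s)) (σ i s))) s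
          (r (varPos (ambForm g r) (fun y => f (r y)) a (t, f (γ t)) (σ i t))) t +
        ∑ i, L g (r (varPos (ambForm g r) (fun y => f (r y)) (-a) (s, f (γ s)) (σ i s))) s
          (r (varPos (ambForm g r) (fun y => f (r y)) (-a) (t, f (γ t)) (σ i t))) t ≤
      2 * (n * L g (γ s) s (γ t) t) + a ^ 2 * (K + ε)) :
    scalarCurv (g t) (γ t) - scalarCurv (g s) (γ s) ≤ K := by
  have hs : s ∈ Icc s t := left_mem_Icc.2 hst.le
  have ht : t ∈ Icc s t := right_mem_Icc.2 hst.le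
  obtain ⟨hC2, hH⟩ := hS s (openInterval_subset T (hsT hs)) t (openInterval_subset T (hsT ht)) hst γ
    hmin huniq
  have h0 : ∀ (τ : ℝ) (x : M) (v : W),
      r (varPos (ambForm g r) (fun y => f (r y)) 0 (τ, f x) v) = x := by
    intro τ x v
    simp [varPos, h.left_inv]
  have hj : ∀ i, ∃ v₁, HasJet (fun a =>
      L g (r (varPos (ambForm g r) (fun y => f (r y)) a (s, f (γ s)) (σ i s))) s
        (r (varPos (ambForm g r) (fun y => f (r y)) a (t, f (γ t)) (σ i t))) t)
      (L g (γ s) s (γ t) t) v₁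
      (hessProd (g s) (g t) (fun z => L g z.1 s z.2 t) (γ s) (γ t)
        (tangentOf (n := n) f r (γ s) (σ i s)) (tangentOf (n := n) f r (γ t) (σ i t))
        (tangentOf (n := n) f r (γ s) (σ i s)) (tangentOf (n := n) f r (γ t) (σ i t))) :=
    fun i => hasJet_hessProd hC2 (h.continuousAt_varPos g s (γ s) (σ i s)) (h0 _ _ _)
      (h.continuousAt_varPos g t (γ t) (σ i t)) (h0 _ _ _) _ _
      (h.hasJet_varPos hg (hsT hs) (γ s) (σ i s)) (h.hasJet_varPos hg (hsT ht) (γ t) (σ i t))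
  choose v₁ hj using hj
  have h1 := (HasJet.sum (s := Finset.univ) hj).le_of_second_difference (K := K) fun ε hε => by
    filter_upwards [hK ε hε] with a ha
    simpa using ha
  have h2 : ∀ i, hessProd (g s) (g t) (fun z => L g z.1 s z.2 t) (γ s) (γ t)
        (tangentOf (n := n) f r (γ s) (σ i s)) (tangentOf (n := n) f r (γ t) (σ i t))
        (tangentOf (n := n) f r (γ s) (σ i s)) (tangentOf (n := n) f r (γ t) (σ i t)) =
      ricci (g t) (γ t) (tangentOf (n := n) f r (γ t) (σ i t))
        (tangentOf (n := n) f r (γ t) (σ i t)) -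
      ricci (g s) (γ s) (tangentOf (n := n) f r (γ s) (σ i s))
        (tangentOf (n := n) f r (γ s) (σ i s)) := by
    intro i
    have h3 := h.isTransported hg hsT hY hv (hσ i)
    have := hH _ _ h3 h3
    linarith
  simp only [h2, sum_sub_distrib, h.sum_ricci hg (hsT ht) _ (ho t ht),
    h.sum_ricci hg (hsT hs) _ (ho s hs)] at h1
  exact h1

end IsTube

end Ambient

/-! ### Existence of the embedding, and the zero-dimensional case -/

theorem exists_isTube {n : ℕ} {M : Type*} [TopologicalSpace M]
    [ChartedSpace (ℝ^n) M] [IsManifold (𝓡 n) ∞ M] [T2Space M]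
    [CompactSpace M] [Nonempty M] :
    ∃ (N : ℕ) (f : M → ℝ^N) (r : ℝ^N → M), IsTube n f r := by
  obtain ⟨N, f, hf, he, hd⟩ := exists_embedding_euclidean_of_compact (I := 𝓡 n) (M := M)
  obtain ⟨r, h1, h2⟩ := exists_retraction hf he hd
  exact ⟨N, f, r, h1, hf, h2⟩

theorem infL_eq_zero {M : Type*} [TopologicalSpace M] [ChartedSpace (ℝ^0) M] [IsManifold (𝓡 0) ∞ M]
    (g : ℝ → Metric 0 M) (A t : ℝ) : infL g A t = 0 := by
  have h1 : ∀ s t (γ : ℝ → M), pathLength g s t γ = 0 := by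
    intro s t γ
    unfold pathLength
    have h : ∀ τ, (g τ).inner (γ τ) (velocity γ s t τ) (velocity γ s t τ) = 0 := by
      intro τ
      have h0 : velocity (n := 0) γ s t τ = 0 := Subsingleton.elim (α := ℝ^0) _ _
      rw [h0, map_zero]
    simp [scalarCurv, h]
  have h2 : ∀ z : M × M, L g z.1 t z.2 (t + A) = 0 := by
    intro z
    unfold L
    rcases eq_empty_or_nonempty {γ | IsPath 0 z.1 t z.2 (t + A) γ} with h | ⟨γ, hγ⟩
    · rw [h, image_empty, Real.sInf_empty]
    · have : pathLength g t (t + A) '' {γ | IsPath 0 z.1 t z.2 (t + A) γ} = {0} :=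
        eq_singleton_iff_unique_mem.2 ⟨⟨γ, hγ, h1 _ _ _⟩, by rintro _ ⟨σ, -, rfl⟩; exact h1 _ _ _⟩
      rw [this, csInf_singleton]
  simp [infL, h2]

section Embedded

variable {n : ℕ} {M : Type*} [TopologicalSpace M] [ChartedSpace (ℝ^n) M] [IsManifold (𝓡 n) ∞ M]
  {N : ℕ} {f : M → ℝ^N} {r : ℝ^N → M} {g : ℝ → Metric n M} {T : EReal}

local notation "χ" => extChartAt (𝓡 n)

theorem norm_le_card_mul {v : ℝ^N} {ε : ℝ} (h : ∀ i, |v i| ≤ ε) : ‖v‖ ≤ N * ε := by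
  rw [sum_single v]
  refine (norm_sum_le _ _).trans ?_
  have : ∀ i ∈ (Finset.univ : Finset (Fin N)), ‖v i • (𝐞 i : ℝ^N)‖ ≤ ε := by
    intro i _
    rw [norm_smul, PiLp.norm_single, norm_one, mul_one]
    exact h i
  simpa using sum_le_sum this

/-- Any two points are joined by a `C¹` path: a continuous path is approximated by polynomials in
the ambient space, and the approximation is retracted. -/
theorem IsTube.exists_isPath [CompactSpace M] [ConnectedSpace M] (h : IsTube n f r)
    (p q : M) {s t : ℝ} (hst : s < t) : ∃ γ, IsPath n p s q t γ := by
  have : LocallyPathConnectedSpace M := ChartedSpace.locallyPathConnectedSpace (ℝ^n) M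
  have : PathConnectedSpace M := pathConnectedSpace_iff_connectedSpace.2 inferInstance
  set c := PathConnectedSpace.somePath p q with hc
  set Z : ℝ → ℝ^N := fun τ => f (c.extend ((τ - s) / (t - s))) with hZ
  have hZc : Continuous Z := h.smooth.continuous.comp (c.continuous_extend.comp (by fun_prop))
  have hst' : t - s ≠ 0 := (sub_pos.2 hst).ne'
  have hZs : Z s = f p := by simp [hZ]
  have hZt : Z t = f q := by simp [hZ, div_self hst']
  obtain ⟨δ, hδ, hU⟩ : ∃ δ > 0, ∀ y ∈ range f, ∀ y', ‖y' - y‖ < δ →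
      ContMDiffAt 𝓘(ℝ, ℝ^N) (𝓡 n) 1 r y' := by
    have h1 : {y | ContMDiffAt 𝓘(ℝ, ℝ^N) (𝓡 n) 1 r y} ∈ 𝓝ˢ (range f) :=
      mem_nhdsSet_iff_forall.2 h.eventually_smooth_retr_one
    obtain ⟨δ, hδ, hδU⟩ := h.isCompact_range.exists_thickening_subset_open isOpen_interior
      (subset_interior_iff_mem_nhdsSet.2 h1)
    refine ⟨δ, hδ, fun y hy y' hyy => interior_subset (hδU ?_)⟩
    rw [Metric.mem_thickening_iff]
    exact ⟨y, hy, by rwa [dist_eq_norm]⟩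
  -- half of the error is spent on the approximation, half on the linear correction at the endpoints
  have hε : 0 < δ / (2 * N + 1) / 2 := by positivity
  choose P hP using fun i => exists_polynomial_near_of_continuousOn s t (fun τ => Z τ i) (by
      have : Continuous fun τ => Z τ i := by fun_prop
      exact this.continuousOn) _ hε
  set Q : ℝ → ℝ^N := fun τ => WithLp.toLp 2 fun i => (P i).eval τ +
    (t - τ) / (t - s) * (Z s i - (P i).eval s) + (τ - s) / (t - s) * (Z t i - (P i).eval t) with hQ
  have hQs : Q s = f p := by
    rw [← hZs]; ext i; simp [hQ, div_self hst']
  have hQt : Q t = f q := by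
    rw [← hZt]; ext i; simp [hQ, div_self hst']
  have hQd : ContDiff ℝ 1 Q := by
    rw [contDiff_piLp]
    intro i
    have : ContDiff ℝ 1 fun τ : ℝ => (P i).eval τ := by
      simpa using Polynomial.contDiff_aeval (𝕜 := ℝ) (P i) 1
    simp only [hQ]
    fun_prop
  have hclose : ∀ τ ∈ Icc s t, ‖Q τ - Z τ‖ < δ := by
    intro τ hτ
    have h1 : ‖Q τ - Z τ‖ ≤ N * (2 * (δ / (2 * N + 1) / 2)) := by
      refine norm_le_card_mul fun i => ?_
      have e1 := hP i τ hτ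
      have e2 := hP i s ⟨le_rfl, hst.le⟩
      have e3 := hP i t ⟨hst.le, le_rfl⟩
      have l1 : 0 ≤ (t - τ) / (t - s) := div_nonneg (by linarith [hτ.2]) (by linarith)
      have l2 : 0 ≤ (τ - s) / (t - s) := div_nonneg (by linarith [hτ.1]) (by linarith)
      have l3 : (t - τ) / (t - s) + (τ - s) / (t - s) = 1 := by field_simp; ring
      have e4 : |(t - τ) / (t - s) * (Z s i - (P i).eval s)| ≤
          (t - τ) / (t - s) * (δ / (2 * N + 1) / 2) := by
        rw [abs_mul, abs_of_nonneg l1, abs_sub_comm]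
        exact mul_le_mul_of_nonneg_left e2.le l1
      have e5 : |(τ - s) / (t - s) * (Z t i - (P i).eval t)| ≤
          (τ - s) / (t - s) * (δ / (2 * N + 1) / 2) := by
        rw [abs_mul, abs_of_nonneg l2, abs_sub_comm]
        exact mul_le_mul_of_nonneg_left e3.le l2
      have e6 : (Q τ - Z τ) i = ((P i).eval τ - Z τ i) +
          ((t - τ) / (t - s) * (Z s i - (P i).eval s) +
            (τ - s) / (t - s) * (Z t i - (P i).eval t)) := by
        simp only [hQ, PiLp.sub_apply]; ring
      rw [e6]
      refine (abs_add_le _ _).trans ?_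
      have e7 := abs_add_le ((t - τ) / (t - s) * (Z s i - (P i).eval s))
        ((τ - s) / (t - s) * (Z t i - (P i).eval t))
      have e8 : (t - τ) / (t - s) * (δ / (2 * N + 1) / 2) +
          (τ - s) / (t - s) * (δ / (2 * N + 1) / 2) = δ / (2 * N + 1) / 2 := by
        rw [← add_mul, l3, one_mul]
      linarith [e1.le]
    refine h1.trans_lt ?_
    rw [show (N : ℝ) * (2 * (δ / (2 * N + 1) / 2)) = δ * N / (2 * N + 1) by ring,
      div_lt_iff₀ (by positivity)]
    have : (0 : ℝ) ≤ N := Nat.cast_nonneg N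
    nlinarith
  refine ⟨fun τ => r (Q τ), fun τ hτ => ?_, by simp [hQs, h.left_inv], by simp [hQt, h.left_inv]⟩
  exact ((hU (Z τ) (mem_range_self _) (Q τ) (hclose τ hτ)).comp τ
    hQd.contDiffAt.contMDiffAt).contMDiffWithinAt

/-- Paths whose `𝓛`-length is as close as desired to `infL`. -/
theorem IsTube.exists_path_lt [CompactSpace M] [ConnectedSpace M] (h : IsTube n f r)
    {A t η : ℝ} (hA : 0 < A) (hη : 0 < η) :
    ∃ γ : ℝ → M, ContMDiffOn 𝓘(ℝ, ℝ) (𝓡 n) 1 γ (Icc t (t + A)) ∧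
      pathLength g t (t + A) γ < infL g A t + η := by
  have h1 : infL g A t < infL g A t + η := by linarith
  obtain ⟨z, hz⟩ := exists_lt_of_ciInf_lt h1
  obtain ⟨γ₀, hγ₀⟩ := h.exists_isPath z.1 z.2 (show t < t + A by linarith)
  have hne : (pathLength g t (t + A) '' {γ | IsPath n z.1 t z.2 (t + A) γ}).Nonempty :=
    ⟨_, γ₀, hγ₀, rfl⟩
  obtain ⟨_, ⟨γ, hγ, rfl⟩, hlt⟩ := exists_lt_of_csInf_lt hne hz
  exact ⟨γ, hγ.1, hlt⟩

/-! ### Monotonicity -/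

theorem pathLength_const (s t : ℝ) (p : M) :
    pathLength g s t (fun _ => p) = ∫ τ in s..t, scalarCurv (g τ) p := by
  refine integral_congr fun τ _ => ?_
  have h : velocity (n := n) (fun _ : ℝ => p) s t τ = 0 := by
    unfold velocity
    rw [mfderivWithin_const]
    rfl
  simp only [h, map_zero, add_zero]

theorem infL_le_integral [CompactSpace M] (hg : IsRicciFlow g T) {A t : ℝ} (hA : 0 ≤ A)
    (hsT : Icc t (t + A) ⊆ timeInterval T) (p : M) :
    infL g A t ≤ ∫ τ in t..(t + A), scalarCurv (g τ) p := by
  rw [← pathLength_const]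
  exact infL_le_pathLength hg hA hsT contMDiffOn_const

theorem infL_le_of_bound [CompactSpace M] [Nonempty M] (hg : IsRicciFlow g T) {A t C : ℝ}
    (hA : 0 ≤ A) (hsT : Icc t (t + A) ⊆ timeInterval T)
    (hC : ∀ τ ∈ Icc t (t + A), ∀ x : M, |scalarCurv (g τ) x| ≤ C) : infL g A t ≤ C * A := by
  obtain ⟨p⟩ := ‹Nonempty M›
  refine (infL_le_integral hg hA hsT p).trans ((le_abs_self _).trans ?_)
  have h := norm_integral_le_of_norm_le_const (a := t) (b := t + A) (C := C)
    (f := fun τ => scalarCurv (g τ) p) fun τ hτ => by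
      rw [uIoc_of_le (by linarith)] at hτ
      exact hC τ ⟨hτ.1.le, hτ.2⟩ p
  rwa [add_sub_cancel_left, abs_of_nonneg hA] at h

/-- A bound for the Euclidean energy of a curve in terms of its `𝓛`-length. -/
theorem IsTube.integral_sq_le (h : IsTube n f r)
    (hg : IsRicciFlow g T) {s t c C E : ℝ} (hst : s ≤ t) (hsT : Icc s t ⊆ timeInterval T)
    (hc : 0 < c) (hcB : ∀ τ ∈ Icc s t, ∀ y ∈ range f, ∀ v, fderiv ℝ (fun y => f (r y)) y v = v →
      c * ‖v‖ ^ 2 ≤ ambForm g r (τ, y) v v)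
    (hC : ∀ τ ∈ Icc s t, ∀ x : M, |scalarCurv (g τ) x| ≤ C)
    {Y w : ℝ → ℝ^N} (hY : ContinuousOn Y (Icc s t))
    (hw : ContinuousOn w (Icc s t)) (hYK : ∀ τ ∈ Icc s t, Y τ ∈ range f)
    (hwt : ∀ τ ∈ Icc s t, fderiv ℝ (fun y => f (r y)) (Y τ) (w τ) = w τ)
    (hE : ∫ τ in s..t, lag (ambForm g r) (ambScal g r) (τ, Y τ) (1, w τ) ≤ E) :
    ∫ τ in s..t, ‖w τ‖ ^ 2 ≤ (E + C * (t - s)) / c := by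
  rw [le_div_iff₀ hc]
  have hint : ∀ {φ : ℝ → ℝ}, ContinuousOn φ (Icc s t) → IntervalIntegrable φ volume s t :=
    (·.intervalIntegrable_of_Icc hst)
  have h1 : ∫ τ in s..t, (‖w τ‖ ^ 2 * c - C) ≤
      ∫ τ in s..t, lag (ambForm g r) (ambScal g r) (τ, Y τ) (1, w τ) := by
    refine integral_mono_on hst
      (hint (((hw.norm.pow 2).mul continuousOn_const).sub continuousOn_const))
      (hint (h.continuousOn_lag hg hsT hY hw hYK)) fun τ hτ => ?_
    have e1 := hcB τ hτ _ (hYK τ hτ) _ (hwt τ hτ)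
    have e2 := neg_le_of_abs_le (hC τ hτ (r (Y τ)))
    simp only [lag, one_pow, one_mul, ambScal]
    linarith
  have hi : IntervalIntegrable (fun τ => ‖w τ‖ ^ 2 * c) volume s t :=
    hint ((hw.norm.pow 2).mul continuousOn_const)
  rw [integral_sub hi intervalIntegrable_const,
    integral_mul_const, integral_const, smul_eq_mul] at h1
  linarith

/-- Averaging the `𝓛`-lengths of the variations, moved back in time, of a nearly minimizing path
along a frame: `infL` cannot increase by more than the cubic error when time is moved back. -/
theorem IsTube.infL_sub_le [CompactSpace M] [ConnectedSpace M] (h : IsTube n f r)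
    (hg : IsRicciFlow g T) (hn : n ≠ 0) {A : ℝ} (hA : 0 < A) {J : Set ℝ} (hJ : IsCompact J)
    (hJT : J ⊆ openInterval T) :
    ∃ C δ : ℝ, 0 ≤ C ∧ 0 < δ ∧ ∀ t a : ℝ, 0 < a → a ≤ δ → Icc t (t + A) ⊆ J →
      Icc (t - (n : ℝ)⁻¹ * (a ^ 2 / 2)) (t - (n : ℝ)⁻¹ * (a ^ 2 / 2) + A) ⊆ timeInterval T →
      infL g A (t - (n : ℝ)⁻¹ * (a ^ 2 / 2)) ≤ infL g A t + C * a ^ 3 := by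
  have hJT' : J ⊆ timeInterval T := hJT.trans (openInterval_subset T)
  obtain ⟨c, hc, hcB⟩ := h.exists_coercive hg hJ hJT'
  obtain ⟨CR, hCR, hCRb⟩ := exists_bound_scalarCurv (M := M) hg hJ hJT'
  obtain ⟨D₁, hD₁, hfr⟩ := ((h.isAmbientFlow hg).mono hJT).exists_frame hJ h.isCompact_range
  -- the energy of a path of length at most `CR * A + 1` is at most `Q₀`, uniformly in `t`
  set Q₀ := A + (CR * A + 1 + CR * A) / c with hQ₀
  have hQ₀n : 0 ≤ Q₀ := by positivity
  obtain ⟨C, δ, hC, hδ, hv⟩ := h.exists_variation hg hJ hJT (n : ℝ)⁻¹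
    (D₁ * Real.exp (D₁ * (2 * Q₀)))
  -- the constant `1` accounts for the choice of a path within `a³` of the infimum
  refine ⟨1 + C * Q₀, min δ 1, by positivity, lt_min hδ one_pos, ?_⟩
  intro t a ha haδ htJ htT
  have ha1 : a ≤ 1 := haδ.trans (min_le_right _ _)
  have ha3 : a ^ 3 ≤ 1 := pow_le_one₀ ha.le ha1
  obtain ⟨γ, hγ, hlt⟩ := h.exists_path_lt (g := g) (t := t) hA (show 0 < a ^ 3 by positivity)
  have htA : t < t + A := by linarith
  obtain ⟨w, hY, hw, hwt, -, hlen⟩ := h.exists_lift (g := g) htA hγ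
  have hYK : ∀ τ ∈ Icc t (t + A), f (γ τ) ∈ range f := fun τ _ => mem_range_self _
  have hYc : ContinuousOn (fun τ => f (γ τ)) (Icc t (t + A)) := fun τ hτ =>
    (hY τ hτ).continuousWithinAt
  obtain ⟨σ, hσ, ho, hσb⟩ := hfr t (t + A) htA.le htJ _ w hY hw hYK
  have hinf : infL g A t ≤ CR * A := infL_le_of_bound hg hA.le (htJ.trans hJT')
    fun τ hτ => hCRb τ (htJ hτ)
  have hsq := h.integral_sq_le hg htA.le (htJ.trans hJT') hc (fun τ hτ => hcB τ (htJ hτ))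
    (fun τ hτ => hCRb τ (htJ hτ)) hYc hw hYK hwt (E := CR * A + 1) (by rw [← hlen]; linarith)
  rw [add_sub_cancel_left] at hsq
  have hint : ∀ {φ : ℝ → ℝ}, ContinuousOn φ (Icc t (t + A)) →
      IntervalIntegrable φ volume t (t + A) :=
    (·.intervalIntegrable_of_Icc htA.le)
  have hQ : ∫ τ in t..(t + A), (1 + ‖w τ‖ ^ 2) ≤ Q₀ := by
    have hi : IntervalIntegrable (fun τ => ‖w τ‖ ^ 2) volume t (t + A) := hint (hw.norm.pow 2)
    rw [integral_add intervalIntegrable_const hi,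
      integral_const, add_sub_cancel_left, smul_eq_mul, mul_one]
    linarith
  have hQ' : ∫ τ in t..(t + A), (1 + ‖w τ‖) ≤ 2 * Q₀ := by
    refine le_trans ?_ (mul_le_mul_of_nonneg_left hQ zero_le_two)
    rw [← integral_const_mul]
    refine integral_mono_on htA.le (hint (continuousOn_const.add hw.norm))
      (hint (continuousOn_const.mul (continuousOn_const.add (hw.norm.pow 2)))) fun τ _ => ?_
    nlinarith [sq_nonneg (‖w τ‖ - 1), norm_nonneg (w τ)]
  have hσD : ∀ i, ∀ τ ∈ Icc t (t + A), ‖σ i τ‖ ≤ D₁ * Real.exp (D₁ * (2 * Q₀)) :=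
    fun i τ hτ => (hσb i τ hτ).trans (by gcongr)
  have haa : |a| ≤ δ := by rw [abs_of_pos ha]; exact haδ.trans (min_le_left _ _)
  obtain ⟨hp1, hp3⟩ := hv t (t + A) htA htJ _ w hY hw hYK hwt σ hσ ho hσD a haa
  obtain ⟨hp2, -⟩ := hv t (t + A) htA htJ _ w hY hw hYK hwt σ hσ ho hσD (-a) (by rwa [abs_neg])
  rw [neg_sq] at hp2
  have hn' : (n : ℝ) ≠ 0 := Nat.cast_ne_zero.2 hn
  -- for `κ = 1 / n` the time shift cancels the second order term exactly
  rw [mul_inv_cancel₀ hn', sub_self, zero_mul, zero_mul, sub_zero, ← hlen, abs_of_pos ha] at hp3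
  set θ := (n : ℝ)⁻¹ * (a ^ 2 / 2) with hθ
  have hend : t + A - θ = t - θ + A := by ring
  rw [hend] at hp1 hp2 hp3
  -- each varied path is a competitor for `infL` at the shifted time
  have hlow : ∑ _i : Fin n, (infL g A (t - θ) + infL g A (t - θ)) ≤
      ∑ i, (pathLength g (t - θ) (t - θ + A) (varPath g f r (n : ℝ)⁻¹ (fun τ => f (γ τ)) (σ i) a) +
        pathLength g (t - θ) (t - θ + A) (varPath g f r (n : ℝ)⁻¹ (fun τ => f (γ τ)) (σ i) (-a))) :=
    sum_le_sum fun i _ => add_le_add (infL_le_pathLength hg hA.le htT (hp1 i))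
      (infL_le_pathLength hg hA.le htT (hp2 i))
  rw [sum_const, card_univ, Fintype.card_fin, nsmul_eq_mul] at hlow
  have h1 := le_of_abs_le hp3
  have h2 : C * a ^ 3 * ∫ τ in t..(t + A), (1 + ‖w τ‖ ^ 2) ≤ C * a ^ 3 * Q₀ := by gcongr
  have hn1 : (1 : ℝ) ≤ n := by exact_mod_cast Nat.one_le_iff_ne_zero.2 hn
  have h3 : 2 * (n : ℝ) * (infL g A (t - θ) - pathLength g t (t + A) γ) ≤ C * a ^ 3 * Q₀ := by
    linarith
  have h4 : infL g A (t - θ) - pathLength g t (t + A) γ ≤ C * a ^ 3 * Q₀ := by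
    by_contra hcon
    push Not at hcon
    have h5 : 0 ≤ C * a ^ 3 * Q₀ := by positivity
    nlinarith
  nlinarith

theorem IsTube.infL_mono_of_pos [CompactSpace M] [ConnectedSpace M] (h : IsTube n f r)
    (hg : IsRicciFlow g T) (hn : n ≠ 0) {A : ℝ} (hA : 0 < A) {t₁ t₂ : ℝ} (h1 : 0 < t₁)
    (h12 : t₁ ≤ t₂) (h2 : ((t₂ + A : ℝ) : EReal) < T) : infL g A t₁ ≤ infL g A t₂ := by
  have hJT : Icc t₁ (t₂ + A) ⊆ openInterval T := fun τ hτ =>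
    ⟨h1.trans_le hτ.1, lt_of_le_of_lt (EReal.coe_le_coe_iff.2 hτ.2) h2⟩
  obtain ⟨C, δ, hC, hδ, H⟩ := h.infL_sub_le hg hn hA isCompact_Icc hJT
  have hn' : (n : ℝ) ≠ 0 := Nat.cast_ne_zero.2 hn
  have hnp : (0 : ℝ) < n := by positivity
  rcases h12.eq_or_lt with rfl | hlt
  · exact le_rfl
  -- `k` steps of time `a² / (2 n) = (t₂ - t₁) / k`, each with error `C a³`: the total error is of
  -- order `a`
  set a : ℕ → ℝ := fun k => Real.sqrt (2 * n * ((t₂ - t₁) / k)) with ha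
  have hlim : Tendsto a atTop (𝓝 0) := by
    have h3 : Tendsto (fun k : ℕ => 2 * n * ((t₂ - t₁) / k)) atTop (𝓝 (2 * n * 0)) :=
      (tendsto_const_div_atTop_nhds_zero_nat (t₂ - t₁)).const_mul _
    have h4 := (Real.continuous_sqrt.tendsto _).comp h3
    simp only [mul_zero, Real.sqrt_zero] at h4
    exact h4
  have hstep : ∀ᶠ k : ℕ in atTop, infL g A t₁ ≤ infL g A t₂ + C * (a k * (2 * n * (t₂ - t₁))) := by
    filter_upwards [hlim.eventually (ge_mem_nhds hδ), eventually_gt_atTop 0] with k hk hk0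
    have hk0' : (0 : ℝ) < k := by exact_mod_cast hk0
    have hkpos : 0 < 2 * n * ((t₂ - t₁) / k) := by
      have := sub_pos.2 hlt; positivity
    have hapos : 0 < a k := Real.sqrt_pos.2 hkpos
    have hasq : a k ^ 2 = 2 * n * ((t₂ - t₁) / k) := Real.sq_sqrt hkpos.le
    have hθ : (n : ℝ)⁻¹ * (a k ^ 2 / 2) = (t₂ - t₁) / k := by rw [hasq]; field_simp
    have hind : ∀ j : ℕ, j ≤ k →
        infL g A (t₂ - j * ((t₂ - t₁) / k)) ≤ infL g A t₂ + j * (C * a k ^ 3) := by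
      intro j
      induction j with
      | zero => intro _; simp
      | succ j ih =>
        intro hj
        have hj' : ((j : ℝ) + 1) ≤ k := by exact_mod_cast hj
        have e1 : (((j : ℝ) + 1) * ((t₂ - t₁) / k)) ≤ t₂ - t₁ := by
          rw [mul_div_assoc', div_le_iff₀ hk0', mul_comm]
          exact mul_le_mul_of_nonneg_left hj' (sub_pos.2 hlt).le
        have e2 : 0 ≤ (t₂ - t₁) / k := by have := sub_pos.2 hlt; positivity
        have e3 : 0 ≤ (j : ℝ) * ((t₂ - t₁) / k) := by positivity
        have e5 : ((j : ℝ) + 1) * ((t₂ - t₁) / k) = j * ((t₂ - t₁) / k) + (t₂ - t₁) / k := by ring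
        have h3 := H (t₂ - j * ((t₂ - t₁) / k)) (a k) hapos hk
          (Icc_subset_Icc (by linarith) (by linarith))
          ((Icc_subset_Icc (by rw [hθ]; linarith) (by rw [hθ]; linarith)).trans
            (hJT.trans (openInterval_subset T)))
        rw [hθ] at h3
        have e4 : t₂ - (↑(j + 1) : ℝ) * ((t₂ - t₁) / k) =
            t₂ - j * ((t₂ - t₁) / k) - (t₂ - t₁) / k := by push_cast; ring
        rw [e4]
        have := ih (Nat.le_of_succ_le hj)
        push_cast
        linarith
    have h3 := hind k le_rfl
    have e5 : t₂ - k * ((t₂ - t₁) / k) = t₁ := by field_simp; ring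
    have e6 : (k : ℝ) * (C * a k ^ 3) = C * (a k * (2 * n * (t₂ - t₁))) := by
      rw [pow_succ, hasq]; field_simp
    rwa [e5, e6] at h3
  have hlim2 : Tendsto (fun k => infL g A t₂ + C * (a k * (2 * n * (t₂ - t₁)))) atTop
      (𝓝 (infL g A t₂)) := by
    simpa using ((hlim.mul_const (2 * n * (t₂ - t₁))).const_mul C).const_add (infL g A t₂)
  exact ge_of_tendsto hlim2 hstep

/-- `infL` at the initial time is bounded by its values shortly after. -/
theorem IsTube.infL_zero_le [CompactSpace M] [ConnectedSpace M] (h : IsTube n f r)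
    (hg : IsRicciFlow g T) {A : ℝ} (hA : 0 < A) {b : ℝ} (hb : 0 < b)
    (hbT : ((b + A : ℝ) : EReal) < T) {ε : ℝ} (hε : 0 < ε) :
    ∃ t, 0 < t ∧ t ≤ b ∧ infL g A 0 ≤ infL g A t + ε := by
  set J := Icc (0 : ℝ) (b + A) with hJ
  have hJT : J ⊆ timeInterval T := fun τ hτ =>
    ⟨hτ.1, lt_of_le_of_lt (EReal.coe_le_coe_iff.2 hτ.2) hbT⟩
  have hJc : IsCompact J := isCompact_Icc
  obtain ⟨c, hc, hcB⟩ := h.exists_coercive hg hJc hJT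
  obtain ⟨CR, hCR, hCRb⟩ := exists_bound_scalarCurv (M := M) hg hJc hJT
  have hQ₀ : 0 ≤ (CR * A + 1 + CR * A) / c := by positivity
  set Q₀ := (CR * A + 1 + CR * A) / c with hQ₀d
  set η := min 1 (ε / (1 + A + Q₀)) with hη
  have hη0 : 0 < η := by positivity
  have hη1 : η ≤ 1 := min_le_left _ _
  have hηε : η * (1 + A + Q₀) ≤ ε := by
    rw [← le_div_iff₀ (by positivity)]; exact min_le_right _ _
  have hcomp := hJc.prod h.isCompact_range
  have hmono : J ×ˢ range f ⊆ timeInterval T ×ˢ range f := prod_mono hJT subset_rfl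
  obtain ⟨δ₁, hδ₁, H₁⟩ := Metric.uniformContinuousOn_iff.1
    (hcomp.uniformContinuousOn_of_continuous ((h.continuousOn_ambForm hg).mono hmono)) η hη0
  obtain ⟨δ₂, hδ₂, H₂⟩ := Metric.uniformContinuousOn_iff.1
    (hcomp.uniformContinuousOn_of_continuous ((h.continuousOn_ambScal hg).mono hmono)) η hη0
  set t := min b (min (δ₁ / 2) (δ₂ / 2)) with ht
  have ht0 : 0 < t := by positivity
  have htb : t ≤ b := min_le_left _ _
  have htδ₁ : t < δ₁ := by
    have : t ≤ δ₁ / 2 := (min_le_right _ _).trans (min_le_left _ _)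
    linarith
  have htδ₂ : t < δ₂ := by
    have : t ≤ δ₂ / 2 := (min_le_right _ _).trans (min_le_right _ _)
    linarith
  refine ⟨t, ht0, htb, ?_⟩
  have htA : t < t + A := by linarith
  have htJ : Icc t (t + A) ⊆ J := Icc_subset_Icc ht0.le (by linarith)
  obtain ⟨γ, hγ, hlt⟩ := h.exists_path_lt (g := g) (t := t) hA hη0
  obtain ⟨w, hY, hw, hwt, -, hlen⟩ := h.exists_lift (g := g) htA hγ
  have hYK : ∀ τ ∈ Icc t (t + A), f (γ τ) ∈ range f := fun τ _ => mem_range_self _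
  have hYc : ContinuousOn (fun τ => f (γ τ)) (Icc t (t + A)) := fun τ hτ =>
    (hY τ hτ).continuousWithinAt
  have hinf : infL g A t ≤ CR * A := infL_le_of_bound hg hA.le (htJ.trans hJT)
    fun τ hτ => hCRb τ (htJ hτ)
  have hsq := h.integral_sq_le hg htA.le (htJ.trans hJT) hc (fun τ hτ => hcB τ (htJ hτ))
    (fun τ hτ => hCRb τ (htJ hτ)) hYc hw hYK hwt (E := CR * A + 1) (by rw [← hlen]; linarith)
  rw [add_sub_cancel_left] at hsq
  -- the path moved back to start at the initial time
  have hmap : MapsTo (fun τ => τ + t) (Icc 0 (0 + A)) (Icc t (t + A)) := fun τ hτ =>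
    ⟨by linarith [hτ.1], by linarith [hτ.2]⟩
  have hmapc : ContinuousOn (fun τ : ℝ => τ + t) (Icc 0 (0 + A)) := by fun_prop
  have hY' : ∀ τ ∈ Icc 0 (0 + A), HasDerivWithinAt (fun τ => f (γ (τ + t))) (w (τ + t))
      (Icc 0 (0 + A)) τ := by
    intro τ hτ
    have h1 : HasDerivWithinAt (fun τ => τ + t) 1 (Icc 0 (0 + A)) τ :=
      (hasDerivWithinAt_id _ _).add_const t
    simpa [Function.comp_def] using (hY _ (hmap hτ)).scomp τ h1 hmap
  have hw' : ContinuousOn (fun τ => w (τ + t)) (Icc 0 (0 + A)) := hw.comp hmapc hmap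
  have hsm : ∀ τ ∈ Icc (0 : ℝ) (0 + A),
      ContMDiffAt 𝓘(ℝ, ℝ^N) (𝓡 n) 1 r (f (γ (τ + t))) := fun τ _ =>
    (h.smooth_retr _).of_le (by norm_cast)
  have h0A : (0 : ℝ) < 0 + A := by linarith
  have h0J : Icc (0 : ℝ) (0 + A) ⊆ J := Icc_subset_Icc le_rfl (by linarith)
  have hp := IsTube.pathLength_comp (g := g) h0A hY' hw' hsm
  have hle := infL_le_pathLength hg hA.le (h0J.trans hJT) (IsTube.velocity_comp h0A hY' hw' hsm).1
  rw [hp] at hle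
  have hint : ∀ {φ : ℝ → ℝ}, ContinuousOn φ (Icc t (t + A)) →
      IntervalIntegrable φ volume t (t + A) :=
    (·.intervalIntegrable_of_Icc htA.le)
  have hL := h.continuousOn_lag hg (htJ.trans hJT) hYc hw hYK
  have hcomp2 : ∫ τ in (0 : ℝ)..(0 + A), lag (ambForm g r) (ambScal g r)
      (τ, f (γ (τ + t))) (1, w (τ + t)) ≤
      ∫ τ in t..(t + A), (lag (ambForm g r) (ambScal g r) (τ, f (γ τ)) (1, w τ) +
        (η + η * ‖w τ‖ ^ 2)) := by
    have e1 : ∫ τ in t..(t + A), (lag (ambForm g r) (ambScal g r) (τ, f (γ τ)) (1, w τ) +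
        (η + η * ‖w τ‖ ^ 2)) = ∫ τ in (0 : ℝ)..(0 + A),
        (lag (ambForm g r) (ambScal g r) (τ + t, f (γ (τ + t))) (1, w (τ + t)) +
          (η + η * ‖w (τ + t)‖ ^ 2)) := by
      rw [integral_comp_add_right (fun τ =>
        lag (ambForm g r) (ambScal g r) (τ, f (γ τ)) (1, w τ) + (η + η * ‖w τ‖ ^ 2)) t,
        zero_add, zero_add, add_comm A t]
    rw [e1]
    have hcL := h.continuousOn_lag hg (h0J.trans hJT)
      (fun τ hτ => (hY' τ hτ).continuousWithinAt) hw' fun τ hτ => mem_range_self _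
    have hcR : ContinuousOn (fun τ =>
        lag (ambForm g r) (ambScal g r) (τ + t, f (γ (τ + t))) (1, w (τ + t)) +
          (η + η * ‖w (τ + t)‖ ^ 2)) (Icc 0 (0 + A)) :=
      (hL.comp hmapc hmap).add (continuousOn_const.add (continuousOn_const.mul (hw'.norm.pow 2)))
    refine integral_mono_on h0A.le (ContinuousOn.intervalIntegrable (by rwa [uIcc_of_le h0A.le]))
      (ContinuousOn.intervalIntegrable (by rwa [uIcc_of_le h0A.le])) fun τ hτ => ?_
    have m1 : (τ, f (γ (τ + t))) ∈ J ×ˢ range f := ⟨h0J hτ, mem_range_self _⟩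
    have m2 : (τ + t, f (γ (τ + t))) ∈ J ×ˢ range f := ⟨htJ (hmap hτ), mem_range_self _⟩
    have hd : dist (τ, f (γ (τ + t))) (τ + t, f (γ (τ + t))) = t := by
      rw [Prod.dist_eq, dist_self, Real.dist_eq]
      simp [abs_of_pos ht0, ht0.le]
    have k1 := H₁ _ m1 _ m2 (by rw [hd]; exact htδ₁)
    have k2 := H₂ _ m1 _ m2 (by rw [hd]; exact htδ₂)
    rw [dist_eq_norm] at k1
    rw [Real.dist_eq] at k2
    -- the metrics at times `τ` and `τ + t` differ by at most `η`
    have k3 : ambForm g r (τ, f (γ (τ + t))) (w (τ + t)) (w (τ + t)) -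
        ambForm g r (τ + t, f (γ (τ + t))) (w (τ + t)) (w (τ + t)) ≤ η * ‖w (τ + t)‖ ^ 2 := by
      have := ContinuousLinearMap.le_opNorm₂ (ambForm g r (τ, f (γ (τ + t))) -
        ambForm g r (τ + t, f (γ (τ + t)))) (w (τ + t)) (w (τ + t))
      rw [sub_apply, sub_apply] at this
      refine ((le_abs_self _).trans this).trans ?_
      rw [mul_assoc, ← sq]
      exact mul_le_mul_of_nonneg_right k1.le (sq_nonneg _)
    have k4 := (abs_lt.1 k2).2
    simp only [lag, one_pow, one_mul]
    linarith
  have hi : IntervalIntegrable (fun τ => η * ‖w τ‖ ^ 2) volume t (t + A) :=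
    hint (continuousOn_const.mul (hw.norm.pow 2))
  rw [integral_add (hint hL) (intervalIntegrable_const.add hi),
    integral_add intervalIntegrable_const hi,
    integral_const, integral_const_mul, add_sub_cancel_left,
    smul_eq_mul, ← hlen] at hcomp2
  have h5 : η * ∫ τ in t..(t + A), ‖w τ‖ ^ 2 ≤ η * Q₀ := by gcongr
  have h6 : η * (1 + A + Q₀) = η + A * η + η * Q₀ := by ring
  linarith

theorem IsTube.infL_mono [CompactSpace M] [ConnectedSpace M] (h : IsTube n f r)
    (hg : IsRicciFlow g T) (hn : n ≠ 0) {A : ℝ} (hA : 0 < A) {t₁ t₂ : ℝ} (h1 : 0 ≤ t₁)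
    (h12 : t₁ ≤ t₂) (h2 : ((t₂ + A : ℝ) : EReal) < T) : infL g A t₁ ≤ infL g A t₂ := by
  rcases h1.eq_or_lt with rfl | h1
  · rcases h12.eq_or_lt with rfl | h12
    · exact le_rfl
    · refine le_of_forall_pos_le_add fun ε hε => ?_
      obtain ⟨t, ht0, htb, ht⟩ := h.infL_zero_le hg hA h12 h2 hε
      have := h.infL_mono_of_pos hg hn hA ht0 htb h2
      linarith
  · exact h.infL_mono_of_pos hg hn hA h1 h12 h2

/-! ### Unique minimizing paths starting at rest -/

theorem IsRicciFlow.isActionOn (hg : IsRicciFlow g T) (c : M) :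
    IsActionOn (openInterval T ×ˢ (χ c).target) (fun z => bil (flowCoeff g c z))
      (scal (flowCoeff g c)) where
  isOpen := (hg.isFlowOn c).isOpen
  smooth z hz := (contDiffAt_bil ((hg.isFlowOn c).smooth z hz)).of_le (by norm_cast)
  smooth_pot z hz := ((hg.isFlowOn c).contDiffAt_scal hz).of_le (by norm_cast)
  symm z hz := bil_symm ((hg.isFlowOn c).symm z hz)
  pos := (hg.isFlowOn c).pos

namespace IsTube

variable (h : IsTube n f r) (hg : IsRicciFlow g T)

include h hg

theorem lag_chart {τ : ℝ} (hτ : τ ∈ timeInterval T) {c x : M} (hx : x ∈ (χ c).source) (w : ℝ^N) :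
    lag (ambForm g r) (ambScal g r) (τ, f x) (1, w) =
      lag (fun z => bil (flowCoeff g c z)) (scal (flowCoeff g c)) (τ, χ c x)
        (1, fderiv ℝ (fun y => χ c (r y)) (f x) w) := by
  have hr : r (f x) ∈ (χ c).source := by rwa [h.left_inv]
  simp only [lag, one_pow, one_mul, ambScal, h.left_inv, hg.scalarCurv_eq hτ hx]
  rw [ambForm_eq hr ((h.smooth_retr x).of_le (by norm_cast)), h.left_inv]

/-- The length of a path inside a chart. -/
theorem exists_chart_lift {γ : ℝ → M} {s t : ℝ} (hst : s < t) (hsT : Icc s t ⊆ timeInterval T)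
    (hγ : ContMDiffOn 𝓘(ℝ, ℝ) (𝓡 n) 1 γ (Icc s t)) {c : M}
    (hc : ∀ τ ∈ Icc s t, γ τ ∈ (χ c).source) :
    ∃ y' : ℝ → ℝ^n, (∀ τ ∈ Icc s t, HasDerivWithinAt (fun τ => χ c (γ τ)) (y' τ) (Icc s t) τ) ∧
      ContinuousOn y' (Icc s t) ∧ pathLength g s t γ =
        ∫ τ in s..t, lag (fun z => bil (flowCoeff g c z)) (scal (flowCoeff g c))
          (τ, χ c (γ τ)) (1, y' τ) := by
  obtain ⟨w, hY, hw, -, -, hlen⟩ := h.exists_lift (g := g) hst hγ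
  have hsm : ∀ τ ∈ Icc s t, ContDiffAt ℝ 2 (fun y => χ c (r y)) (f (γ τ)) := by
    intro τ hτ
    have h1 : ContMDiffAt (𝓡 n) 𝓘(ℝ, ℝ^n) 2 (χ c) (r (f (γ τ))) := by
      rw [h.left_inv]
      exact (contMDiffAt_extChartAt' (n := ∞) (by simpa using hc τ hτ)).of_le (by norm_cast)
    exact contMDiffAt_iff_contDiffAt.1
      (h1.comp (f (γ τ)) ((h.smooth_retr (γ τ)).of_le (by norm_cast)))
  refine ⟨fun τ => fderiv ℝ (fun y => χ c (r y)) (f (γ τ)) (w τ), fun τ hτ => ?_,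
    fun τ hτ => ?_, ?_⟩
  · have h1 : HasDerivWithinAt (fun τ => χ c (r (f (γ τ)))) _ (Icc s t) τ :=
      HasFDerivAt.comp_hasDerivWithinAt (l := fun y => χ c (r y))
        (f := fun τ => f (γ τ)) τ ((hsm τ hτ).differentiableAt (by simp)).hasFDerivAt (hY τ hτ)
    simpa only [h.left_inv] using h1
  · have h1 : ContinuousWithinAt (fun τ => fderiv ℝ (fun y => χ c (r y)) (f (γ τ))) (Icc s t) τ :=
      ContinuousAt.comp_continuousWithinAt
        (g := fderiv ℝ (fun y => χ c (r y))) (f := fun τ => f (γ τ))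
        ((hsm τ hτ).fderiv_right (m := 1) (by norm_num)).continuousAt (hY τ hτ).continuousWithinAt
    exact h1.clm_apply (hw τ hτ)
  · rw [hlen]
    refine integral_congr fun τ hτ => ?_
    rw [uIcc_of_le hst.le] at hτ
    exact h.lag_chart hg (hsT hτ) (hc τ hτ) _

omit hg in
theorem pathLength_congr {γ σ : ℝ → M} {s t : ℝ} (hst : s < t)
    (hγ : ContMDiffOn 𝓘(ℝ, ℝ) (𝓡 n) 1 γ (Icc s t)) (hσ : ContMDiffOn 𝓘(ℝ, ℝ) (𝓡 n) 1 σ (Icc s t))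
    (he : EqOn σ γ (Icc s t)) : pathLength g s t σ = pathLength g s t γ := by
  obtain ⟨w, hY, -, -, -, hlen⟩ := h.exists_lift (g := g) hst hγ
  obtain ⟨w', hY', -, -, -, hlen'⟩ := h.exists_lift (g := g) hst hσ
  rw [hlen, hlen']
  refine integral_congr fun τ hτ => ?_
  rw [uIcc_of_le hst.le] at hτ
  have h1 : w' τ = w τ := (uniqueDiffOn_Icc hst τ hτ).eq_deriv _ (hY' τ hτ)
    ((hY τ hτ).congr (fun τ' hτ' => by rw [he hτ']) (by rw [he hτ]))
  simp only [h1, he hτ]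

omit h hg in
/-- A curve of finite energy stays close to its starting point for a short time. -/
theorem norm_sub_le {Y w : ℝ → ℝ^N} {s t Q : ℝ} (hst : s ≤ t)
    (hY : ∀ τ ∈ Icc s t, HasDerivWithinAt Y (w τ) (Icc s t) τ) (hw : ContinuousOn w (Icc s t))
    (hQ : ∫ τ in s..t, ‖w τ‖ ^ 2 ≤ Q) {τ : ℝ} (hτ : τ ∈ Icc s t) : ‖Y τ - Y s‖ ≤ (t - s) + Q := by
  have hsub : Icc s τ ⊆ Icc s t := Icc_subset_Icc le_rfl hτ.2
  have hi : ∀ {φ : ℝ → ℝ}, ContinuousOn φ (Icc s t) → IntervalIntegrable φ volume s t :=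
    (·.intervalIntegrable_of_Icc hst)
  have hsq : IntervalIntegrable (fun τ => ‖w τ‖ ^ 2) volume s t := hi (hw.norm.pow 2)
  have h1 : ∫ r in s..τ, w r = Y τ - Y s := integral_eq_sub_of_hasDerivAt_of_le hτ.1
      (fun r hr => ((hY r (hsub hr)).continuousWithinAt).mono hsub)
      (fun r hr => (hY r (hsub (Ioo_subset_Icc_self hr))).hasDerivAt
        (Icc_mem_nhds hr.1 (hr.2.trans_le hτ.2)))
      (ContinuousOn.intervalIntegrable (by rw [uIcc_of_le hτ.1]; exact hw.mono hsub))
  rw [← h1]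
  refine (norm_integral_le_integral_norm hτ.1).trans ?_
  refine (integral_mono_interval le_rfl hτ.1 hτ.2
    (Eventually.of_forall fun _ => norm_nonneg _) (hi hw.norm)).trans ?_
  have h2 : ∫ r in s..t, ‖w r‖ ≤ ∫ r in s..t, (1 + ‖w r‖ ^ 2) := by
    refine integral_mono_on hst (hi hw.norm) (intervalIntegrable_const.add hsq) fun r _ => ?_
    nlinarith [sq_nonneg (‖w r‖ - 1), norm_nonneg (w r)]
  rw [integral_add intervalIntegrable_const hsq, integral_const, smul_eq_mul, mul_one] at h2
  linarith

/-- From every point of space-time there starts, at rest, a path which is uniquely minimizing for a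
short time. -/
theorem exists_unique_minimizer [CompactSpace M] {s : ℝ} (hs : s ∈ openInterval T) {c : M} {u : ℝ^n}
    (hu : u ∈ (χ c).target) : ∃ (x v : ℝ → ℝ^n) (ε : ℝ), 0 < ε ∧ x s = u ∧ v s = 0 ∧
      (∀ τ ∈ Icc s (s + ε), τ ∈ openInterval T ∧ x τ ∈ (χ c).target ∧ HasDerivAt x (v τ) τ ∧
        HasDerivAt v (extremalAcc (fun z => bil (flowCoeff g c z)) (scal (flowCoeff g c))
          (τ, x τ, v τ)) τ) ∧
      ∀ t, s < t → t ≤ s + ε → IsMinimizing g ((χ c).symm (x s)) s ((χ c).symm (x t)) t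
          (fun τ => (χ c).symm (x τ)) ∧
        ∀ σ, IsMinimizing g ((χ c).symm (x s)) s ((χ c).symm (x t)) t σ →
          EqOn σ (fun τ => (χ c).symm (x τ)) (Icc s t) := by
  have hact := hg.isActionOn c
  obtain ⟨x, v, ε₁, hε₁, hxs, hvs, hx⟩ := hact.exists_extremal (s := s) (u := u) ⟨hs, hu⟩
  obtain ⟨η, hη, hstrict⟩ := hact.exists_strict_minimum (s := s) (u := u) ⟨hs, hu⟩
  have hJ₁ : Icc s (s + ε₁ / 2) ⊆ Ioo (s - ε₁) (s + ε₁) := fun τ hτ =>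
    ⟨by linarith [hτ.1], by linarith [hτ.2]⟩
  have hJT : Icc s (s + ε₁ / 2) ⊆ openInterval T := fun τ hτ => (hx τ (hJ₁ hτ)).1.1
  have hJT' := hJT.trans (openInterval_subset T)
  obtain ⟨k, hk, hkB⟩ := h.exists_coercive hg isCompact_Icc hJT'
  obtain ⟨CR, hCR, hCRb⟩ := exists_bound_scalarCurv (M := M) hg isCompact_Icc hJT'
  -- the Lagrangian along the extremal is bounded
  have hlagc : ContinuousOn (fun τ => lag (fun z => bil (flowCoeff g c z)) (scal (flowCoeff g c))
      (τ, x τ) (1, v τ)) (Icc s (s + ε₁ / 2)) := by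
    intro τ hτ
    obtain ⟨h1, -, h2, h3⟩ := hx τ (hJ₁ hτ)
    have h4 : ContinuousAt (fun τ => (τ, x τ)) τ := continuousAt_id.prodMk h2.continuousAt
    have h5 := ContinuousAt.comp (g := fun z => bil (flowCoeff g c z)) (f := fun τ => (τ, x τ))
      (hact.smooth _ h1).continuousAt h4
    have h6 := ContinuousAt.comp (g := scal (flowCoeff g c)) (f := fun τ => (τ, x τ))
      (hact.smooth_pot _ h1).continuousAt h4
    simp only [lag, one_pow, one_mul]
    exact (h6.add ((h5.clm_apply h3.continuousAt).clm_apply h3.continuousAt)).continuousWithinAt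
  obtain ⟨C, hC⟩ := isCompact_Icc.exists_bound_of_continuousOn hlagc
  have hC0 : 0 ≤ C := (norm_nonneg _).trans (hC s (left_mem_Icc.2 (by linarith)))
  -- a neighbourhood of the starting point in the ambient space
  set p := (χ c).symm u with hp
  have hpc : p ∈ (χ c).source := (χ c).map_target hu
  have hpu : χ c p = u := (χ c).right_inv hu
  have hrp : ContinuousAt r (f p) := (h.smooth_retr p).continuousAt
  have hn1 : ∀ᶠ y in 𝓝 (f p), r y ∈ (χ c).source :=
    hrp.eventually (by rw [h.left_inv]; exact (isOpen_extChartAt_source c).mem_nhds hpc)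
  have hn2 : ∀ᶠ y in 𝓝 (f p), ‖χ c (r y) - u‖ < η := by
    have h1 : ContinuousAt (χ c) (r (f p)) := by
      rw [h.left_inv]; exact continuousAt_extChartAt' (by simpa using hpc)
    have h2 := (ContinuousAt.comp (g := χ c) (f := r) h1 hrp)
    have h3 : Tendsto (fun y => ‖χ c (r y) - u‖) (𝓝 (f p)) (𝓝 0) := by
      have := (h2.sub (continuousAt_const (y := u))).norm.tendsto
      simpa only [Function.comp_def, Pi.sub_apply, h.left_inv, hpu, sub_self, norm_zero] using this
    exact h3.eventually (gt_mem_nhds hη)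
  obtain ⟨δ, hδ, hδb⟩ := Metric.eventually_nhds_iff.1 (hn1.and hn2)
  have hn3 : ∀ᶠ τ in 𝓝 s, ‖x τ - u‖ < η := by
    have h1 : ContinuousAt x s := (hx s ⟨by linarith, by linarith⟩).2.2.1.continuousAt
    have h3 : Tendsto (fun τ => ‖x τ - u‖) (𝓝 s) (𝓝 0) := by
      have := (h1.sub (continuousAt_const (y := u))).norm.tendsto
      simpa [hxs] using this
    exact h3.eventually (gt_mem_nhds hη)
  obtain ⟨δ', hδ', hδb'⟩ := Metric.eventually_nhds_iff.1 hn3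
  -- a competitor over a time `t - s` stays within `(t - s) Q` of its starting point
  set Q := (C + CR) / k + 1 with hQ
  have hQ0 : 0 < Q := by positivity
  set ε := min (ε₁ / 2) (min (η / 2) (min (δ' / 2) (δ / (2 * Q)))) with hε
  have hε0 : 0 < ε := by positivity
  have hεε : ε ≤ ε₁ / 2 := min_le_left _ _
  have hεη : ε ≤ η / 2 := (min_le_right _ _).trans (min_le_left _ _)
  have hεδ' : ε ≤ δ' / 2 := (min_le_right _ _).trans ((min_le_right _ _).trans (min_le_left _ _))
  have hεδ : ε ≤ δ / (2 * Q) :=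
    (min_le_right _ _).trans ((min_le_right _ _).trans (min_le_right _ _))
  have hsub : Icc s (s + ε) ⊆ Icc s (s + ε₁ / 2) := Icc_subset_Icc le_rfl (by linarith)
  refine ⟨x, v, ε, hε0, hxs, hvs, fun τ hτ => ?_, ?_⟩
  · obtain ⟨h1, -, h2, h3⟩ := hx τ (hJ₁ (hsub hτ))
    exact ⟨h1.1, h1.2, h2, h3⟩
  intro t hst htε
  set γ : ℝ → M := fun τ => (χ c).symm (x τ) with hγd
  have hsubt : Icc s t ⊆ Icc s (s + ε₁ / 2) := (Icc_subset_Icc le_rfl htε).trans hsub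
  have hxd : ∀ τ ∈ Icc s t, (τ, x τ) ∈ openInterval T ×ˢ (χ c).target ∧
      ‖v τ‖ ≤ 1 ∧ HasDerivAt x (v τ) τ ∧ _ := fun τ hτ => hx τ (hJ₁ (hsubt hτ))
  have hvc : ContinuousOn v (Icc s t) := fun τ hτ =>
      (hxd τ hτ).2.2.2.continuousAt.continuousWithinAt
  have hγ : ContMDiffOn 𝓘(ℝ, ℝ) (𝓡 n) 1 γ (Icc s t) := (velocity_comp (r := (χ c).symm) hst
      (fun τ hτ => (hxd τ hτ).2.2.1.hasDerivWithinAt) hvc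
      (fun τ hτ => (contMDiffAt_chart_symm (hxd τ hτ).1.2).of_le (by norm_cast))).1
  have hγx : ∀ τ ∈ Icc s t, χ c (γ τ) = x τ := fun τ hτ =>
    (χ c).right_inv (hxd τ hτ).1.2
  have hsT := hsubt.trans hJT'
  obtain ⟨y₀, hy₀, -, hγlen⟩ := h.exists_chart_lift hg hst hsT hγ (c := c) fun τ hτ =>
    (χ c).map_target (hxd τ hτ).1.2
  have hγlen' : pathLength g s t γ = ∫ τ in s..t, lag (fun z => bil (flowCoeff g c z))
      (scal (flowCoeff g c)) (τ, x τ) (1, v τ) := by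
    rw [hγlen]
    refine integral_congr fun τ hτ => ?_
    rw [uIcc_of_le hst.le] at hτ
    have h1 : y₀ τ = v τ := (uniqueDiffOn_Icc hst τ hτ).eq_deriv _ (hy₀ τ hτ)
      ((hxd τ hτ).2.2.1.hasDerivWithinAt.congr hγx (hγx τ hτ))
    simp only [h1, hγx τ hτ]
  have hbound : pathLength g s t γ ≤ C * (t - s) := by
    rw [hγlen']
    have := norm_integral_le_of_norm_le_const (a := s) (b := t) (C := C)
      (f := fun τ => lag (fun z => bil (flowCoeff g c z)) (scal (flowCoeff g c)) (τ, x τ) (1, v τ))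
      fun τ hτ => hC τ (hsubt (by
        rw [uIoc_of_le hst.le] at hτ; exact Ioc_subset_Icc_self hτ))
    rw [abs_of_pos (sub_pos.2 hst)] at this
    exact (le_abs_self _).trans this
  -- a competitor which is not longer stays in the chart
  have key : ∀ σ, IsPath n (γ s) s (γ t) t σ → pathLength g s t σ ≤ pathLength g s t γ →
      EqOn σ γ (Icc s t) := by
    rintro σ ⟨hσ, hσs, hσt⟩ hle
    obtain ⟨w, hY, hw, hwt, -, hlen⟩ := h.exists_lift (g := g) hst hσ
    have hsq := h.integral_sq_le hg hst.le hsT hk (fun τ hτ => hkB τ (hsubt hτ))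
      (fun τ hτ => hCRb τ (hsubt hτ)) (fun τ hτ => (hY τ hτ).continuousWithinAt) hw
      (fun τ _ => mem_range_self _) hwt (E := C * (t - s)) (by rw [← hlen]; linarith)
    have hnear : ∀ τ ∈ Icc s t, dist (f (σ τ)) (f p) < δ := by
      intro τ hτ
      have h1 := norm_sub_le hst.le hY hw hsq hτ
      have h2 : σ s = p := by rw [hσs, hγd, hp]; simp only [hxs]
      rw [h2] at h1
      rw [dist_eq_norm]
      refine h1.trans_lt ?_
      have e1 : t - s + (C * (t - s) + CR * (t - s)) / k = (t - s) * Q := by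
        rw [hQ]; field_simp; ring
      rw [e1]
      have h3 : t - s ≤ δ / (2 * Q) := by linarith
      rw [le_div_iff₀ (by positivity)] at h3
      linarith
    have hin : ∀ τ ∈ Icc s t, σ τ ∈ (χ c).source ∧ ‖χ c (σ τ) - u‖ < η := by
      intro τ hτ
      have := hδb (hnear τ hτ)
      rwa [h.left_inv] at this
    obtain ⟨y', hy', hy'c, hσlen⟩ := h.exists_chart_lift hg hst hsT hσ (c := c) fun τ hτ =>
      (hin τ hτ).1
    have h4 := hstrict t hst (by linarith) x v (fun τ => χ c (σ τ)) y' (fun τ hτ => ⟨hδb' (by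
          rw [Real.dist_eq, abs_of_nonneg (by linarith [hτ.1])]; linarith [hτ.2]),
        (hin τ hτ).2, (hxd τ hτ).2.1, (hxd τ hτ).2.2.1.hasDerivWithinAt,
        (hxd τ hτ).2.2.2.hasDerivWithinAt, hy' τ hτ⟩) hy'c
      (by rw [hσs, hγx s (left_mem_Icc.2 hst.le)]) (by rw [hσt, hγx t (right_mem_Icc.2 hst.le)])
      (by rw [← hσlen, ← hγlen']; exact hle)
    intro τ hτ
    rw [hγd]
    simp only [← h4 hτ]
    exact ((χ c).left_inv (hin τ hτ).1).symm
  refine ⟨⟨⟨hγ, rfl, rfl⟩, fun σ hσ => ?_⟩, fun σ hσ => key σ hσ.1 (hσ.2 γ ⟨hγ, rfl, rfl⟩)⟩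
  by_contra hcon
  push Not at hcon
  exact hcon.ne (h.pathLength_congr hst hγ hσ.1 (key σ hσ hcon.le))

end IsTube

/-! ### The scalar curvature of a soliton is constant in space -/

theorem IsMinimizing.L_eq {p q : M} {s t : ℝ} {γ : ℝ → M} (h : IsMinimizing g p s q t γ) :
    L g p s q t = pathLength g s t γ :=
  IsLeast.csInf_eq ⟨⟨γ, h.1, rfl⟩, by rintro _ ⟨σ, hσ, rfl⟩; exact h.2 σ hσ⟩

namespace IsTube

variable (h : IsTube n f r) (hg : IsRicciFlow g T)

include h hg

theorem lagTime_chart {τ : ℝ} (hτ : τ ∈ openInterval T) {c x : M} (hx : x ∈ (χ c).source)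
    (w : ℝ^N) : lagTime (ambForm g r) (ambScal g r) (τ, f x) (1, w) =
      lagTime (fun z => bil (flowCoeff g c z)) (scal (flowCoeff g c)) (τ, χ c x)
        (1, fderiv ℝ (fun y => χ c (r y)) (f x) w) := by
  have hm := h.isLocalModel hg hτ hx
  have hz : (τ, χ c x) ∈ openInterval T ×ˢ (χ c).target := ⟨hτ, (χ c).map_source hx⟩
  have h1 := hm.fderiv_scal_time
  have h2 := hm.fderiv_metric_time 1 w w
  simp only [h.left_inv] at h1 h2
  have h3 := dd_bil (A := flowCoeff g c) (x := (τ, χ c x))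
    (fun i j => ((hg.isFlowOn c).smooth _ hz i j).differentiableAt (by simp)) tm
    (fderiv ℝ (fun y => χ c (r y)) (f x) w)
    (fderiv ℝ (fun y => χ c (r y)) (f x) w)
  have h4 : fderiv ℝ (fun z => bil (flowCoeff g c z)) (τ, χ c x) (1, 0)
      (fderiv ℝ (fun y => χ c (r y)) (f x) w)
      (fderiv ℝ (fun y => χ c (r y)) (f x) w) =
      1 * (-2 * ricB (fun u => flowCoeff g c (τ, u)) (χ c x) (fderiv ℝ (fun y => χ c (r y)) (f x) w)
        (fderiv ℝ (fun y => χ c (r y)) (f x) w)) := by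
    refine h3.trans ?_
    rw [ricB, bil_apply, one_mul, mul_sum]
    refine sum_congr rfl fun i _ => ?_
    rw [mul_sum]
    refine sum_congr rfl fun j _ => ?_
    rw [(hg.isFlowOn c).flow _ hz, Matrix.of_apply]
    ring
  simp only [lagTime, one_pow, one_mul]
  rw [h1, h2, h4]
  rfl

/-- Extremals of a soliton which start at rest stay at rest. -/
theorem fderiv_scal_eq_zero [CompactSpace M]
    (hS : IsTwistedGradientSoliton g T) {s : ℝ} (hs : s ∈ openInterval T) {c : M}
    {u : ℝ^n} (hu : u ∈ (χ c).target)
    (ξ : ℝ^n) : fderiv ℝ (scal (flowCoeff g c)) (s, u) (0, ξ) = 0 := by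
  have hact := hg.isActionOn c
  obtain ⟨x, v, ε, hε, hxs, hvs, hx, hmin⟩ := h.exists_unique_minimizer hg hs hu
  have hJT : Icc s (s + ε) ⊆ openInterval T := fun τ hτ => (hx τ hτ).1
  obtain ⟨D, hD, hfr⟩ := ((h.isAmbientFlow hg).mono hJT).exists_frame isCompact_Icc
    h.isCompact_range
  have hss : s ∈ Icc s (s + ε) := left_mem_Icc.2 (by linarith)
  -- the traced soliton equation bounds `R(t) - R(s)` by the integral of the time derivative of the
  -- Lagrangian, which by the energy identity is `R(t) - R(s) - |v(t)|²`
  have hrest : ∀ t, s < t → t ≤ s + ε → v t = 0 := by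
    intro t hst htε
    set γ : ℝ → M := fun τ => (χ c).symm (x τ) with hγd
    obtain ⟨hmin, huniq⟩ := hmin t hst htε
    have hsub : Icc s t ⊆ Icc s (s + ε) := Icc_subset_Icc le_rfl htε
    have hsT := hsub.trans hJT
    have hsT' := hsT.trans (openInterval_subset T)
    have hsc : ∀ τ ∈ Icc s t, γ τ ∈ (χ c).source := fun τ hτ =>
      (χ c).map_target (hx τ (hsub hτ)).2.1
    have hγx : ∀ τ ∈ Icc s t, χ c (γ τ) = x τ := fun τ hτ =>
      (χ c).right_inv (hx τ (hsub hτ)).2.1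
    obtain ⟨w, hY, hw, hwt, hv, hlen⟩ := h.exists_lift (g := g) hst hmin.1.1
    have hYK : ∀ τ ∈ Icc s t, f (γ τ) ∈ range f := fun τ _ => mem_range_self _
    have hYc : ContinuousOn (fun τ => f (γ τ)) (Icc s t) := fun τ hτ =>
      (hY τ hτ).continuousWithinAt
    obtain ⟨σ, hσ, ho, hσb⟩ := hfr s t hst.le hsub _ w hY hw hYK
    obtain ⟨C, δ, hC, hδ, hvar⟩ := h.exists_variation hg isCompact_Icc hJT 0
      (D * Real.exp (D * ∫ r in s..t, (1 + ‖w r‖)))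
    set I := ∫ τ in s..t, (1 + ‖w τ‖ ^ 2) with hI
    have hI0 : 0 ≤ I := integral_nonneg hst.le fun τ _ => by positivity
    set K := ∫ τ in s..t, lagTime (ambForm g r) (ambScal g r) (τ, f (γ τ)) (1, w τ) with hK
    have hLγ : L g (γ s) s (γ t) t = pathLength g s t γ := hmin.L_eq
    have hsoliton := h.scalarCurv_sub_le hg hS hst hsT hY hv hσ ho hmin huniq (K := K) (by
      intro η hη
      have hsmall : ∀ᶠ a in 𝓝[>] (0 : ℝ), a ∈ Ioo 0 (min δ (η / (C * I + 1))) :=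
        Ioo_mem_nhdsGT (by positivity)
      filter_upwards [hsmall] with a ha
      have ha0 : 0 < a := ha.1
      have haδ : |a| ≤ δ := by rw [abs_of_pos ha0]; exact ha.2.le.trans (min_le_left _ _)
      have haη : a * (C * I + 1) ≤ η := by
        rw [← le_div_iff₀ (by positivity)]; exact ha.2.le.trans (min_le_right _ _)
      obtain ⟨hp1, hp3⟩ := hvar s t hst hsub _ w hY hw hYK hwt σ hσ ho hσb a haδ
      obtain ⟨hp2, -⟩ := hvar s t hst hsub _ w hY hw hYK hwt σ hσ ho hσb (-a) (by rwa [abs_neg])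
      simp only [zero_mul, sub_zero, mul_zero, one_mul] at hp1 hp2 hp3
      have hle : ∀ b i, ContMDiffOn 𝓘(ℝ, ℝ) (𝓡 n) 1 (varPath g f r 0 (fun τ => f (γ τ)) (σ i) b)
          (Icc s t) → L g (r (varPos (ambForm g r) (fun y => f (r y)) b (s, f (γ s)) (σ i s))) s
          (r (varPos (ambForm g r) (fun y => f (r y)) b (t, f (γ t)) (σ i t))) t ≤
          pathLength g s t (varPath g f r 0 (fun τ => f (γ τ)) (σ i) b) := fun b i hb =>
        L_le_pathLength hg hst.le hsT' ⟨hb, by simp [varPath], by simp [varPath]⟩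
      have h1 := sum_le_sum fun i (_ : i ∈ Finset.univ) => hle a i (hp1 i)
      have h2 := sum_le_sum fun i (_ : i ∈ Finset.univ) => hle (-a) i (hp2 i)
      rw [sum_add_distrib, ← hlen, abs_of_pos ha0] at hp3
      have h3 := le_of_abs_le hp3
      have h4 : C * a ^ 3 * I ≤ a ^ 2 * η := by
        have : a ^ 2 * (a * (C * I + 1)) ≤ a ^ 2 * η := by gcongr
        nlinarith [pow_pos ha0 3]
      rw [hLγ]
      linarith)
    -- the energy identity along the extremal
    have hKE : K = (scal (flowCoeff g c) (t, x t) - bil (flowCoeff g c (t, x t)) (v t) (v t)) -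
        (scal (flowCoeff g c) (s, x s) - bil (flowCoeff g c (s, x s)) (v s) (v s)) := by
      refine integral_eq_sub_of_hasDerivAt (f := fun τ =>
        scal (flowCoeff g c) (τ, x τ) - bil (flowCoeff g c (τ, x τ)) (v τ) (v τ)) ?_ ?_
      · intro τ hτ
        rw [uIcc_of_le hst.le] at hτ
        obtain ⟨hτT, hτt, hxd, hvd⟩ := hx τ (hsub hτ)
        have h1 : fderiv ℝ (fun y => χ c (r y)) (f (γ τ)) (w τ) = v τ := by
          have hd : DifferentiableAt ℝ (fun y => χ c (r y)) (f (γ τ)) :=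
            (h.isLocalModel hg hτT (hsc τ hτ)).smooth.differentiableAt (by simp)
          have h2 : HasDerivWithinAt (fun τ => χ c (r (f (γ τ)))) _ (Icc s t) τ :=
            HasFDerivAt.comp_hasDerivWithinAt (l := fun y => χ c (r y))
              (f := fun τ => f (γ τ)) τ hd.hasFDerivAt (hY τ hτ)
          simp only [h.left_inv] at h2
          exact (uniqueDiffOn_Icc hst τ hτ).eq_deriv _ h2
            (hxd.hasDerivWithinAt.congr hγx (hγx τ hτ))
        rw [h.lagTime_chart hg hτT (hsc τ hτ), h1, hγx τ hτ]
        exact hact.hasDerivAt_energy ⟨hτT, hτt⟩ hxd hvd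
      · exact ContinuousOn.intervalIntegrable (by
          rw [uIcc_of_le hst.le]
          exact ((h.isAmbientFlow hg).mono hJT).continuousOn_lagTime hsub hYc hw hYK)
    have ht : t ∈ Icc s t := right_mem_Icc.2 hst.le
    have hs' : s ∈ Icc s t := left_mem_Icc.2 hst.le
    rw [hg.scalarCurv_eq (hsT' ht) (hsc t ht), hg.scalarCurv_eq (hsT' hs') (hsc s hs'),
      hγx t ht, hγx s hs', hKE, hvs, map_zero, sub_zero] at hsoliton
    by_contra hne
    have := hact.pos (t, x t) ⟨hsT ht, (hx t (hsub ht)).2.1⟩ (v t) hne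
    linarith
  obtain ⟨-, -, -, hvd⟩ := hx s hss
  have h0 : HasDerivWithinAt v 0 (Icc s (s + ε)) s := by
    refine (hasDerivWithinAt_const s (Icc s (s + ε)) (0 : ℝ^n)).congr ?_ hvs
    intro τ hτ
    rcases hτ.1.eq_or_lt with rfl | hlt
    · exact hvs
    · exact hrest τ hlt hτ.2
  -- the acceleration at rest is half the gradient of the scalar curvature
  have hacc := (uniqueDiffOn_Icc (by linarith) s hss).eq_deriv _ hvd.hasDerivWithinAt h0
  have hEL := hact.extremalAcc_apply (τ := s) (x := x s) ⟨hs, by rwa [hxs]⟩ (v s) ξ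
  rw [hacc, hvs, hxs] at hEL
  simp only [map_zero, zero_apply, mul_zero, add_zero, sub_zero] at hEL
  exact hEL.symm

theorem scalarCurv_eq_of_isSoliton [CompactSpace M] [ConnectedSpace M]
    (hS : IsTwistedGradientSoliton g T) {s : ℝ} (hs : s ∈ openInterval T)
    (p q : M) : scalarCurv (g s) p = scalarCurv (g s) q := by
  have hloc : IsLocallyConstant (scalarCurv (g s)) := by
    refine (IsLocallyConstant.iff_eventually_eq _).2 fun p => ?_
    set u := χ p p
    obtain ⟨δ, hδ, hball⟩ := Metric.isOpen_iff.1 (isOpen_extChartAt_target (I := 𝓡 n) p) u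
      (mem_extChartAt_target p)
    have hd : ∀ y ∈ Metric.ball u δ,
        HasFDerivAt (fun y => scal (flowCoeff g p) (s, y)) (0 : ℝ^n →L[ℝ] ℝ) y := by
      intro y hy
      have h1 := (((hg.isFlowOn p).contDiffAt_scal (z := (s, y)) ⟨hs, hball hy⟩).differentiableAt
        (by simp)).hasFDerivAt.comp y (hasFDerivAt_prodMk_right (𝕜 := ℝ) s y)
      have h2 : (fderiv ℝ (scal (flowCoeff g p)) (s, y)).comp
          (ContinuousLinearMap.inr ℝ ℝ (ℝ^n)) = 0 := by
        ext ξ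
        exact h.fderiv_scal_eq_zero hg hS hs (hball hy) ξ
      rw [h2] at h1
      exact h1
    have hconst : ∀ y ∈ Metric.ball u δ, scal (flowCoeff g p) (s, y) = scal (flowCoeff g p)
        (s, u) :=
      fun y hy => (convex_ball u δ).is_const_of_fderivWithin_eq_zero (𝕜 := ℝ)
        (f := fun y => scal (flowCoeff g p) (s, y))
        (fun y hy => (hd y hy).differentiableAt.differentiableWithinAt)
        (fun y hy => by rw [fderivWithin_of_isOpen Metric.isOpen_ball hy, (hd y hy).fderiv])
        hy (Metric.mem_ball_self hδ)
    have e1 : ∀ᶠ y in 𝓝 p, y ∈ (χ p).source := extChartAt_source_mem_nhds p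
    have e2 : ∀ᶠ y in 𝓝 p, χ p y ∈ Metric.ball u δ :=
      (continuousAt_extChartAt p).eventually (Metric.ball_mem_nhds u hδ)
    filter_upwards [e1, e2] with y h1 h2
    rw [hg.scalarCurv_eq (openInterval_subset T hs) h1, hconst _ h2,
      hg.scalarCurv_eq (openInterval_subset T hs) (mem_extChartAt_source (I := 𝓡 n) p)]
  exact hloc.apply_eq_of_preconnectedSpace p q

end IsTube

/-! ### The scalar curvature of a soliton is constant in time -/

theorem continuousOn_scalarCurv_time (hg : IsRicciFlow g T) (p : M) :
    ContinuousOn (fun τ => scalarCurv (g τ) p) (timeInterval T) :=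
  ContinuousOn.comp (g := fun z : ℝ × M => scalarCurv (g z.1) z.2) (f := fun τ => (τ, p))
    (IsTube.continuousOn_scalarCurv (n := n) hg) (Continuous.prodMk_left p).continuousOn
    fun _ hτ => ⟨hτ, mem_univ _⟩

namespace IsTube

variable (h : IsTube n f r) (hg : IsRicciFlow g T)

include h hg

theorem integral_le_pathLength {s t : ℝ} (hst : s < t) (hsT : Icc s t ⊆ timeInterval T) {p : M}
    (hR : ∀ τ ∈ Icc s t, ∀ q : M, scalarCurv (g τ) q = scalarCurv (g τ) p) {γ : ℝ → M}
    (hγ : ContMDiffOn 𝓘(ℝ, ℝ) (𝓡 n) 1 γ (Icc s t)) :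
    ∫ τ in s..t, scalarCurv (g τ) p ≤ pathLength g s t γ := by
  obtain ⟨w, hY, hw, -, -, hlen⟩ := h.exists_lift (g := g) hst hγ
  rw [hlen]
  refine integral_mono_on hst.le (ContinuousOn.intervalIntegrable
      (by rw [uIcc_of_le hst.le]; exact (continuousOn_scalarCurv_time hg p).mono hsT))
    (ContinuousOn.intervalIntegrable (by
      rw [uIcc_of_le hst.le]
      exact h.continuousOn_lag hg hsT (fun τ hτ => (hY τ hτ).continuousWithinAt) hw
        fun τ _ => mem_range_self _)) fun τ hτ => ?_
  simp only [lag, one_pow, one_mul, ambScal, hR τ hτ (r (f (γ τ)))]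
  exact le_add_of_nonneg_right (ambForm_nonneg _ _)

/-- When the scalar curvature depends only on time, constant paths are the unique minimizing paths
between their endpoints. -/
theorem isMinimizing_const [CompactSpace M]
    {s t : ℝ} (hst : s < t) (hsT : Icc s t ⊆ timeInterval T) (p : M)
    (hR : ∀ τ ∈ Icc s t, ∀ q : M, scalarCurv (g τ) q = scalarCurv (g τ) p) :
    IsMinimizing g p s p t (fun _ => p) ∧
      ∀ γ, IsMinimizing g p s p t γ → EqOn γ (fun _ => p) (Icc s t) := by
  have hmin : IsMinimizing g p s p t (fun _ => p) := ⟨⟨contMDiffOn_const, rfl, rfl⟩, fun γ hγ => by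
      rw [pathLength_const]; exact h.integral_le_pathLength hg hst hsT hR hγ.1⟩
  refine ⟨hmin, fun γ hγ => ?_⟩
  have hle := hγ.2 _ hmin.1
  obtain ⟨w, hY, hw, hwt, -, hlen⟩ := h.exists_lift (g := g) hst hγ.1.1
  obtain ⟨c, hc, hcB⟩ := h.exists_coercive hg isCompact_Icc hsT
  have hLc := h.continuousOn_lag hg hsT (fun τ hτ => (hY τ hτ).continuousWithinAt) hw
        fun τ _ => mem_range_self _
  have hw0 : ∀ τ ∈ Icc s t, w τ = 0 := by
    by_contra! hne
    obtain ⟨τ₀, hτ₀, hne⟩ := hne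
    rw [pathLength_const, hlen] at hle
    refine hle.not_gt (integral_lt_integral_of_continuousOn_of_le_of_exists_lt hst
      ((continuousOn_scalarCurv_time hg p).mono hsT) hLc (fun τ hτ => ?_) ⟨τ₀, hτ₀, ?_⟩)
    · simp only [lag, one_pow, one_mul, ambScal, hR τ ⟨hτ.1.le, hτ.2⟩ (r (f (γ τ)))]
      exact le_add_of_nonneg_right (ambForm_nonneg _ _)
    · have h1 := hcB τ₀ hτ₀ _ (mem_range_self _) _ (hwt τ₀ hτ₀)
      have h2 := mul_pos hc (pow_pos (norm_pos_iff.2 hne) 2)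
      simp only [lag, one_pow, one_mul, ambScal, hR τ₀ hτ₀ (r (f (γ τ₀)))]
      linarith
  intro τ hτ
  have h1 := constant_of_has_deriv_right_zero (f := fun τ => f (γ τ)) (a := s) (b := t)
    (fun τ hτ => (hY τ hτ).continuousWithinAt) (fun τ hτ => by
      have := hY τ ⟨hτ.1, hτ.2.le⟩
      rw [hw0 τ ⟨hτ.1, hτ.2.le⟩] at this
      exact this.mono_of_mem_nhdsWithin (Icc_mem_nhdsGE_of_mem hτ)) τ hτ
  have h2 := congrArg r h1
  simp only [h.left_inv] at h2
  rw [h2, hγ.1.2.1]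

/-- The second variation of the `𝓛`-length at a constant path, as an upper bound for `L`, when the
scalar curvature depends only on time. -/
theorem eventually_L_le_rest [CompactSpace M]
    {s t : ℝ} (hst : s < t) (hsT : Icc s t ⊆ openInterval T) (p : M)
    (hR : ∀ τ ∈ Icc s t, ∀ q : M, scalarCurv (g τ) q = scalarCurv (g τ) p) {X X' : ℝ → ℝ^N}
    (hX : ∀ τ ∈ Icc s t, HasDerivWithinAt X (X' τ) (Icc s t) τ) (hX' : ContinuousOn X' (Icc s t))
    (c₀ c₁ : ℝ^N) {ε : ℝ} (hε : 0 < ε) :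
    ∀ᶠ a in 𝓝 (0 : ℝ), L g (r (f p + a • X s + (a ^ 2 / 2) • c₀)) s
        (r (f p + a • X t + (a ^ 2 / 2) • c₁)) t ≤ (∫ τ in s..t, scalarCurv (g τ) p) +
        a ^ 2 * ((∫ τ in s..t, ambForm g r (τ, f p) (X' τ) (X' τ)) + ε) := by
  have hsT' := hsT.trans (openInterval_subset T)
  have hts : 0 < t - s := sub_pos.2 hst
  -- the acceleration is only prescribed at the endpoints, and does not contribute to second order
  set V := (t - s)⁻¹ • (c₁ - c₀) with hV
  set Y : ℝ → ℝ → ℝ^N := fun a τ =>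
    f p + a • X τ + (a ^ 2 / 2) • (c₀ + (τ - s) • V) with hYd
  set u : ℝ → ℝ → ℝ^N := fun a τ => X' τ + (a / 2) • V with hud
  have hXc : ContinuousOn X (Icc s t) := fun τ hτ => (hX τ hτ).continuousWithinAt
  have hY : ∀ a, ∀ τ ∈ Icc s t, HasDerivWithinAt (Y a) (a • u a τ) (Icc s t) τ := by
    intro a τ hτ
    have h1 : HasDerivWithinAt (fun τ => τ - s) 1 (Icc s t) τ :=
      (hasDerivWithinAt_id _ _).sub_const s
    refine ((((hX τ hτ).const_smul a).const_add (f p)).add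
      (((h1.smul_const V).const_add c₀).const_smul (a ^ 2 / 2))).congr_deriv ?_
    simp only [hud, one_smul, smul_add, smul_smul]
    ring_nf
  have huc : ∀ a, ContinuousOn (fun τ => a • u a τ) (Icc s t) := fun a =>
    (hX'.add continuousOn_const).const_smul a
  set ε' := ε / (t - s) with hε'
  have hε'0 : 0 < ε' := div_pos hε hts
  -- a neighbourhood of `a = 0` that works for all `τ`, by compactness of the time interval
  have key : ∀ᶠ a in 𝓝 (0 : ℝ), ∀ τ ∈ (univ : Set (Icc s t)),
      ContMDiffAt 𝓘(ℝ, ℝ^N) (𝓡 n) 1 r (Y a τ) ∧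
      ContinuousAt (ambForm g r) ((τ : ℝ), Y a τ) ∧
      ambForm g r (τ, Y a τ) (u a τ) (u a τ) ≤ ambForm g r (τ, f p) (X' τ) (X' τ) + ε' := by
    refine isCompact_univ.eventually_forall_of_forall_eventually fun τ _ => ?_
    have hm := h.isLocalModel hg (hsT τ.2) (mem_extChartAt_source (I := 𝓡 n) p)
    have hXs : Continuous fun τ : Icc s t => X τ := hXc.domRestrict
    have hX's : Continuous fun τ : Icc s t => X' τ := hX'.domRestrict
    have hYs : Continuous fun q : ℝ × Icc s t => Y q.1 q.2 := by
      have := hXs.comp (continuous_snd (X := ℝ))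
      have h2 : Continuous fun q : ℝ × Icc s t => (q.2 : ℝ) :=
        continuous_subtype_val.comp continuous_snd
      simp only [hYd]
      exact ((continuous_const.add (continuous_fst.smul this)).add
        (((continuous_fst.pow 2).div_const 2).smul
          (continuous_const.add ((h2.sub continuous_const).smul continuous_const))))
    have hus : Continuous fun q : ℝ × Icc s t => u q.1 q.2 :=
      (hX's.comp (continuous_snd (X := ℝ))).add ((continuous_fst.div_const 2).smul continuous_const)
    have hY0 : ∀ τ, Y 0 τ = f p := fun τ => by simp [hYd]
    have hu0 : ∀ τ, u 0 τ = X' τ := fun τ => by simp [hud]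
    have h1 : ContinuousAt (fun q : ℝ × Icc s t => ((q.2 : ℝ), Y q.1 q.2)) (0, τ) :=
      ((continuous_subtype_val.comp continuous_snd).prodMk hYs).continuousAt
    have hB0 : ∀ᶠ z in 𝓝 ((τ : ℝ), f p), ContinuousAt (ambForm g r) z :=
      (hm.contDiffAt_metric.eventually (by simp)).mono fun z hz => hz.continuousAt
    have e1 : ∀ᶠ q in 𝓝 ((0 : ℝ), τ), ContMDiffAt 𝓘(ℝ, ℝ^N) (𝓡 n) 1 r (Y q.1 q.2) := by
      have := h.eventually_smooth_retr p
      rw [← hY0 τ] at this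
      exact (hYs.continuousAt (x := (0, τ))).eventually
        (this.mono fun y hy => hy.of_le (by norm_cast))
    have e2 : ∀ᶠ q in 𝓝 ((0 : ℝ), τ), ContinuousAt (ambForm g r) ((q.2 : ℝ), Y q.1 q.2) := by
      rw [← hY0 τ] at hB0
      exact h1.eventually hB0
    have h2 : ContinuousAt (fun q : ℝ × Icc s t => ambForm g r ((q.2 : ℝ), Y q.1 q.2)) (0, τ) := by
      refine ContinuousAt.comp (g := ambForm g r) ?_ h1
      simp only [hY0]
      exact hm.contDiffAt_metric.continuousAt
    have h3 : ContinuousAt (fun q : ℝ × Icc s t => ambForm g r ((q.2 : ℝ), f p)) (0, τ) := by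
      refine ContinuousAt.comp (g := ambForm g r) (f := fun q : ℝ × Icc s t => ((q.2 : ℝ), f p)) ?_
        ((continuous_subtype_val.comp continuous_snd).prodMk continuous_const).continuousAt
      exact hm.contDiffAt_metric.continuousAt
    have hX'q := (hX's.comp (continuous_snd (X := ℝ))).continuousAt (x := (0, τ))
    have h4 := ((h2.clm_apply hus.continuousAt).clm_apply hus.continuousAt).sub
      ((h3.clm_apply hX'q).clm_apply hX'q)
    have e3 := h4.eventually (p := (· < ε')) (by
      simp only [hY0, hu0, Function.comp_apply, Pi.sub_apply, sub_self]
      exact gt_mem_nhds hε'0)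
    filter_upwards [e1, e2, e3] with q h1 h2 h3
    refine ⟨h1, h2, ?_⟩
    simp only [Pi.sub_apply, Function.comp_apply] at h3
    linarith
  filter_upwards [key] with a ha
  have hr : ∀ τ ∈ Icc s t, ContMDiffAt 𝓘(ℝ, ℝ^N) (𝓡 n) 1 r (Y a τ) :=
    fun τ hτ => (ha ⟨τ, hτ⟩ (mem_univ _)).1
  have hYs : Y a s = f p + a • X s + (a ^ 2 / 2) • c₀ := by simp [hYd]
  have hYt : Y a t = f p + a • X t + (a ^ 2 / 2) • c₁ := by
    simp only [hYd, hV, smul_smul, mul_inv_cancel₀ hts.ne', one_smul, add_sub_cancel]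
  rw [← hYs, ← hYt]
  refine (L_le_pathLength hg hst.le hsT' (γ := fun τ => r (Y a τ))
    ⟨(velocity_comp hst (hY a) (huc a) hr).1, rfl, rfl⟩).trans ?_
  rw [pathLength_comp hst (hY a) (huc a) hr]
  have hRc := (continuousOn_scalarCurv_time hg p).mono hsT'
  have hYc : ContinuousOn (Y a) (Icc s t) := fun τ hτ => (hY a τ hτ).continuousWithinAt
  have hBc : ContinuousOn (fun τ => ambForm g r (τ, Y a τ)) (Icc s t) := fun τ hτ =>
    ContinuousAt.comp_continuousWithinAt (g := ambForm g r) (f := fun τ => (τ, Y a τ))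
      (ha ⟨τ, hτ⟩ (mem_univ _)).2.1 (continuousWithinAt_id.prodMk (hYc τ hτ))
  have hB₀ : ContinuousOn (fun τ => ambForm g r (τ, f p)) (Icc s t) :=
    (h.continuousOn_ambForm hg).comp (continuousOn_id.prodMk continuousOn_const)
      fun τ hτ => ⟨hsT' hτ, mem_range_self _⟩
  have hint : ∀ {φ : ℝ → ℝ}, ContinuousOn φ (Icc s t) → IntervalIntegrable φ volume s t :=
    (·.intervalIntegrable_of_Icc hst.le)
  have hlag : ∀ τ, lag (ambForm g r) (ambScal g r) (τ, Y a τ) (1, a • u a τ) =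
      scalarCurv (g τ) (r (Y a τ)) + a ^ 2 * ambForm g r (τ, Y a τ) (u a τ) (u a τ) := by
    intro τ
    simp only [lag, one_pow, one_mul, ambScal, map_smul, smul_apply, smul_eq_mul]
    ring
  simp only [hlag]
  have e1 : IntervalIntegrable (fun τ => scalarCurv (g τ) p) volume s t := hint hRc
  have e2 : IntervalIntegrable (fun τ => ambForm g r (τ, f p) (X' τ) (X' τ))
      volume s t := hint ((hB₀.clm_apply hX').clm_apply hX')
  have huc' : ContinuousOn (u a) (Icc s t) := hX'.add continuousOn_const
  calc ∫ τ in s..t, (scalarCurv (g τ) (r (Y a τ)) + a ^ 2 * ambForm g r (τ, Y a τ) (u a τ) (u a τ))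
      ≤ ∫ τ in s..t, (scalarCurv (g τ) p + a ^ 2 * (ambForm g r (τ, f p) (X' τ) (X' τ) + ε')) := by
        refine integral_mono_on hst.le (hint ?_)
          (e1.add ((e2.add intervalIntegrable_const).const_mul _)) fun τ hτ => ?_
        · exact (hRc.congr fun τ hτ => hR τ hτ _).add
            (continuousOn_const.mul ((hBc.clm_apply huc').clm_apply huc'))
        · rw [hR τ hτ]
          have := (ha ⟨τ, hτ⟩ (mem_univ _)).2.2
          gcongr
    _ = _ := by
        rw [integral_add e1 ((e2.add intervalIntegrable_const).const_mul _),
          integral_const_mul, integral_add e2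
          intervalIntegrable_const, integral_const, smul_eq_mul, hε',
          mul_div_cancel₀ _ hts.ne']

/-- The traced second variation inequality of a soliton at a constant path, for the transported
frame multiplied by a function `θ` of time. -/
theorem integral_rest_nonneg [CompactSpace M] [ConnectedSpace M]
    (hS : IsTwistedGradientSoliton g T) {s t : ℝ} (hst : s < t)
    (hsT : Icc s t ⊆ openInterval T) (p : M) {θ θ' : ℝ → ℝ} (hθ : ∀ τ, HasDerivAt θ (θ' τ) τ)
    (hθ' : Continuous θ') (hθs : θ s = 1) (hθt : θ t = 1) :
    0 ≤ ∫ τ in s..t, (2 * n * θ' τ ^ 2 + 2 * θ τ * θ' τ * scalarCurv (g τ) p) := by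
  have hsT' := hsT.trans (openInterval_subset T)
  have hsp : ∀ τ ∈ openInterval T, ∀ q : M, scalarCurv (g τ) q = scalarCurv (g τ) p :=
    fun τ hτ q => h.scalarCurv_eq_of_isSoliton hg hS hτ q p
  have hR : ∀ τ ∈ Icc s t, ∀ q : M, scalarCurv (g τ) q = scalarCurv (g τ) p :=
    fun τ hτ => hsp τ (hsT hτ)
  obtain ⟨hmin, huniq⟩ := h.isMinimizing_const hg hst hsT' p hR
  have hflow := (h.isAmbientFlow hg).mono hsT
  obtain ⟨_, _, hfr⟩ := hflow.exists_frame isCompact_Icc h.isCompact_range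
  have hY : ∀ τ ∈ Icc s t, HasDerivWithinAt (fun _ : ℝ => f p) 0 (Icc s t) τ := fun τ _ =>
    hasDerivWithinAt_const _ _ _
  obtain ⟨σ, hσ, ho, -⟩ := hfr s t hst.le subset_rfl (fun _ => f p) (fun _ => 0) hY
    continuousOn_const fun _ _ => mem_range_self _
  set e : Fin n → ℝ → ℝ^N := fun i τ =>
    extTransport (ambForm g r) (fun y => f (r y)) ((τ, f p), σ i τ, (1, 0)) with he
  have hσc : ∀ i, ContinuousOn (σ i) (Icc s t) := fun i τ hτ => (hσ i τ hτ).continuousWithinAt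
  have hec : ∀ i, ContinuousOn (e i) (Icc s t) := by
    intro i τ hτ
    have hm := h.isLocalModel hg (hsT hτ) (mem_extChartAt_source (I := 𝓡 n) p)
    exact ContinuousAt.comp_continuousWithinAt (g := extTransport (ambForm g r) fun y => f (r y))
      (f := fun τ => ((τ, f p), σ i τ, ((1 : ℝ), 0)))
      (hm.contDiffAt_extTransport (σ i τ) (1, 0)).continuousAt
      ((continuousWithinAt_id.prodMk continuousWithinAt_const).prodMk
        ((hσc i τ hτ).prodMk continuousWithinAt_const))
  have hθc : Continuous θ := continuous_iff_continuousAt.2 fun τ => (hθ τ).continuousAt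
  set U : Fin n → ℝ → ℝ^N := fun i τ => θ τ • e i τ + θ' τ • σ i τ with hU
  have hUd : ∀ i, ∀ τ ∈ Icc s t, HasDerivWithinAt (fun τ => θ τ • σ i τ) (U i τ) (Icc s t) τ :=
    fun i τ hτ => (hθ τ).hasDerivWithinAt.smul (hσ i τ hτ)
  have hUc : ∀ i, ContinuousOn (U i) (Icc s t) := fun i =>
    (hθc.continuousOn.smul (hec i)).add (hθ'.continuousOn.smul (hσc i))
  have hB₀ : ContinuousOn (fun τ => ambForm g r (τ, f p)) (Icc s t) :=
    (h.continuousOn_ambForm hg).comp (continuousOn_id.prodMk continuousOn_const)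
      fun τ hτ => ⟨hsT' hτ, mem_range_self _⟩
  have hint : ∀ {φ : ℝ → ℝ}, ContinuousOn φ (Icc s t) → IntervalIntegrable φ volume s t :=
    (·.intervalIntegrable_of_Icc hst.le)
  have hL : L g p s p t = ∫ τ in s..t, scalarCurv (g τ) p := by
    rw [hmin.L_eq, pathLength_const]
  set Q : Fin n → ℝ := fun i => ∫ τ in s..t, ambForm g r (τ, f p) (U i τ) (U i τ) with hQ
  have key := h.scalarCurv_sub_le hg hS hst hsT (γ := fun _ => p) (w := fun _ => 0) (σ := σ)
    hY (fun τ _ => by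
      rw [map_zero]
      unfold velocity
      rw [mfderivWithin_const]
      rfl) hσ ho hmin huniq (K := 2 * ∑ i, Q i) (by
    intro ε hε
    have hev : ∀ i, ∀ᶠ a in 𝓝 (0 : ℝ),
        L g (r (varPos (ambForm g r) (fun y => f (r y)) a (s, f p) (σ i s))) s
          (r (varPos (ambForm g r) (fun y => f (r y)) a (t, f p) (σ i t))) t ≤
        (∫ τ in s..t, scalarCurv (g τ) p) + a ^ 2 * (Q i + ε / (2 * (n + 1))) := by
      intro i
      have h1 := h.eventually_L_le_rest hg hst hsT p hR (hUd i) (hUc i)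
        (extAcc (ambForm g r) (fun y => f (r y)) (s, f p, σ i s))
        (extAcc (ambForm g r) (fun y => f (r y)) (t, f p, σ i t))
        (show 0 < ε / (2 * (n + 1)) by positivity)
      simp only [hθs, hθt, one_smul] at h1
      exact h1
    have h1 := eventually_all.2 hev
    have h2 : Tendsto (fun a : ℝ => -a) (𝓝 0) (𝓝 0) := by
      simpa using (continuous_neg.tendsto (0 : ℝ))
    filter_upwards [(h1.and (h2.eventually h1)).filter_mono nhdsWithin_le_nhds] with a ha
    have h3 := sum_le_sum fun i (_ : i ∈ Finset.univ) => ha.1 i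
    have h4 := sum_le_sum fun i (_ : i ∈ Finset.univ) => ha.2 i
    simp only [neg_sq, sum_add_distrib, sum_const, card_univ,
      Fintype.card_fin, nsmul_eq_mul, ← mul_sum, ← hL] at h3 h4
    have h5 : (n : ℝ) * (ε / (2 * (n + 1))) ≤ ε / 2 := by
      rw [mul_div_assoc', div_le_div_iff₀ (by positivity) two_pos]
      nlinarith
    have h6 : a ^ 2 * (n * (ε / (2 * (n + 1)))) ≤ a ^ 2 * (ε / 2) := by gcongr
    linarith)
  -- the traces of the form on the frame
  have hRd : ∀ τ ∈ Icc s t, HasDerivAt (fun τ => scalarCurv (g τ) p)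
      (lagTime (ambForm g r) (ambScal g r) (τ, f p) (1, 0)) τ := by
    intro τ hτ
    have hm := h.isLocalModel hg (hsT hτ) (mem_extChartAt_source (I := 𝓡 n) p)
    have h1 := (hm.contDiffAt_scal.differentiableAt (by simp)).hasFDerivAt.comp_hasDerivAt
      (f := fun τ => (τ, f p)) τ ((hasDerivAt_id τ).prodMk (hasDerivAt_const τ (f p)))
    simpa [Function.comp_def, ambScal, h.left_inv, lagTime] using h1
  have htr : ∀ τ ∈ Icc s t, ∑ i, ambForm g r (τ, f p) (U i τ) (U i τ) =
      n * θ' τ ^ 2 + 2 * θ τ * θ' τ * scalarCurv (g τ) p +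
        θ τ ^ 2 * (lagTime (ambForm g r) (ambScal g r) (τ, f p) (1, 0) / 2) := by
    intro τ hτ
    have hm := h.isLocalModel hg (hsT hτ) (mem_extChartAt_source (I := 𝓡 n) p)
    obtain ⟨h1, h2⟩ := hm.trace_transport_rest (ho τ hτ) (Rt := fun τ => scalarCurv (g τ) p)
      ((continuous_fst.continuousAt.eventually ((isOpen_openInterval T).mem_nhds (hsT hτ))).mono
        fun z hz => hsp z.1 hz _)
    have h3 : lagTime (ambForm g r) (ambScal g r) (τ, f p) (1, 0) =
        fderiv ℝ (ambScal g r) (τ, f p) (1, 0) := by simp [lagTime]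
    rw [h3, ← h2]
    have h4 : ambScal g r (τ, f p) = scalarCurv (g τ) p := by simp [ambScal, h.left_inv]
    rw [← h4, ← h1]
    have h5 : ∀ i, ambForm g r (τ, f p) (U i τ) (U i τ) = θ' τ ^ 2 +
        2 * θ τ * θ' τ * ambForm g r (τ, f p) (e i τ) (σ i τ) +
        θ τ ^ 2 * ambForm g r (τ, f p) (e i τ) (e i τ) := by
      intro i
      have h6 := hm.metric_symm.self_of_nhds (σ i τ) (e i τ)
      have h7 := ho τ hτ i i
      simp only [if_true] at h7
      simp only [hU, map_add, map_smul, add_apply, smul_apply, smul_eq_mul, h6, h7]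
      ring
    simp only [h5, sum_add_distrib, sum_const, card_univ, Fintype.card_fin, nsmul_eq_mul, ← mul_sum]
    simp only [he]
    ring
  have hRc := (continuousOn_scalarCurv_time hg p).mono hsT'
  have hR'c : ContinuousOn (fun τ => lagTime (ambForm g r) (ambScal g r) (τ, f p) (1, 0))
      (Icc s t) := hflow.continuousOn_lagTime (Y := fun _ => f p) (w := fun _ => 0) subset_rfl
        continuousOn_const continuousOn_const fun _ _ => mem_range_self _
  have hsum : ∑ i, Q i = ∫ τ in s..t, (n * θ' τ ^ 2 + 2 * θ τ * θ' τ * scalarCurv (g τ) p +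
      θ τ ^ 2 * (lagTime (ambForm g r) (ambScal g r) (τ, f p) (1, 0) / 2)) := by
    rw [hQ, ← integral_finsetSum fun i _ =>
      hint ((hB₀.clm_apply (hUc i)).clm_apply (hUc i))]
    refine integral_congr fun τ hτ => ?_
    rw [uIcc_of_le hst.le] at hτ
    exact htr τ hτ
  -- integration of the derivative of `θ² R`, where `θ = 1` at both ends
  have hpart : ∫ τ in s..t, (2 * θ τ * θ' τ * scalarCurv (g τ) p +
      θ τ ^ 2 * lagTime (ambForm g r) (ambScal g r) (τ, f p) (1, 0)) =
      scalarCurv (g t) p - scalarCurv (g s) p := by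
    rw [integral_eq_sub_of_hasDerivAt (f := fun τ => θ τ ^ 2 * scalarCurv (g τ) p)]
    · simp only [hθs, hθt, one_pow, one_mul]
    · intro τ hτ
      rw [uIcc_of_le hst.le] at hτ
      refine (((hθ τ).fun_pow 2).fun_mul (hRd τ hτ)).congr_deriv ?_
      norm_num
    · exact hint (((continuousOn_const.mul hθc.continuousOn).mul hθ'.continuousOn).mul hRc |>.add
        ((hθc.continuousOn.pow 2).mul hR'c))
  have hc1 : ContinuousOn (fun τ => 2 * n * θ' τ ^ 2 + 2 * θ τ * θ' τ * scalarCurv (g τ) p)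
      (Icc s t) := (continuousOn_const.mul (hθ'.continuousOn.pow 2)).add
    (((continuousOn_const.mul hθc.continuousOn).mul hθ'.continuousOn).mul hRc)
  have hc2 : ContinuousOn (fun τ => 2 * θ τ * θ' τ * scalarCurv (g τ) p +
      θ τ ^ 2 * lagTime (ambForm g r) (ambScal g r) (τ, f p) (1, 0)) (Icc s t) :=
    (((continuousOn_const.mul hθc.continuousOn).mul hθ'.continuousOn).mul hRc).add
      ((hθc.continuousOn.pow 2).mul hR'c)
  have hfin : 2 * ∑ i, Q i =
      (∫ τ in s..t, (2 * n * θ' τ ^ 2 + 2 * θ τ * θ' τ * scalarCurv (g τ) p)) +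
        (scalarCurv (g t) p - scalarCurv (g s) p) := by
    rw [hsum, ← hpart, ← integral_add (hint hc1) (hint hc2), ← integral_const_mul]
    exact integral_congr fun τ _ => by ring
  linarith

/-- The scalar curvature of a soliton is constant in time: the first variation in `θ` at `θ = 1`
vanishes, since `θ = 1` gives equality. -/
theorem scalarCurv_time_eq_of_isSoliton [CompactSpace M] [ConnectedSpace M]
    (hS : IsTwistedGradientSoliton g T) {s t : ℝ}
    (hst : s < t) (hsT : Icc s t ⊆ openInterval T) (p : M) :
    scalarCurv (g s) p = scalarCurv (g t) p := by
  have hts : 0 < t - s := sub_pos.2 hst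
  have hRc := (continuousOn_scalarCurv_time hg p).mono (hsT.trans (openInterval_subset T))
  set R : ℝ → ℝ := IccExtend hst.le (fun τ : Icc s t => scalarCurv (g τ) p) with hRd
  have hR : Continuous R := (continuousOn_iff_continuous_domRestrict.1 hRc).Icc_extend'
  have hRR : ∀ τ ∈ Icc s t, R τ = scalarCurv (g τ) p := fun τ hτ => IccExtend_of_mem hst.le _ hτ
  -- the variation `θ = 1 + c ψ` with `ψ' = R - m`, where the mean `m` makes `ψ` vanish at both ends
  set m : ℝ := (t - s)⁻¹ * ∫ τ in s..t, R τ with hm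
  set ψ : ℝ → ℝ := fun τ => ∫ x in s..τ, (R x - m) with hψ
  have hRm : Continuous fun x => R x - m := hR.sub continuous_const
  have hψd : ∀ τ, HasDerivAt ψ (R τ - m) τ := fun τ =>
    integral_hasDerivAt_right (hRm.intervalIntegrable _ _)
      (hRm.stronglyMeasurableAtFilter _ _) hRm.continuousAt
  have hψc : Continuous ψ := continuous_iff_continuousAt.2 fun τ => (hψd τ).continuousAt
  have hψs : ψ s = 0 := by simp [hψ]
  have hψt : ψ t = 0 := by
    simp only [hψ]
    rw [integral_sub (hR.intervalIntegrable _ _) intervalIntegrable_const,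
      integral_const, smul_eq_mul, hm]
    field_simp
    ring
  have hint : ∀ {φ : ℝ → ℝ}, Continuous φ → IntervalIntegrable φ volume s t :=
    fun hφ => hφ.intervalIntegrable _ _
  set a := ∫ τ in s..t, (R τ - m) ^ 2 with ha
  set b := ∫ τ in s..t, (2 * n * (R τ - m) ^ 2 + 2 * ψ τ * (R τ - m) * R τ) with hb
  have hmR : ∫ τ in s..t, (R τ - m) * R τ = a := by
    have h1 : ∫ τ in s..t, (R τ - m) = 0 := hψt
    have h2 : ∫ τ in s..t, (R τ - m) * R τ = ∫ τ in s..t, ((R τ - m) ^ 2 + (R τ - m) * m) :=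
      integral_congr fun τ _ => by ring
    have i1 : IntervalIntegrable (fun τ => (R τ - m) ^ 2) volume s t := hint (hRm.pow 2)
    have i2 : IntervalIntegrable (fun τ => (R τ - m) * m) volume s t :=
      hint (hRm.mul continuous_const)
    rw [h2, integral_add i1 i2, integral_mul_const, h1, zero_mul, add_zero]
  -- nonnegative for all `c` only if the linear coefficient vanishes
  have hquad : ∀ c : ℝ, 0 ≤ c * (2 * a) + c ^ 2 * b := by
    intro c
    have h1 := h.integral_rest_nonneg hg hS hst hsT p (θ := fun τ => 1 + c * ψ τ)
      (θ' := fun τ => c * (R τ - m)) (fun τ => ((hψd τ).const_mul c).const_add 1)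
      (continuous_const.mul hRm) (by simp [hψs]) (by simp [hψt])
    refine h1.trans_eq ?_
    rw [← hmR, hb, ← integral_const_mul, ← integral_const_mul, ← integral_const_mul, ← integral_add
      (hint (by fun_prop)) (hint (by fun_prop))]
    refine integral_congr fun τ hτ => ?_
    rw [uIcc_of_le hst.le] at hτ
    simp only [← hRR τ hτ]
    ring
  have ha0 : a ≤ 0 := by
    by_contra! hpos
    have h1 := hquad (-(a / (|b| + 1)))
    have h2 : 0 < |b| + 1 := by positivity
    set x := a / (|b| + 1) with hx
    have hx0 : 0 < x := div_pos hpos h2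
    have h3 : x * (|b| + 1) = a := div_mul_cancel₀ _ h2.ne'
    have h4 : x * b ≤ x * |b| := mul_le_mul_of_nonneg_left (le_abs_self b) hx0.le
    have h5 : x * (x * b) ≤ x * a := mul_le_mul_of_nonneg_left (by linarith) hx0.le
    have h6 := mul_pos hx0 hpos
    nlinarith
  have hconst : ∀ τ ∈ Icc s t, R τ = m := by
    by_contra! hne
    obtain ⟨τ, hτ, hne⟩ := hne
    have h1 := integral_pos hst (hRm.pow 2).continuousOn
      (fun τ _ => sq_nonneg (R τ - m)) ⟨τ, hτ, sq_pos_of_ne_zero (sub_ne_zero.2 hne)⟩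
    exact ha0.not_gt h1
  rw [← hRR s (left_mem_Icc.2 hst.le), ← hRR t (right_mem_Icc.2 hst.le),
    hconst s (left_mem_Icc.2 hst.le), hconst t (right_mem_Icc.2 hst.le)]

/-- The scalar curvature of a soliton is constant in space and time. -/
theorem exists_scalarCurv_eq_of_isSoliton [CompactSpace M] [ConnectedSpace M]
    (hS : IsTwistedGradientSoliton g T) :
    ∃ κ : ℝ, ∀ τ ∈ timeInterval T, ∀ q : M, scalarCurv (g τ) q = κ := by
  obtain ⟨p⟩ := (inferInstance : Nonempty M)
  rcases (timeInterval T).eq_empty_or_nonempty with h0 | ⟨τ₀, hτ₀⟩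
  · exact ⟨0, by simp [h0]⟩
  obtain ⟨s, hs⟩ := openInterval_nonempty hτ₀
  have hsub : ∀ a ∈ openInterval T, ∀ b ∈ openInterval T, Icc a b ⊆ openInterval T :=
    fun a ha b hb τ hτ => ⟨ha.1.trans_le hτ.1, (EReal.coe_le_coe_iff.2 hτ.2).trans_lt hb.2⟩
  have hop : ∀ τ ∈ openInterval T, ∀ q : M, scalarCurv (g τ) q = scalarCurv (g s) p := by
    intro τ hτ q
    rw [h.scalarCurv_eq_of_isSoliton hg hS hτ q p]
    rcases lt_trichotomy τ s with hlt | rfl | hlt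
    · exact h.scalarCurv_time_eq_of_isSoliton hg hS hlt (hsub _ hτ _ hs) p
    · rfl
    · exact (h.scalarCurv_time_eq_of_isSoliton hg hS hlt (hsub _ hs _ hτ) p).symm
  refine ⟨scalarCurv (g s) p, fun τ hτ q => ?_⟩
  rcases hτ.1.eq_or_lt with rfl | hpos
  · -- the initial time is a limit of positive times
    have h1 : Tendsto (fun τ => scalarCurv (g τ) q) (𝓝[openInterval T] 0)
        (𝓝 (scalarCurv (g 0) q)) :=
      (continuousOn_scalarCurv_time hg q 0 hτ).mono_left (nhdsWithin_mono _ (openInterval_subset T))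
    have hne : (𝓝[openInterval T] (0 : ℝ)).NeBot := by
      refine NeBot.mono (nhdsGT_neBot (0 : ℝ)) (nhdsWithin_le_iff.2 ?_)
      filter_upwards [Ioo_mem_nhdsGT hs.1] with x hx
      exact ⟨hx.1, (EReal.coe_lt_coe_iff.2 hx.2).trans hs.2⟩
    exact tendsto_nhds_unique h1 (tendsto_const_nhds.congr' (by
      filter_upwards [self_mem_nhdsWithin] with x hx using (hop x hx q).symm))
  · exact hop τ ⟨hpos, hτ.2⟩ q

theorem infL_eq_of_scalarCurv_eq [CompactSpace M] [ConnectedSpace M] {κ : ℝ}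
    (hκ : ∀ τ ∈ timeInterval T, ∀ q : M, scalarCurv (g τ) q = κ) {A t : ℝ} (hA : 0 < A)
    (hsT : Icc t (t + A) ⊆ timeInterval T) : infL g A t = κ * A := by
  have htA : t < t + A := by linarith
  have hint : ∀ p : M, ∫ τ in t..(t + A), scalarCurv (g τ) p = κ * A := by
    intro p
    have h1 : ∫ τ in t..(t + A), scalarCurv (g τ) p = ∫ _ in t..(t + A), κ :=
      integral_congr fun τ hτ => by
        rw [uIcc_of_le htA.le] at hτ
        exact hκ τ (hsT hτ) p
    rw [h1, integral_const, add_sub_cancel_left, smul_eq_mul, mul_comm]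
  obtain ⟨p⟩ := (inferInstance : Nonempty M)
  refine le_antisymm ((infL_le_integral hg hA.le hsT p).trans_eq (hint p)) (le_ciInf fun z => ?_)
  obtain ⟨γ₀, hγ₀⟩ := h.exists_isPath z.1 z.2 htA
  refine le_csInf ⟨_, γ₀, hγ₀, rfl⟩ ?_
  rintro _ ⟨γ, hγ, rfl⟩
  rw [← hint p]
  exact h.integral_le_pathLength hg htA hsT
    (fun τ hτ q => by rw [hκ τ (hsT hτ), hκ τ (hsT hτ)]) hγ.1

end IsTube

end Embedded

end RicciFlowLength

end

theorem corollary1p5 {n : ℕ} {M : Type*} [TopologicalSpace M]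
    [ChartedSpace (EuclideanSpace ℝ (Fin n)) M] [IsManifold (𝓡 n) ∞ M]
    [T2Space M] [CompactSpace M] [ConnectedSpace M]
    (g : ℝ → RicciFlowLength.Metric n M) (T : EReal)
    (hg : RicciFlowLength.IsRicciFlow g T) (A : ℝ) (hA : 0 < A) :
    (∀ t₁ t₂ : ℝ, 0 ≤ t₁ → t₁ ≤ t₂ → ((t₂ + A : ℝ) : EReal) < T →
      RicciFlowLength.infL g A t₁ ≤ RicciFlowLength.infL g A t₂) ∧
    (RicciFlowLength.IsTwistedGradientSoliton g T →
      ∀ t₁ t₂ : ℝ, 0 ≤ t₁ → ((t₁ + A : ℝ) : EReal) < T → 0 ≤ t₂ → ((t₂ + A : ℝ) : EReal) < T →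
        RicciFlowLength.infL g A t₁ = RicciFlowLength.infL g A t₂) := by
  obtain ⟨N, f, r, h⟩ := RicciFlowLength.exists_isTube (n := n) (M := M)
  refine ⟨fun t₁ t₂ h1 h12 h2 => ?_, fun hS t₁ t₂ h1 h1T h2 h2T => ?_⟩
  · rcases eq_or_ne n 0 with rfl | hn
    · rw [RicciFlowLength.infL_eq_zero, RicciFlowLength.infL_eq_zero]
    · exact h.infL_mono hg hn hA h1 h12 h2
  · obtain ⟨κ, hκ⟩ := h.exists_scalarCurv_eq_of_isSoliton hg hS
    have hsub : ∀ t : ℝ, 0 ≤ t → ((t + A : ℝ) : EReal) < T →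
        Set.Icc t (t + A) ⊆ RicciFlowLength.timeInterval T := fun t h0 ht τ hτ =>
      ⟨h0.trans hτ.1, (EReal.coe_le_coe_iff.2 hτ.2).trans_lt ht⟩
    rw [h.infL_eq_of_scalarCurv_eq hg hκ hA (hsub t₁ h1 h1T),
      h.infL_eq_of_scalarCurv_eq hg hκ hA (hsub t₂ h2 h2T)]
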